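/- **Setting.** Let $\Gamma^A$, $A=1,\dots,M$, be real local coordinates of Grassmann parity $\epsilon_A$ on a superdomain over an open set $U$ (in the space of the even coordinates). Functions of $\Gamma$ are smooth functions on $U$ with values in the complex Grassmann algebra generated by the odd coordinates; the body of a function is its value when the odd coordinates are put to zero. Let $E^{AB}$ be a smooth, real, non-degenerate antisymplectic bivector, of parity $\epsilon_A+\epsilon_B+1$, with $E^{BA}=-(-1)^{(\epsilon_A+1)(\epsilon_B+1)}E^{AB}$ and whose antibracket $(F,G)=(F\overleftarrow{\partial}_A)E^{AB}(\overrightarrow{\partial}_BG)$ satisfies the graded Jacobi identity. Let $\Theta^a$ be real second-class constraints of definite parity, i.e. the matrix $E^{ab}=(\Theta^a,\Theta^b)$ has an inverse $E_{ab}$. Let $\rho_D$ be a real even measure density with nowhere vanishing body. Put $$(F,G)_D=(F,G)-(F,\Theta^a)E_{ab}(\Theta^b,G),\qquad E_D^{AB}=(\Gamma^A,\Gamma^B)_D .$$ Let $\lambda^\alpha$ be Lagrange multipliers of parity $\epsilon_\alpha$ and $\lambda^*_\alpha$ their antifields, of parity $\epsilon_\alpha+1$, and put $$\Delta_{[1]D}=\frac{(-1)^{\epsilon_A}}{2\rho_D}\overrightarrow{\partial}_A\,\rho_D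 E_D^{AB}\,\overrightarrow{\partial}_B+(-1)^{\epsilon_\alpha}\frac{\overrightarrow{\partial}}{\partial\lambda^\alpha}\frac{\overrightarrow{\partial}}{\partial\lambda^*_\alpha}.$$ Let $X_D=\sum_{k\ge 0}(i\hbar)^kX_k$ be even, where the $X_k$ are formal power series in $\lambda,\lambda^*$ with functions of $\Gamma$ as coefficients, and let $X_D$ have Planck number $1$, where $\hbar$ and $\lambda^\alpha$ have Planck number $1$, $\lambda^*_\alpha$ has $-1$ and $\Gamma^A$ has $0$. Write $$X_D=G_\alpha\lambda^\alpha+i\hbar H+O(\lambda^*).$$ Let $F^\alpha$ be arbitrary functions of $\Gamma$, of parity $\epsilon_\alpha+1$, such that $\bar\Gamma=\{F^\alpha;G_\alpha;\Theta^a\}$ is a real coordinate system over $U$: its Jacobian supermatrix is invertible and the bodies of its members separate the points of $U$. Let $J_D=\mathrm{sdet}(\partial\bar\Gamma^A/\partial\Gamma^B)$. Assume that the constraint surface, i.e. the set of the points of $U$ at which the bodies of all $G_\alpha$ and all $\Theta^a$ vanish, is connected or empty. **Theorem (square-root formula with second-class constraints).** If $X_D$ satisfies the Quantum Master Equation $\Delta_{[1]D}\exp\left[\frac{i}{\hbar}X_D\right]=0$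 (for all $\hbar\neq0$), then there are an open set $V\subseteq U$ that contains the constraint surface and an integration constant $c\in\mathbb C$ such that the matrix $(F^\alpha,G_\beta)_D$ is invertible over $V$ and, over $V$, $$H=-\ln\sqrt{\frac{J_D\ \mathrm{sdet}(F^\alpha,G_\beta)_D}{\rho_D}}+c+O(G;\Theta),$$ where $O(G;\Theta)$ denotes an element of the ideal generated by the $G_\alpha$ and the $\Theta^a$ in the smooth functions over $V$. (The argument of the logarithm has real nonzero body, and the principal branches of $\sqrt{\ }$ and $\ln$ are taken.) -/

import Mathlib

open scoped BigOperators

noncomputable section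

namespace SuperBV

/-! ### Grassmann algebras -/

/-- The complex Grassmann algebra on anticommuting generators `θ i`, `i : κ`.  An element is the
family of its coefficients: `f S` is the coefficient of the product of the `θ i`, `i ∈ S`, taken in
increasing order. -/
def Grassmann (κ : Type) : Type := Finset κ → ℂ

namespace Grassmann

variable {κ : Type}

instance [Fintype κ] : NormedAddCommGroup (Grassmann κ) :=
  inferInstanceAs (NormedAddCommGroup (Finset κ → ℂ))

instance [Fintype κ] : NormedSpace ℂ (Grassmann κ) :=
  inferInstanceAs (NormedSpace ℂ (Finset κ → ℂ))

instance [Fintype κ] : NormedSpace ℝ (Grassmann κ) :=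
  inferInstanceAs (NormedSpace ℝ (Finset κ → ℂ))

/-- Number of inversions between two sets of generators. -/
def inv [LinearOrder κ] (S T : Finset κ) : ℕ := ∑ s ∈ S, ∑ t ∈ T, if t < s then 1 else 0

/-- For disjoint `S`, `T` one has `θ_S θ_T = sgn S T • θ_{S ∪ T}`. -/
def sgn [LinearOrder κ] (S T : Finset κ) : ℂ := (-1) ^ inv S T

/-- The Grassmann product. -/
def gmul [LinearOrder κ] (f g : Grassmann κ) : Grassmann κ :=
  fun S => ∑ T ∈ S.powerset, sgn T (S \ T) * f T * g (S \ T)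

/-- The unit element. -/
def gone [DecidableEq κ] : Grassmann κ := fun S => if S = ∅ then 1 else 0

/-- The generator `θ i`. -/
def gen [DecidableEq κ] (i : κ) : Grassmann κ := fun S => if S = {i} then 1 else 0

/-- The body: the coefficient of the empty monomial. -/
def body (f : Grassmann κ) : ℂ := f ∅

/-- `f` is homogeneous of Grassmann parity `p`. -/
def HasParity (f : Grassmann κ) (p : ZMod 2) : Prop := ∀ S, f S ≠ 0 → (S.card : ZMod 2) = p

/-- All coefficients are real. -/
def IsReal (f : Grassmann κ) : Prop := ∀ S, (f S).im = 0

/-- Left derivative with respect to the generator `θ i`. -/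
def leftDer [LinearOrder κ] (i : κ) (f : Grassmann κ) : Grassmann κ :=
  fun S => if i ∈ S then 0 else sgn {i} S * f (insert i S)

/-- Right derivative with respect to the generator `θ i`. -/
def rightDer [LinearOrder κ] (i : κ) (f : Grassmann κ) : Grassmann κ :=
  fun S => if i ∈ S then 0 else sgn S {i} * f (insert i S)

section ring

variable [LinearOrder κ]

theorem inv_union_left {S T : Finset κ} (U : Finset κ) (h : Disjoint S T) :
    inv (S ∪ T) U = inv S U + inv T U := by
  simp [inv, Finset.sum_union h]

theorem inv_union_right (S : Finset κ) {T U : Finset κ} (h : Disjoint T U) :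
    inv S (T ∪ U) = inv S T + inv S U := by
  simp [inv, Finset.sum_union h, Finset.sum_add_distrib]

theorem inv_add_inv {S T : Finset κ} (h : Disjoint S T) : inv S T + inv T S = S.card * T.card := by
  have h2 : inv T S = ∑ s ∈ S, ∑ t ∈ T, if s < t then 1 else 0 := by
    unfold inv; rw [Finset.sum_comm]
  rw [h2]; unfold inv
  rw [← Finset.sum_add_distrib]
  have : ∀ s ∈ S, ((∑ t ∈ T, if t < s then 1 else 0) + ∑ t ∈ T, if s < t then 1 else 0)
      = T.card := by
    intro s hs
    rw [← Finset.sum_add_distrib, Finset.card_eq_sum_ones]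
    refine Finset.sum_congr rfl fun t ht => ?_
    have hne : t ≠ s := fun e => Finset.disjoint_left.mp h hs (e ▸ ht)
    rcases lt_or_gt_of_ne hne with h1 | h1
    · simp [h1, h1.not_gt]
    · simp [h1, h1.not_gt]
  rw [Finset.sum_congr rfl this]; simp

theorem gmul_assoc (f g h : Grassmann κ) : gmul (gmul f g) h = gmul f (gmul g h) := by
  funext S
  simp only [gmul, Finset.mul_sum, Finset.sum_mul]
  rw [Finset.sum_sigma', Finset.sum_sigma']
  refine Finset.sum_bij' (fun p _ => ⟨p.2, p.1 \ p.2⟩) (fun p _ => ⟨p.1 ∪ p.2, p.1⟩) ?_ ?_ ?_ ?_ ?_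
  · rintro ⟨T, R⟩ hp
    simp only [Finset.mem_sigma, Finset.mem_powerset] at hp ⊢
    exact ⟨hp.2.trans hp.1, Finset.sdiff_subset_sdiff hp.1 le_rfl⟩
  · rintro ⟨R, Q⟩ hp
    simp only [Finset.mem_sigma, Finset.mem_powerset] at hp ⊢
    exact ⟨Finset.union_subset hp.1 (hp.2.trans Finset.sdiff_subset), Finset.subset_union_left⟩
  · rintro ⟨T, R⟩ hp
    simp only [Finset.mem_sigma, Finset.mem_powerset] at hp
    simp [Finset.union_sdiff_of_subset hp.2]
  · rintro ⟨R, Q⟩ hp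
    simp only [Finset.mem_sigma, Finset.mem_powerset] at hp
    have hd : Disjoint R Q := by
      rw [Finset.disjoint_left]; intro a ha hq
      exact (Finset.mem_sdiff.mp (hp.2 hq)).2 ha
    simp [Finset.union_sdiff_cancel_left hd]
  · rintro ⟨T, R⟩ hp
    simp only [Finset.mem_sigma, Finset.mem_powerset] at hp
    obtain ⟨hT, hR⟩ := hp
    have e1 : (S \ R) \ (T \ R) = S \ T := by
      ext a; simp only [Finset.mem_sdiff]
      have := @hR a
      tauto
    have e2 : S \ R = (T \ R) ∪ (S \ T) := by
      ext a; simp only [Finset.mem_sdiff, Finset.mem_union]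
      have := @hR a; have := @hT a
      tauto
    have e3 : R ∪ (T \ R) = T := Finset.union_sdiff_of_subset hR
    have d1 : Disjoint R (T \ R) := Finset.disjoint_sdiff
    have d2 : Disjoint (T \ R) (S \ T) := by
      rw [Finset.disjoint_left]; intro a ha hb
      exact (Finset.mem_sdiff.mp hb).2 (Finset.mem_sdiff.mp ha).1
    have hs : sgn T (S \ T) * sgn R (T \ R) = sgn R (S \ R) * sgn (T \ R) (S \ T) := by
      unfold sgn
      rw [← pow_add, ← pow_add, e2, inv_union_right R d2]
      nth_rewrite 1 [← e3]
      rw [inv_union_left _ d1]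
      congr 1; ring
    dsimp only
    rw [e1]
    linear_combination (f R * g (T \ R) * h (S \ T)) * hs

theorem gone_gmul (f : Grassmann κ) : gmul gone f = f := by
  funext S
  rw [gmul, Finset.sum_eq_single ∅]
  · simp [gone, sgn, inv]
  · intro T _ hT; simp [gone, hT]
  · simp

theorem gmul_gone (f : Grassmann κ) : gmul f gone = f := by
  funext S
  rw [gmul, Finset.sum_eq_single S]
  · simp [gone, sgn, inv]
  · intro T hT hne
    have : S \ T ≠ ∅ := fun h =>
      hne (Finset.Subset.antisymm (Finset.mem_powerset.mp hT) (Finset.sdiff_eq_empty_iff_subset.mp h))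
    simp [gone, this]
  · simp

variable [Fintype κ]


instance : Ring (Grassmann κ) :=
  { (inferInstance : AddCommGroup (Grassmann κ)) with
    mul := gmul
    one := gone
    mul_assoc := gmul_assoc
    one_mul := gone_gmul
    mul_one := gmul_gone
    left_distrib := fun f g h => by
      funext S
      change gmul f (g + h) S = gmul f g S + gmul f h S
      unfold gmul
      rw [← Finset.sum_add_distrib]
      refine Finset.sum_congr rfl fun T _ => ?_
      change _ * (g _ + h _) = _
      ring
    right_distrib := fun f g h => by
      funext S
      change gmul (f + g) h S = gmul f h S + gmul g h S
      unfold gmul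
      rw [← Finset.sum_add_distrib]
      refine Finset.sum_congr rfl fun T _ => ?_
      change _ * (f _ + g _) * _ = _
      ring
    zero_mul := fun f => by
      funext S
      change gmul 0 f S = 0
      unfold gmul
      refine Finset.sum_eq_zero fun T _ => ?_
      change _ * (0 : ℂ) * _ = 0
      ring
    mul_zero := fun f => by
      funext S
      change gmul f 0 S = 0
      unfold gmul
      refine Finset.sum_eq_zero fun T _ => ?_
      change _ * (0 : ℂ) = 0
      ring }

theorem mul_apply (f g : Grassmann κ) (S : Finset κ) :
    (f * g) S = ∑ T ∈ S.powerset, sgn T (S \ T) * f T * g (S \ T) := rfl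

theorem HasParity.mul {f g : Grassmann κ} {p q : ZMod 2} (hf : HasParity f p)
    (hg : HasParity g q) : HasParity (f * g) (p + q) := by
  intro S hS
  rw [mul_apply] at hS
  obtain ⟨T, hT, h⟩ := Finset.exists_ne_zero_of_sum_ne_zero hS
  have h1 := hf T (fun e => h (by simp [e]))
  have h2 := hg (S \ T) (fun e => h (by simp [e]))
  rw [← h1, ← h2, ← Nat.cast_add, add_comm,
    Finset.card_sdiff_add_card_eq_card (Finset.mem_powerset.mp hT)]

theorem mul_comm_of_even {f g : Grassmann κ} (hf : HasParity f 0) : f * g = g * f := by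
  funext S
  rw [mul_apply, mul_apply]
  refine Finset.sum_bij' (fun T _ => S \ T) (fun T _ => S \ T) ?_ ?_ ?_ ?_ ?_
  · intro T _; simp
  · intro T _; simp
  · intro T hT; simpa using Finset.mem_powerset.mp hT
  · intro T hT; simpa using Finset.mem_powerset.mp hT
  · intro T hT
    have hT' := Finset.mem_powerset.mp hT
    rw [show S \ (S \ T) = T by simpa using hT']
    by_cases h0 : f T = 0
    · simp [h0]
    have he : Even T.card := by
      have := hf T h0
      exact (ZMod.natCast_eq_zero_iff_even).mp this
    have hs : sgn T (S \ T) * sgn (S \ T) T = 1 := by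
      unfold sgn
      rw [← pow_add, inv_add_inv Finset.disjoint_sdiff]
      exact (he.mul_right _).neg_one_pow
    have h3 : sgn (S \ T) T * sgn (S \ T) T = 1 := by
      unfold sgn; rw [← pow_add]; exact (Even.add_self _).neg_one_pow
    linear_combination (f T * g (S \ T)) * (sgn (S \ T) T * hs - sgn T (S \ T) * h3)

end ring

/-- The commutative ring of even elements. -/
def evenSubring (κ : Type) [Fintype κ] [LinearOrder κ] : Subring (Grassmann κ) where
  carrier := {f | HasParity f 0}
  mul_mem' := fun {f g} hf hg => by simpa using HasParity.mul hf hg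
  one_mem' := fun S hS => by
    have : S = ∅ := by
      by_contra h
      exact hS (if_neg h)
    simp [this]
  add_mem' := fun {f g} hf hg S hS => by
    by_cases h : f S = 0
    · refine hg S fun h' => hS ?_
      change f S + g S = 0
      rw [h, h', add_zero]
    · exact hf S h
  zero_mem' := fun S hS => absurd rfl hS
  neg_mem' := fun {f} hf S hS => hf S fun h => hS (by change -(f S) = 0; rw [h, neg_zero])

instance (κ : Type) [Fintype κ] [LinearOrder κ] : CommRing (evenSubring κ) :=
  { (inferInstance : Ring (evenSubring κ)) with
    mul_comm := fun f _ => Subtype.ext (mul_comm_of_even f.2) }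

/-- Projection onto the even part. -/
def evenPart {κ : Type} [Fintype κ] [LinearOrder κ] (f : Grassmann κ) : evenSubring κ :=
  ⟨fun S => if (S.card : ZMod 2) = 0 then f S else 0, fun S hS => by
    by_contra h
    exact hS (if_neg h)⟩

/-- The superdeterminant (Berezinian) `det (A - B D⁻¹ C) / det D` of an even supermatrix with rows
and columns of parity `p`, where `A` is the even-even, `B` the even-odd, `C` the odd-even and `D`
the odd-odd block. -/
def sdet {κ ι : Type} [Fintype κ] [LinearOrder κ] [Fintype ι] [DecidableEq ι] (p : ι → ZMod 2)
    (M : Matrix ι ι (Grassmann κ)) : Grassmann κ :=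
  let A : Matrix {i // p i = 0} {i // p i = 0} (Grassmann κ) := fun i j => M i j
  let B : Matrix {i // p i = 0} {i // p i ≠ 0} (Grassmann κ) := fun i j => M i j
  let C : Matrix {i // p i ≠ 0} {i // p i = 0} (Grassmann κ) := fun i j => M i j
  let D : Matrix {i // p i ≠ 0} {i // p i ≠ 0} (evenSubring κ) := fun i j => evenPart (M i j)
  let Dinv : Matrix {i // p i ≠ 0} {i // p i ≠ 0} (Grassmann κ) :=
    (D⁻¹).map fun z => (z : Grassmann κ)
  (((A - B * Dinv * C).map evenPart).det * Ring.inverse D.det : evenSubring κ)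

/-- The logarithm of an even element with nonzero body `b`: with `f = b (1 + n)`, `n` nilpotent,
it is `log b + ∑ (-1)^(k+1) n^k / k` (a finite sum, as `n ^ k = 0` for `k` larger than the number
of generators). -/
def glog {κ : Type} [Fintype κ] [LinearOrder κ] (f : Grassmann κ) : Grassmann κ :=
  let n : Grassmann κ := (body f)⁻¹ • f - 1
  Complex.log (body f) • (1 : Grassmann κ) +
    ∑ k ∈ Finset.Icc 1 (Fintype.card κ), ((-1 : ℂ) ^ (k + 1) / (k : ℂ)) • n ^ k

/-- `ln √f`. -/
def lnSqrt {κ : Type} [Fintype κ] [LinearOrder κ] (f : Grassmann κ) : Grassmann κ :=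
  (1 / 2 : ℂ) • glog f

/-- The inclusion of the Grassmann algebra on `κ` into the one on `κ ⊕ ι`. -/
def incl {κ ι : Type} [Fintype κ] [DecidableEq κ] [DecidableEq ι] [Fintype ι]
    (f : Grassmann κ) : Grassmann (κ ⊕ₗ ι) :=
  fun S => if ∀ i : ι, (Sum.inrₗ i : κ ⊕ₗ ι) ∉ S then
    f (Finset.univ.filter fun a : κ => (Sum.inlₗ a : κ ⊕ₗ ι) ∈ S) else 0

end Grassmann

open Grassmann

/-! ### Superdomains

`M` coordinates `Γ^A` with parities `ε A`; the even ones are real coordinates, the odd ones are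
generators of a Grassmann algebra. -/

/-- The sign `(-1)^p`. -/
def psign (p : ZMod 2) : ℂ := (-1) ^ p.val

/-- Indices of the odd coordinates. -/
abbrev OddIx {M : ℕ} (ε : Fin M → ZMod 2) : Type := {A : Fin M // ε A ≠ 0}

/-- Points of the underlying real space: values of the even coordinates. -/
abbrev Pt {M : ℕ} (ε : Fin M → ZMod 2) : Type := {A : Fin M // ε A = 0} → ℝ

/-- Functions of the coordinates `Γ^A` (smoothness is a separate condition). -/
abbrev SFun {M : ℕ} (ε : Fin M → ZMod 2) : Type := Pt ε → Grassmann (OddIx ε)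

/-- Smoothness on a set. -/
def SmoothOn {M : ℕ} {ε : Fin M → ZMod 2} {κ : Type} [Fintype κ]
    (f : Pt ε → Grassmann κ) (U : Set (Pt ε)) : Prop :=
  ContDiffOn ℝ ((⊤ : ℕ∞) : WithTop ℕ∞) f U

/-- Left derivative with respect to `Γ^A`, where `j` names the generators that are the odd
coordinates. -/
def dL {M : ℕ} {ε : Fin M → ZMod 2} {κ : Type} [Fintype κ] [LinearOrder κ] (j : OddIx ε → κ)
    (A : Fin M) (f : Pt ε → Grassmann κ) : Pt ε → Grassmann κ := fun x =>
  if h : ε A = 0 then fderiv ℝ f x (Pi.single ⟨A, h⟩ 1) else leftDer (j ⟨A, h⟩) (f x)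

/-- Right derivative with respect to `Γ^A`. -/
def dR {M : ℕ} {ε : Fin M → ZMod 2} {κ : Type} [Fintype κ] [LinearOrder κ] (j : OddIx ε → κ)
    (A : Fin M) (f : Pt ε → Grassmann κ) : Pt ε → Grassmann κ := fun x =>
  if h : ε A = 0 then fderiv ℝ f x (Pi.single ⟨A, h⟩ 1) else rightDer (j ⟨A, h⟩) (f x)

section geometry

variable {M : ℕ} {ε : Fin M → ZMod 2}

/-- The coordinate function `Γ^A`. -/
def coord (ε : Fin M → ZMod 2) (A : Fin M) : SFun ε := fun x =>
  if h : ε A = 0 then ((x ⟨A, h⟩ : ℝ) : ℂ) • (1 : Grassmann (OddIx ε)) else gen ⟨A, h⟩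

/-- The antibracket `(F,G) = (F ∂ᵣ/∂Γ^A) E^{AB} (∂ₗ/∂Γ^B G)`. -/
def antibracket (E : Fin M → Fin M → SFun ε) (F G : SFun ε) : SFun ε :=
  ∑ A, ∑ B, dR id A F * E A B * dL id B G

/-- `E^{AB}` is a smooth, real, non-degenerate antisymplectic bi-vector on `U`. -/
structure IsAntisymplectic (U : Set (Pt ε)) (E : Fin M → Fin M → SFun ε) : Prop where
  smooth : ∀ A B, SmoothOn (E A B) U
  real : ∀ A B, ∀ x ∈ U, IsReal (E A B x)
  parity : ∀ A B, ∀ x ∈ U, HasParity (E A B x) (ε A + ε B + 1)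
  skew : ∀ A B, ∀ x ∈ U, E B A x = -(psign ((ε A + 1) * (ε B + 1)) • E A B x)
  jacobi : ∀ (F G H : SFun ε) (f g h : ZMod 2),
    SmoothOn F U → SmoothOn G U → SmoothOn H U →
    (∀ x ∈ U, HasParity (F x) f) → (∀ x ∈ U, HasParity (G x) g) →
    (∀ x ∈ U, HasParity (H x) h) →
    ∀ x ∈ U,
      psign ((f + 1) * (h + 1)) • antibracket E F (antibracket E G H) x +
      psign ((g + 1) * (f + 1)) • antibracket E G (antibracket E H F) x +
      psign ((h + 1) * (g + 1)) • antibracket E H (antibracket E F G) x = 0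
  nondegenerate : ∀ x ∈ U, IsUnit (Matrix.of fun A B => E A B x)

variable {D : ℕ}

/-- The matrix `E^{ab} = (Θ^a, Θ^b)` at a point. -/
def constraintMatrix (E : Fin M → Fin M → SFun ε) (Θ : Fin D → SFun ε) (x : Pt ε) :
    Matrix (Fin D) (Fin D) (Grassmann (OddIx ε)) :=
  Matrix.of fun a b => antibracket E (Θ a) (Θ b) x

/-- The entries `E_{ab}` of the inverse matrix. -/
def constraintInv (E : Fin M → Fin M → SFun ε) (Θ : Fin D → SFun ε) (a b : Fin D) : SFun ε :=
  fun x => Ring.inverse (constraintMatrix E Θ x) a b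

/-- The Dirac antibracket `(F,G)_D = (F,G) - (F,Θ^a) E_{ab} (Θ^b,G)`. -/
def diracBracket (E : Fin M → Fin M → SFun ε) (Θ : Fin D → SFun ε) (F G : SFun ε) : SFun ε :=
  antibracket E F G -
    ∑ a, ∑ b, antibracket E F (Θ a) * constraintInv E Θ a b * antibracket E (Θ b) G

/-- `E_D^{AB} = (Γ^A, Γ^B)_D`. -/
def diracE (E : Fin M → Fin M → SFun ε) (Θ : Fin D → SFun ε) (A B : Fin M) : SFun ε :=
  diracBracket E Θ (coord ε A) (coord ε B)

/-- `Θ^a`, of parities `τ a`, are second-class constraints: the matrix `(Θ^a, Θ^b)` is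
invertible. -/
structure IsSecondClass (U : Set (Pt ε)) (E : Fin M → Fin M → SFun ε) (τ : Fin D → ZMod 2)
    (Θ : Fin D → SFun ε) : Prop where
  smooth : ∀ a, SmoothOn (Θ a) U
  real : ∀ a, ∀ x ∈ U, IsReal (Θ a x)
  parity : ∀ a, ∀ x ∈ U, HasParity (Θ a x) (τ a)
  invertible : ∀ x ∈ U, IsUnit (constraintMatrix E Θ x)

/-- A measure density: real, smooth, even, with nowhere vanishing body. -/
structure IsDensity (U : Set (Pt ε)) (ρ : SFun ε) : Prop where
  smooth : SmoothOn ρ U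
  real : ∀ x ∈ U, IsReal (ρ x)
  parity : ∀ x ∈ U, HasParity (ρ x) 0
  body_ne_zero : ∀ x ∈ U, body (ρ x) ≠ 0

/-- The matrix `Γ'^A ∂ᵣ/∂Γ^B` at a point. -/
def jacobianMatrix (Γ' : Fin M → SFun ε) (x : Pt ε) :
    Matrix (Fin M) (Fin M) (Grassmann (OddIx ε)) :=
  Matrix.of fun A B => dR id B (Γ' A) x

/-- `Γ'^A` is a coordinate system on the superdomain over `U`, with the parities of `Γ^A`: the
functions are real and smooth, the Jacobian supermatrix is invertible, and the bodies of the even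
functions separate the points of `U`. -/
structure IsCoordinateSystem (U : Set (Pt ε)) (Γ' : Fin M → SFun ε) : Prop where
  smooth : ∀ A, SmoothOn (Γ' A) U
  real : ∀ A, ∀ x ∈ U, IsReal (Γ' A x)
  parity : ∀ A, ∀ x ∈ U, HasParity (Γ' A x) (ε A)
  jacobian : ∀ x ∈ U, IsUnit (jacobianMatrix Γ' x)
  injective : Set.InjOn (fun x A => body (Γ' A x)) U

variable {K : ℕ}

/-- The family `{F^α; G_α; Θ^a}`, labelled by the index set of the `Γ^A` through `e`. -/
def combine (e : (Fin K ⊕ Fin K) ⊕ Fin D ≃ Fin M) (F G : Fin K → SFun ε) (Θ : Fin D → SFun ε) :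
    Fin M → SFun ε :=
  fun A => Sum.elim (Sum.elim F G) Θ (e.symm A)

/-- The matrix `(F^α, G_β)_D` at a point. -/
def gaugeMatrix (E : Fin M → Fin M → SFun ε) (Θ : Fin D → SFun ε) (F G : Fin K → SFun ε)
    (x : Pt ε) : Matrix (Fin K) (Fin K) (Grassmann (OddIx ε)) :=
  Matrix.of fun α β => diracBracket E Θ (F α) (G β) x

/-- The points of `U` at which (the bodies of) all `G_α` and all `Θ^a` vanish. -/
def constraintSurface (U : Set (Pt ε)) (G : Fin K → SFun ε) (Θ : Fin D → SFun ε) :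
    Set (Pt ε) :=
  {x ∈ U | (∀ α, body (G α x) = 0) ∧ ∀ a, body (Θ a x) = 0}

/-- `f` is `O(G;Θ)` over `V`: it lies in the ideal of the smooth functions over `V` that is
generated by all `G_α` and `Θ^a`. -/
def IsOrderOn (V : Set (Pt ε)) (G : Fin K → SFun ε) (Θ : Fin D → SFun ε) (f : SFun ε) : Prop :=
  ∃ (u : Fin K → SFun ε) (v : Fin D → SFun ε), (∀ α, SmoothOn (u α) V) ∧
    (∀ a, SmoothOn (v a) V) ∧
    ∀ x ∈ V, f x = ∑ α, G α x * u α x + ∑ a, Θ a x * v a x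

end geometry

/-! ### The first level

Lagrange multipliers `λ^α` of parity `δ α` and their antifields `λ*_α` of parity `δ α + 1`. In each
pair exactly one member is even and one is odd. Functions of `Γ^A, λ^α, λ*_α` are formal power
series in the even members (variable `α`), with coefficients that are functions of the `Γ^A` and of
the odd members (generator `Sum.inrₗ α`). -/

section firstLevel

variable {M K : ℕ} {ε : Fin M → ZMod 2}

/-- Names of all odd variables. -/
abbrev OddIx1 (ε : Fin M → ZMod 2) (K : ℕ) : Type := OddIx ε ⊕ₗ Fin K

/-- Functions of the zeroth- and first-level fields. -/
abbrev FL (ε : Fin M → ZMod 2) (K : ℕ) : Type :=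
  MvPowerSeries (Fin K) (Pt ε → Grassmann (OddIx1 ε K))

/-- A function of the `Γ^A` as a function of all fields. -/
def up (f : SFun ε) : FL ε K := MvPowerSeries.C (fun x => incl (f x))

/-- `λ^α`. -/
def lam (δ : Fin K → ZMod 2) (α : Fin K) : FL ε K :=
  if δ α = 0 then MvPowerSeries.X α else MvPowerSeries.C (fun _ => gen (Sum.inrₗ α))

/-- Degree in the `λ`'s of the monomial with even exponents `n` and odd factors `S`. -/
def lamDeg (δ : Fin K → ZMod 2) (n : Fin K →₀ ℕ) (S : Finset (OddIx1 ε K)) : ℕ :=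
  ∑ α, if δ α = 0 then n α else if (Sum.inrₗ α : OddIx1 ε K) ∈ S then 1 else 0

/-- Degree in the `λ*`'s of the monomial with even exponents `n` and odd factors `S`. -/
def lamStarDeg (δ : Fin K → ZMod 2) (n : Fin K →₀ ℕ) (S : Finset (OddIx1 ε K)) : ℕ :=
  ∑ α, if δ α = 0 then (if (Sum.inrₗ α : OddIx1 ε K) ∈ S then 1 else 0) else n α

/-- Restriction to `λ* = 0`. -/
def atLamStarZero (δ : Fin K → ZMod 2) (X : FL ε K) : FL ε K :=
  fun n x S => if lamStarDeg δ n S = 0 then X n x S else 0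

/-- Derivative with respect to the even variable numbered `α`. -/
def dEven (α : Fin K) (X : FL ε K) : FL ε K :=
  fun n => ((n α : ℂ) + 1) • X (n + Finsupp.single α 1)

/-- Left derivative with respect to the odd first-level variable numbered `α`. -/
def dOdd (α : Fin K) (X : FL ε K) : FL ε K :=
  fun n x => leftDer (Sum.inrₗ α) (X n x)

/-- `∂ₗ/∂λ^α`. -/
def dLam (δ : Fin K → ZMod 2) (α : Fin K) (X : FL ε K) : FL ε K :=
  if δ α = 0 then dEven α X else dOdd α X

/-- `∂ₗ/∂λ*_α`. -/
def dLamStar (δ : Fin K → ZMod 2) (α : Fin K) (X : FL ε K) : FL ε K :=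
  if δ α = 0 then dOdd α X else dEven α X

/-- `∂ₗ/∂Γ^A`. -/
def dGamma (A : Fin M) (X : FL ε K) : FL ε K := fun n => dL Sum.inlₗ A (X n)

/-- The exponential: with `X = b + s`, where `b` is the complex-valued function of the even `Γ^A`
that is left when all other variables are put to zero, it is `exp b * ∑ s^k / k!`; the coefficient
of a monomial of degree `n` in the even variables gets contributions only from `s^k` with
`k ≤ n + (number of odd variables)`. -/
def fexp (X : FL ε K) : FL ε K :=
  let b : Pt ε → ℂ := fun x => body (X 0 x)
  let s : FL ε K := X - MvPowerSeries.C (fun x => b x • (1 : Grassmann (OddIx1 ε K)))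
  fun n x => Complex.exp (b x) •
    ∑ k ∈ Finset.range (n.degree + Fintype.card (OddIx1 ε K) + 1),
      ((k.factorial : ℂ)⁻¹) • (s ^ k) n x

/-- The first-level Dirac odd Laplacian
`Δ_{[1]D} = (-1)^{ε_A} (2ρ_D)⁻¹ ∂_A ρ_D E_D^{AB} ∂_B + (-1)^{ε_α} ∂/∂λ^α ∂/∂λ*_α`. -/
def diracDelta1 {D : ℕ} (E : Fin M → Fin M → SFun ε) (Θ : Fin D → SFun ε) (ρ : SFun ε)
    (δ : Fin K → ZMod 2) (X : FL ε K) : FL ε K :=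
  (∑ A, ∑ B, (psign (ε A) / 2) •
    (up (fun x => Ring.inverse (ρ x)) * dGamma A (up (ρ * diracE E Θ A B) * dGamma B X))) +
  ∑ α, psign (δ α) • dLam δ α (dLamStar δ α X)

/-- The value `∑ (iħ)^k X_k` of a quantum action given by its expansion in powers of `iħ`. For an
action of definite Planck number the sum is finite for each monomial. -/
def actionAt (X : ℕ → FL ε K) (ħ : ℝ) : FL ε K :=
  fun n x S => ∑ᶠ k : ℕ, (Complex.I * (ħ : ℂ)) ^ k * X k n x S

/-- `X = ∑ (iħ)^k X_k` is a first-level gauge-fixing action over `U`: smooth, even (bosonic), of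
Planck number one, where `ħ` and `λ^α` have Planck number `1`, `λ*_α` has `-1` and `Γ^A` has `0`,
and satisfying the Quantum Master Equation `Δ_{[1]D} exp(iX/ħ) = 0`. -/
structure IsGaugeFixingAction {D : ℕ} (U : Set (Pt ε)) (E : Fin M → Fin M → SFun ε)
    (Θ : Fin D → SFun ε) (ρ : SFun ε) (δ : Fin K → ZMod 2) (X : ℕ → FL ε K) : Prop where
  smooth : ∀ k n, SmoothOn (X k n) U
  parity : ∀ k n, ∀ x ∈ U, HasParity (X k n x) 0
  planck : ∀ k n, ∀ x ∈ U, ∀ S, X k n x S ≠ 0 → lamDeg δ n S + k = lamStarDeg δ n S + 1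
  master : ∀ ħ : ℝ, ħ ≠ 0 → ∀ n, ∀ x ∈ U,
    diracDelta1 E Θ ρ δ (fexp ((Complex.I / (ħ : ℂ)) • actionAt X ħ)) n x = 0

/-- The expansion `X = G_α λ^α + (iħ) H + O(λ*)` over `U`. -/
def HasExpansion (U : Set (Pt ε)) (δ : Fin K → ZMod 2) (X : ℕ → FL ε K) (G : Fin K → SFun ε)
    (H : SFun ε) : Prop :=
  ∀ ħ : ℝ, ∀ n, ∀ x ∈ U, atLamStarZero δ (actionAt X ħ) n x =
    ((∑ α, up (G α) * lam δ α) + (Complex.I * (ħ : ℂ)) • up H : FL ε K) n x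

end firstLevel

end SuperBV

end

open SuperBV SuperBV.Grassmann

open scoped BigOperators
noncomputable section
set_option linter.unusedSectionVars false

namespace SuperBV

/-! Put w = iX/ħ at ħ = 1 and write exp(-w) Δ exp(w) as a polynomial in the derivatives of w. The
Planck number bounds the λ-degree of every term of w by its λ*-degree plus one. Therefore the
second-order coefficient in λ of this expression, at λ* = 0, says that (G_γ,G_β)_D = G_σ v^σ_{βγ},
where v comes from the λλλ*-terms of the action, and the first-order coefficient says that Δ_D G_β −
(H,G_β)_D is the signed trace of v modulo the G's (`FirstLevel.br_gauge`, `FirstLevel.lap_sub_mem`,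
collected in `master_algebra`).

On the other hand 2Δ_D G_β is the divergence, with respect to ρ, of the Hamiltonian vector field of
G_β (`SDom.lap_eq`). In the coordinates {F;G;Θ} this divergence can be read off: the Θ-components of
the field vanish because the Dirac bracket annihilates Θ, the G-components contribute the trace of
v, and the F-components contribute the derivatives of (F^α,G_β)_D along F^α. The change from Γ to
these coordinates costs the logarithmic derivative of J_D. The Jacobi identity of the Dirac bracket,
valid modulo Θ (`SDom.jacobi_dirE`), turns the F-part into the logarithmic derivative of sdet(F,G)_D
and a second trace of v. Both logarithmic derivatives rest on `SuperRing.ber_log`. The comparison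
(`SDom.lap_gauge`, `SDom.dbar_action_add_log_mem`) shows that the bracket of H + ½ ln(J_D
sdet(F,G)_D / ρ) with every G_β lies in the ideal I generated by G and Θ. As (F,G)_D is invertible,
the derivatives of this function along F lie in I as well.

It remains to integrate (`Sm.eq_const_add`). Modulo I the dependence on the odd coordinates can be
removed, and a function without such dependence is determined by its body. The body is locally
constant on the constraint surface, hence constant there by connectedness, and Hadamard's lemma in
the chart given by the bodies of the even members of {F;G;Θ} makes the deviation from the constant a
combination of constraints near the surface (`chart_hadamard`). Invertibility of (F,G)_D near the
surface follows from the nondegeneracy of E (`SDom.det_gmat_ne_zero`).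

The algebra takes place in abstract supercommutative algebras with derivations (`SuperRing`, `SDom`,
`FirstLevel`); these are afterwards realised by the smooth functions `Sm U κ` and by power series
over them. -/

theorem zmod2_cases (p : ZMod 2) : p = 0 ∨ p = 1 := by
  revert p; decide

@[simp] theorem psign_zero : psign 0 = 1 := by simp [psign]

@[simp] theorem psign_one : psign 1 = -1 := by
  simp [psign, ZMod.val_one]

theorem psign_add (p q : ZMod 2) : psign (p + q) = psign p * psign q := by
  rcases zmod2_cases p with rfl | rfl <;> rcases zmod2_cases q with rfl | rfl <;>
    simp [show (1 : ZMod 2) + 1 = 0 from rfl]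

@[simp] theorem psign_mul_self (p : ZMod 2) : psign p * psign p = 1 := by
  rcases zmod2_cases p with rfl | rfl <;> simp

theorem psign_ne_zero (p : ZMod 2) : psign p ≠ 0 := by
  rcases zmod2_cases p with rfl | rfl <;> simp

theorem psign_natCast (n : ℕ) : psign (n : ZMod 2) = (-1) ^ n := by
  induction n with
  | zero => simp
  | succ n ih => rw [Nat.cast_succ, psign_add, ih, psign_one, pow_succ]

theorem psign_eq_iff {p q : ZMod 2} : psign p = psign q ↔ p = q := by
  rcases zmod2_cases p with rfl | rfl <;> rcases zmod2_cases q with rfl | rfl <;>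
    norm_num

/-! ### The Grassmann algebra: signs, parity automorphism, derivatives, degree filtration. -/

namespace Grassmann

variable {κ : Type}

section basics

variable [Fintype κ]

@[ext] theorem gext {f g : Grassmann κ} (h : ∀ S, f S = g S) : f = g := funext h

@[simp] theorem add_apply (f g : Grassmann κ) (S : Finset κ) : (f + g) S = f S + g S := rfl
@[simp] theorem sub_apply (f g : Grassmann κ) (S : Finset κ) : (f - g) S = f S - g S := rfl
@[simp] theorem neg_apply (f : Grassmann κ) (S : Finset κ) : (-f) S = -f S := rfl
@[simp] theorem zero_apply (S : Finset κ) : (0 : Grassmann κ) S = 0 := rfl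
@[simp] theorem smul_apply (c : ℂ) (f : Grassmann κ) (S : Finset κ) : (c • f) S = c * f S := rfl

/-- Coefficient extraction as a linear map. -/
def coeffₗ (S : Finset κ) : Grassmann κ →ₗ[ℂ] ℂ where
  toFun f := f S
  map_add' _ _ := rfl
  map_smul' _ _ := rfl

theorem sum_apply {ι : Type*} (s : Finset ι) (f : ι → Grassmann κ) (S : Finset κ) :
    (∑ i ∈ s, f i) S = ∑ i ∈ s, f i S :=
  map_sum (coeffₗ S) f s

end basics

section signs

variable [LinearOrder κ]

theorem inv_singleton_add {i : κ} {S : Finset κ} (h : i ∉ S) :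
    inv {i} S + inv S {i} = S.card := by
  simpa using inv_add_inv (S := {i}) (T := S) (by simpa using h)

theorem sgn_insert_left {i : κ} {S : Finset κ} (T : Finset κ) (h : i ∉ S) :
    sgn (insert i S) T = sgn {i} T * sgn S T := by
  unfold sgn
  rw [Finset.insert_eq, inv_union_left _ (by simpa using h), pow_add]

theorem sgn_insert_right {i : κ} (S : Finset κ) {T : Finset κ} (h : i ∉ T) :
    sgn S (insert i T) = sgn S {i} * sgn S T := by
  unfold sgn
  rw [Finset.insert_eq, inv_union_right _ (by simpa using h), pow_add]

@[simp] theorem sgn_mul_self (S T : Finset κ) : sgn S T * sgn S T = 1 := by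
  unfold sgn; rw [← pow_add]; exact (Even.add_self _).neg_one_pow

theorem sgn_swap_singleton {i : κ} {S : Finset κ} (h : i ∉ S) :
    sgn S {i} = (-1) ^ S.card * sgn {i} S := by
  have := inv_singleton_add h
  have h2 : sgn {i} S * sgn S {i} = (-1) ^ S.card := by
    unfold sgn; rw [← pow_add, this]
  rw [← h2]
  linear_combination (-sgn S {i}) * sgn_mul_self {i} S

theorem sgn_pair {i j : κ} (h : i ≠ j) : sgn {i} {j} = -sgn {j} {i} := by
  rw [sgn_swap_singleton (i := j) (S := {i}) (by simpa using h.symm)]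
  simp

@[simp] theorem sgn_empty_left (S : Finset κ) : sgn ∅ S = 1 := by simp [sgn, inv]
@[simp] theorem sgn_empty_right (S : Finset κ) : sgn S ∅ = 1 := by simp [sgn, inv]

end signs

section algebra

variable [Fintype κ] [LinearOrder κ]

theorem one_apply (S : Finset κ) : (1 : Grassmann κ) S = if S = ∅ then 1 else 0 := rfl

namespace Alg

/-- The Grassmann algebra as a complex algebra. -/
scoped instance instAlgebra : Algebra ℂ (Grassmann κ) :=
  Algebra.ofModule
    (fun r f g => by
      ext S
      simp only [mul_apply, smul_apply, Finset.mul_sum]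
      exact Finset.sum_congr rfl fun T _ => by ring)
    (fun r f g => by
      ext S
      simp only [mul_apply, smul_apply, Finset.mul_sum]
      exact Finset.sum_congr rfl fun T _ => by ring)

end Alg

end algebra

open scoped Grassmann.Alg

section algebra

variable [Fintype κ] [LinearOrder κ]

/-- The parity automorphism as a linear map. -/
def gsigₗ : Grassmann κ →ₗ[ℂ] Grassmann κ where
  toFun f S := (-1) ^ S.card * f S
  map_add' _ _ := funext fun _ => mul_add _ _ _
  map_smul' _ _ := funext fun _ => mul_left_comm _ _ _

theorem gsigₗ_apply (f : Grassmann κ) (S : Finset κ) : gsigₗ f S = (-1) ^ S.card * f S := rfl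

/-- The parity automorphism. -/
def gsig : Grassmann κ →ₐ[ℂ] Grassmann κ :=
  AlgHom.ofLinearMap gsigₗ
    (by ext S; rw [gsigₗ_apply]; by_cases h : S = ∅ <;> simp [one_apply, h])
    (by
      intro f g
      ext S
      simp only [mul_apply, gsigₗ_apply, Finset.mul_sum]
      refine Finset.sum_congr rfl fun T hT => ?_
      rw [← Finset.card_sdiff_add_card_eq_card (Finset.mem_powerset.mp hT), pow_add]
      ring)

theorem gsig_apply (f : Grassmann κ) (S : Finset κ) : gsig f S = (-1) ^ S.card * f S := rfl

theorem gsig_gsig (f : Grassmann κ) : gsig (gsig f) = f := by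
  ext S
  rw [gsig_apply, gsig_apply, ← mul_assoc, ← pow_add, (Even.add_self _).neg_one_pow, one_mul]

/-- Parity becomes an eigenvalue equation of an algebra automorphism. This form makes sense in any
algebra with such an automorphism and is the one used from here on. -/
theorem hasParity_iff {f : Grassmann κ} {p : ZMod 2} :
    HasParity f p ↔ gsig f = psign p • f := by
  constructor
  · intro h
    ext S
    rw [gsig_apply, smul_apply]
    by_cases hS : f S = 0
    · simp [hS]
    · rw [← h S hS, psign_natCast]
  · intro h S hS
    have := congrFun h S
    rw [gsig_apply, smul_apply, ← psign_natCast] at this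
    exact psign_eq_iff.mp (mul_right_cancel₀ hS this)

/-- The parity automorphism raised to the power `p`. -/
def gsigp (p : ZMod 2) : Grassmann κ →ₐ[ℂ] Grassmann κ := if p = 0 then AlgHom.id ℂ _ else gsig

/-- Only `g` has to be homogeneous: a monomial of degree |T| in `f` that passes `g` acquires the
sign (-1)^(|T| p), which is what the p-th power of the parity automorphism does. -/
theorem mul_comm_of_parity {g : Grassmann κ} {p : ZMod 2} (hg : HasParity g p) (f : Grassmann κ) :
    f * g = g * gsigp p f := by
  have key : ∀ S : Finset κ, ∀ T ∈ S.powerset, sgn T (S \ T) * f T * g (S \ T) =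
      sgn (S \ T) T * g (S \ T) * gsigp p f T := by
    intro S T hT
    by_cases h0 : g (S \ T) = 0
    · simp [h0]
    have hp := hg _ h0
    have hs : sgn T (S \ T) * sgn (S \ T) T = psign ((T.card : ZMod 2) * p) := by
      rw [← hp, ← Nat.cast_mul, psign_natCast]
      unfold sgn
      rw [← pow_add, inv_add_inv Finset.disjoint_sdiff]
    have hsig : gsigp p f T = psign ((T.card : ZMod 2) * p) * f T := by
      rcases zmod2_cases p with rfl | rfl
      · simp [gsigp]
      · rw [mul_one, psign_natCast]; simp [gsigp, gsig_apply]
    rw [hsig, ← hs]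
    linear_combination (-(f T * g (S \ T) * sgn T (S \ T))) * sgn_mul_self (S \ T) T
  ext S
  rw [mul_apply, mul_apply, Finset.sum_congr rfl (key S)]
  refine Finset.sum_bij' (fun T _ => S \ T) (fun T _ => S \ T) ?_ ?_ ?_ ?_ ?_
  · intro T _; simp
  · intro T _; simp
  · intro T hT; simpa using Finset.mem_powerset.mp hT
  · intro T hT; simpa using Finset.mem_powerset.mp hT
  · intro T hT
    have hT' := Finset.mem_powerset.mp hT
    rw [show S \ (S \ T) = T by simpa using hT']

/-- Left derivative as a linear map. -/
def leftDerₗ (i : κ) : Grassmann κ →ₗ[ℂ] Grassmann κ where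
  toFun := leftDer i
  map_add' f g := by ext S; simp only [leftDer, add_apply]; split_ifs <;> ring
  map_smul' c f := by
    ext S; simp only [leftDer, smul_apply, RingHom.id_apply]; split_ifs <;> ring

theorem leftDer_apply_of_mem {i : κ} {S : Finset κ} (h : i ∈ S) (f : Grassmann κ) :
    leftDer i f S = 0 := if_pos h

theorem leftDer_apply_of_notMem {i : κ} {S : Finset κ} (h : i ∉ S) (f : Grassmann κ) :
    leftDer i f S = sgn {i} S * f (insert i S) := if_neg h

theorem leftDer_mul (i : κ) (f g : Grassmann κ) :
    leftDer i (f * g) = leftDer i f * g + gsig f * leftDer i g := by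
  ext S
  rw [add_apply]
  by_cases hi : i ∈ S
  -- If `i ∈ S`, the left side vanishes. On the right, the surviving terms of the two products are
  -- indexed by the same sets `T ⊆ R` and cancel in pairs.
  · obtain ⟨R, hR, rfl⟩ : ∃ R, i ∉ R ∧ insert i R = S :=
      ⟨S.erase i, Finset.notMem_erase i S, Finset.insert_erase hi⟩
    rw [leftDer_apply_of_mem hi, mul_apply, mul_apply, Finset.sum_powerset_insert hR,
      Finset.sum_powerset_insert hR]
    have z1 : ∀ T ∈ R.powerset, sgn (insert i T) (insert i R \ insert i T) *
        leftDer i f (insert i T) * g (insert i R \ insert i T) = 0 := fun T _ => by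
      rw [leftDer_apply_of_mem (Finset.mem_insert_self i T)]; ring
    have z2 : ∀ T ∈ R.powerset, sgn T (insert i R \ T) * gsig f T *
        leftDer i g (insert i R \ T) = 0 := fun T hT => by
      rw [leftDer_apply_of_mem]
      · ring
      · simp only [Finset.mem_sdiff, Finset.mem_insert_self, true_and]
        exact fun h => hR (Finset.mem_powerset.mp hT h)
    rw [Finset.sum_eq_zero z1, Finset.sum_eq_zero z2, add_zero, zero_add,
      ← Finset.sum_add_distrib, eq_comm]
    refine Finset.sum_eq_zero fun T hT => ?_
    have hT' := Finset.mem_powerset.mp hT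
    have hiT : i ∉ T := fun h => hR (hT' h)
    have e1 : insert i R \ T = insert i (R \ T) := Finset.insert_sdiff_of_notMem _ hiT
    have e2 : insert i R \ insert i T = R \ T := by
      ext a; simp only [Finset.mem_sdiff, Finset.mem_insert]
      by_cases ha : a = i
      · subst ha; simp [hR]
      · simp [ha]
    have hiRT : i ∉ R \ T := fun h => hR (Finset.mem_sdiff.mp h).1
    rw [e1, e2, leftDer_apply_of_notMem hiT, leftDer_apply_of_notMem hiRT, gsig_apply,
      sgn_insert_left _ hiT, sgn_insert_right _ hiRT, sgn_swap_singleton hiT,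
      Finset.card_insert_of_notMem hiT, pow_succ]
    linear_combination ((-1) ^ T.card * sgn T (R \ T) * f (insert i T) * g (insert i (R \ T))) *
      (sgn_mul_self {i} T - sgn_mul_self {i} (R \ T))
  -- If `i ∉ S`, the subsets of `insert i S` that contain `i` give the first Leibniz term and the
  -- others give the second.
  · rw [leftDer_apply_of_notMem hi, mul_apply, mul_apply, mul_apply,
      Finset.sum_powerset_insert hi, mul_add, add_comm, Finset.mul_sum, Finset.mul_sum]
    congr 1
    · refine Finset.sum_congr rfl fun T hT => ?_
      have hT' := Finset.mem_powerset.mp hT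
      have hiT : i ∉ T := fun h => hi (hT' h)
      have e2 : insert i S \ insert i T = S \ T := by
        ext a; simp only [Finset.mem_sdiff, Finset.mem_insert]
        by_cases ha : a = i
        · subst ha; simp [hi]
        · simp [ha]
      have e3 : sgn {i} S = sgn {i} T * sgn {i} (S \ T) := by
        unfold sgn
        rw [← pow_add, ← inv_union_right _ Finset.disjoint_sdiff,
          Finset.union_sdiff_of_subset hT']
      rw [e2, leftDer_apply_of_notMem hiT, sgn_insert_left _ hiT, e3]
      linear_combination (sgn {i} T * sgn T (S \ T) * f (insert i T) * g (S \ T)) *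
        sgn_mul_self {i} (S \ T)
    · refine Finset.sum_congr rfl fun T hT => ?_
      have hT' := Finset.mem_powerset.mp hT
      have hiT : i ∉ T := fun h => hi (hT' h)
      have hiST : i ∉ S \ T := fun h => hi (Finset.mem_sdiff.mp h).1
      have e1 : insert i S \ T = insert i (S \ T) := Finset.insert_sdiff_of_notMem _ hiT
      have e3 : sgn {i} S = sgn {i} T * sgn {i} (S \ T) := by
        unfold sgn
        rw [← pow_add, ← inv_union_right _ Finset.disjoint_sdiff,
          Finset.union_sdiff_of_subset hT']
      rw [e1, leftDer_apply_of_notMem hiST, sgn_insert_right _ hiST, gsig_apply, e3,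
        sgn_swap_singleton hiT]
      linear_combination ((-1) ^ T.card * sgn {i} (S \ T) * sgn T (S \ T) * f T *
        g (insert i (S \ T))) * sgn_mul_self {i} T

theorem leftDer_leftDer (i j : κ) (f : Grassmann κ) :
    leftDer i (leftDer j f) = -leftDer j (leftDer i f) := by
  ext S
  rw [neg_apply]
  by_cases hi : i ∈ S
  · rw [leftDer_apply_of_mem hi]
    by_cases hj : j ∈ S
    · rw [leftDer_apply_of_mem hj, neg_zero]
    · rw [leftDer_apply_of_notMem hj, leftDer_apply_of_mem (Finset.mem_insert_of_mem hi)]; ring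
  · rw [leftDer_apply_of_notMem hi]
    by_cases hj : j ∈ S
    · rw [leftDer_apply_of_mem hj, leftDer_apply_of_mem (Finset.mem_insert_of_mem hj)]; ring
    · rw [leftDer_apply_of_notMem hj]
      by_cases hij : i = j
      · subst hij
        rw [leftDer_apply_of_mem (Finset.mem_insert_self _ _)]; ring
      · have h1 : j ∉ insert i S := by simp [hj, Ne.symm hij]
        have h2 : i ∉ insert j S := by simp [hi, hij]
        rw [leftDer_apply_of_notMem h1, leftDer_apply_of_notMem h2,
          sgn_insert_right _ hi, sgn_insert_right _ hj, Finset.insert_comm, sgn_pair hij]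
        ring

theorem gsig_leftDer (i : κ) (f : Grassmann κ) : gsig (leftDer i f) = -leftDer i (gsig f) := by
  ext S
  rw [neg_apply, gsig_apply]
  by_cases hi : i ∈ S
  · rw [leftDer_apply_of_mem hi, leftDer_apply_of_mem hi]; ring
  · rw [leftDer_apply_of_notMem hi, leftDer_apply_of_notMem hi, gsig_apply,
      Finset.card_insert_of_notMem hi, pow_succ]
    ring

/-- Extracting the generator on the right of a monomial instead of on the left moves it past the |S|
remaining generators. -/
theorem rightDer_eq (i : κ) (f : Grassmann κ) : rightDer i f = gsig (leftDer i f) := by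
  ext S
  rw [gsig_apply]
  by_cases hi : i ∈ S
  · simp [rightDer, leftDer, hi]
  · rw [leftDer_apply_of_notMem hi]
    simp only [rightDer, hi, if_false]
    rw [sgn_swap_singleton hi]; ring

theorem leftDer_gen (i j : κ) : leftDer i (gen j) = if i = j then 1 else 0 := by
  ext S
  by_cases hi : i ∈ S
  · rw [leftDer_apply_of_mem hi]
    split_ifs
    · rw [one_apply, if_neg (Finset.ne_empty_of_mem hi)]
    · rfl
  · rw [leftDer_apply_of_notMem hi]
    unfold gen
    by_cases hij : i = j
    · subst hij
      rw [if_pos rfl, one_apply]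
      by_cases hS : S = ∅
      · subst hS; simp
      · rw [if_neg hS, if_neg, mul_zero]
        intro h
        apply hS
        rw [← Finset.erase_insert hi, h]; simp
    · rw [if_neg hij, if_neg, mul_zero]; rfl
      intro h
      have : i ∈ ({j} : Finset κ) := h ▸ Finset.mem_insert_self i S
      exact hij (Finset.mem_singleton.mp this)

/-- The body as an algebra homomorphism. -/
def bodyₐ : Grassmann κ →ₐ[ℂ] ℂ :=
  AlgHom.ofLinearMap (coeffₗ ∅) rfl (fun f g => by
    change (f * g) ∅ = f ∅ * g ∅
    rw [mul_apply]; simp)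

theorem bodyₐ_apply (f : Grassmann κ) : bodyₐ f = body f := rfl

/-- Elements all of whose monomials have degree at least `k`. -/
def DegGE (k : ℕ) (f : Grassmann κ) : Prop := ∀ S : Finset κ, S.card < k → f S = 0

theorem DegGE.mul {k l : ℕ} {f g : Grassmann κ} (hf : DegGE k f) (hg : DegGE l g) :
    DegGE (k + l) (f * g) := by
  intro S hS
  rw [mul_apply]
  refine Finset.sum_eq_zero fun T hT => ?_
  have := Finset.card_sdiff_add_card_eq_card (Finset.mem_powerset.mp hT)
  by_cases h : T.card < k
  · rw [hf T h]; ring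
  · rw [hg (S \ T) (by omega)]; ring

theorem DegGE.add {k : ℕ} {f g : Grassmann κ} (hf : DegGE k f) (hg : DegGE k g) :
    DegGE k (f + g) := fun S hS => by rw [add_apply, hf S hS, hg S hS, add_zero]

theorem DegGE.neg {k : ℕ} {f : Grassmann κ} (hf : DegGE k f) :
    DegGE k (-f) := fun S hS => by rw [neg_apply, hf S hS, neg_zero]

theorem DegGE.sum {ι : Type*} {k : ℕ} {s : Finset ι} {f : ι → Grassmann κ}
    (hf : ∀ i ∈ s, DegGE k (f i)) : DegGE k (∑ i ∈ s, f i) := fun S hS => by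
  rw [sum_apply]; exact Finset.sum_eq_zero fun i hi => hf i hi S hS

theorem DegGE.smul {k : ℕ} {f : Grassmann κ} (c : ℂ) (hf : DegGE k f) :
    DegGE k (c • f) := fun S hS => by rw [smul_apply, hf S hS, mul_zero]

theorem degGE_zero (f : Grassmann κ) : DegGE 0 f := fun S hS => absurd hS (by omega)

theorem DegGE.mono {k l : ℕ} {f : Grassmann κ} (hf : DegGE k f) (h : l ≤ k) : DegGE l f :=
  fun S hS => hf S (by omega)

theorem degGE_one_iff {f : Grassmann κ} : DegGE 1 f ↔ body f = 0 := by
  constructor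
  · intro h; exact h ∅ (by simp)
  · intro h S hS
    have : S = ∅ := by simpa using hS
    rw [this]; exact h

theorem eq_zero_of_degGE {f : Grassmann κ} (h : DegGE (Fintype.card κ + 1) f) : f = 0 := by
  ext S; exact h S (Nat.lt_succ_of_le (Finset.card_le_univ S))

theorem degGE_one_of_parity_one {f : Grassmann κ} (h : HasParity f 1) : DegGE 1 f := by
  rw [degGE_one_iff]
  by_contra h0
  have := h ∅ h0
  simp at this

theorem DegGE.pow {k : ℕ} {f : Grassmann κ} (hf : DegGE k f) (n : ℕ) : DegGE (n * k) (f ^ n) := by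
  induction n with
  | zero => rw [Nat.zero_mul]; exact degGE_zero _
  | succ n ih => rw [pow_succ, Nat.succ_mul]; exact ih.mul hf

theorem isNilpotent_of_body {f : Grassmann κ} (h : body f = 0) :
    f ^ (Fintype.card κ + 1) = 0 := by
  apply eq_zero_of_degGE
  simpa using (degGE_one_iff.mpr h).pow (Fintype.card κ + 1)

theorem body_smul_one (c : ℂ) : body (c • (1 : Grassmann κ)) = c := by
  simp [body, one_apply]

end algebra

end Grassmann
end SuperBV
end

/-! ### Abstract supercommutative algebras and their right derivations. -/

open scoped BigOperators
noncomputable section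
set_option linter.unusedSectionVars false

namespace SuperBV

/-- A supercommutative complex algebra, given by its parity automorphism. -/
class SuperRing (R : Type) [Ring R] [Algebra ℂ R] where
  sig : R →ₐ[ℂ] R
  sig_sig : ∀ a, sig (sig a) = a
  -- In both axioms only `g` is homogeneous; `a` is arbitrary, so identities need not be checked on
  -- the homogeneous parts of `a`.
  even_comm : ∀ a g : R, sig g = g → a * g = g * a
  odd_comm : ∀ a g : R, sig g = -g → a * g = g * sig a

namespace SuperRing

variable {R : Type} [Ring R] [Algebra ℂ R] [SuperRing R]

/-- The parity automorphism raised to the power `p`. -/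
def sgp (p : ZMod 2) : R →ₐ[ℂ] R := if p = 0 then AlgHom.id ℂ R else sig

/-- `a` is homogeneous of parity `p`. -/
def IsPar (p : ZMod 2) (a : R) : Prop := sig a = psign p • a

@[simp] theorem sgp_zero (a : R) : sgp 0 a = a := rfl
@[simp] theorem sgp_one (a : R) : sgp 1 a = sig a := rfl

theorem sgp_add (p q : ZMod 2) (a : R) : sgp (p + q) a = sgp p (sgp q a) := by
  rcases zmod2_cases p with rfl | rfl <;> rcases zmod2_cases q with rfl | rfl <;>
    simp [show (1 : ZMod 2) + 1 = 0 from rfl, sig_sig]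

theorem sgp_sgp_self (p : ZMod 2) (a : R) : sgp p (sgp p a) = a := by
  rw [← sgp_add, CharTwo.add_self_eq_zero, sgp_zero]

theorem sgp_comm (p q : ZMod 2) (a : R) : sgp p (sgp q a) = sgp q (sgp p a) := by
  rw [← sgp_add, ← sgp_add, add_comm]

theorem IsPar.sgp {q : ZMod 2} {a : R} (h : IsPar q a) (p : ZMod 2) :
    sgp p a = psign (p * q) • a := by
  rcases zmod2_cases p with rfl | rfl
  · simp
  · simpa using! h

theorem isPar_zero_iff {a : R} : IsPar 0 a ↔ sig a = a := by simp [IsPar]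

theorem isPar_one : IsPar 0 (1 : R) := by simp [IsPar]

theorem isPar_zero (p : ZMod 2) : IsPar p (0 : R) := by simp [IsPar]

theorem IsPar.mul {p q : ZMod 2} {a b : R} (ha : IsPar p a) (hb : IsPar q b) :
    IsPar (p + q) (a * b) := by
  unfold IsPar at *
  rw [map_mul, ha, hb, smul_mul_smul_comm, psign_add]

theorem IsPar.mul' {p q r : ZMod 2} {a b : R} (ha : IsPar p a) (hb : IsPar q b)
    (h : p + q = r) : IsPar r (a * b) := h ▸ ha.mul hb

theorem IsPar.add {p : ZMod 2} {a b : R} (ha : IsPar p a) (hb : IsPar p b) :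
    IsPar p (a + b) := by
  unfold IsPar at *
  rw [map_add, ha, hb, smul_add]

theorem IsPar.neg {p : ZMod 2} {a : R} (ha : IsPar p a) : IsPar p (-a) := by
  unfold IsPar at *
  rw [map_neg, ha, smul_neg]

theorem IsPar.sub {p : ZMod 2} {a b : R} (ha : IsPar p a) (hb : IsPar p b) :
    IsPar p (a - b) := by
  rw [sub_eq_add_neg]; exact ha.add hb.neg

theorem IsPar.smul {p : ZMod 2} {a : R} (c : ℂ) (ha : IsPar p a) : IsPar p (c • a) := by
  unfold IsPar at *
  rw [map_smul, ha, smul_comm]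

theorem IsPar.sum {ι : Type*} {p : ZMod 2} {s : Finset ι} {f : ι → R}
    (h : ∀ i ∈ s, IsPar p (f i)) : IsPar p (∑ i ∈ s, f i) := by
  unfold IsPar at *
  rw [map_sum, Finset.smul_sum]
  exact Finset.sum_congr rfl h

theorem IsPar.cast {p q : ZMod 2} {a : R} (ha : IsPar p a) (h : p = q) : IsPar q a := h ▸ ha

theorem IsPar.comm_left {p : ZMod 2} {g : R} (hg : IsPar p g) (a : R) : a * g = g * SuperRing.sgp p a := by
  rcases zmod2_cases p with rfl | rfl
  · exact even_comm a g (isPar_zero_iff.mp hg)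
  · exact odd_comm a g (by simpa [IsPar] using hg)

theorem IsPar.comm {p q : ZMod 2} {a b : R} (ha : IsPar p a) (hb : IsPar q b) :
    a * b = psign (p * q) • (b * a) := by
  rw [hb.comm_left a, ha.sgp, mul_smul_comm, mul_comm q p]

theorem IsPar.comm_zero {a : R} (ha : IsPar 0 a) (b : R) : b * a = a * b := ha.comm_left b

/-- The even elements. -/
def evenSub (R : Type) [Ring R] [Algebra ℂ R] [SuperRing R] : Subring R where
  carrier := {a | sig a = a}
  mul_mem' {a b} ha hb := by
    change sig (a * b) = _
    rw [map_mul, show sig a = a from ha, show sig b = b from hb]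
  one_mem' := map_one _
  add_mem' {a b} ha hb := by
    change sig (a + b) = _
    rw [map_add, show sig a = a from ha, show sig b = b from hb]
  zero_mem' := map_zero _
  neg_mem' {a} ha := by
    change sig (-a) = _
    rw [map_neg, show sig a = a from ha]

instance : CommRing (evenSub R) :=
  { (inferInstance : Ring (evenSub R)) with
    mul_comm := fun _ b => Subtype.ext (even_comm _ _ b.2) }

theorem coe_isPar (a : evenSub R) : IsPar 0 (a : R) := isPar_zero_iff.mpr a.2

/-- The even part. -/
def evp (a : R) : evenSub R := ⟨(1 / 2 : ℂ) • (a + sig a), by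
  change sig _ = _
  rw [map_smul, map_add, sig_sig, add_comm]⟩

theorem evp_of_even {a : R} (ha : IsPar 0 a) : (evp a : R) = a := by
  change (1 / 2 : ℂ) • (a + sig a) = a
  rw [isPar_zero_iff.mp ha, ← two_smul ℂ a, smul_smul]; norm_num

/-- Right derivations of parity `q`. -/
structure IsRDer (q : ZMod 2) (X : R →ₗ[ℂ] R) : Prop where
  leib : ∀ a b, X (a * b) = a * X b + X a * sgp q b
  sig : ∀ a, SuperRing.sig (X a) = psign q • X (SuperRing.sig a)

namespace IsRDer

variable {q : ZMod 2} {X : R →ₗ[ℂ] R} (hX : IsRDer q X)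

include hX

theorem par {p : ZMod 2} {a : R} (ha : IsPar p a) : IsPar (p + q) (X a) := by
  unfold IsPar at *
  rw [hX.sig, ha, map_smul, psign_add, smul_smul, mul_comm]

theorem map_one : X 1 = 0 := by
  have := hX.leib 1 1
  rw [_root_.map_one (sgp q : R →ₐ[ℂ] R), mul_one, mul_one, one_mul] at this
  simpa using this

theorem leib_par {p : ZMod 2} {b : R} (a : R) (hb : IsPar p b) :
    X (a * b) = a * X b + psign (q * p) • (X a * b) := by
  rw [hX.leib, hb.sgp, mul_smul_comm]

theorem leib_even (a : R) {b : R} (hb : IsPar 0 b) : X (a * b) = a * X b + b * X a := by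
  rw [hX.leib_par a hb, mul_zero, psign_zero, one_smul, hb.comm_zero]

theorem prod_even {ι : Type*} [DecidableEq ι] (s : Finset ι) (f : ι → evenSub R) :
    X ((∏ i ∈ s, f i : evenSub R) : R) =
      ∑ k ∈ s, ((∏ i ∈ s.erase k, f i : evenSub R) : R) * X (f k : R) := by
  induction s using Finset.induction_on with
  | empty => simpa using hX.map_one
  | insert a s ha ih =>
    rw [Finset.prod_insert ha, Subring.coe_mul, hX.leib_even _ (coe_isPar _), ih,
      Finset.sum_insert ha, Finset.erase_insert ha, add_comm, Finset.mul_sum]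
    congr 1
    refine Finset.sum_congr rfl fun k hk => ?_
    have hne : a ≠ k := fun h => ha (h ▸ hk)
    rw [Finset.erase_insert_of_ne hne, Finset.prod_insert (by simp [ha]), Subring.coe_mul,
      mul_assoc]

/-- Jacobi's formula. -/
theorem det {n : Type*} [Fintype n] [DecidableEq n] (S : Matrix n n (evenSub R)) :
    X (S.det : R) = ∑ i, ∑ j, (S.adjugate i j : R) * X (S j i : R) := by
  -- The adjugate entry collects the terms of the Leibniz expansion with `σ i = j`, with the factor
  -- in column `i` removed. This is exactly what remains when the product rule differentiates that
  -- factor.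
  have hadj : ∀ i j, S.adjugate i j = ∑ σ : Equiv.Perm n,
      if σ i = j then ((Equiv.Perm.sign σ : ℤ) : evenSub R) * ∏ k ∈ Finset.univ.erase i, S (σ k) k
        else 0 := by
    intro i j
    rw [show S.adjugate i j = (S.updateCol i (Pi.single j 1)).det by
      rw [← Matrix.transpose_apply S.adjugate, Matrix.adjugate_transpose, Matrix.adjugate_apply,
        Matrix.updateRow_transpose, Matrix.det_transpose]]
    rw [Matrix.det_apply']
    refine Finset.sum_congr rfl fun σ _ => ?_
    rw [← Finset.mul_prod_erase _ _ (Finset.mem_univ i)]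
    have : ∀ k ∈ Finset.univ.erase i, S.updateCol i (Pi.single j 1) (σ k) k = S (σ k) k := by
      intro k hk
      rw [Matrix.updateCol_ne (Finset.ne_of_mem_erase hk)]
    rw [Finset.prod_congr rfl this, Matrix.updateCol_self]
    by_cases h : σ i = j
    · simp [h]
    · simp [h]
  rw [Matrix.det_apply']
  have e1 : ∀ σ : Equiv.Perm n,
      X ((((Equiv.Perm.sign σ : ℤ) : evenSub R) * ∏ k, S (σ k) k : evenSub R) : R) =
        ∑ i, ((((Equiv.Perm.sign σ : ℤ) : evenSub R) * ∏ k ∈ Finset.univ.erase i, S (σ k) k :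
          evenSub R) : R) * X (S (σ i) i : R) := by
    intro σ
    have h0 : X (((Equiv.Perm.sign σ : ℤ) : evenSub R) : R) = 0 := by
      rw [Subring.coe_intCast, ← zsmul_one, map_zsmul, hX.map_one, smul_zero]
    rw [Subring.coe_mul, hX.leib_even _ (coe_isPar _), h0, mul_zero, add_zero,
      hX.prod_even, Finset.mul_sum]
    refine Finset.sum_congr rfl fun i _ => ?_
    rw [Subring.coe_mul, mul_assoc]
  have e2 : ((∑ σ : Equiv.Perm n, ((Equiv.Perm.sign σ : ℤ) : evenSub R) * ∏ k, S (σ k) k :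
      evenSub R) : R) = ∑ σ : Equiv.Perm n,
        ((((Equiv.Perm.sign σ : ℤ) : evenSub R) * ∏ k, S (σ k) k : evenSub R) : R) :=
    map_sum (evenSub R).subtype _ _
  rw [e2, map_sum, Finset.sum_congr rfl fun σ _ => e1 σ, Finset.sum_comm]
  refine Finset.sum_congr rfl fun i _ => ?_
  have e3 : ∀ j, ((S.adjugate i j : evenSub R) : R) * X (S j i : R) = ∑ σ : Equiv.Perm n,
      if σ i = j then ((((Equiv.Perm.sign σ : ℤ) : evenSub R) *
        ∏ k ∈ Finset.univ.erase i, S (σ k) k : evenSub R) : R) * X (S j i : R) else 0 := by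
    intro j
    rw [hadj, show ((∑ σ : Equiv.Perm n, if σ i = j then ((Equiv.Perm.sign σ : ℤ) : evenSub R) *
      ∏ k ∈ Finset.univ.erase i, S (σ k) k else 0 : evenSub R) : R) = _ from
      map_sum (evenSub R).subtype _ _, Finset.sum_mul]
    refine Finset.sum_congr rfl fun σ _ => ?_
    split_ifs
    · rfl
    · simp
  rw [Finset.sum_congr rfl fun j _ => e3 j, Finset.sum_comm]
  refine Finset.sum_congr rfl fun σ _ => ?_
  rw [Finset.sum_ite_eq]; simp

end IsRDer

/-! ### Supermatrices, supertraces, derivations acting on matrices. -/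

section matrices

variable {ι : Type} [Fintype ι] [DecidableEq ι]

/-- Matrices with entries of parity `r i + c j`. -/
def MatPar {ι' : Type} (r : ι → ZMod 2) (c : ι' → ZMod 2) (M : Matrix ι ι' R) : Prop :=
  ∀ i j, IsPar (r i + c j) (M i j)

/-- Applying the parity automorphism to the entries of `N`, together with the expected signs, gives
another left inverse of `M`, which must coincide with `N`. -/
theorem MatPar.inv {r c : ι → ZMod 2} {M N : Matrix ι ι R} (hM : MatPar r c M)
    (h1 : M * N = 1) (h2 : N * M = 1) : MatPar c r N := by
  let N' : Matrix ι ι R := fun j i => psign (c j + r i) • sig (N j i)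
  have h3 : N' * M = 1 := by
    ext j k
    have : ∀ i, N' j i * M i k = psign (c j + c k) • sig (N j i * M i k) := by
      intro i
      have e := hM i k
      have e' : M i k = psign (r i + c k) • sig (M i k) := by
        rw [e, smul_smul, psign_mul_self, one_smul]
      change psign (c j + r i) • sig (N j i) * M i k = _
      nth_rewrite 1 [e']
      rw [map_mul, smul_mul_smul_comm, ← psign_add]
      congr 2
      linear_combination CharTwo.add_self_eq_zero (r i)
    rw [Matrix.mul_apply, Finset.sum_congr rfl fun i _ => this i, ← Finset.smul_sum, ← map_sum,
      ← Matrix.mul_apply, h2]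
    by_cases hjk : j = k
    · subst hjk; simp [CharTwo.add_self_eq_zero]
    · simp [Matrix.one_apply_ne hjk]
  have h4 : N' = N := left_inv_eq_right_inv h3 h1
  intro j i
  have : N' j i = N j i := by rw [h4]
  change psign (c j + r i) • sig (N j i) = N j i at this
  unfold IsPar
  nth_rewrite 2 [← this]
  rw [smul_smul, psign_mul_self, one_smul]

/-- The supertrace of matrices of total parity `q`. -/
def strq (q : ZMod 2) (p : ι → ZMod 2) (N : Matrix ι ι R) : R :=
  -- For `q = 0` this is the usual supertrace, for `q = 1` the trace without signs.
  ∑ i, psign ((q + 1) * p i) • N i i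

theorem strq_add (q : ZMod 2) (p : ι → ZMod 2) (N N' : Matrix ι ι R) :
    strq q p (N + N') = strq q p N + strq q p N' := by
  simp [strq, Finset.sum_add_distrib]

theorem strq_sub (q : ZMod 2) (p : ι → ZMod 2) (N N' : Matrix ι ι R) :
    strq q p (N - N') = strq q p N - strq q p N' := by
  simp [strq, smul_sub]

theorem strq_smul (q : ZMod 2) (p : ι → ZMod 2) (c : ℂ) (N : Matrix ι ι R) :
    strq q p (c • N) = c • strq q p N := by
  simp only [strq, Finset.smul_sum, Matrix.smul_apply]
  exact Finset.sum_congr rfl fun i _ => smul_comm _ _ _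

/-- Exchanging `A i j` and `Y j i` produces just the sign that turns the weight of the index `i`
into the weight of the index `j`; the column parities of `Y` must be shifted by `q` for this to
work. -/
theorem strq_cyc {q : ZMod 2} {p : ι → ZMod 2} {A Y : Matrix ι ι R} (hA : MatPar p p A)
    (hY : MatPar p (fun j => p j + q) Y) : strq q p (A * Y) = strq q p (Y * A) := by
  unfold strq
  simp only [Matrix.mul_apply, Finset.smul_sum]
  rw [Finset.sum_comm]
  refine Finset.sum_congr rfl fun j _ => Finset.sum_congr rfl fun i _ => ?_
  rw [(hA i j).comm (hY j i), smul_smul]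
  congr 1
  rw [← psign_add]
  exact congrArg psign ((by decide : ∀ a b q : ZMod 2,
    (q + 1) * a + (a + b) * (b + (a + q)) = (q + 1) * b) (p i) (p j) q)

/-- Application of a derivation of parity `q` to a supermatrix. -/
def xmap (q : ZMod 2) (p : ι → ZMod 2) (X : R →ₗ[ℂ] R) (M : Matrix ι ι R) : Matrix ι ι R :=
  fun i j => psign (q * p j) • X (M i j)

variable {q : ZMod 2} {X : R →ₗ[ℂ] R} {p : ι → ZMod 2}

theorem xmap_par (hX : IsRDer q X) {M : Matrix ι ι R} (hM : MatPar p p M) :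
    MatPar p (fun j => p j + q) (xmap q p X M) := fun i j =>
  ((hX.par (hM i j)).smul _).cast (by ring)

/-- The column sign in `xmap` is made for this rule: passing `N k j` costs (-1)^(q (p k + p j)),
which changes the sign of column `j` into that of column `k`. -/
theorem xmap_mul (hX : IsRDer q X) (M : Matrix ι ι R) {N : Matrix ι ι R} (hN : MatPar p p N) :
    xmap q p X (M * N) = M * xmap q p X N + xmap q p X M * N := by
  ext i j
  rw [Matrix.add_apply, Matrix.mul_apply, Matrix.mul_apply]
  unfold xmap
  rw [Matrix.mul_apply, map_sum, Finset.smul_sum, ← Finset.sum_add_distrib]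
  refine Finset.sum_congr rfl fun k _ => ?_
  rw [hX.leib_par _ (hN k j), smul_add, mul_smul_comm, smul_mul_assoc, smul_smul, ← psign_add]
  congr 3
  linear_combination q * CharTwo.add_self_eq_zero (p j)

theorem MatPar.mul {ι' : Type} {r : ι → ZMod 2} {c : ι' → ZMod 2} {A : Matrix ι ι R} {B : Matrix ι ι' R}
    (hA : MatPar r p A) (hB : MatPar p c B) : MatPar r c (A * B) := fun i j => by
  rw [Matrix.mul_apply]
  refine IsPar.sum fun k _ => ((hA i k).mul (hB k j)).cast ?_
  linear_combination CharTwo.add_self_eq_zero (p k)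

/-- The logarithmic derivative is additive on products. -/
theorem strq_log_mul (hX : IsRDer q X) {M N Mi Ni : Matrix ι ι R} (hM : MatPar p p M)
    (hN : MatPar p p N) (hMi : MatPar p p Mi) (hNi : MatPar p p Ni) (h1 : Mi * M = 1)
    (h2 : N * Ni = 1) :
    strq q p (Ni * Mi * xmap q p X (M * N)) =
      strq q p (Mi * xmap q p X M) + strq q p (Ni * xmap q p X N) := by
  have e1 : Ni * Mi * xmap q p X (M * N) =
      Ni * xmap q p X N + Ni * (Mi * xmap q p X M * N) := by
    rw [xmap_mul hX _ hN, mul_add]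
    congr 1
    · rw [mul_assoc, ← mul_assoc Mi, h1, one_mul]
    · simp only [mul_assoc]
  have hY : MatPar p (fun j => p j + q) (Mi * xmap q p X M * N) := by
    intro i j
    rw [Matrix.mul_apply]
    refine IsPar.sum fun k _ => (((hMi.mul (xmap_par hX hM)) i k).mul (hN k j)).cast ?_
    linear_combination CharTwo.add_self_eq_zero (p k)
  rw [e1, strq_add, add_comm, strq_cyc hNi hY, mul_assoc, h2, mul_one]

end matrices

/-! ### The Berezinian and its logarithmic derivative. -/

section berezinian

variable {q : ZMod 2} {X : R →ₗ[ℂ] R} {m n : Type} [Fintype m] [Fintype n] [DecidableEq m]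
  [DecidableEq n]

/-- Inclusion of matrices with even entries. -/
def coeM {m n : Type} (S : Matrix m n (evenSub R)) : Matrix m n R := S.map fun z => (z : R)

theorem coeM_par {m n : Type} (S : Matrix m n (evenSub R)) (i : m) (j : n) :
    IsPar 0 (coeM S i j) := coe_isPar _

theorem coeM_mul {l : Type} (S : Matrix l m (evenSub R)) (T : Matrix m n (evenSub R)) :
    coeM (S * T) = coeM S * coeM T :=
  Matrix.map_mul (f := (evenSub R).subtype)

theorem coeM_one : coeM (1 : Matrix m m (evenSub R)) = 1 :=
  Matrix.map_one (fun z : evenSub R => (z : R)) rfl rfl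

theorem trace_log_det (hX : IsRDer q X) (S : Matrix m m (evenSub R)) (hS : IsUnit S.det) :
    X (S.det : R) = (S.det : R) * ∑ i, ∑ j, (S⁻¹ i j : R) * X (S j i : R) := by
  rw [hX.det, Finset.mul_sum]
  refine Finset.sum_congr rfl fun i _ => ?_
  rw [Finset.mul_sum]
  refine Finset.sum_congr rfl fun j _ => ?_
  rw [← mul_assoc, ← Subring.coe_mul, Matrix.inv_def, Matrix.smul_apply, smul_eq_mul,
    Ring.mul_inverse_cancel_left _ _ hS]

theorem IsRDer.inverse (hX : IsRDer q X) {u : evenSub R} (hu : IsUnit u) :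
    X (Ring.inverse u : evenSub R) = -(((Ring.inverse u : evenSub R) : R) *
      (((Ring.inverse u : evenSub R) : R) * X u)) := by
  set v := Ring.inverse u with hv
  have h1 : (v : R) * u = 1 := by
    rw [← Subring.coe_mul, hv, Ring.inverse_mul_cancel _ hu]; rfl
  have h2 := hX.leib_even (u : R) (coe_isPar v)
  rw [← (coe_isPar v).comm_zero] at h1
  rw [h1, hX.map_one] at h2
  have h3 : (v : R) * (u * X v) = X v := by
    rw [← mul_assoc, ← (coe_isPar v).comm_zero, h1, one_mul]
  rw [← h3]
  rw [eq_neg_iff_add_eq_zero, ← mul_add, ← h2, mul_zero]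

/-- Parities of a block index. -/
def blockPar (m n : Type) : m ⊕ n → ZMod 2 := Sum.elim (fun _ => 0) (fun _ => 1)

theorem blockPar_fromBlocks {A : Matrix m m R} {B : Matrix m n R} {C : Matrix n m R}
    {D : Matrix n n R} (hA : ∀ i j, IsPar 0 (A i j)) (hB : ∀ i j, IsPar 1 (B i j))
    (hC : ∀ i j, IsPar 1 (C i j)) (hD : ∀ i j, IsPar 0 (D i j)) :
    MatPar (blockPar m n) (blockPar m n) (Matrix.fromBlocks A B C D) := by
  rintro (i | i) (j | j)
  · exact (hA i j).cast (by simp [blockPar])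
  · exact (hB i j).cast (by simp [blockPar])
  · exact (hC i j).cast (by simp [blockPar])
  · exact (hD i j).cast (by simp [blockPar]; rfl)

theorem isPar_one_apply (i j : m) : IsPar 0 ((1 : Matrix m m R) i j) := by
  by_cases h : i = j
  · subst h; rw [Matrix.one_apply_eq]; exact isPar_one
  · rw [Matrix.one_apply_ne h]; exact isPar_zero _

theorem isUnit_det_of_inv {S : Matrix m m (evenSub R)} {T : Matrix m m R}
    (hT : ∀ i j, IsPar 0 (T i j)) (h : coeM S * T = 1) : IsUnit S.det := by
  have e : coeM (T.map evp) = T := by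
    ext i j; exact evp_of_even (hT i j)
  have : S * T.map evp = 1 := by
    have h2 : coeM (S * T.map evp) = coeM 1 := by rw [coeM_mul, e, h, coeM_one]
    ext i j
    exact congrFun (congrFun h2 i) j
  exact Matrix.isUnit_det_of_right_inverse this

/-- Logarithmic derivative of the Berezinian, in block form. -/
theorem ber_log_block (hX : IsRDer q X) {S : Matrix m m (evenSub R)} {D : Matrix n n (evenSub R)}
    {B : Matrix m n R} {C : Matrix n m R} (hS : IsUnit S.det) (hD : IsUnit D.det)
    (hB : ∀ i j, IsPar 1 (B i j)) (hC : ∀ i j, IsPar 1 (C i j)) {Mi : Matrix (m ⊕ n) (m ⊕ n) R}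
    (hMi : Matrix.fromBlocks (coeM S + B * coeM D⁻¹ * C) B C (coeM D) * Mi = 1) :
    X ((S.det * Ring.inverse D.det : evenSub R) : R) =
      ((S.det * Ring.inverse D.det : evenSub R) : R) * strq q (blockPar m n)
        (Mi * xmap q (blockPar m n) X
          (Matrix.fromBlocks (coeM S + B * coeM D⁻¹ * C) B C (coeM D))) := by
  have hDD : coeM D * coeM D⁻¹ = 1 := by
    rw [← coeM_mul, Matrix.mul_nonsing_inv _ hD, coeM_one]
  have hDD' : coeM D⁻¹ * coeM D = 1 := by
    rw [← coeM_mul, Matrix.nonsing_inv_mul _ hD, coeM_one]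
  have hSS : coeM S * coeM S⁻¹ = 1 := by
    rw [← coeM_mul, Matrix.mul_nonsing_inv _ hS, coeM_one]
  have hSS' : coeM S⁻¹ * coeM S = 1 := by
    rw [← coeM_mul, Matrix.nonsing_inv_mul _ hS, coeM_one]
  have pB : ∀ i j, IsPar 1 ((B * coeM D⁻¹) i j) := fun i j => by
    rw [Matrix.mul_apply]
    exact IsPar.sum fun k _ => ((hB i k).mul (coe_isPar (D⁻¹ k j))).cast (by simp)
  have pC : ∀ i j, IsPar 1 ((coeM D⁻¹ * C) i j) := fun i j => by
    rw [Matrix.mul_apply]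
    exact IsPar.sum fun k _ => ((coe_isPar (D⁻¹ i k)).mul (hC k j)).cast (by simp)
  have z0 : ∀ {a b : Type} (r : ZMod 2) (i : a) (j : b), IsPar r ((0 : Matrix a b R) i j) :=
    fun r i j => isPar_zero r
  -- Gauss decomposition with respect to the odd-odd block: the matrix is `L * (T * V)` with `L`,
  -- `V` unipotent and `T` block diagonal. The logarithmic derivative is additive on products, the
  -- unipotent factors contribute nothing, and `T` contributes the two ordinary Jacobi formulas.
  set L : Matrix (m ⊕ n) (m ⊕ n) R := Matrix.fromBlocks 1 (B * coeM D⁻¹) 0 1 with hL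
  set Li : Matrix (m ⊕ n) (m ⊕ n) R := Matrix.fromBlocks 1 (-(B * coeM D⁻¹)) 0 1 with hLi
  set T : Matrix (m ⊕ n) (m ⊕ n) R := Matrix.fromBlocks (coeM S) 0 0 (coeM D) with hT
  set Ti : Matrix (m ⊕ n) (m ⊕ n) R := Matrix.fromBlocks (coeM S⁻¹) 0 0 (coeM D⁻¹) with hTi
  set V : Matrix (m ⊕ n) (m ⊕ n) R := Matrix.fromBlocks 1 0 (coeM D⁻¹ * C) 1 with hV
  set Vi : Matrix (m ⊕ n) (m ⊕ n) R := Matrix.fromBlocks 1 0 (-(coeM D⁻¹ * C)) 1 with hVi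
  have eM : Matrix.fromBlocks (coeM S + B * coeM D⁻¹ * C) B C (coeM D) = L * (T * V) := by
    rw [hL, hT, hV, Matrix.fromBlocks_multiply, Matrix.fromBlocks_multiply]
    simp only [Matrix.mul_one, Matrix.one_mul, Matrix.mul_zero, Matrix.zero_mul, add_zero,
      zero_add]
    rw [← Matrix.mul_assoc (coeM D), hDD, Matrix.one_mul, Matrix.mul_assoc B (coeM D⁻¹) (coeM D),
      hDD', Matrix.mul_one]
  have hone : (1 : Matrix (m ⊕ n) (m ⊕ n) R) = Matrix.fromBlocks 1 0 0 1 :=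
    Matrix.fromBlocks_one.symm
  have hLL : L * Li = 1 := by
    rw [hL, hLi, hone, Matrix.fromBlocks_multiply]; simp
  have hLL' : Li * L = 1 := by
    rw [hL, hLi, hone, Matrix.fromBlocks_multiply]; simp
  have hTT : T * Ti = 1 := by
    rw [hT, hTi, hone, Matrix.fromBlocks_multiply]; simp [hSS, hDD]
  have hTT' : Ti * T = 1 := by
    rw [hT, hTi, hone, Matrix.fromBlocks_multiply]; simp [hSS', hDD']
  have hVV : V * Vi = 1 := by
    rw [hV, hVi, hone, Matrix.fromBlocks_multiply]; simp
  have hVV' : Vi * V = 1 := by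
    rw [hV, hVi, hone, Matrix.fromBlocks_multiply]; simp
  have pone := fun (i j : m) => isPar_one_apply (R := R) i j
  have pone' := fun (i j : n) => isPar_one_apply (R := R) i j
  have pL : MatPar (blockPar m n) (blockPar m n) L := blockPar_fromBlocks pone pB (z0 1) pone'
  have pLi : MatPar (blockPar m n) (blockPar m n) Li :=
    blockPar_fromBlocks pone (fun i j => (pB i j).neg) (z0 1) pone'
  have pT : MatPar (blockPar m n) (blockPar m n) T :=
    blockPar_fromBlocks (coeM_par _) (z0 1) (z0 1) (coeM_par _)
  have pTi : MatPar (blockPar m n) (blockPar m n) Ti :=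
    blockPar_fromBlocks (coeM_par _) (z0 1) (z0 1) (coeM_par _)
  have pV : MatPar (blockPar m n) (blockPar m n) V := blockPar_fromBlocks pone (z0 1) pC pone'
  have pVi : MatPar (blockPar m n) (blockPar m n) Vi :=
    blockPar_fromBlocks pone (z0 1) (fun i j => (pC i j).neg) pone'
  have hMi' : Mi = Vi * Ti * Li := by
    have h : Vi * Ti * Li * (L * (T * V)) = 1 := by
      calc Vi * Ti * Li * (L * (T * V)) = Vi * (Ti * (Li * L) * T) * V := by
            simp only [Matrix.mul_assoc]
        _ = 1 := by rw [hLL', Matrix.mul_one, hTT', Matrix.mul_one, hVV']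
    rw [eM] at hMi
    exact (left_inv_eq_right_inv h hMi).symm
  have hTV : T * V * (Vi * Ti) = 1 := by
    rw [Matrix.mul_assoc, ← Matrix.mul_assoc V, hVV, Matrix.one_mul, hTT]
  rw [eM, hMi', strq_log_mul hX pL (pT.mul pV) pLi (pVi.mul pTi) hLL' hTV,
    strq_log_mul hX pT pV pTi pVi hTT' hVV]
  have oneX : ∀ {a : Type} [DecidableEq a] (i j : a), X ((1 : Matrix a a R) i j) = 0 := by
    intro a _ i j
    by_cases h : i = j
    · subst h; rw [Matrix.one_apply_eq, hX.map_one]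
    · rw [Matrix.one_apply_ne h, map_zero]
  -- Differentiation leaves only the off-diagonal block of `L`, and multiplication by `Li` keeps it
  -- off the diagonal.
  have tL : strq q (blockPar m n) (Li * xmap q (blockPar m n) X L) = 0 := by
    unfold strq
    refine Finset.sum_eq_zero fun i _ => ?_
    rw [Matrix.mul_apply, Fintype.sum_sum_type]
    rcases i with i | i
    · simp [hL, hLi, xmap, oneX]
    · simp [hL, hLi, xmap, oneX]
  have tV : strq q (blockPar m n) (Vi * xmap q (blockPar m n) X V) = 0 := by
    unfold strq
    refine Finset.sum_eq_zero fun i _ => ?_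
    rw [Matrix.mul_apply, Fintype.sum_sum_type]
    rcases i with i | i
    · simp [hV, hVi, xmap, oneX]
    · simp [hV, hVi, xmap, oneX]
  have tT : strq q (blockPar m n) (Ti * xmap q (blockPar m n) X T) =
      (∑ i, ∑ j, (S⁻¹ i j : R) * X (S j i : R)) - ∑ i, ∑ j, (D⁻¹ i j : R) * X (D j i : R) := by
    unfold strq
    rw [Fintype.sum_sum_type, sub_eq_add_neg, ← Finset.sum_neg_distrib]
    congr 1
    · refine Finset.sum_congr rfl fun i _ => ?_
      rw [Matrix.mul_apply, Fintype.sum_sum_type]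
      simp [hT, hTi, xmap, blockPar, coeM]
    · refine Finset.sum_congr rfl fun i _ => ?_
      rw [Matrix.mul_apply, Fintype.sum_sum_type]
      simp [hT, hTi, xmap, blockPar, coeM, Finset.smul_sum, smul_smul, psign_add]
  rw [tL, tV, tT, zero_add, add_zero, Subring.coe_mul,
    hX.leib_even _ (coe_isPar _), trace_log_det hX S hS, hX.inverse hD, trace_log_det hX D hD]
  set a := ∑ i, ∑ j, (S⁻¹ i j : R) * X (S j i : R)
  set b := ∑ i, ∑ j, (D⁻¹ i j : R) * X (D j i : R)
  have hd : ((Ring.inverse D.det : evenSub R) : R) * (D.det : R) = 1 := by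
    rw [← Subring.coe_mul, Ring.inverse_mul_cancel _ hD]; rfl
  rw [← mul_assoc ((Ring.inverse D.det : evenSub R) : R) (D.det : R), hd, one_mul, mul_sub,
    ← mul_assoc ((Ring.inverse D.det : evenSub R) : R) (S.det : R), (coe_isPar S.det).comm_zero]
  noncomm_ring

variable {ι : Type} [Fintype ι] [DecidableEq ι]

/-- The block of rows of parity satisfying `P` and columns satisfying `Q`. -/
def blk {ι : Type} (P Q : ι → Prop) (M : Matrix ι ι R) : Matrix {i // P i} {j // Q j} R :=
  fun i j => M i j

/-- The even-even block made even. -/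
def berD (p : ι → ZMod 2) (M : Matrix ι ι R) :
    Matrix {i // p i ≠ 0} {i // p i ≠ 0} (evenSub R) :=
  fun i j => evp (M i j)

/-- The Schur complement of the odd-odd block. -/
def berS (p : ι → ZMod 2) (M : Matrix ι ι R) :
    Matrix {i // p i = 0} {i // p i = 0} (evenSub R) :=
  (blk (p · = 0) (p · = 0) M - blk (p · = 0) (p · ≠ 0) M * coeM (berD p M)⁻¹ *
    blk (p · ≠ 0) (p · = 0) M).map evp

/-- The Berezinian in a supercommutative algebra. -/
def ber (p : ι → ZMod 2) (M : Matrix ι ι R) : evenSub R :=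
  (berS p M).det * Ring.inverse (berD p M).det

/-- After sorting the indices by parity, the matrix is written through `berS` and `berD` as in
`ber_log_block`. The even parts in their definitions change nothing when the entries have the right
parities. -/
theorem ber_blocks {p : ι → ZMod 2} {M : Matrix ι ι R} (hM : MatPar p p M) :
    M.submatrix (Equiv.sumCompl (p · = 0)) (Equiv.sumCompl (p · = 0)) =
      Matrix.fromBlocks (coeM (berS p M) + blk (p · = 0) (p · ≠ 0) M * coeM (berD p M)⁻¹ *
        blk (p · ≠ 0) (p · = 0) M) (blk (p · = 0) (p · ≠ 0) M) (blk (p · ≠ 0) (p · = 0) M)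
        (coeM (berD p M)) := by
  have hodd : ∀ i : {i // p i ≠ 0}, p i = 1 := fun i => (zmod2_cases _).resolve_left i.2
  have hD : coeM (berD p M) = blk (p · ≠ 0) (p · ≠ 0) M := by
    ext i j
    exact evp_of_even ((hM i j).cast (by rw [hodd, hodd]; rfl))
  have hS : coeM (berS p M) = blk (p · = 0) (p · = 0) M - blk (p · = 0) (p · ≠ 0) M *
      coeM (berD p M)⁻¹ * blk (p · ≠ 0) (p · = 0) M := by
    ext i j
    refine evp_of_even ?_
    rw [Matrix.sub_apply]
    refine ((hM i j).cast (by rw [i.2, j.2]; rfl)).sub ?_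
    rw [Matrix.mul_apply]
    refine IsPar.sum fun k _ => ?_
    rw [Matrix.mul_apply]
    refine IsPar.mul' (p := 1) (q := 1) (IsPar.sum fun l _ => ?_)
      ((hM k j).cast (by rw [hodd, j.2]; rfl)) rfl
    exact IsPar.mul' (p := 1) (q := 0) ((hM i l).cast (by rw [hodd, i.2]; rfl))
      (coeM_par _ _ _) rfl
  rw [hS, hD, sub_add_cancel]
  ext (i | i) (j | j) <;> rfl

theorem sumCompl_par (p : ι → ZMod 2) (i) :
    p (Equiv.sumCompl (p · = 0) i) = blockPar {i // p i = 0} {i // ¬ p i = 0} i := by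
  rcases i with i | i
  · exact i.2
  · exact (zmod2_cases _).resolve_left i.2

theorem strq_submatrix (q : ZMod 2) (p : ι → ZMod 2) (N : Matrix ι ι R) :
    strq q (blockPar {i // p i = 0} {i // ¬ p i = 0})
      (N.submatrix (Equiv.sumCompl (p · = 0)) (Equiv.sumCompl (p · = 0))) = strq q p N := by
  unfold strq
  rw [← Equiv.sum_comp (Equiv.sumCompl (p · = 0))]
  refine Finset.sum_congr rfl fun i _ => ?_
  rw [sumCompl_par p i]; rfl

/-- The even-even block of the inverse of `M` is an inverse of the Schur complement. -/
theorem berS_isUnit {p : ι → ZMod 2} {M Mi : Matrix ι ι R} (hM : MatPar p p M)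
    (h1 : M * Mi = 1) (h2 : Mi * M = 1) (hD : IsUnit (berD p M).det) :
    IsUnit (berS p M).det := by
  have pMi := hM.inv h1 h2
  set σ := Equiv.sumCompl (p · = 0)
  have hb := ber_blocks hM
  have h1' : M.submatrix σ σ * Mi.submatrix σ σ = 1 := by
    rw [Matrix.submatrix_mul_equiv, h1, Matrix.submatrix_one_equiv]
  rw [hb, ← Matrix.fromBlocks_toBlocks (Mi.submatrix σ σ), Matrix.fromBlocks_multiply,
    ← Matrix.fromBlocks_one, Matrix.fromBlocks_inj] at h1'
  obtain ⟨e11, -, e21, -⟩ := h1'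
  refine isUnit_det_of_inv (T := (Mi.submatrix σ σ).toBlocks₁₁) (fun i j => ?_) ?_
  · exact (pMi i j).cast (by rw [i.2, j.2]; rfl)
  · have hDD' : coeM (berD p M)⁻¹ * coeM (berD p M) = 1 := by
      rw [← coeM_mul, Matrix.nonsing_inv_mul _ hD, coeM_one]
    have e21' : coeM (berD p M)⁻¹ * (blk (p · ≠ 0) (p · = 0) M * (Mi.submatrix σ σ).toBlocks₁₁) +
        (Mi.submatrix σ σ).toBlocks₂₁ = 0 := by
      have := congrArg (coeM (berD p M)⁻¹ * ·) e21
      simp only [Matrix.mul_add, Matrix.mul_zero] at this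
      rwa [← Matrix.mul_assoc _ (coeM (berD p M)), hDD', Matrix.one_mul] at this
    rw [← e11, Matrix.add_mul, add_assoc, left_eq_add, Matrix.mul_assoc, Matrix.mul_assoc,
      ← Matrix.mul_add, e21', Matrix.mul_zero]

/-- The supertrace does not depend on the order of the indices, so `ber_log_block` carries over to
the original labelling. -/
theorem ber_log (hX : IsRDer q X) {p : ι → ZMod 2} {M Mi : Matrix ι ι R} (hM : MatPar p p M)
    (h1 : M * Mi = 1) (h2 : Mi * M = 1) (hD : IsUnit (berD p M).det) :
    X (ber p M : R) = (ber p M : R) * strq q p (Mi * xmap q p X M) := by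
  set σ := Equiv.sumCompl (p · = 0)
  have hb := ber_blocks hM
  have h1' : M.submatrix σ σ * Mi.submatrix σ σ = 1 := by
    rw [Matrix.submatrix_mul_equiv, h1, Matrix.submatrix_one_equiv]
  rw [hb] at h1'
  have hodd : ∀ i : {i // p i ≠ 0}, p i = 1 := fun i => (zmod2_cases _).resolve_left i.2
  have key := ber_log_block (B := blk (p · = 0) (p · ≠ 0) M) (C := blk (p · ≠ 0) (p · = 0) M) hX (berS_isUnit hM h1 h2 hD) hD
    (fun i j => (hM i j).cast (by rw [hodd, i.2]; rfl))
    (fun i j => (hM i j).cast (by rw [hodd, j.2]; rfl)) h1'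
  rw [← hb] at key
  have e : xmap q (blockPar {i // p i = 0} {i // ¬ p i = 0}) X (M.submatrix σ σ) =
      (xmap q p X M).submatrix σ σ := by
    ext i j
    simp only [xmap, Matrix.submatrix_apply]
    rw [sumCompl_par p j]
  rw [e, Matrix.submatrix_mul_equiv, strq_submatrix] at key
  exact key

theorem ber_isUnit {p : ι → ZMod 2} {M Mi : Matrix ι ι R} (hM : MatPar p p M)
    (h1 : M * Mi = 1) (h2 : Mi * M = 1) (hD : IsUnit (berD p M).det) : IsUnit (ber p M) :=
  (berS_isUnit hM h1 h2 hD).mul (by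
    rw [Ring.inverse_of_isUnit hD]; exact Units.isUnit _)

end berezinian

end SuperRing
end SuperBV
end

/-! ### Ideals with homogeneous generators, superdomains and brackets of bivectors. -/

open scoped BigOperators
noncomputable section
set_option linter.unusedSectionVars false

namespace SuperBV
open SuperRing

section ideal

variable {R : Type} [Ring R] [Algebra ℂ R] [SuperRing R] {ζ : Type} [Fintype ζ]

/-- The ideal generated by homogeneous elements. -/
def genIdeal (z : ζ → R) (pz : ζ → ZMod 2) (hz : ∀ i, IsPar (pz i) (z i)) : Ideal R where
  carrier := {f | ∃ u : ζ → R, f = ∑ i, z i * u i}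
  add_mem' := by
    rintro a b ⟨u, rfl⟩ ⟨v, rfl⟩
    exact ⟨u + v, by simp [mul_add, Finset.sum_add_distrib]⟩
  zero_mem' := ⟨0, by simp⟩
  smul_mem' := by
    rintro c _ ⟨u, rfl⟩
    -- Homogeneity of the generators allows a left factor to be moved to the right of them, twisted
    -- by the parity automorphism. Hence the right combinations form a two-sided ideal.
    refine ⟨fun i => sgp (pz i) c * u i, ?_⟩
    rw [smul_eq_mul, Finset.mul_sum]
    refine Finset.sum_congr rfl fun i _ => ?_
    rw [← mul_assoc, (hz i).comm_left, mul_assoc]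

instance (z : ζ → R) (pz : ζ → ZMod 2) (hz : ∀ i, IsPar (pz i) (z i)) :
    (genIdeal z pz hz).IsTwoSided where
  mul_mem_of_left := by
    rintro a b ⟨u, rfl⟩
    exact ⟨fun i => u i * b, by simp [Finset.sum_mul, mul_assoc]⟩

theorem gen_mem_genIdeal [DecidableEq ζ] (z : ζ → R) (pz : ζ → ZMod 2)
    (hz : ∀ i, IsPar (pz i) (z i)) (i : ζ) : z i ∈ genIdeal z pz hz :=
  ⟨Pi.single i 1, by simp [Pi.single_apply]⟩

variable {I : Ideal R} [I.IsTwoSided]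

theorem mkₐ_eq_zero_iff {a : R} : Ideal.Quotient.mkₐ ℂ I a = 0 ↔ a ∈ I :=
  Ideal.Quotient.eq_zero_iff_mem

theorem mkₐ_eq_iff {a b : R} : Ideal.Quotient.mkₐ ℂ I a = Ideal.Quotient.mkₐ ℂ I b ↔ a - b ∈ I :=
  Ideal.Quotient.mk_eq_mk_iff_sub_mem a b

theorem smul_mem_ideal (c : ℂ) {a : R} (ha : a ∈ I) : c • a ∈ I := by
  rw [← mkₐ_eq_zero_iff] at *; rw [map_smul, ha, smul_zero]

end ideal

/-- Left partial derivatives on a supercommutative algebra. -/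
structure SDom (R : Type) [Ring R] [Algebra ℂ R] [SuperRing R] {ι : Type} (ε : ι → ZMod 2) where
  d : ι → R →ₗ[ℂ] R
  leib : ∀ A a b, d A (a * b) = d A a * b + sgp (ε A) a * d A b
  sig_d : ∀ A a, sig (d A a) = psign (ε A) • d A (sig a)
  comm : ∀ A B a, d A (d B a) = psign (ε A * ε B) • d B (d A a)

variable {R : Type} [Ring R] [Algebra ℂ R] [SuperRing R]

namespace SuperRing.IsRDer

theorem mul_right {q r : ZMod 2} {X : R →ₗ[ℂ] R} (hX : IsRDer q X) {c : R} (hc : IsPar r c) :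
    IsRDer (q + r) ((LinearMap.mulRight ℂ c).comp X) where
  leib a b := by
    simp only [LinearMap.comp_apply, LinearMap.mulRight_apply]
    rw [hX.leib, add_mul, mul_assoc, mul_assoc, hc.comm_left (sgp q b), mul_assoc, add_comm q r,
      sgp_add]
  sig a := by
    simp only [LinearMap.comp_apply, LinearMap.mulRight_apply]
    rw [map_mul, hX.sig, hc, smul_mul_smul_comm, psign_add]

theorem add {q : ZMod 2} {X Y : R →ₗ[ℂ] R} (hX : IsRDer q X) (hY : IsRDer q Y) :
    IsRDer q (X + Y) where
  leib a b := by
    simp only [LinearMap.add_apply, hX.leib, hY.leib, mul_add, add_mul]; abel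
  sig a := by simp only [LinearMap.add_apply, map_add, hX.sig, hY.sig, smul_add]

theorem zero (q : ZMod 2) : IsRDer q (0 : R →ₗ[ℂ] R) where
  leib a b := by simp
  sig a := by simp

theorem sum {ι : Type} {q : ZMod 2} (s : Finset ι) {X : ι → R →ₗ[ℂ] R}
    (hX : ∀ i ∈ s, IsRDer q (X i)) : IsRDer q (∑ i ∈ s, X i) :=
  Finset.sum_induction X (IsRDer q) (fun _ _ => add) (zero q) hX

end SuperRing.IsRDer

namespace SDom

variable {ι : Type} [Fintype ι] [DecidableEq ι] {ε : ι → ZMod 2} (d : SDom R ε)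

theorem d_par {A : ι} {p : ZMod 2} {a : R} (ha : IsPar p a) : IsPar (p + ε A) (d.d A a) := by
  unfold IsPar at *
  rw [d.sig_d, ha, map_smul, smul_smul, psign_add, mul_comm]

/-- Right partial derivatives. -/
def dr (A : ι) : R →ₗ[ℂ] R := (sgp (ε A)).toLinearMap.comp (d.d A)

theorem dr_apply (A : ι) (a : R) : d.dr A a = sgp (ε A) (d.d A a) := rfl

theorem dr_par {A : ι} {p : ZMod 2} {a : R} (ha : IsPar p a) :
    d.dr A a = psign (ε A * (p + ε A)) • d.d A a := (d.d_par ha).sgp _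

theorem d_eq_dr {A : ι} {p : ZMod 2} {a : R} (ha : IsPar p a) :
    d.d A a = psign (ε A * (p + ε A)) • d.dr A a := by
  rw [d.dr_par ha, smul_smul, psign_mul_self, one_smul]

theorem isRDer_dr (A : ι) : IsRDer (ε A) (d.dr A) where
  leib a b := by
    rw [dr_apply, d.leib, map_add, map_mul, map_mul, sgp_sgp_self, add_comm]; rfl
  sig a := by
    rw [dr_apply, dr_apply, ← sgp_one, sgp_comm, sgp_one, d.sig_d, map_smul]

theorem sgp_d (p : ZMod 2) (A : ι) (a : R) :
    sgp p (d.d A a) = psign (p * ε A) • d.d A (sgp p a) := by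
  rcases zmod2_cases p with rfl | rfl
  · simp
  · rw [one_mul]; exact d.sig_d A a

theorem dr_comm (A B : ι) (a : R) : d.dr A (d.dr B a) = psign (ε A * ε B) • d.dr B (d.dr A a) := by
  have h1 : ∀ A B x, d.d A (sgp (ε B) x) = psign (ε A * ε B) • sgp (ε B) (d.d A x) :=
    fun A B x => by rw [sgp_d, smul_smul, mul_comm (ε A), psign_mul_self, one_smul]
  simp only [dr_apply]
  rw [h1, h1, d.comm B A, map_smul, map_smul, map_smul, map_smul, sgp_comm, smul_smul, smul_smul,
    mul_comm (ε B), psign_mul_self, one_mul]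

/-- The bracket of a bivector. -/
def br (E : ι → ι → R) (f g : R) : R := ∑ A, ∑ B, d.dr A f * E A B * d.d B g

/-- The components of the Hamiltonian vector field of `g`. -/
def ham (E : ι → ι → R) (g : R) (A : ι) : R := ∑ B, E A B * d.d B g

theorem br_eq_ham (E : ι → ι → R) (f g : R) : d.br E f g = ∑ A, d.dr A f * d.ham E g A := by
  simp only [br, ham, Finset.mul_sum, mul_assoc]

/-- The bracket with `g` as a linear map. -/
def brL (E : ι → ι → R) (g : R) : R →ₗ[ℂ] R :=
  ∑ A, (LinearMap.mulRight ℂ (d.ham E g A)).comp (d.dr A)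

theorem brL_apply (E : ι → ι → R) (f g : R) : d.brL E g f = d.br E f g := by
  rw [br_eq_ham, brL, LinearMap.sum_apply]; rfl

/-- Odd skew bivectors. -/
structure IsBiv (ε : ι → ZMod 2) (E : ι → ι → R) : Prop where
  par : ∀ A B, IsPar (ε A + ε B + 1) (E A B)
  skew : ∀ A B, E B A = -(psign ((ε A + 1) * (ε B + 1)) • E A B)

variable {E : ι → ι → R} (hE : IsBiv ε E)

include hE

theorem ham_par {p : ZMod 2} {g : R} (hg : IsPar p g) (A : ι) :
    IsPar (ε A + (p + 1)) (d.ham E g A) :=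
  IsPar.sum fun B _ => (hE.par A B).mul' (d.d_par hg) (by
    linear_combination CharTwo.add_self_eq_zero (ε B))

/-- The bracket with a homogeneous function is a right vector field, so that all results on right
derivations, in particular `ber_log`, apply to it. -/
theorem isRDer_brL {p : ZMod 2} {g : R} (hg : IsPar p g) : IsRDer (p + 1) (d.brL E g) := by
  refine IsRDer.sum _ fun A _ => ?_
  have := (d.isRDer_dr A).mul_right (d.ham_par hE hg A)
  rwa [← add_assoc (ε A), CharTwo.add_self_eq_zero, zero_add] at this

theorem br_par {p r : ZMod 2} {f g : R} (hf : IsPar p f) (hg : IsPar r g) :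
    IsPar (p + r + 1) (d.br E f g) := by
  rw [← brL_apply]
  exact ((d.isRDer_brL hE hg).par hf).cast (by ring)

theorem br_mul_left {p r : ZMod 2} (f : R) {h g : R} (hh : IsPar r h) (hg : IsPar p g) :
    d.br E (f * h) g = f * d.br E h g + psign ((p + 1) * r) • (d.br E f g * h) := by
  simp only [← brL_apply]
  exact (d.isRDer_brL hE hg).leib_par f hh

theorem br_skew {p r : ZMod 2} {f g : R} (hf : IsPar p f) (hg : IsPar r g) :
    d.br E g f = -(psign ((p + 1) * (r + 1)) • d.br E f g) := by
  unfold br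
  rw [Finset.sum_comm, Finset.smul_sum, ← Finset.sum_neg_distrib]
  refine Finset.sum_congr rfl fun B _ => ?_
  rw [Finset.smul_sum, ← Finset.sum_neg_distrib]
  refine Finset.sum_congr rfl fun A _ => ?_
  have h1 : d.d A g * E B A * d.d B f =
      psign ((r + ε A) * (ε B + ε A + 1) + (r + ε A + (ε B + ε A + 1)) * (p + ε B)) •
        (d.d B f * E B A * d.d A g) := by
    rw [((d.d_par hg).mul (hE.par B A)).comm (d.d_par hf), (d.d_par hg).comm (hE.par B A),
      mul_smul_comm, smul_smul, mul_assoc, psign_add, mul_comm]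
  rw [d.dr_par hg, d.dr_par hf, hE.skew B A]
  simp only [smul_mul_assoc, mul_neg, neg_mul, mul_smul_comm]
  rw [h1, smul_smul, smul_smul, smul_smul, neg_inj, ← psign_add, ← psign_add, ← psign_add]
  congr 2
  generalize ε A = a, ε B = b
  exact (by decide : ∀ a b p r : ZMod 2, (b + 1) * (a + 1) + a * (r + a) +
    ((r + a) * (b + a + 1) + (r + a + (b + a + 1)) * (p + b)) =
    (p + 1) * (r + 1) + b * (p + b)) a b p r

theorem br_mul_right {p : ZMod 2} {f : R} (hf : IsPar p f) (g h : R) :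
    d.br E f (g * h) = d.br E f g * h + sgp (p + 1) g * d.br E f h := by
  unfold br
  rw [Finset.sum_mul, Finset.mul_sum, ← Finset.sum_add_distrib]
  refine Finset.sum_congr rfl fun A _ => ?_
  rw [Finset.sum_mul, Finset.mul_sum, ← Finset.sum_add_distrib]
  refine Finset.sum_congr rfl fun B _ => ?_
  rw [d.leib, mul_add, ← mul_assoc]
  congr 1
  have hp : IsPar (p + 1 + ε B) (d.dr A f * E A B) :=
    ((d.isRDer_dr A).par hf).mul' (hE.par A B) (by
      linear_combination CharTwo.add_self_eq_zero (ε A))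
  have := hp.comm_left (sgp (p + 1) g)
  rw [← sgp_add, show p + 1 + ε B + (p + 1) = ε B by
    linear_combination CharTwo.add_self_eq_zero (p + 1)] at this
  rw [← mul_assoc (sgp (p + 1) g), this, mul_assoc, mul_assoc, mul_assoc]

omit hE in
theorem br_sub_left (f g h : R) : d.br E (f - g) h = d.br E f h - d.br E g h := by
  simp only [← brL_apply, map_sub]

omit hE in
theorem br_sum_left {κ : Type} (s : Finset κ) (f : κ → R) (h : R) :
    d.br E (∑ i ∈ s, f i) h = ∑ i ∈ s, d.br E (f i) h := by
  simp only [← brL_apply, map_sum]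

omit hE in
theorem br_sub_right (f g h : R) : d.br E f (g - h) = d.br E f g - d.br E f h := by
  simp only [br, map_sub, mul_sub, Finset.sum_sub_distrib]

omit hE in
theorem br_smul_right (f : R) (c : ℂ) (g : R) : d.br E f (c • g) = c • d.br E f g := by
  simp only [br, map_smul, mul_smul_comm, Finset.smul_sum]

omit hE in
theorem br_smul_left (f : R) (c : ℂ) (g : R) : d.br E (c • f) g = c • d.br E f g := by
  simp only [← brL_apply, map_smul]

/-- The bracket with `f` on the left as a linear map. -/
def brR (E : ι → ι → R) (f : R) : R →ₗ[ℂ] R :=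
  ∑ A, ∑ B, (LinearMap.mulLeft ℂ (d.dr A f * E A B)).comp (d.d B)

omit hE in
theorem brR_apply (f g : R) : d.brR E f g = d.br E f g := by
  simp [brR, br, mul_assoc]

omit hE in
theorem br_sum_right {κ : Type} (s : Finset κ) (f : R) (g : κ → R) :
    d.br E f (∑ i ∈ s, g i) = ∑ i ∈ s, d.br E f (g i) := by
  simp only [← brR_apply, map_sum]

end SDom

end SuperBV
end

/-! ### The Dirac bracket. -/

open scoped BigOperators
noncomputable section
set_option linter.unusedSectionVars false

namespace SuperBV
open SuperRing

namespace SDom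

variable {R : Type} [Ring R] [Algebra ℂ R] [SuperRing R]
variable {ι : Type} [Fintype ι] [DecidableEq ι] {ε : ι → ZMod 2} (d : SDom R ε)
variable {t : Type} [Fintype t] [DecidableEq t]

/-- The components of the left Hamiltonian vector field of `f`. -/
def cham (E : ι → ι → R) (f : R) (B : ι) : R := ∑ C, d.dr C f * E C B

theorem br_eq_cham (E : ι → ι → R) (f g : R) : d.br E f g = ∑ B, d.cham E f B * d.d B g := by
  simp only [br, cham, Finset.sum_mul]
  exact Finset.sum_comm

theorem cham_eq_ham {E : ι → ι → R} (hE : IsBiv ε E) {p : ZMod 2} {f : R} (hf : IsPar p f) (B : ι) :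
    d.cham E f B = -(psign ((p + 1) * (ε B + 1)) • d.ham E f B) := by
  unfold cham ham
  rw [Finset.smul_sum, ← Finset.sum_neg_distrib]
  refine Finset.sum_congr rfl fun C _ => ?_
  rw [d.dr_par hf, smul_mul_assoc, (d.d_par hf).comm (hE.par C B), hE.skew B C]
  simp only [smul_mul_assoc, neg_mul, smul_neg, smul_smul, ← psign_add]
  congr 3
  generalize ε C = a, ε B = b
  exact (by decide : ∀ a b p : ZMod 2, a * (p + a) +
    ((p + a) * (a + b + 1) + (b + 1) * (a + 1)) =
    (p + 1) * (b + 1)) a b p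

/-- The Dirac bivector. -/
def dirE (E : ι → ι → R) (Θ : t → R) (Ei : Matrix t t R) (A B : ι) : R :=
  E A B - ∑ a, ∑ b, d.ham E (Θ a) A * Ei a b * d.cham E (Θ b) B

/-- The matrix of brackets of constraints. -/
def cmat (E : ι → ι → R) (Θ : t → R) : Matrix t t R := fun a b => d.br E (Θ a) (Θ b)

/-- `dirE` is a bivector given by its components. Contracting these with the derivatives of
arbitrary functions reproduces the Dirac formula, since the Hamiltonian fields of the constraints
contract to brackets. -/
theorem br_dirE (E : ι → ι → R) (Θ : t → R) (Ei : Matrix t t R) (f g : R) :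
    d.br (d.dirE E Θ Ei) f g =
      d.br E f g - ∑ a, ∑ b, d.br E f (Θ a) * Ei a b * d.br E (Θ b) g := by
  have h : ∀ a b, d.br E f (Θ a) * Ei a b * d.br E (Θ b) g =
      ∑ A, ∑ B, d.dr A f * (d.ham E (Θ a) A * Ei a b * d.cham E (Θ b) B) * d.d B g := by
    intro a b
    rw [br_eq_ham, br_eq_cham d E (Θ b), Finset.sum_mul, Finset.sum_mul]
    refine Finset.sum_congr rfl fun A _ => ?_
    rw [Finset.mul_sum]
    refine Finset.sum_congr rfl fun B _ => ?_
    simp only [mul_assoc]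
  simp only [h]
  unfold br dirE
  simp only [mul_sub, sub_mul, Finset.sum_sub_distrib]
  congr 1
  simp only [Finset.mul_sum, Finset.sum_mul]
  rw [Finset.sum_congr rfl fun A _ => Finset.sum_comm, Finset.sum_comm]
  refine Finset.sum_congr rfl fun a _ => ?_
  rw [Finset.sum_congr rfl fun A _ => (Finset.sum_congr rfl fun B _ => rfl),
    Finset.sum_congr rfl fun A _ => Finset.sum_comm, Finset.sum_comm]

variable {E : ι → ι → R} (hE : IsBiv ε E) {Θ : t → R} {τ : t → ZMod 2}
  (hΘ : ∀ a, IsPar (τ a) (Θ a)) {Ei : Matrix t t R}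
  (h1 : d.cmat E Θ * Ei = 1) (h2 : Ei * d.cmat E Θ = 1)

include hE hΘ h1 h2

theorem constraintInv_par (a b : t) : IsPar (τ a + (τ b + 1)) (Ei a b) :=
  MatPar.inv (r := fun a => τ a + 1) (c := τ) (M := d.cmat E Θ) (N := Ei)
    (fun a b => (d.br_par hE (hΘ a) (hΘ b)).cast (by ring)) h1 h2 a b

/-- The transposed matrix with the expected signs is a left inverse of the matrix of brackets,
because that matrix has its own graded symmetry; inverses are unique. -/
theorem constraintInv_skew (a b : t) : Ei b a = -(psign (τ a * τ b) • Ei a b) := by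
  let N : Matrix t t R := fun c b => -(psign (τ b * τ c) • Ei b c)
  have hN : N * d.cmat E Θ = 1 := by
    ext c a
    have : ∀ b, N c b * d.cmat E Θ b a =
        psign (τ a * τ c + τ c) • (d.cmat E Θ a b * Ei b c) := by
      intro b
      change -(psign (τ b * τ c) • Ei b c) * d.br E (Θ b) (Θ a) = _ • (d.br E (Θ a) (Θ b) * _)
      rw [neg_mul, smul_mul_assoc, (d.constraintInv_par hE hΘ h1 h2 b c).comm
        (d.br_par hE (hΘ b) (hΘ a)), d.br_skew hE (hΘ a) (hΘ b)]
      simp only [neg_mul, smul_neg, neg_neg, smul_mul_assoc, smul_smul, ← psign_add]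
      congr 2
      generalize τ a = a, τ b = b, τ c = c
      exact (by decide : ∀ a b c : ZMod 2, b * c +
        ((b + (c + 1)) * (b + a + 1) + (a + 1) * (b + 1)) =
        a * c + c) a b c
    rw [Matrix.mul_apply, Finset.sum_congr rfl fun b _ => this b, ← Finset.smul_sum,
      ← Matrix.mul_apply, h1]
    by_cases hac : a = c
    · subst hac
      have : τ a * τ a + τ a = 0 := (by decide : ∀ a : ZMod 2, a * a + a = 0) _
      rw [this]; simp
    · rw [Matrix.one_apply_ne hac, Matrix.one_apply_ne (Ne.symm hac), smul_zero]
  have h : N = Ei := left_inv_eq_right_inv hN h1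
  exact (congrFun (congrFun h b) a).symm

theorem isBiv_dirE : IsBiv ε (d.dirE E Θ Ei) where
  par A B := by
    refine (hE.par A B).sub (IsPar.sum fun a _ => IsPar.sum fun b _ => ?_)
    rw [cham_eq_ham d hE (hΘ b), mul_neg, mul_smul_comm]
    refine (IsPar.smul _ (IsPar.mul' ((d.ham_par hE (hΘ a) A).mul
      (d.constraintInv_par hE hΘ h1 h2 a b)) (d.ham_par hE (hΘ b) B) ?_)).neg
    generalize τ a = a, τ b = b, ε A = x, ε B = y
    exact (by decide : ∀ a b x y : ZMod 2, x + (a + 1) + (a + (b + 1)) + (y + (b + 1)) =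
      x + y + 1) a b x y
  skew A B := by
    unfold dirE
    rw [hE.skew A B, smul_sub, neg_sub, sub_eq_add_neg, add_comm, ← sub_eq_add_neg, Finset.sum_comm]
    rw [sub_eq_add_neg, sub_eq_add_neg, Finset.smul_sum]
    congr 1
    rw [← Finset.sum_neg_distrib]
    refine Finset.sum_congr rfl fun b _ => ?_
    rw [Finset.smul_sum, ← Finset.sum_neg_distrib]
    refine Finset.sum_congr rfl fun a _ => ?_
    have pa := d.ham_par hE (hΘ a)
    have pb := d.ham_par hE (hΘ b)
    have pE := d.constraintInv_par hE hΘ h1 h2 b a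
    rw [cham_eq_ham d hE (hΘ b), cham_eq_ham d hE (hΘ a), d.constraintInv_skew hE hΘ h1 h2 b a]
    have h3 : d.ham E (Θ a) B * Ei b a * d.ham E (Θ b) A =
        psign ((ε B + (τ a + 1)) * (τ b + (τ a + 1)) +
          (ε B + (τ a + 1) + (τ b + (τ a + 1))) * (ε A + (τ b + 1))) •
        (d.ham E (Θ b) A * Ei b a * d.ham E (Θ a) B) := by
      rw [((pa B).mul pE).comm (pb A), (pa B).comm pE, mul_smul_comm, smul_smul, mul_assoc,
        psign_add, mul_comm]
    simp only [mul_neg, neg_mul, neg_neg, smul_neg, mul_smul_comm, smul_mul_assoc]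
    rw [h3]
    simp only [smul_smul, ← psign_add]
    congr 2
    generalize τ a = a, τ b = b, ε A = x, ε B = y
    exact congrArg psign <| (by decide : ∀ a b x y : ZMod 2, (b + 1) * (x + 1) + (b * a +
      ((y + (a + 1)) * (b + (a + 1)) + (y + (a + 1) + (b + (a + 1))) * (x + (b + 1)))) =
      (x + 1) * (y + 1) + (a + 1) * (y + 1)) a b x y

omit hE hΘ h1 in
-- The constraints are Casimir functions of the Dirac bracket: in the correction term the inverse
-- matrix meets the matrix of brackets and restores (f, Θ^c).
theorem br_dirE_right (f : R) (c : t) : d.br (d.dirE E Θ Ei) f (Θ c) = 0 := by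
  rw [br_dirE]
  have : ∀ a, ∑ b, d.br E f (Θ a) * Ei a b * d.br E (Θ b) (Θ c) =
      d.br E f (Θ a) * (1 : Matrix t t R) a c := by
    intro a
    rw [← h2, Matrix.mul_apply, Finset.mul_sum]
    exact Finset.sum_congr rfl fun b _ => mul_assoc _ _ _
  rw [Finset.sum_congr rfl fun a _ => this a]
  simp [Matrix.one_apply]

omit hE hΘ h2 in
theorem br_dirE_left (f : R) (c : t) : d.br (d.dirE E Θ Ei) (Θ c) f = 0 := by
  rw [br_dirE, Finset.sum_comm]
  have : ∀ b, ∑ a, d.br E (Θ c) (Θ a) * Ei a b * d.br E (Θ b) f =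
      (1 : Matrix t t R) c b * d.br E (Θ b) f := by
    intro a
    rw [← h1, Matrix.mul_apply, Finset.sum_mul]
    rfl
  rw [Finset.sum_congr rfl fun a _ => this a]
  simp [Matrix.one_apply]

omit h1 h2 in
omit hΘ in
/-- The Jacobi identity in the form of a Leibniz rule. -/
theorem jacobi_leibniz
    (hJ : ∀ (F G H : R) (f g h : ZMod 2), IsPar f F → IsPar g G → IsPar h H →
      psign ((f + 1) * (h + 1)) • d.br E F (d.br E G H) +
      psign ((g + 1) * (f + 1)) • d.br E G (d.br E H F) +
      psign ((h + 1) * (g + 1)) • d.br E H (d.br E F G) = 0)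
    {F G H : R} {f g h : ZMod 2} (hF : IsPar f F) (hG : IsPar g G) (hH : IsPar h H) :
    d.br E (d.br E F H) G =
      d.br E F (d.br E H G) + psign ((g + 1) * (h + 1)) • d.br E (d.br E F G) H := by
  have key := hJ F H G f h g hF hH hG
  have hneg : ∀ a b : R, d.br E a (-b) = -d.br E a b := fun a b => by
    rw [← brR_apply, map_neg, brR_apply]
  rw [d.br_skew hE (d.br_par hE hF hH) hG, d.br_skew hE hF hG, hneg, br_smul_right,
    d.br_skew hE (d.br_par hE hF hG) hH] at key
  simp only [smul_neg, neg_neg, smul_smul, ← psign_add] at key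
  have e1 : (h + 1) * (f + 1) + ((f + 1) * (g + 1) + (f + g + 1 + 1) * (h + 1)) =
      (f + 1) * (g + 1) + (g + 1) * (h + 1) :=
    (by decide : ∀ f g h : ZMod 2, (h + 1) * (f + 1) + ((f + 1) * (g + 1) +
      (f + g + 1 + 1) * (h + 1)) = (f + 1) * (g + 1) + (g + 1) * (h + 1)) f g h
  have e2 : (g + 1) * (h + 1) + (f + h + 1 + 1) * (g + 1) = (f + 1) * (g + 1) :=
    (by decide : ∀ f g h : ZMod 2, (g + 1) * (h + 1) + (f + h + 1 + 1) * (g + 1) =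
      (f + 1) * (g + 1)) f g h
  rw [e1, e2, psign_add, mul_smul, ← sub_eq_add_neg, ← smul_add, ← smul_sub,
    smul_eq_zero_iff_right (psign_ne_zero _), sub_eq_zero] at key
  exact key.symm

/-- As the constraints are Casimir functions, bracketing a combination of them differentiates only
the coefficients. The Dirac bracket therefore descends to the quotient by the constraints. -/
theorem br_mem_left {g : R} {p : ZMod 2} (hg : IsPar p g) {x : R}
    (hx : x ∈ genIdeal Θ τ hΘ) : d.br (d.dirE E Θ Ei) x g ∈ genIdeal Θ τ hΘ := by
  obtain ⟨u, rfl⟩ := hx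
  rw [br_sum_left]
  refine Submodule.sum_mem _ fun a _ => ?_
  rw [← brL_apply, (d.isRDer_brL (d.isBiv_dirE hE hΘ h1 h2) hg).leib, brL_apply, brL_apply,
    br_dirE_left d h1, zero_mul, add_zero]
  exact Ideal.mul_mem_right _ _ (gen_mem_genIdeal _ _ _ a)

theorem br_mem_right {f : R} {p : ZMod 2} (hf : IsPar p f) {x : R}
    (hx : x ∈ genIdeal Θ τ hΘ) : d.br (d.dirE E Θ Ei) f x ∈ genIdeal Θ τ hΘ := by
  obtain ⟨u, rfl⟩ := hx
  rw [br_sum_right]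
  refine Submodule.sum_mem _ fun a _ => ?_
  rw [d.br_mul_right (d.isBiv_dirE hE hΘ h1 h2) hf, br_dirE_right d h2, zero_mul, zero_add,
    (hΘ a).sgp, smul_mul_assoc]
  exact smul_mem_ideal _ (Ideal.mul_mem_right _ _ (gen_mem_genIdeal _ _ _ a))

/-- The Dirac bracket satisfies the Jacobi identity modulo the constraints. -/
theorem jacobi_dirE
    (hJ : ∀ (F G H : R) (f g h : ZMod 2), IsPar f F → IsPar g G → IsPar h H →
      psign ((f + 1) * (h + 1)) • d.br E F (d.br E G H) +
      psign ((g + 1) * (f + 1)) • d.br E G (d.br E H F) +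
      psign ((h + 1) * (g + 1)) • d.br E H (d.br E F G) = 0)
    {F G H : R} {f g h : ZMod 2} (hF : IsPar f F) (hG : IsPar g G) (hH : IsPar h H) :
    d.br (d.dirE E Θ Ei) (d.br (d.dirE E Θ Ei) F H) G -
      (d.br (d.dirE E Θ Ei) F (d.br (d.dirE E Θ Ei) H G) +
        psign ((g + 1) * (h + 1)) • d.br (d.dirE E Θ Ei) (d.br (d.dirE E Θ Ei) F G) H) ∈
      genIdeal Θ τ hΘ := by
  set ED := d.dirE E Θ Ei
  set I := genIdeal Θ τ hΘ
  set π := Ideal.Quotient.mkₐ ℂ I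
  have pEi := d.constraintInv_par hE hΘ h1 h2
  have hED := d.isBiv_dirE hE hΘ h1 h2
  -- `tR g` and `tL f` differ from `g` and `f` by combinations of constraints, chosen such that
  -- their ordinary brackets are Dirac brackets modulo the constraints. The multipliers stand on the
  -- right in one and on the left in the other, to match the side on which each enters a bracket.
  let w : R → t → R := fun g a => ∑ b, Ei a b * d.br E (Θ b) g
  let tR : R → R := fun g => g - ∑ a, Θ a * w g a
  let u : R → t → R := fun f b => ∑ a, d.br E f (Θ a) * Ei a b
  let tL : R → R := fun f => f - ∑ b, u f b * Θ b
  have pw : ∀ {p : ZMod 2} {g : R}, IsPar p g → ∀ a, IsPar (τ a + p) (w g a) := fun {p g} hg a =>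
    IsPar.sum fun b _ => (pEi a b).mul' (d.br_par hE (hΘ b) hg) (by
      generalize τ a = a, τ b = b
      exact (by decide : ∀ a b p : ZMod 2, a + (b + 1) + (b + p + 1) = a + p) a b p)
  have pu : ∀ {p : ZMod 2} {f : R}, IsPar p f → ∀ b, IsPar (τ b + p) (u f b) := fun {p f} hf b =>
    IsPar.sum fun a _ => (d.br_par hE hf (hΘ a)).mul' (pEi a b) (by
      generalize τ a = a, τ b = b
      exact (by decide : ∀ a b p : ZMod 2, p + a + 1 + (a + (b + 1)) = b + p) a b p)
  have ptR : ∀ {p : ZMod 2} {g : R}, IsPar p g → IsPar p (tR g) := fun {p g} hg =>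
    hg.sub (IsPar.sum fun a _ => (hΘ a).mul' (pw hg a) (by
      linear_combination CharTwo.add_self_eq_zero (τ a)))
  have ptL : ∀ {p : ZMod 2} {f : R}, IsPar p f → IsPar p (tL f) := fun {p f} hf =>
    hf.sub (IsPar.sum fun b _ => (pu hf b).mul' (hΘ b) (by
      linear_combination CharTwo.add_self_eq_zero (τ b)))
  have mΘ : ∀ a, π (Θ a) = 0 := fun a => mkₐ_eq_zero_iff.mpr (gen_mem_genIdeal Θ τ hΘ a)
  have L1 : ∀ {k : ZMod 2} {K : R} (g : R), IsPar k K → π (d.br E K (tR g)) = π (d.br ED K g) := by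
    intro k K g hK
    change π (d.br E K (g - ∑ a, Θ a * w g a)) = π (d.br (d.dirE E Θ Ei) K g)
    rw [br_sub_right, br_dirE, br_sum_right, map_sub, map_sub, map_sum, map_sum]
    congr 1
    refine Finset.sum_congr rfl fun a _ => ?_
    rw [d.br_mul_right hE hK, (hΘ a).sgp, map_add, smul_mul_assoc, map_smul, map_mul π (Θ a), mΘ,
      zero_mul, smul_zero, add_zero, Finset.mul_sum]
    simp only [mul_assoc]
  have L2 : ∀ {k : ZMod 2} {K : R} (f : R), IsPar k K → π (d.br E (tL f) K) = π (d.br ED f K) := by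
    intro k K f hK
    change π (d.br E (f - ∑ b, u f b * Θ b) K) = π (d.br (d.dirE E Θ Ei) f K)
    rw [br_sub_left, br_dirE, br_sum_left, map_sub, map_sub, map_sum, Finset.sum_comm, map_sum]
    congr 1
    refine Finset.sum_congr rfl fun b _ => ?_
    rw [d.br_mul_left hE _ (hΘ b) hK, map_add, map_smul, map_mul π _ (Θ b), mΘ,
      mul_zero, smul_zero, add_zero, Finset.sum_mul]
  have L3l : ∀ {k : ZMod 2} {K a b : R}, IsPar k K → π a = π b →
      π (d.br ED a K) = π (d.br ED b K) := by
    intro k K a b hK hab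
    rw [mkₐ_eq_iff] at hab ⊢
    rw [← br_sub_left]
    exact d.br_mem_left hE hΘ h1 h2 hK hab
  have L3r : ∀ {k : ZMod 2} {K a b : R}, IsPar k K → π a = π b →
      π (d.br ED K a) = π (d.br ED K b) := by
    intro k K a b hK hab
    rw [mkₐ_eq_iff] at hab ⊢
    rw [← br_sub_right]
    exact d.br_mem_right hE hΘ h1 h2 hK hab
  have etR : ∀ g, π (tR g) = π g := by
    intro g
    change π (g - ∑ a, Θ a * w g a) = π g
    rw [map_sub, map_sum, Finset.sum_eq_zero fun a _ => by rw [map_mul, mΘ, zero_mul], sub_zero]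
  -- Nested ordinary brackets of the modified functions are nested Dirac brackets modulo the
  -- constraints, because brackets with constraints stay in the ideal. The Jacobi identity of the
  -- ordinary bracket is thereby transferred.
  have hL : ∀ {f g h : ZMod 2} {F G H : R}, IsPar f F → IsPar g G → IsPar h H →
      π (d.br E (d.br E (tL F) (tR H)) (tR G)) = π (d.br ED (d.br ED F H) G) := by
    intro f g h F G H hF hG hH
    rw [L1 _ (d.br_par hE (ptL hF) (ptR hH))]
    refine L3l hG ?_
    rw [L2 _ (ptR hH)]
    exact L3r hF (etR H)
  have hR : π (d.br E (tL F) (d.br E (tR H) (tR G))) = π (d.br ED F (d.br ED H G)) := by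
    rw [L2 _ (d.br_par hE (ptR hH) (ptR hG))]
    refine L3r hF ?_
    rw [L1 _ (ptR hH)]
    exact L3l hG (etR H)
  rw [← mkₐ_eq_iff, map_add, map_smul]
  change π _ = π _ + _ • π _
  rw [← hL hF hG hH, ← hR, ← hL hF hH hG, d.jacobi_leibniz hE hJ (ptL hF) (ptR hG) (ptR hH),
    map_add, map_smul]

end SDom

end SuperBV
end

/-! ### The odd Laplacian, divergences and changes of coordinates. -/

open scoped BigOperators
noncomputable section
set_option linter.unusedSectionVars false

namespace SuperBV
open SuperRing

namespace SDom

variable {R : Type} [Ring R] [Algebra ℂ R] [SuperRing R]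
variable {ι : Type} [Fintype ι] [DecidableEq ι] {ε : ι → ZMod 2} (d : SDom R ε)

/-- The odd Laplacian of a bivector and a density. -/
def lap (E : ι → ι → R) (ρ ρi : R) (f : R) : R :=
  ∑ A, ∑ B, (psign (ε A) / 2) • (ρi * d.d A (ρ * E A B * d.d B f))

/-- The matrix of right derivatives of a family of functions. -/
def jac {ι' : Type} (y : ι' → R) : Matrix ι' ι R := fun A B => d.dr B (y A)

/-- Right derivatives with respect to the coordinates whose inverse Jacobian is `Ki`. -/
def dbar (Ki : Matrix ι ι R) (A : ι) : R →ₗ[ℂ] R :=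
  ∑ B, (LinearMap.mulRight ℂ (Ki B A)).comp (d.dr B)

theorem dbar_apply (Ki : Matrix ι ι R) (A : ι) (f : R) :
    d.dbar Ki A f = ∑ B, d.dr B f * Ki B A := by
  rw [dbar, LinearMap.sum_apply]; rfl

variable {E : ι → ι → R} (hE : IsBiv ε E)

section density

variable {ρ ρi : R} (hρ : IsPar 0 ρ) (hρi : ρi * ρ = 1)

include hE hρ hρi

/-- The odd Laplacian is half the divergence of the Hamiltonian vector field. -/
theorem lap_eq {s : ZMod 2} {g : R} (hg : IsPar s g) :
    (2 : ℂ) • d.lap E ρ ρi g = strq (s + 1) ε (d.jac (d.ham E g)) + ρi * d.br E ρ g := by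
  have h1 : d.lap E ρ ρi g = ∑ A, (psign (ε A) / 2) • (ρi * d.d A (ρ * d.ham E g A)) := by
    unfold lap ham
    refine Finset.sum_congr rfl fun A _ => ?_
    simp only [Finset.mul_sum, map_sum, Finset.smul_sum, mul_assoc]
  -- The Leibniz rule splits the divergence of ρ times the Hamiltonian field into the derivative of
  -- ρ along the field and ρ times the divergence of the field.
  have h2 : ∀ A, d.d A (ρ * d.ham E g A) = psign (ε A) • (d.dr A ρ * d.ham E g A) +
      psign (ε A * (s + 1)) • (ρ * d.dr A (d.ham E g A)) := by
    intro A
    rw [d.leib, hρ.sgp, mul_zero, psign_zero, one_smul, d.d_eq_dr hρ,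
      d.d_eq_dr (d.ham_par hE hg A), smul_mul_assoc, mul_smul_comm]
    congr 3
    · generalize ε A = a
      exact (by decide : ∀ a : ZMod 2, a * (0 + a) = a) a
    · generalize ε A = a
      exact (by decide : ∀ a s : ZMod 2, a * (a + (s + 1) + a) = a * (s + 1)) a s
  rw [h1, br_eq_ham, strq, Finset.mul_sum, Finset.smul_sum, ← Finset.sum_add_distrib]
  refine Finset.sum_congr rfl fun A _ => ?_
  rw [h2, mul_add, mul_smul_comm, mul_smul_comm, ← mul_assoc ρi ρ, hρi, one_mul, smul_add,
    smul_add, smul_smul, smul_smul, smul_smul, smul_smul, add_comm]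
  congr 1
  · change _ • _ = _ • d.dr A (d.ham E g A)
    congr 1
    rw [show (s + 1 + 1) * ε A = ε A + ε A * (s + 1) by ring, psign_add]
    ring
  · rw [show (2 : ℂ) * (psign (ε A) / 2) * psign (ε A) = psign (ε A) * psign (ε A) by ring,
      psign_mul_self, one_smul]

end density

section coordinates

variable {y : ι → R} (hy : ∀ A, IsPar (ε A) (y A)) {Ki : Matrix ι ι R}
  (k1 : d.jac y * Ki = 1) (k2 : Ki * d.jac y = 1)

include hy k1 k2

theorem jac_par : MatPar ε ε (d.jac y) := fun A B => (d.isRDer_dr B).par (hy A)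

theorem isRDer_dbar (A : ι) : IsRDer (ε A) (d.dbar Ki A) := by
  refine IsRDer.sum _ fun B _ => ?_
  have := (d.isRDer_dr B).mul_right ((d.jac_par hy k1 k2).inv k1 k2 B A)
  rwa [← add_assoc, CharTwo.add_self_eq_zero, zero_add] at this

omit hy k2 in
theorem dbar_coord (A B : ι) : d.dbar Ki A (y B) = (1 : Matrix ι ι R) B A := by
  rw [dbar_apply, ← k1, Matrix.mul_apply]; rfl

omit hy k1 in
theorem dr_eq_dbar (B : ι) (f : R) : d.dr B f = ∑ A, d.dbar Ki A f * d.jac y A B := by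
  simp only [dbar_apply, Finset.sum_mul, mul_assoc]
  rw [Finset.sum_comm]
  have : ∀ C, ∑ A, d.dr C f * (Ki C A * d.jac y A B) = d.dr C f * (1 : Matrix ι ι R) C B := by
    intro C
    rw [← k2, Matrix.mul_apply, Finset.mul_sum]
  rw [Finset.sum_congr rfl fun C _ => this C]
  simp [Matrix.one_apply]

omit hy k1 in
/-- Chain rule for the bracket. -/
theorem br_chain (f g : R) : d.br E f g = ∑ A, d.dbar Ki A f * d.br E (y A) g := by
  rw [br_eq_ham]
  simp only [d.dr_eq_dbar k2 _ f, br_eq_ham, Finset.sum_mul, Finset.mul_sum]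
  rw [Finset.sum_comm]
  refine Finset.sum_congr rfl fun A _ => Finset.sum_congr rfl fun B _ => ?_
  rw [mul_assoc]; rfl

omit k1 k2 in
include hE in
-- Differentiating `(y A, g)` with respect to Γ^B hits either the derivatives of `y A` or the
-- components of the field of `g`. The first kind is the derivative of the Jacobian along the field,
-- because second derivatives commute.
theorem xmap_jac {s : ZMod 2} {g : R} (hg : IsPar s g) :
    xmap (s + 1) ε (d.brL E g) (d.jac y) =
      d.jac (fun A => d.br E (y A) g) - d.jac y * d.jac (d.ham E g) := by
  ext A B
  rw [Matrix.sub_apply, Matrix.mul_apply]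
  change psign ((s + 1) * ε B) • d.brL E g (d.dr B (y A)) = d.dr B (d.br E (y A) g) -
    ∑ C, d.dr C (y A) * d.dr B (d.ham E g C)
  rw [brL_apply, br_eq_ham, br_eq_ham, map_sum, ← Finset.sum_sub_distrib, Finset.smul_sum]
  refine Finset.sum_congr rfl fun C _ => ?_
  rw [(d.isRDer_dr B).leib, add_sub_cancel_left, (d.ham_par hE hg C).sgp, d.dr_comm B C,
    mul_smul_comm, smul_mul_assoc, smul_smul, ← psign_add]
  congr 2
  generalize ε B = b, ε C = c
  exact (by decide : ∀ b c s : ZMod 2, (s + 1) * b = b * (c + (s + 1)) + b * c) b c s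

include hE in
/-- The logarithmic derivative of the Jacobian compares divergences. -/
theorem strq_jac {s : ZMod 2} {g : R} (hg : IsPar s g) :
    strq (s + 1) ε (Ki * xmap (s + 1) ε (d.brL E g) (d.jac y)) =
      (∑ A, psign ((s + 1 + 1) * ε A) • d.dbar Ki A (d.br E (y A) g)) -
        strq (s + 1) ε (d.jac (d.ham E g)) := by
  -- `P` is the matrix of derivatives of the components of the field in the new coordinates. The
  -- chain rule gives `P * d.jac y` in the old ones, and cyclicity reduces the supertrace to that of
  -- `P`, the divergence in the new coordinates.
  let P : Matrix ι ι R := fun A C => d.dbar Ki C (d.br E (y A) g)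
  have hP : d.jac (fun A => d.br E (y A) g) = P * d.jac y := by
    ext A B
    rw [Matrix.mul_apply]
    exact d.dr_eq_dbar k2 B _
  have pKi := (d.jac_par hy k1 k2).inv k1 k2
  have pY : MatPar ε (fun j => ε j + (s + 1)) (P * d.jac y) := by
    rw [← hP]
    intro A B
    exact ((d.isRDer_dr B).par (d.br_par hE (hy A) hg)).cast (by ring)
  rw [d.xmap_jac hE hy hg, mul_sub, ← mul_assoc, k2, one_mul, strq_sub, hP, strq_cyc pKi pY,
    mul_assoc, k1, mul_one]
  rfl

end coordinates

/-! ### The vector fields of the gauge generators in the coordinates {F;G;Θ}. -/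

section gauge

variable {k t : Type} [Fintype k] [DecidableEq k] [Fintype t] [DecidableEq t]
  {δ : k → ZMod 2} (e : (k ⊕ k) ⊕ t ≃ ι)
  (eF : ∀ α, ε (e (Sum.inl (Sum.inl α))) = δ α + 1) (eG : ∀ α, ε (e (Sum.inl (Sum.inr α))) = δ α)
  {F G : k → R} {Θ : t → R} {y : ι → R} (yF : ∀ α, y (e (Sum.inl (Sum.inl α))) = F α)
  (yG : ∀ α, y (e (Sum.inl (Sum.inr α))) = G α) (yΘ : ∀ a, y (e (Sum.inr a)) = Θ a)
  (hy : ∀ A, IsPar (ε A) (y A)) {Ki : Matrix ι ι R}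
  (k1 : d.jac y * Ki = 1) (k2 : Ki * d.jac y = 1)
  {I : Ideal R} [I.IsTwoSided] (mG : ∀ α, G α ∈ I)
  (cΘ : ∀ f a, d.br E (Θ a) f = 0) (inv : ∀ γ β, d.br E (G γ) (G β) ∈ I)

omit [DecidableEq ι] [DecidableEq k] [DecidableEq t] in
theorem sum_blocks (f : ι → R) : ∑ A, f A = ∑ α, f (e (Sum.inl (Sum.inl α))) +
    ∑ α, f (e (Sum.inl (Sum.inr α))) + ∑ a, f (e (Sum.inr a)) := by
  rw [← Equiv.sum_comp e, Fintype.sum_sum_type, Fintype.sum_sum_type]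

/-- The matrix of brackets of gauge functions with constraints. -/
def gmat (E : ι → ι → R) (F G : k → R) : Matrix k k R := fun α γ => d.br E (F α) (G γ)

include yF yG yΘ k2 cΘ inv

/-- Modulo the constraints, the vector fields of the constraints act along the gauge functions. -/
theorem br_chain_mod (f : R) (β : k) : Ideal.Quotient.mkₐ ℂ I (d.br E f (G β)) =
    Ideal.Quotient.mkₐ ℂ I (∑ α, d.dbar Ki (e (Sum.inl (Sum.inl α))) f * d.gmat E F G α β) := by
  rw [d.br_chain k2, sum_blocks e, map_add, map_add]
  simp only [yF, yG, yΘ, cΘ, mul_zero, Finset.sum_const_zero, map_zero, add_zero]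
  have h : Ideal.Quotient.mkₐ ℂ I
      (∑ α, d.dbar Ki (e (Sum.inl (Sum.inr α))) f * d.br E (G α) (G β)) = 0 := by
    rw [map_sum]
    exact Finset.sum_eq_zero fun α _ => by
      rw [map_mul, mkₐ_eq_zero_iff.mpr (inv α β), mul_zero]
  rw [h, add_zero]
  rfl

/-- A function annihilated by all constraint vector fields modulo the constraints has no
derivatives along the gauge functions modulo the constraints. -/
theorem dbar_mem {Mi : Matrix k k R} (m1 : d.gmat E F G * Mi = 1) {f : R}
    (hf : ∀ β, d.br E f (G β) ∈ I) (α : k) : d.dbar Ki (e (Sum.inl (Sum.inl α))) f ∈ I := by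
  set π := Ideal.Quotient.mkₐ ℂ I
  have h : ∀ β, π (∑ α, d.dbar Ki (e (Sum.inl (Sum.inl α))) f * d.gmat E F G α β) = 0 := fun β => by
    rw [← d.br_chain_mod e yF yG yΘ k2 cΘ inv, mkₐ_eq_zero_iff]; exact hf β
  -- The derivatives along F are recovered from the brackets with the G's through the inverse of the
  -- gauge matrix.
  have h2 : d.dbar Ki (e (Sum.inl (Sum.inl α))) f =
      ∑ β, (∑ γ, d.dbar Ki (e (Sum.inl (Sum.inl γ))) f * d.gmat E F G γ β) * Mi β α := by
    simp only [Finset.sum_mul, mul_assoc]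
    rw [Finset.sum_comm]
    simp only [← Finset.mul_sum]
    have : ∀ γ, ∑ β, d.gmat E F G γ β * Mi β α = (1 : Matrix k k R) γ α := fun γ => by
      rw [← m1, Matrix.mul_apply]
    simp [this, Matrix.one_apply]
  rw [← mkₐ_eq_zero_iff, h2, map_sum]
  exact Finset.sum_eq_zero fun β _ => by rw [map_mul, h β, zero_mul]

include hE hy eF eG mG k1

omit hE k2 yF yΘ inv cΘ mG yG k1 eG in
theorem par_F (yF : ∀ α, y (e (Sum.inl (Sum.inl α))) = F α) (α : k) : IsPar (δ α + 1) (F α) := by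
  rw [← yF, ← eF]; exact hy _

omit hE k2 yF yΘ inv cΘ mG yG k1 eF in
theorem par_G (yG : ∀ α, y (e (Sum.inl (Sum.inr α))) = G α) (α : k) : IsPar (δ α) (G α) := by
  rw [← yG, ← eG]; exact hy _

omit k2 yΘ inv cΘ mG k1 in
theorem par_gmat : MatPar δ δ (d.gmat E F G) := fun α γ =>
  (d.br_par hE (par_F e eF hy yF α) (par_G e eG hy yG γ)).cast (by
    linear_combination CharTwo.add_self_eq_zero (1 : ZMod 2))

/-- The divergence of the vector field of a constraint modulo the constraints. -/
theorem lap_gauge {ρ ρi : R} (hρ : IsPar 0 ρ) (hρi : ρi * ρ = 1) {Mi : Matrix k k R}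
    (m1 : d.gmat E F G * Mi = 1) (m2 : Mi * d.gmat E F G = 1) (β : k) {v : k → k → R}
    (hv : ∀ γ, d.br E (G γ) (G β) = ∑ σ, G σ * v σ γ)
    (pv : ∀ σ γ, IsPar (δ σ + δ γ + (δ β + 1)) (v σ γ))
    (hJ : ∀ α γ, d.br E (d.br E (F α) (G γ)) (G β) -
      (d.br E (F α) (d.br E (G γ) (G β)) +
        psign ((δ β + 1) * (δ γ + 1)) • d.br E (d.br E (F α) (G β)) (G γ)) ∈ I) :
    (2 : ℂ) • d.lap E ρ ρi (G β) - (ρi * d.br E ρ (G β) -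
      strq (δ β + 1) ε (Ki * xmap (δ β + 1) ε (d.brL E (G β)) (d.jac y)) -
      strq (δ β + 1) δ (Mi * xmap (δ β + 1) δ (d.brL E (G β)) (d.gmat E F G)) +
      (2 : ℂ) • ∑ γ, psign (δ γ) • v γ γ) ∈ I := by
  have pF := par_F e eF hy yF
  have pG := par_G e eG hy yG
  have pM := d.par_gmat hE e eF eG yF yG hy
  have pMi := pM.inv m1 m2
  set q := δ β + 1 with hq
  set π := Ideal.Quotient.mkₐ ℂ I with hπ
  have zG : ∀ γ, π (G γ) = 0 := fun γ => mkₐ_eq_zero_iff.mpr (mG γ)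
  -- `Q` contains the derivatives along the F's of the column `β` of the gauge matrix, `V` the
  -- structure functions with signs. They are the two contributions to the derivative of the gauge
  -- matrix along the field of `G β`.
  let Q : Matrix k k R := fun α σ => d.dbar Ki (e (Sum.inl (Sum.inl σ))) (d.gmat E F G α β)
  let V : Matrix k k R := fun σ γ => psign (q * δ γ) • v σ γ
  have pQ : MatPar δ (fun j => δ j + q) Q := fun α σ =>
    ((d.isRDer_dbar hy k1 k2 _).par (pM α β)).cast (by rw [eF, hq]; ring)
  have pQM : MatPar δ (fun j => δ j + q) (Q * d.gmat E F G) := fun i j => by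
    rw [Matrix.mul_apply]
    refine IsPar.sum fun l _ => (pQ i l).mul' (pM l j) ?_
    linear_combination CharTwo.add_self_eq_zero (δ l)
  -- the divergence along the gauge functions and the constraints
  have s1 : π (∑ A, psign ((q + 1) * ε A) • d.dbar Ki A (d.br E (y A) (G β))) =
      π (-(psign q • strq q δ Q) + ∑ γ, psign (δ γ) • v γ γ) := by
    rw [sum_blocks e]
    simp only [yF, yG, yΘ, cΘ, map_zero, smul_zero, Finset.sum_const_zero, add_zero]
    rw [map_add, map_add]
    congr 1
    · congr 1
      rw [strq, Finset.smul_sum, ← Finset.sum_neg_distrib]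
      refine Finset.sum_congr rfl fun α _ => ?_
      rw [smul_smul, ← neg_smul, eF]
      congr 1
      rw [mul_add, psign_add, mul_one, psign_add, psign_one]
      ring
    · rw [map_sum, map_sum]
      refine Finset.sum_congr rfl fun γ _ => ?_
      rw [hv, map_sum, map_smul, map_sum, map_smul, Finset.sum_eq_single γ]
      · rw [(d.isRDer_dbar hy k1 k2 _).leib_par _ (pv γ γ), map_add, map_mul, zG, zero_mul, zero_add,
          ← yG, d.dbar_coord k1, Matrix.one_apply_eq, one_mul, map_smul, smul_smul, eG, ← psign_add]
        congr 2
        generalize δ γ = a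
        exact (by decide : ∀ a q : ZMod 2, (q + 1) * a + a * (a + a + q) = a) a q
      · intro σ _ hσ
        rw [(d.isRDer_dbar hy k1 k2 _).leib_par _ (pv σ γ), map_add, map_mul, zG, zero_mul, zero_add,
          ← yG, d.dbar_coord k1, Matrix.one_apply_ne, zero_mul, smul_zero, map_zero]
        intro h
        exact hσ (Sum.inr_injective (Sum.inl_injective (e.injective h)))
      · simp
  -- the derivative of the gauge matrix
  have s2 : ∀ α γ, π (xmap q δ (d.brL E (G β)) (d.gmat E F G) α γ) =
      π ((d.gmat E F G * V + psign q • (Q * d.gmat E F G)) α γ) := by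
    intro α γ
    have hJ' := mkₐ_eq_iff.mpr (hJ α γ)
    -- Modulo the G's, the bracket has to differentiate the factor `G σ` of the combination; this
    -- leaves the gauge matrix times the structure functions.
    have a1 : π (d.br E (F α) (d.br E (G γ) (G β))) = π (∑ σ, d.gmat E F G α σ * v σ γ) := by
      rw [hv, br_sum_right, map_sum, map_sum]
      refine Finset.sum_congr rfl fun σ _ => ?_
      rw [d.br_mul_right hE (pF α), map_add, (pG σ).sgp, smul_mul_assoc, map_smul, map_mul π (G σ),
        zG, zero_mul, smul_zero, add_zero]
      rfl
    have a2 := d.br_chain_mod e yF yG yΘ k2 cΘ inv (d.br E (F α) (G β)) γ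
    change π (psign (q * δ γ) • d.brL E (G β) (d.gmat E F G α γ)) = _
    rw [Matrix.add_apply, Matrix.smul_apply, Matrix.mul_apply, Matrix.mul_apply, brL_apply,
      map_smul, gmat, hJ', map_add, map_smul, a1, a2, smul_add, smul_smul, ← psign_add, map_add,
      map_smul, ← map_smul, Finset.smul_sum]
    congr 2
    · refine Finset.sum_congr rfl fun σ _ => ?_
      exact (mul_smul_comm _ _ _).symm
    · refine congrArg psign ?_
      rw [hq]
      generalize δ γ = a, δ β = b
      exact (by decide : ∀ a b : ZMod 2, (b + 1) * a + (b + 1) * (a + 1) = b + 1) a b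
  have s3 : π (strq q δ (Mi * xmap q δ (d.brL E (G β)) (d.gmat E F G))) =
      π ((∑ γ, psign (δ γ) • v γ γ) + psign q • strq q δ Q) := by
    -- Multiplied by the inverse of the gauge matrix, the derivative becomes `V` plus a conjugate of
    -- `Q`, and cyclicity removes the conjugation.
    have b1 : strq q δ (Mi * (d.gmat E F G * V + psign q • (Q * d.gmat E F G))) =
        (∑ γ, psign (δ γ) • v γ γ) + psign q • strq q δ Q := by
      rw [mul_add, strq_add, ← mul_assoc, m2, one_mul, mul_smul_comm, strq_smul, strq_cyc pMi pQM,
        mul_assoc, m1, mul_one]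
      congr 1
      refine Finset.sum_congr rfl fun γ _ => ?_
      change psign ((q + 1) * δ γ) • psign (q * δ γ) • v γ γ = _
      rw [smul_smul, ← psign_add]
      congr 2
      generalize δ γ = a
      exact (by decide : ∀ a q : ZMod 2, (q + 1) * a + q * a = a) a q
    rw [← b1]
    unfold strq
    rw [map_sum, map_sum]
    refine Finset.sum_congr rfl fun α _ => ?_
    rw [map_smul, map_smul, Matrix.mul_apply, Matrix.mul_apply, map_sum, map_sum]
    congr 1
    refine Finset.sum_congr rfl fun γ _ => ?_
    rw [map_mul, map_mul, s2]
  -- The supertraces of `Q` from the divergence and from the gauge matrix cancel, and the two traces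
  -- of `v` add up to the factor 2.
  rw [← mkₐ_eq_iff, d.lap_eq hE hρ hρi (pG β), d.strq_jac hE hy k1 k2 (pG β), ← hq]
  simp only [map_add, map_sub, ← hπ] at s1 s3 ⊢
  rw [s1, s3, two_smul ℂ, map_add]
  simp only [map_neg]
  abel

end gauge

end SDom

end SuperBV
end

/-! ### Smoothness and partial derivatives of Grassmann-valued functions. -/

open scoped BigOperators
noncomputable section
set_option linter.unusedSectionVars false

namespace SuperBV
open scoped Grassmann.Alg
open SuperRing Grassmann

namespace Grassmann

variable {κ : Type} [Fintype κ]

theorem real_smul_eq (c : ℝ) (f : Grassmann κ) : c • f = (c : ℂ) • f := rfl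

instance : IsScalarTower ℝ ℂ (Grassmann κ) where
  smul_assoc c z f := by ext S; exact smul_assoc c z (f S)

instance : FiniteDimensional ℝ (Grassmann κ) :=
  inferInstanceAs (FiniteDimensional ℝ (Finset κ → ℂ))

/-- A complex-linear map between Grassmann algebras as a continuous real-linear map. -/
def toCLM {F : Type} [NormedAddCommGroup F] [NormedSpace ℝ F] [NormedSpace ℂ F]
    [IsScalarTower ℝ ℂ F] (L : Grassmann κ →ₗ[ℂ] F) : Grassmann κ →L[ℝ] F :=
  (L.restrictScalars ℝ).toContinuousLinearMap

variable [LinearOrder κ]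

/-- Multiplication as a continuous bilinear map. -/
def mulCLM : Grassmann κ →L[ℝ] Grassmann κ →L[ℝ] Grassmann κ :=
  LinearMap.toContinuousBilinearMap (LinearMap.mk₂ ℝ (fun f g => f * g) add_mul
    (fun c f g => by rw [real_smul_eq, real_smul_eq, smul_mul_assoc]) mul_add
    (fun c f g => by rw [real_smul_eq, real_smul_eq, mul_smul_comm]))

end Grassmann

variable {M : ℕ} {ε : Fin M → ZMod 2}

section smooth

variable {κ : Type} [Fintype κ]

theorem smoothOn_iff {f : Pt ε → Grassmann κ} {U : Set (Pt ε)} :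
    SmoothOn f U ↔ ∀ S, ContDiffOn ℝ ((⊤ : ℕ∞) : WithTop ℕ∞) (fun x => f x S) U :=
  contDiffOn_pi

theorem SmoothOn.mono {f : Pt ε → Grassmann κ} {U V : Set (Pt ε)} (hf : SmoothOn f U) (h : V ⊆ U) :
    SmoothOn f V := ContDiffOn.mono hf h

theorem SmoothOn.congr {f g : Pt ε → Grassmann κ} {U : Set (Pt ε)} (hf : SmoothOn f U)
    (h : ∀ x ∈ U, g x = f x) : SmoothOn g U := ContDiffOn.congr hf h

theorem smoothOn_const (c : Grassmann κ) (U : Set (Pt ε)) : SmoothOn (fun _ => c) U :=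
  contDiffOn_const

theorem SmoothOn.add {f g : Pt ε → Grassmann κ} {U : Set (Pt ε)} (hf : SmoothOn f U)
    (hg : SmoothOn g U) : SmoothOn (fun x => f x + g x) U := ContDiffOn.add hf hg

theorem SmoothOn.linear {F : Type} [NormedAddCommGroup F] [NormedSpace ℝ F] [NormedSpace ℂ F]
    [IsScalarTower ℝ ℂ F] (L : Grassmann κ →ₗ[ℂ] F) {f : Pt ε → Grassmann κ} {U : Set (Pt ε)}
    (hf : SmoothOn f U) : ContDiffOn ℝ ((⊤ : ℕ∞) : WithTop ℕ∞) (fun x => L (f x)) U :=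
  ContDiffOn.continuousLinearMap_comp (toCLM L) hf

theorem SmoothOn.const_smul (c : ℂ) {f : Pt ε → Grassmann κ} {U : Set (Pt ε)} (hf : SmoothOn f U) :
    SmoothOn (fun x => c • f x) U :=
  hf.linear (LinearMap.lsmul ℂ (Grassmann κ) c)

theorem SmoothOn.smul_one [LinearOrder κ] {φ : Pt ε → ℂ} {U : Set (Pt ε)}
    (hφ : ContDiffOn ℝ ((⊤ : ℕ∞) : WithTop ℕ∞) φ U) :
    SmoothOn (fun x => φ x • (1 : Grassmann κ)) U := by
  rw [smoothOn_iff]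
  intro S
  exact hφ.mul contDiffOn_const

theorem SmoothOn.mul [LinearOrder κ] {f g : Pt ε → Grassmann κ} {U : Set (Pt ε)}
    (hf : SmoothOn f U) (hg : SmoothOn g U) : SmoothOn (fun x => f x * g x) U :=
  (mulCLM (κ := κ)).isBoundedBilinearMap.contDiff.comp₂_contDiffOn hf hg

theorem SmoothOn.differentiableAt {f : Pt ε → Grassmann κ} {U : Set (Pt ε)} (hU : IsOpen U)
    (hf : SmoothOn f U) {x : Pt ε} (hx : x ∈ U) : DifferentiableAt ℝ f x :=
  (hf.contDiffAt (hU.mem_nhds hx)).differentiableAt (by simp)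

end smooth

section derivatives

variable {κ : Type} [Fintype κ] [LinearOrder κ] {j : OddIx ε → κ} {U : Set (Pt ε)} (hU : IsOpen U)

theorem dL_even {A : Fin M} (h : ε A = 0) (f : Pt ε → Grassmann κ) (x : Pt ε) :
    dL j A f x = fderiv ℝ f x (Pi.single ⟨A, h⟩ 1) := dif_pos h

theorem dL_odd {A : Fin M} (h : ε A ≠ 0) (f : Pt ε → Grassmann κ) (x : Pt ε) :
    dL j A f x = leftDer (j ⟨A, h⟩) (f x) := dif_neg h

theorem dR_eq (A : Fin M) (f : Pt ε → Grassmann κ) (x : Pt ε) :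
    dR j A f x = gsigp (ε A) (dL j A f x) := by
  by_cases h : ε A = 0
  · rw [dL_even h, h]; simp [dR, h, gsigp]
  · rw [dL_odd h]; simp [dR, h, gsigp, rightDer_eq]

include hU

theorem dL_congr {f g : Pt ε → Grassmann κ} (hfg : ∀ x ∈ U, f x = g x) {x : Pt ε} (hx : x ∈ U)
    (A : Fin M) : dL j A f x = dL j A g x := by
  by_cases h : ε A = 0
  · rw [dL_even h, dL_even h,
      Filter.EventuallyEq.fderiv_eq (Filter.eventuallyEq_of_mem (hU.mem_nhds hx) hfg)]
  · rw [dL_odd h, dL_odd h, hfg x hx]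

theorem SmoothOn.dL {f : Pt ε → Grassmann κ} (hf : SmoothOn f U) (A : Fin M) :
    SmoothOn (dL j A f) U := by
  by_cases h : ε A = 0
  · have : SmoothOn (fun x => fderiv ℝ f x (Pi.single ⟨A, h⟩ 1)) U :=
      (ContDiffOn.fderiv_of_isOpen hf hU (by simp)).clm_apply contDiffOn_const
    exact this.congr fun x _ => dL_even h f x
  · exact SmoothOn.congr (hf.linear (leftDerₗ (j ⟨A, h⟩))) fun x _ => dL_odd h f x

theorem dL_linear {L : Grassmann κ →ₗ[ℂ] Grassmann κ} {f : Pt ε → Grassmann κ} (hf : SmoothOn f U)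
    {x : Pt ε} (hx : x ∈ U) {A : Fin M} (h : ε A = 0) :
    SuperBV.dL j A (fun y => L (f y)) x = L (SuperBV.dL j A f x) := by
  rw [dL_even h, dL_even h]
  have := ((toCLM L).hasFDerivAt.comp x (hf.differentiableAt hU hx).hasFDerivAt).fderiv
  have e : fderiv ℝ (fun y => L (f y)) x = (toCLM L).comp (fderiv ℝ f x) := this
  rw [e]; rfl

theorem dL_add {f g : Pt ε → Grassmann κ} (hf : SmoothOn f U) (hg : SmoothOn g U) {x : Pt ε}
    (hx : x ∈ U) (A : Fin M) :
    SuperBV.dL j A (fun y => f y + g y) x = SuperBV.dL j A f x + SuperBV.dL j A g x := by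
  by_cases h : ε A = 0
  · rw [dL_even h, dL_even h, dL_even h,
      fderiv_fun_add (hf.differentiableAt hU hx) (hg.differentiableAt hU hx)]
    rfl
  · rw [dL_odd h, dL_odd h, dL_odd h]
    exact map_add (leftDerₗ (j ⟨A, h⟩)) _ _

theorem dL_smul (c : ℂ) {f : Pt ε → Grassmann κ} (hf : SmoothOn f U) {x : Pt ε}
    (hx : x ∈ U) (A : Fin M) :
    SuperBV.dL j A (fun y => c • f y) x = c • SuperBV.dL j A f x := by
  by_cases h : ε A = 0
  · exact dL_linear hU (L := LinearMap.lsmul ℂ (Grassmann κ) c) hf hx h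
  · rw [dL_odd h, dL_odd h]
    exact map_smul (leftDerₗ (j ⟨A, h⟩)) c _

theorem dL_mul {f g : Pt ε → Grassmann κ} (hf : SmoothOn f U) (hg : SmoothOn g U) {x : Pt ε}
    (hx : x ∈ U) (A : Fin M) :
    SuperBV.dL j A (fun y => f y * g y) x =
      SuperBV.dL j A f x * g x + gsigp (ε A) (f x) * SuperBV.dL j A g x := by
  by_cases h : ε A = 0
  · rw [dL_even h, dL_even h, dL_even h, h]
    have := (mulCLM (κ := κ)).fderiv_of_bilinear (hf.differentiableAt hU hx)
      (hg.differentiableAt hU hx)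
    have e : fderiv ℝ (fun y => f y * g y) x = _ := this
    rw [e, add_comm]
    rfl
  · rw [dL_odd h, dL_odd h, dL_odd h, leftDer_mul]
    simp [gsigp, h]

theorem gsig_dL {f : Pt ε → Grassmann κ} (hf : SmoothOn f U) {x : Pt ε}
    (hx : x ∈ U) (A : Fin M) :
    gsig (SuperBV.dL j A f x) = psign (ε A) • SuperBV.dL j A (fun y => gsig (f y)) x := by
  by_cases h : ε A = 0
  · rw [h, psign_zero, one_smul]
    exact (dL_linear hU (L := gsig.toLinearMap) hf hx h).symm
  · rw [dL_odd h, dL_odd h, (zmod2_cases _).resolve_left h, psign_one, neg_one_smul, gsig_leftDer]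

/-- Symmetry of second derivatives for two even coordinates, anticommuting left derivatives for two
odd ones; a mixed pair commutes because an odd derivative is a constant linear map. -/
theorem dL_comm {f : Pt ε → Grassmann κ} (hf : SmoothOn f U) {x : Pt ε}
    (hx : x ∈ U) (A B : Fin M) :
    SuperBV.dL j A (SuperBV.dL j B f) x =
      psign (ε A * ε B) • SuperBV.dL j B (SuperBV.dL j A f) x := by
  by_cases hA : ε A = 0
  · rw [hA, zero_mul, psign_zero, one_smul]
    by_cases hB : ε B = 0
    · rw [dL_even hA, dL_even hB]
      have e : ∀ (C : Fin M) (hC : ε C = 0), SuperBV.dL j C f =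
          fun y => fderiv ℝ f y (Pi.single ⟨C, hC⟩ 1) := fun C hC => funext fun y => dL_even hC f y
      rw [e A hA, e B hB]
      have hd : DifferentiableAt ℝ (fderiv ℝ f) x :=
        ((ContDiffOn.fderiv_of_isOpen hf hU (m := ((⊤ : ℕ∞) : WithTop ℕ∞)) (by simp)).contDiffAt
          (hU.mem_nhds hx)).differentiableAt (by simp)
      have hs : IsSymmSndFDerivAt ℝ f x :=
        (ContDiffOn.contDiffAt hf (hU.mem_nhds hx)).isSymmSndFDerivAt (by
          simp only [minSmoothness_of_isRCLikeNormedField]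
          exact WithTop.coe_le_coe.mpr (le_top : (2 : ℕ∞) ≤ ⊤))
      have e2 : ∀ v : Pt ε, fderiv ℝ (fun y => fderiv ℝ f y v) x =
          (ContinuousLinearMap.apply ℝ _ v).comp (fderiv ℝ (fderiv ℝ f) x) := fun v =>
        ((ContinuousLinearMap.apply ℝ (Grassmann κ) v).hasFDerivAt.comp x hd.hasFDerivAt).fderiv
      rw [e2, e2]
      exact hs _ _
    · rw [dL_odd hB]
      have e : SuperBV.dL j B f = fun y => leftDerₗ (j ⟨B, hB⟩) (f y) :=
        funext fun y => dL_odd hB f y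
      rw [e, dL_linear hU hf hx hA]; rfl
  · by_cases hB : ε B = 0
    · rw [hB, mul_zero, psign_zero, one_smul, dL_odd hA]
      have e : SuperBV.dL j A f = fun y => leftDerₗ (j ⟨A, hA⟩) (f y) :=
        funext fun y => dL_odd hA f y
      rw [e, dL_linear hU hf hx hB]; rfl
    · rw [dL_odd hA, dL_odd hB, dL_odd hB, dL_odd hA, (zmod2_cases _).resolve_left hA,
        (zmod2_cases _).resolve_left hB, mul_one, psign_one, neg_one_smul, leftDer_leftDer]

end derivatives

end SuperBV
end

/-! ### The algebra of smooth functions on an open set as a superdomain. -/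

open scoped BigOperators
noncomputable section
set_option linter.unusedSectionVars false

namespace SuperBV
open scoped Grassmann.Alg
open SuperRing Grassmann TopologicalSpace

variable {M : ℕ} {ε : Fin M → ZMod 2} {κ : Type} [Fintype κ] [LinearOrder κ]

/-- The algebra of smooth Grassmann-valued functions on an open set. -/
def Sm (U : Opens (Pt ε)) (κ : Type) [Fintype κ] [LinearOrder κ] :
    Subalgebra ℂ (U → Grassmann κ) where
  -- Elements are functions on the subtype, so equality on `U` is equality; smoothness is that of
  -- some representative on the whole space.
  carrier := {f | ∃ g : Pt ε → Grassmann κ, SmoothOn g U ∧ ∀ x : U, f x = g x}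
  mul_mem' := by
    rintro _ _ ⟨g, hg, h⟩ ⟨g', hg', h'⟩
    exact ⟨_, hg.mul hg', fun x => by rw [Pi.mul_apply, h, h']⟩
  add_mem' := by
    rintro _ _ ⟨g, hg, h⟩ ⟨g', hg', h'⟩
    exact ⟨_, hg.add hg', fun x => by rw [Pi.add_apply, h, h']⟩
  algebraMap_mem' c := ⟨fun _ => algebraMap ℂ _ c, smoothOn_const _ _, fun _ => rfl⟩

namespace Sm

variable {U : Opens (Pt ε)}

instance : Ring (Sm U κ) := (Sm U κ).toRing
instance : Semiring (Sm U κ) := Ring.toSemiring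
instance : @Algebra ℂ (Sm U κ) _ Ring.toSemiring := (Sm U κ).algebra
instance : AddCommGroup (Sm U κ) := Ring.toAddCommGroup
instance : AddCommMonoid (Sm U κ) := NonUnitalNonAssocSemiring.toAddCommMonoid
instance : Module ℂ (Sm U κ) := Algebra.toModule
instance : Mul (Sm U κ) := NonUnitalNonAssocSemiring.toMul

/-- The restriction of a function that is smooth on `U`. -/
def of (g : Pt ε → Grassmann κ) (hg : SmoothOn g U) : Sm U κ := ⟨fun x => g x, g, hg, fun _ => rfl⟩

/-- Evaluation at a point. -/
def ev (x : U) : Sm U κ →ₐ[ℂ] Grassmann κ := (Pi.evalAlgHom ℂ _ x).comp (Sm U κ).val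

@[simp] theorem ev_of (g : Pt ε → Grassmann κ) (hg : SmoothOn g U) (x : U) :
    ev x (of g hg) = g x := rfl

theorem ext_ev {f g : Sm U κ} (h : ∀ x, ev x f = ev x g) : f = g := Subtype.ext (funext h)

/-- Extension by zero. -/
def extz (f : Sm U κ) : Pt ε → Grassmann κ := by
  classical exact fun x => if h : x ∈ U then ev ⟨x, h⟩ f else 0

theorem extz_apply (f : Sm U κ) {x : Pt ε} (hx : x ∈ U) : extz f x = ev ⟨x, hx⟩ f := dif_pos hx

theorem extz_coe (f : Sm U κ) (x : U) : extz f x = ev x f := dif_pos x.2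

theorem smooth_extz (f : Sm U κ) : SmoothOn (extz f) U := by
  obtain ⟨f, g, hg, h⟩ := f
  refine hg.congr fun x hx => ?_
  rw [extz_apply _ hx]; exact h ⟨x, hx⟩

theorem extz_of (g : Pt ε → Grassmann κ) (hg : SmoothOn g U) {x : Pt ε} (hx : x ∈ U) :
    extz (of g hg) x = g x := by rw [extz_apply _ hx, ev_of]

theorem smooth_gsig {g : Pt ε → Grassmann κ} {U : Set (Pt ε)} (hg : SmoothOn g U) :
    SmoothOn (fun x => gsig (g x)) U := SmoothOn.linear gsig.toLinearMap hg

/-- The parity automorphism of smooth functions. -/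
def sigS : Sm U κ →ₐ[ℂ] Sm U κ where
  toFun f := of (fun x => gsig (extz f x)) (smooth_gsig (smooth_extz f))
  map_one' := ext_ev fun x => by rw [ev_of, extz_coe, map_one, map_one]
  map_mul' f g := ext_ev fun x => by
    rw [map_mul, ev_of, ev_of, ev_of, extz_coe, extz_coe, extz_coe, map_mul, map_mul]
  map_zero' := ext_ev fun x => by rw [ev_of, extz_coe, map_zero, map_zero]
  map_add' f g := ext_ev fun x => by
    rw [map_add, ev_of, ev_of, ev_of, extz_coe, extz_coe, extz_coe, map_add, map_add]
  commutes' c := ext_ev fun x => by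
    rw [ev_of, extz_coe, AlgHom.commutes, AlgHom.commutes]

theorem ev_sigS (f : Sm U κ) (x : U) : ev x (sigS f) = gsig (ev x f) := by
  rw [← extz_coe f]; rfl

instance : SuperRing (Sm U κ) where
  sig := sigS
  sig_sig f := ext_ev fun x => by rw [ev_sigS, ev_sigS, gsig_gsig]
  even_comm f g hg := ext_ev fun x => by
    rw [map_mul, map_mul]
    have hg' : gsig (ev x g) = ev x g := by rw [← ev_sigS, hg]
    have := mul_comm_of_parity (p := 0) (hasParity_iff.mpr (by simpa using hg')) (ev x f)
    simpa [gsigp] using this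
  odd_comm f g hg := ext_ev fun x => by
    rw [map_mul, map_mul, ev_sigS]
    have hg' : gsig (ev x g) = -ev x g := by rw [← ev_sigS, hg, map_neg]
    have := mul_comm_of_parity (p := 1) (hasParity_iff.mpr (by simpa using hg')) (ev x f)
    simpa [gsigp] using this

theorem ev_sig (f : Sm U κ) (x : U) : ev x (sig f) = gsig (ev x f) := ev_sigS f x

theorem ev_sgp (p : ZMod 2) (f : Sm U κ) (x : U) : ev x (sgp p f) = gsigp p (ev x f) := by
  rcases zmod2_cases p with rfl | rfl
  · rfl
  · exact ev_sig f x

theorem isPar_iff {p : ZMod 2} {f : Sm U κ} : IsPar p f ↔ ∀ x, HasParity (ev x f) p := by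
  unfold IsPar
  constructor
  · intro h x
    rw [hasParity_iff, ← ev_sig, h, map_smul]
  · intro h
    refine ext_ev fun x => ?_
    rw [ev_sig, map_smul, hasParity_iff.mp (h x)]

theorem isPar_of {p : ZMod 2} {g : Pt ε → Grassmann κ} {hg : SmoothOn g U}
    (h : ∀ x ∈ U, HasParity (g x) p) : IsPar p (of g hg) :=
  isPar_iff.mpr fun x => h x x.2

/-- A left partial derivative of smooth functions. -/
def dLin (j : OddIx ε → κ) (A : Fin M) : Sm U κ →ₗ[ℂ] Sm U κ where
  toFun f := of (dL j A (extz f)) ((smooth_extz f).dL U.2 A)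
  map_add' f g := ext_ev fun x => by
    rw [map_add, ev_of, ev_of, ev_of,
      ← dL_add U.2 (smooth_extz f) (smooth_extz g) x.2]
    refine dL_congr U.2 (fun y hy => ?_) x.2 A
    rw [extz_apply _ hy, extz_apply _ hy, extz_apply _ hy, map_add]
  map_smul' c f := ext_ev fun x => by
    rw [RingHom.id_apply, map_smul, ev_of, ev_of, ← dL_smul U.2 c (smooth_extz f) x.2]
    refine dL_congr U.2 (fun y hy => ?_) x.2 A
    rw [extz_apply _ hy, extz_apply _ hy, map_smul]

theorem ev_dLin (j : OddIx ε → κ) (A : Fin M) (f : Sm U κ) (x : U) :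
    ev x (dLin j A f) = dL j A (extz f) x := rfl

theorem dLin_of (j : OddIx ε → κ) (A : Fin M) (g : Pt ε → Grassmann κ) (hg : SmoothOn g U) :
    dLin j A (of g hg : Sm U κ) = of (dL j A g) (hg.dL U.2 A) :=
  ext_ev fun x => dL_congr U.2 (fun _ hy => extz_of _ _ hy) x.2 A

theorem dLin_dLin (j : OddIx ε → κ) (A B : Fin M) (f : Sm U κ) :
    dLin j A (dLin j B f) = of (dL j A (dL j B (extz f))) (((smooth_extz f).dL U.2 B).dL U.2 A) :=
  dLin_of j A _ ((smooth_extz f).dL U.2 B)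

/-- Left partial derivatives of smooth functions. -/
def dS (j : OddIx ε → κ) : SDom (Sm U κ) ε where
  d := dLin j
  leib A f g := ext_ev fun x => by
    rw [map_add, map_mul (ev x), map_mul (ev x), ev_sgp, ev_dLin, ev_dLin, ev_dLin,
      ← extz_coe f, ← extz_coe g, ← dL_mul U.2 (smooth_extz f) (smooth_extz g) x.2]
    refine dL_congr U.2 (fun y hy => ?_) x.2 A
    rw [extz_apply _ hy, extz_apply _ hy, extz_apply _ hy, map_mul]
  sig_d A f := ext_ev fun x => by
    rw [map_smul, ev_sig, ev_dLin, ev_dLin, gsig_dL U.2 (smooth_extz f) x.2]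
    congr 1
    refine dL_congr U.2 (fun y hy => ?_) x.2 A
    rw [extz_apply _ hy, extz_apply _ hy, ev_sig]
  comm A B f := ext_ev fun x => by
    rw [map_smul (ev x), dLin_dLin, dLin_dLin, ev_of, ev_of, dL_comm U.2 (smooth_extz f) x.2]

theorem ev_dS (j : OddIx ε → κ) (A : Fin M) (f : Sm U κ) (x : U) :
    ev x ((dS j).d A f) = dL j A (extz f) x := rfl

theorem dS_of (j : OddIx ε → κ) (A : Fin M) (g : Pt ε → Grassmann κ) (hg : SmoothOn g U) :
    (dS j).d A (of g hg : Sm U κ) = of (dL j A g) (hg.dL U.2 A) := dLin_of j A g hg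

theorem ev_dS_of (j : OddIx ε → κ) (A : Fin M) (g : Pt ε → Grassmann κ) (hg : SmoothOn g U)
    (x : U) : ev x ((dS j).d A (of g hg)) = dL j A g x := by rw [dS_of]; rfl

theorem ev_dr (j : OddIx ε → κ) (A : Fin M) (f : Sm U κ) (x : U) :
    ev x ((dS j).dr A f) = dR j A (extz f) x := by
  rw [SDom.dr_apply, ev_sgp, dR_eq]; rfl

theorem dR_congr {j : OddIx ε → κ} {f g : Pt ε → Grassmann κ} (hfg : ∀ x ∈ U, f x = g x) {x : Pt ε}
    (hx : x ∈ U) (A : Fin M) : dR j A f x = dR j A g x := by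
  rw [dR_eq, dR_eq, dL_congr U.2 hfg hx]

/-! ### Inverses -/

/-- The scalar function given by the body. -/
def scal (φ : Pt ε → ℂ) (hφ : ContDiffOn ℝ ((⊤ : ℕ∞) : WithTop ℕ∞) φ U) : Sm U κ :=
  of (fun x => φ x • 1) (SmoothOn.smul_one hφ)

theorem contDiffOn_body (f : Sm U κ) :
    ContDiffOn ℝ ((⊤ : ℕ∞) : WithTop ℕ∞) (fun x => body (extz f x)) U :=
  SmoothOn.linear (bodyₐ (κ := κ)).toLinearMap (smooth_extz f)

theorem isPar_scal (φ : Pt ε → ℂ) (hφ : ContDiffOn ℝ ((⊤ : ℕ∞) : WithTop ℕ∞) φ U) :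
    IsPar 0 (scal (κ := κ) φ hφ) := by
  rw [isPar_zero_iff]
  refine ext_ev fun x => ?_
  rw [ev_sig, scal, ev_of, map_smul, map_one]

theorem pow_eq_zero_of_body {n : Sm U κ} (h : ∀ x, body (ev x n) = 0) :
    n ^ (Fintype.card κ + 1) = 0 :=
  ext_ev fun x => by rw [map_pow, isNilpotent_of_body (h x), map_zero]

/-- Up to the invertible scalar function given by the body, `f` is 1 plus a nilpotent function. -/
theorem isUnit_of_body {f : Sm U κ} (h : ∀ x, body (ev x f) ≠ 0) : IsUnit f := by
  have hc : ContDiffOn ℝ ((⊤ : ℕ∞) : WithTop ℕ∞) (fun x => (body (extz f x))⁻¹) U :=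
    (contDiffOn_body f).inv fun x hx => by rw [extz_apply _ hx]; exact h ⟨x, hx⟩
  have h1 : IsUnit (1 + (scal (κ := κ) _ hc * f - 1)) := by
    refine IsNilpotent.isUnit_one_add ⟨_, pow_eq_zero_of_body fun x => ?_⟩
    rw [map_sub, map_mul, map_one, ← bodyₐ_apply, map_sub, map_mul, map_one, scal, ev_of, map_smul,
      map_one, bodyₐ_apply, extz_coe, smul_eq_mul, mul_one, inv_mul_cancel₀ (h x), sub_self]
  have h2 : scal (κ := κ) _ (contDiffOn_body f) * (scal (κ := κ) _ hc) = 1 := ext_ev fun x => by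
    rw [map_mul, map_one, scal, scal, ev_of, ev_of, smul_mul_smul_comm, mul_one, extz_coe,
      mul_inv_cancel₀ (h x), one_smul]
  have h3 : scal (κ := κ) _ hc * scal (κ := κ) _ (contDiffOn_body f) = 1 := by
    rw [(isPar_scal _ _).comm_zero, h2]
  rw [add_sub_cancel] at h1
  have h4 : f = scal (κ := κ) _ (contDiffOn_body f) * (scal (κ := κ) _ hc * f) := by
    rw [← mul_assoc, h2, one_mul]
  rw [h4]
  exact (isUnit_iff_exists.mpr ⟨_, h2, h3⟩).mul h1

/-- The parity automorphism maps an inverse of an even element to another inverse, so the inverse is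
even. -/
theorem isUnit_even {R : Type} [Ring R] [Algebra ℂ R] [SuperRing R] {u : evenSub R}
    (hu : IsUnit (u : R)) : IsUnit u := by
  obtain ⟨v, hv, -⟩ := isUnit_iff_exists.mp hu
  have h1 : sig v = v := by
    have h2 : (u : R) * sig v = 1 := by
      have := congrArg sig hv
      rwa [map_mul, map_one, show sig (u : R) = u from u.2] at this
    have h3 : v * (u : R) = 1 := by rw [(coe_isPar u).comm_zero, hv]
    exact (left_inv_eq_right_inv h3 h2).symm
  exact IsUnit.of_mul_eq_one ⟨v, h1⟩ (Subtype.ext hv)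

variable {n : Type} [Fintype n] [DecidableEq n]

/-- Body of an even function at a point. -/
def evb (x : U) : evenSub (Sm U κ) →+* ℂ :=
  (bodyₐ (κ := κ)).toRingHom.comp ((ev x).toRingHom.comp (evenSub (Sm U κ)).subtype)

theorem evb_apply (x : U) (f : evenSub (Sm U κ)) : evb x f = body (ev x (f : Sm U κ)) := rfl

theorem isUnit_det_of_body {S : Matrix n n (evenSub (Sm U κ))}
    (h : ∀ x, (S.map (evb x)).det ≠ 0) : IsUnit S.det := by
  refine isUnit_even (isUnit_of_body fun x => ?_)
  have := h x
  rwa [← RingHom.mapMatrix_apply, ← RingHom.map_det] at this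

theorem degGE_matrix_pow {N : Matrix n n (Grassmann κ)} (h : ∀ i j, DegGE 1 (N i j)) (k : ℕ) :
    ∀ i j, DegGE k ((N ^ k) i j) := by
  induction k with
  | zero => intro i j; exact degGE_zero _
  | succ k ih =>
    intro i j
    rw [pow_succ, Matrix.mul_apply]
    exact DegGE.sum fun l _ => (ih i l).mul (h l j)

/-- A matrix of smooth functions whose body is invertible at each point has a smooth inverse. -/
theorem exists_inverse_of_body {N : Matrix n n (Sm U κ)}
    (h : ∀ x, (Matrix.of fun i j => body (ev x (N i j))).det ≠ 0) :
    ∃ Ni, N * Ni = 1 ∧ Ni * N = 1 := by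
  -- `b` is the matrix of bodies, a matrix over a commutative ring with invertible determinant. Then
  -- `N` is `b` times 1 plus a matrix without body, which is nilpotent.
  let b : Matrix n n (evenSub (Sm U κ)) := fun i j =>
    ⟨scal _ (contDiffOn_body (N i j)), isPar_zero_iff.mp (isPar_scal _ _)⟩
  have hb : ∀ x i j, evb x (b i j) = body (ev x (N i j)) := fun x i j => by
    rw [evb_apply]
    change body ((body (extz (N i j) x)) • 1) = _
    rw [body_smul_one, extz_coe]
  have hdet : IsUnit b.det := by
    refine isUnit_det_of_body fun x => ?_
    have e : b.map (evb x) = Matrix.of fun i j => body (ev x (N i j)) := by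
      ext i j; exact hb x i j
    rw [e]
    exact h x
  have e1 : coeM b⁻¹ * coeM b = 1 := by
    rw [← coeM_mul, Matrix.nonsing_inv_mul _ hdet, coeM_one]
  have e2 : coeM b * coeM b⁻¹ = 1 := by
    rw [← coeM_mul, Matrix.mul_nonsing_inv _ hdet, coeM_one]
  have h1 : IsUnit (1 + coeM b⁻¹ * (N - coeM b)) := by
    refine IsNilpotent.isUnit_one_add ⟨Fintype.card κ + 1, ?_⟩
    refine Matrix.ext fun i j => ext_ev fun x => ?_
    rw [Matrix.zero_apply, map_zero]
    have : ((ev x).toRingHom.mapMatrix (coeM b⁻¹ * (N - coeM b))) ^ (Fintype.card κ + 1) = 0 := by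
      ext i j
      have hd := degGE_matrix_pow (κ := κ) (N := (ev x).toRingHom.mapMatrix (coeM b⁻¹ * (N - coeM b)))
        (fun i j => by
          change DegGE 1 (ev x ((coeM b⁻¹ * (N - coeM b)) i j))
          rw [Matrix.mul_apply, map_sum]
          refine DegGE.sum fun l _ => ?_
          rw [map_mul]
          refine (degGE_zero _).mul (degGE_one_iff.mpr ?_)
          rw [Matrix.sub_apply, map_sub, ← bodyₐ_apply, map_sub, sub_eq_zero]
          exact (hb x l j).symm) (Fintype.card κ + 1)
      rw [eq_zero_of_degGE (hd i j)]; rfl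
    rw [← map_pow] at this
    exact congrFun (congrFun this i) j
  have h2 : N = coeM b * (1 + coeM b⁻¹ * (N - coeM b)) := by
    rw [mul_add, mul_one, ← mul_assoc, e2, one_mul, add_sub_cancel]
  have h3 : IsUnit N := by
    rw [h2]
    exact (isUnit_iff_exists.mpr ⟨_, e2, e1⟩).mul h1
  exact isUnit_iff_exists.mp h3

/-- A matrix of smooth functions that is invertible at each point has a smooth inverse. -/
theorem exists_inverse {N : Matrix n n (Sm U κ)} (h : ∀ x, IsUnit (N.map (ev x))) :
    ∃ Ni, N * Ni = 1 ∧ Ni * N = 1 := by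
  refine exists_inverse_of_body fun x => ?_
  have := (h x).map (bodyₐ (κ := κ)).toRingHom.mapMatrix
  rw [Matrix.isUnit_iff_isUnit_det] at this
  exact this.ne_zero

/-! ### The Berezinian -/

/-- Evaluation of even functions. -/
def evE (x : U) : evenSub (Sm U κ) →+* evenSubring κ where
  toFun f := ⟨ev x f, by
    have : IsPar 0 (f : Sm U κ) := coe_isPar f
    exact isPar_iff.mp this x⟩
  map_one' := rfl
  map_mul' _ _ := rfl
  map_zero' := rfl
  map_add' _ _ := rfl

theorem evE_coe (x : U) (f : evenSub (Sm U κ)) : (evE x f : Grassmann κ) = ev x f := rfl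

theorem evE_evp (x : U) (f : Sm U κ) : evE x (evp f) = evenPart (ev x f) := by
  apply Subtype.ext
  rw [evE_coe]
  change ev x ((1 / 2 : ℂ) • (f + sig f)) = _
  rw [map_smul, map_add, ev_sig]
  ext S
  change (1 / 2 : ℂ) * (ev x f S + (-1) ^ S.card * ev x f S) =
    if (S.card : ZMod 2) = 0 then ev x f S else 0
  rw [← psign_natCast]
  rcases zmod2_cases (S.card : ZMod 2) with h | h <;> rw [h]
  · simp
    ring
  · simp

theorem map_inverse {A B : Type} [CommRing A] [CommRing B] (φ : A →+* B) {S : Matrix n n A}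
    (hS : IsUnit S.det) : (S⁻¹).map φ = (S.map φ)⁻¹ := by
  symm
  apply Matrix.inv_eq_left_inv
  rw [← Matrix.map_mul, Matrix.nonsing_inv_mul _ hS, Matrix.map_one _ (map_zero _) (map_one _)]

theorem map_ring_inverse {A B : Type} [Ring A] [Ring B] (φ : A →+* B) {a : A} (ha : IsUnit a) :
    φ (Ring.inverse a) = Ring.inverse (φ a) := by
  have h : φ a * φ (Ring.inverse a) = 1 := by
    rw [← map_mul, Ring.mul_inverse_cancel _ ha, map_one]
  have h2 := Ring.inverse_mul_cancel _ (ha.map φ)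
  exact (left_inv_eq_right_inv h2 h).symm

-- Evaluation at a point commutes with the two inverses in the Berezinian as soon as the determinant
-- of the odd-odd block is a unit; this links `ber` to `sdet`.
set_option maxHeartbeats 1000000 in
theorem ev_ber {p : n → ZMod 2} {N : Matrix n n (Sm U κ)} (hD : IsUnit (berD p N).det) (x : U) :
    ev x (ber p N : Sm U κ) = sdet p (N.map (ev x)) := by
  have e1 : (berD p N).map (evE x) = (Matrix.of fun i j => evenPart (ev x (N i j)) :
      Matrix {i // p i ≠ 0} {i // p i ≠ 0} (evenSubring κ)) := by
    exact Matrix.ext fun i j => evE_evp x (N i j)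
  have e2 : (berD p N)⁻¹.map (evE x) = (Matrix.of fun i j => evenPart (ev x (N i j)) :
      Matrix {i // p i ≠ 0} {i // p i ≠ 0} (evenSubring κ))⁻¹ := by
    rw [map_inverse _ hD, e1]
  have e3 : Ring.inverse (evE x (berD p N).det) =
      Ring.inverse (Matrix.det (Matrix.of fun i j => evenPart (ev x (N i j)) :
        Matrix {i // p i ≠ 0} {i // p i ≠ 0} (evenSubring κ))) := by
    rw [RingHom.map_det, RingHom.mapMatrix_apply, e1]
  have e4 : (berS p N).map (evE x) = ((Matrix.of fun i j => ev x (N i j) :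
      Matrix {i // p i = 0} {i // p i = 0} (Grassmann κ)) -
      (Matrix.of fun i j => ev x (N i j) : Matrix {i // p i = 0} {i // p i ≠ 0} (Grassmann κ)) *
      ((Matrix.of fun i j => evenPart (ev x (N i j)) :
        Matrix {i // p i ≠ 0} {i // p i ≠ 0} (evenSubring κ))⁻¹.map
          fun z => (z : Grassmann κ)) *
      (Matrix.of fun i j => ev x (N i j) : Matrix {i // p i ≠ 0} {i // p i = 0} (Grassmann κ))).map
        evenPart := by
    refine Matrix.ext fun i j => (evE_evp x ((blk (p · = 0) (p · = 0) N -
      blk (p · = 0) (p · ≠ 0) N * coeM (berD p N)⁻¹ * blk (p · ≠ 0) (p · = 0) N) i j)).trans ?_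
    rw [← e2, Matrix.map_apply]
    congr 1
    rw [Matrix.sub_apply, Matrix.sub_apply, map_sub, Matrix.mul_apply, Matrix.mul_apply, map_sum]
    congr 1
    refine Finset.sum_congr rfl fun k _ => ?_
    rw [map_mul, Matrix.mul_apply, Matrix.mul_apply, map_sum]
    congr 1
  have e5 : evE x (ber p N) = ((berS p N).map (evE x)).det * Ring.inverse (evE x (berD p N).det) := by
    rw [ber, map_mul (evE x), map_ring_inverse (evE x) hD, (evE x).map_det]
    rfl
  rw [← evE_coe, e5, e3, e4]
  rfl

/-- The even-odd entries have no body, so in the product `N * Ni = 1` the bodies of the odd-odd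
blocks are already inverse to each other. -/
theorem isUnit_berD {p : n → ZMod 2} {N Ni : Matrix n n (Sm U κ)} (hN : MatPar p p N)
    (h1 : N * Ni = 1) : IsUnit (berD p N).det := by
  have hodd : ∀ i : {i // p i ≠ 0}, p i = 1 := fun i => (zmod2_cases _).resolve_left i.2
  refine isUnit_det_of_body fun x => ?_
  have h : (berD p N).map (evb x) * (Matrix.of fun i j => body (ev x (Ni i j)) :
      Matrix {i // p i ≠ 0} {i // p i ≠ 0} ℂ) = 1 := by
    ext i j
    have h2 := congrArg (fun z => body (ev x z)) (congrFun (congrFun h1 i) j)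
    simp only [← bodyₐ_apply] at h2
    rw [Matrix.mul_apply, map_sum, map_sum] at h2
    rw [Matrix.mul_apply]
    have h3 : ∀ k : n, p k = 0 → bodyₐ (ev x (N i k * Ni k j)) = 0 := by
      intro k hk
      rw [map_mul, map_mul, bodyₐ_apply, degGE_one_iff.mp (degGE_one_of_parity_one
        (isPar_iff.mp ((hN i k).cast (by rw [hodd, hk, add_zero])) x)), zero_mul]
    rw [← Fintype.sum_subtype_add_sum_subtype (fun k => p k ≠ 0),
      Finset.sum_eq_zero (s := (Finset.univ : Finset {k // ¬ p k ≠ 0}))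
        (fun k _ => h3 k (not_not.mp k.2)), add_zero] at h2
    have h4 : ∀ k : {k // p k ≠ 0}, (berD p N).map (evb x) i k * body (ev x (Ni k j)) =
        bodyₐ (ev x (N i k * Ni k j)) := by
      intro k
      rw [map_mul, map_mul]
      congr 1
      rw [Matrix.map_apply, evb_apply, bodyₐ_apply]
      congr 2
      exact evp_of_even ((hN i k).cast (by rw [hodd, hodd]; rfl))
    refine (Finset.sum_congr rfl fun k _ => h4 k).trans ?_
    rw [h2, Matrix.one_apply, Matrix.one_apply]
    by_cases hij : i = j
    · rw [if_pos hij, if_pos (congrArg _ hij), map_one, map_one]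
    · rw [if_neg hij, if_neg (fun e => hij (Subtype.ext e)), map_zero, map_zero]
  exact fun h0 => by
    have := congrArg Matrix.det h
    rw [Matrix.det_mul, h0, zero_mul, Matrix.det_one] at this
    exact zero_ne_one this

end Sm

end SuperBV
end

/-! ### The master equation expanded in the first-level fields, abstractly. -/

open scoped BigOperators
noncomputable section
set_option linter.unusedSectionVars false

namespace SuperBV
open SuperRing

/-- Left derivations of parity `q`. -/
structure SuperRing.IsLDer {S : Type} [Ring S] [Algebra ℂ S] [SuperRing S] (q : ZMod 2)
    (X : S →ₗ[ℂ] S) : Prop where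
  leib : ∀ a b, X (a * b) = X a * b + sgp q a * X b
  sig : ∀ a, SuperRing.sig (X a) = psign q • X (SuperRing.sig a)

section

variable {S : Type} [Ring S] [Algebra ℂ S] [SuperRing S]

theorem SuperRing.IsLDer.par {q p : ZMod 2} {X : S →ₗ[ℂ] S} (hX : IsLDer q X) {a : S}
    (ha : IsPar p a) : IsPar (p + q) (X a) := by
  unfold IsPar at *
  rw [hX.sig, ha, map_smul, smul_smul, psign_add, mul_comm]

theorem SuperRing.IsLDer.leib_par {q p : ZMod 2} {X : S →ₗ[ℂ] S} (hX : IsLDer q X) {a : S}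
    (ha : IsPar p a) (b : S) : X (a * b) = X a * b + psign (q * p) • (a * X b) := by
  rw [hX.leib, ha.sgp, smul_mul_assoc]

theorem SuperRing.IsLDer.mul_of_kill {q p : ZMod 2} {X : S →ₗ[ℂ] S} (hX : IsLDer q X) {a : S}
    (ha : IsPar p a) (h0 : X a = 0) (b : S) : X (a * b) = psign (q * p) • (a * X b) := by
  rw [hX.leib_par ha, h0, zero_mul, zero_add]

/-- An even solution of `X e = e * X w` is treated like the exponential of `w`. -/
theorem SuperRing.IsLDer.exp_mul {q : ZMod 2} {X : S →ₗ[ℂ] S} (hX : IsLDer q X) {e w : S}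
    (he : IsPar 0 e) (hw : X e = e * X w) (z : S) : X (e * z) = e * (X w * z + X z) := by
  rw [hX.leib_par he, mul_zero, psign_zero, one_smul, hw, mul_add, mul_assoc]

/-- Differentiating `e * z = 0` gives `e * X z = 0` without cancelling `e`. Later only the image of
`e` with all first-level fields put to zero has to be a unit. -/
theorem SuperRing.IsLDer.exp_kill {q : ZMod 2} {X : S →ₗ[ℂ] S} (hX : IsLDer q X) {e w : S}
    (he : IsPar 0 e) (hw : X e = e * X w) {z : S} (hz : e * z = 0) : e * X z = 0 := by
  have h := hX.exp_mul he hw z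
  rw [hz, map_zero, mul_add, ← mul_assoc, ← he.comm_zero, mul_assoc, hz, mul_zero, zero_add] at h
  exact h.symm

end

/-- A supercommutative algebra of functions of first-level fields over a superdomain. -/
structure FirstLevel (S R : Type) [Ring S] [Algebra ℂ S] [SuperRing S] [Ring R] [Algebra ℂ R]
    [SuperRing R] {ι k : Type} (ε : ι → ZMod 2) (δ : k → ZMod 2) (d : SDom R ε) where
  -- `P` puts the first-level fields to zero; `D`, `L`, `Ls` are the left derivatives with respect
  -- to Γ, λ and λ*.
  P : S →ₐ[ℂ] R
  P_sig : ∀ a, P (sig a) = sig (P a)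
  D : ι → S →ₗ[ℂ] S
  L : k → S →ₗ[ℂ] S
  Ls : k → S →ₗ[ℂ] S
  der_D : ∀ A, IsLDer (ε A) (D A)
  der_L : ∀ α, IsLDer (δ α) (L α)
  der_Ls : ∀ α, IsLDer (δ α + 1) (Ls α)
  P_D : ∀ A a, P (D A a) = d.d A (P a)
  L_D : ∀ α A a, L α (D A a) = psign (δ α * ε A) • D A (L α a)
  L_L : ∀ α β a, L α (L β a) = psign (δ α * δ β) • L β (L α a)

namespace FirstLevel

variable {S R : Type} [Ring S] [Algebra ℂ S] [SuperRing S] [Ring R] [Algebra ℂ R]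
    [SuperRing R] {ι k : Type} [Fintype ι] [DecidableEq ι] [Fintype k] {ε : ι → ZMod 2}
    {δ : k → ZMod 2} {d : SDom R ε} (T : FirstLevel S R ε δ d)

/-- The second-order part of the Laplacian. -/
def lapS (r : S) (E' : ι → ι → S) (f : S) : S :=
  ∑ A, ∑ B, (psign (ε A) / 2) • (r * T.D A (E' A B * T.D B f))

/-- The first-level Laplacian. -/
def delta (r : S) (E' : ι → ι → S) (f : S) : S :=
  T.lapS r E' f + ∑ α, psign (δ α) • T.L α (T.Ls α f)

/-- The bilinear form of a Laplacian. -/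
def bil (r : S) (E' : ι → ι → S) (p : ZMod 2) (u v : S) : S :=
  ∑ A, ∑ B, (psign (ε A) / 2) • psign (p * ε A) • (r * (T.D A u * (E' A B * T.D B v)))

/-- The expression `exp(-w) Δ exp(w)`. -/
def quantum (r : S) (E' : ι → ι → S) (w : S) : S :=
  T.bil r E' 0 w w + T.lapS r E' w +
    ∑ α, psign (δ α) • (T.L α w * T.Ls α w + T.L α (T.Ls α w))

variable {r : S} {E' : ι → ι → S} (hr : IsPar 0 r)
  (hE' : ∀ A B, IsPar (ε A + ε B + 1) (E' A B))

section exp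

variable {e w : S} (he : IsPar 0 e) (De : ∀ A, T.D A e = e * T.D A w)
  (Le : ∀ α, T.L α e = e * T.L α w) (Lse : ∀ α, T.Ls α e = e * T.Ls α w)

include he De Le Lse

/-- A second-order operator applied to an exponential gives the exponential times terms quadratic
and linear in w. -/
theorem delta_exp : T.delta r E' e = e * T.quantum r E' w := by
  unfold delta quantum lapS bil
  simp only [mul_add, Finset.mul_sum]
  rw [← Finset.sum_add_distrib]
  congr 1
  · refine Finset.sum_congr rfl fun A _ => ?_
    rw [← Finset.sum_add_distrib]
    refine Finset.sum_congr rfl fun B _ => ?_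
    rw [De, ← mul_assoc (E' A B), he.comm_zero, mul_assoc, (T.der_D A).exp_mul he (De A), zero_mul,
      psign_zero, one_smul, mul_smul_comm, mul_smul_comm, ← smul_add]
    congr 1
    rw [← mul_assoc, he.comm_zero, mul_assoc, mul_add, mul_add]
  · refine Finset.sum_congr rfl fun α _ => ?_
    rw [Lse, (T.der_L α).exp_mul he (Le α), mul_smul_comm, mul_add]

/-- The master equation and its derivatives along the first-level fields. -/
theorem quantum_eq_zero (hu : IsUnit (T.P e)) (h : T.delta r E' e = 0) :
    (∀ β, T.P (T.L β (T.quantum r E' w)) = 0) ∧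
      ∀ γ β, T.P (T.L γ (T.L β (T.quantum r E' w))) = 0 := by
  rw [T.delta_exp he De Le Lse] at h
  have h1 : ∀ z, e * z = 0 → T.P z = 0 := fun z hz => by
    have := congrArg T.P hz
    rw [map_mul, map_zero] at this
    exact hu.mul_right_eq_zero.mp this
  have h2 := fun β => (T.der_L β).exp_kill he (Le β) h
  exact ⟨fun β => h1 _ (h2 β), fun γ β => h1 _ ((T.der_L γ).exp_kill he (Le γ) (h2 β))⟩

end exp

section action

variable (Lr : ∀ α, T.L α r = 0) (LE : ∀ α A B, T.L α (E' A B) = 0)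

include hr hE' Lr LE

/-- The density and the bivector do not depend on λ, so the λ-derivative only acquires the sign of
passing an odd operator. -/
theorem L_lapS (β : k) (f : S) : T.L β (T.lapS r E' f) = psign (δ β) • T.lapS r E' (T.L β f) := by
  unfold lapS
  simp only [map_sum, Finset.smul_sum, map_smul]
  refine Finset.sum_congr rfl fun A _ => Finset.sum_congr rfl fun B _ => ?_
  rw [(T.der_L β).mul_of_kill hr (Lr β), T.L_D, (T.der_L β).mul_of_kill (hE' A B) (LE β A B), T.L_D]
  simp only [mul_smul_comm, map_smul, smul_smul]
  congr 1
  rw [← psign_add, ← psign_add, ← psign_add, mul_comm]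
  congr 1
  exact congrArg psign ((by decide : ∀ a b q : ZMod 2,
    q * 0 + (q * a + (q * (a + b + 1) + q * b)) = q) (ε A) (ε B) (δ β))

theorem L_bil (β : k) {p : ZMod 2} {u : S} (hu : IsPar p u) (v : S) :
    T.L β (T.bil r E' p u v) = T.bil r E' (p + δ β) (T.L β u) v +
      psign (δ β * (p + 1)) • T.bil r E' p u (T.L β v) := by
  unfold bil
  simp only [map_sum, Finset.smul_sum, map_smul]
  rw [← Finset.sum_add_distrib]
  refine Finset.sum_congr rfl fun A _ => ?_
  rw [← Finset.sum_add_distrib]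
  refine Finset.sum_congr rfl fun B _ => ?_
  rw [(T.der_L β).mul_of_kill hr (Lr β), (T.der_L β).leib_par ((T.der_D A).par hu), T.L_D,
    (T.der_L β).mul_of_kill (hE' A B) (LE β A B), T.L_D]
  rw [mul_add (r), smul_add, smul_add, smul_add]
  simp only [mul_smul_comm, smul_mul_assoc, smul_smul]
  congr 1
  · congr 1
    rw [← psign_add, ← psign_add]
    congr 1
    exact congrArg psign ((by decide : ∀ a p q : ZMod 2,
      p * a + (q * 0 + q * a) = (p + q) * a) (ε A) p (δ β))
  · congr 1
    rw [mul_left_comm (psign (δ β * (p + 1))), ← psign_add, ← psign_add,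
      ← psign_add, ← psign_add, ← psign_add]
    congr 1
    exact congrArg psign ((by decide : ∀ a b p q : ZMod 2,
      p * a + (q * 0 + (q * (p + a) + (q * (a + b + 1) + q * b))) =
        q * (p + 1) + p * a) (ε A) (ε B) p (δ β))

variable {E : ι → ι → R} {ρ ρi : R} (hρi : ρi * ρ = 1) (Pr : T.P r = ρi)
  (PE : ∀ A B, T.P (E' A B) = ρ * E A B)

include hρi Pr PE

omit hr hE' Lr LE hρi in
theorem P_lapS (f : S) : T.P (T.lapS r E' f) = d.lap E ρ ρi (T.P f) := by
  unfold lapS SDom.lap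
  simp only [map_sum, map_smul, map_mul, Pr, T.P_D, PE]

omit hE' Lr LE in
theorem P_bil {p : ZMod 2} {u : S} (hu : IsPar p u) (v : S) :
    T.P (T.bil r E' p u v) = (1 / 2 : ℂ) • d.br E (T.P u) (T.P v) := by
  have hρ : IsPar 0 ρi := by
    rw [isPar_zero_iff, ← Pr, ← T.P_sig, isPar_zero_iff.mp hr]
  have hPu : IsPar p (T.P u) := by
    unfold IsPar at *
    rw [← T.P_sig, hu, map_smul]
  unfold bil SDom.br
  simp only [map_sum, map_smul, map_mul, Pr, T.P_D, PE, Finset.smul_sum]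
  refine Finset.sum_congr rfl fun A _ => Finset.sum_congr rfl fun B _ => ?_
  rw [d.dr_par hPu, smul_mul_assoc, smul_mul_assoc, smul_smul, smul_smul, ← mul_assoc ρi,
    ← hρ.comm_zero, mul_assoc, ← mul_assoc ρi, ← mul_assoc ρi, hρi, one_mul, mul_assoc]
  congr 1
  rw [div_mul_eq_mul_div, ← psign_add, div_eq_inv_mul, one_div]
  congr 1
  exact congrArg psign ((by decide : ∀ a p : ZMod 2, a + p * a = a * (p + a)) (ε A) p)

variable {w : S} (hw : IsPar 0 w) {G : k → R} {H : R} (hE : SDom.IsBiv ε E)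
  (P0 : T.P w = -H) (P1 : ∀ β, T.P (T.L β w) = (Complex.I * psign (δ β)) • G β)
  (P2 : ∀ γ β, T.P (T.L γ (T.L β w)) = 0) (P3 : ∀ γ β α, T.P (T.L γ (T.L β (T.L α w))) = 0)
  (P4 : ∀ γ β α, T.P (T.L γ (T.L β (T.L α (T.Ls α w)))) = 0)

/-- Structure functions of the constraint algebra. -/
def struc (w : S) (β α γ : k) : R :=
  (Complex.I * psign (δ γ + δ α * (δ β + δ γ))) • T.P (T.L γ (T.L β (T.Ls α w)))

include hw in
omit hr hE' Lr LE hρi Pr PE in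
theorem struc_par (β α γ : k) : IsPar (δ α + δ γ + (δ β + 1)) (T.struc w β α γ) := by
  refine IsPar.smul _ ?_
  have h := (T.der_L γ).par ((T.der_L β).par ((T.der_Ls α).par hw))
  have h2 : IsPar (0 + (δ α + 1) + δ β + δ γ) (T.P (T.L γ (T.L β (T.Ls α w)))) := by
    unfold IsPar at *
    rw [← T.P_sig, h, map_smul]
  exact h2.cast (by ring)

omit hr hE' Lr LE hρi Pr PE in
theorem P_IsPar {p : ZMod 2} {a : S} (ha : IsPar p a) : IsPar p (T.P a) := by
  unfold IsPar at *
  rw [← T.P_sig, ha, map_smul]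

-- The first λ-derivative of the master equation. The bilinear form gives the bracket of H with `G
-- β`, the Laplacian of w gives that of `G β`, the double derivative along λ and λ* gives the trace
-- of the structure functions, and the remaining product contains a factor G and falls into the
-- ideal.
include hw hE P0 P1 P2 in
theorem lap_sub_mem [DecidableEq k] (hG : ∀ α, IsPar (δ α) (G α)) (hH : IsPar 0 H) (β : k)
    (hQ : T.P (T.L β (T.quantum r E' w)) = 0) {I : Ideal R} [I.IsTwoSided] (mG : ∀ α, G α ∈ I) :
    d.lap E ρ ρi (G β) - d.br E H (G β) - ∑ γ, psign (δ γ) • T.struc w β γ γ ∈ I := by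
  have hL := fun α => (T.der_L α).par hw
  have hbr : d.br E (G β) H = psign (δ β) • d.br E H (G β) := by
    rw [d.br_skew hE hH (hG β), ← neg_smul]
    congr 1
    rw [show (0 + 1) * (δ β + 1) = δ β + (1 : ZMod 2) by ring, psign_add, psign_one]; ring
  have key : T.P (T.L β (T.quantum r E' w)) = (psign (δ β)) • (Complex.I * psign (δ β)) •
      (d.lap E ρ ρi (G β) - d.br E H (G β)) +
      ∑ α, psign (δ α) • (psign (δ β * δ α) • (T.P (T.L α w) * T.P (T.L β (T.Ls α w))) +
        T.P (T.L β (T.L α (T.Ls α w)))) := by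
    unfold quantum
    rw [map_add (T.L β), map_add (T.L β), T.L_bil hr hE' Lr LE β hw, T.L_lapS hr hE' Lr LE,
      map_add T.P, map_add T.P, map_add T.P, map_smul T.P, map_smul T.P, T.P_bil hr hρi Pr PE (by simpa using hL β),
      T.P_bil hr hρi Pr PE hw, T.P_lapS Pr PE, P0, P1, map_sum, map_sum]
    congr 1
    · have hl : d.lap E ρ ρi ((Complex.I * psign (δ β)) • G β) =
          (Complex.I * psign (δ β)) • d.lap E ρ ρi (G β) := by
        unfold SDom.lap
        simp only [map_smul, mul_smul_comm, Finset.smul_sum]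
        refine Finset.sum_congr rfl fun A _ => Finset.sum_congr rfl fun B _ => smul_comm _ _ _
      have hn : ∀ f : R, -f = (-1 : ℂ) • f := fun f => by rw [neg_one_smul]
      rw [hl, hn H, d.br_smul_left, d.br_smul_left, d.br_smul_right, d.br_smul_right, hbr, smul_sub]
      simp only [smul_smul, smul_sub]
      rw [← add_smul, sub_eq_add_neg, add_comm, ← neg_smul]
      congr 1
      rw [zero_add, mul_one]
      congr 1
      ring
    · refine Finset.sum_congr rfl fun α _ => ?_
      rw [map_smul, map_smul, map_add, map_add, (T.der_L β).leib_par (hL α), map_add, map_mul, P2,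
        zero_mul, zero_add, zero_add, map_smul, map_mul]
  rw [hQ] at key
  -- The phases in `struc` are such that its diagonal entries, after exchanging two λ-derivatives,
  -- are the terms of the master equation.
  have h2 : ∀ γ, psign (δ γ) • T.struc w β γ γ =
      Complex.I • psign (δ γ) • T.P (T.L β (T.L γ (T.Ls γ w))) := by
    intro γ
    rw [struc, T.L_L γ β, map_smul, smul_smul, smul_smul, smul_smul]
    congr 1
    rw [mul_left_comm, mul_assoc, ← psign_add, ← psign_add]
    congr 2
    exact (by decide : ∀ a b : ZMod 2, a + (a + a * (b + a)) + a * b = a) (δ γ) (δ β)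
  rw [Finset.sum_congr rfl fun γ _ => h2 γ, ← Finset.smul_sum]
  have h3 : ∑ α, psign (δ α) • psign (δ β * δ α) •
      (T.P (T.L α w) * T.P (T.L β (T.Ls α w))) ∈ I := by
    refine I.sum_mem fun α _ => smul_mem_ideal _ (smul_mem_ideal _ ?_)
    rw [P1, smul_mul_assoc]
    exact smul_mem_ideal _ (I.mul_mem_right _ (mG α))
  simp only [smul_add, Finset.sum_add_distrib] at key
  rw [smul_smul, mul_left_comm, psign_mul_self, mul_one] at key
  have h4 : d.lap E ρ ρi (G β) - d.br E H (G β) -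
      Complex.I • ∑ γ, psign (δ γ) • T.P (T.L β (T.L γ (T.Ls γ w))) =
      Complex.I • ∑ α, psign (δ α) • psign (δ β * δ α) •
      (T.P (T.L α w) * T.P (T.L β (T.Ls α w))) := by
    have := congrArg (fun z => Complex.I • z) key
    simp only [smul_add, smul_zero, smul_smul Complex.I Complex.I, Complex.I_mul_I, neg_smul,
      one_smul] at this
    rw [← sub_eq_zero, ← neg_eq_zero]
    rw [this]
    abel
  rw [h4]
  exact smul_mem_ideal _ h3

-- The second λ-derivative of the master equation. As w has no terms λλ, λλλ or λλλλ* of the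
-- relevant kind, only the bracket of two G's and the product of a G with a λλλ*-coefficient
-- survive.
include hw hE P0 P1 P2 P3 P4 in
theorem br_gauge (hG : ∀ α, IsPar (δ α) (G α)) (γ β : k)
    (hQ : T.P (T.L γ (T.L β (T.quantum r E' w))) = 0) :
    d.br E (G γ) (G β) = ∑ α, G α * T.struc w β α γ := by
  have hL := fun α => (T.der_L α).par hw
  have hL' := fun α => (hL α).cast (zero_add _)
  have hbr : d.br E (G β) (G γ) = psign (δ β * δ γ + δ β + δ γ) • d.br E (G γ) (G β) := by
    rw [d.br_skew hE (hG γ) (hG β), ← neg_smul]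
    congr 1
    rw [show (δ γ + 1) * (δ β + 1) = (δ β * δ γ + δ β + δ γ) + (1 : ZMod 2) by ring, psign_add,
      psign_one]; ring
  have key : T.P (T.L γ (T.L β (T.quantum r E' w))) =
      -(psign (δ γ) • d.br E (G γ) (G β)) +
      ∑ α, psign (δ α) • psign (δ α * (δ β + δ γ)) •
        (T.P (T.L α w) * T.P (T.L γ (T.L β (T.Ls α w)))) := by
    have z1 : ∀ f : R, d.br E 0 f = 0 := fun f => by rw [← SDom.brL_apply, map_zero]
    have z2 : ∀ f : R, d.br E f 0 = 0 := fun f => by rw [← SDom.brR_apply, map_zero]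
    have z3 : d.lap E ρ ρi 0 = 0 := by simp [SDom.lap]
    unfold quantum
    rw [map_add (T.L β), map_add (T.L β), T.L_bil hr hE' Lr LE β hw, T.L_lapS hr hE' Lr LE,
      map_add (T.L γ), map_add (T.L γ), map_add (T.L γ), map_smul (T.L γ), map_smul (T.L γ),
      T.L_bil hr hE' Lr LE γ (hL β), T.L_bil hr hE' Lr LE γ hw, T.L_lapS hr hE' Lr LE, map_add T.P,
      map_add T.P, map_add T.P, map_smul T.P, map_smul T.P, map_smul T.P, map_add T.P, map_add T.P,
      map_smul T.P, map_smul T.P,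
      T.P_bil hr hρi Pr PE (by simpa using (T.der_L γ).par (hL β)),
      T.P_bil hr hρi Pr PE (by simpa using hL β), T.P_bil hr hρi Pr PE (by simpa using hL γ),
      T.P_bil hr hρi Pr PE hw, T.P_lapS Pr PE, P2, z1, z2, z3, P1, P1, map_sum, map_sum, map_sum]
    simp only [smul_zero, zero_add, add_zero]
    congr 1
    · rw [d.br_smul_left, d.br_smul_right, d.br_smul_left, d.br_smul_right, hbr]
      simp only [smul_smul]
      rw [← add_smul, ← neg_smul]
      congr 1
      -- Each of the two mixed terms carries half of the bracket, and after reordering they have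
      -- equal sign; this is checked for the four choices of parities.
      generalize δ β = b, δ γ = c
      have h11 : (1 : ZMod 2) + 1 = 0 := rfl
      have hI := Complex.I_mul_I
      rcases zmod2_cases b with rfl | rfl <;> rcases zmod2_cases c with rfl | rfl <;>
        simp only [mul_zero, mul_one, zero_add, add_zero, h11, psign_zero, psign_one] <;>
        first | linear_combination hI | linear_combination -hI
    · refine Finset.sum_congr rfl fun α _ => ?_
      simp only [map_smul, map_add]
      congr 1
      rw [P4, (T.der_L β).leib_par (hL' α), map_add, map_smul, (T.der_L γ).leib_par
        ((T.der_L β).par (hL' α)), (T.der_L γ).leib_par (hL' α)]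
      simp only [map_add, map_smul, map_mul, P2, P3, zero_mul, smul_zero, zero_add, add_zero]
      rw [smul_smul, ← psign_add]
      congr 2
      ring
  rw [hQ] at key
  have h5 : d.br E (G γ) (G β) = psign (δ γ) • ∑ α, psign (δ α) • psign (δ α * (δ β + δ γ)) •
        (T.P (T.L α w) * T.P (T.L γ (T.L β (T.Ls α w)))) := by
    rw [← neg_add_eq_zero.mp key.symm, smul_smul, psign_mul_self, one_smul]
  rw [h5, Finset.smul_sum]
  refine Finset.sum_congr rfl fun α _ => ?_
  rw [P1, struc, mul_smul_comm, smul_mul_assoc]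
  simp only [smul_smul]
  congr 1
  rw [psign_add]
  linear_combination psign (δ γ) * psign (δ α * (δ β + δ γ)) * Complex.I * psign_mul_self (δ α)

end action

end FirstLevel

end SuperBV
end

/-! ### Realisation of the first-level fields by power series over smooth functions. -/

open scoped BigOperators
noncomputable section
set_option linter.unusedSectionVars false

namespace SuperBV
open scoped Grassmann.Alg
open SuperRing Grassmann TopologicalSpace

/-! ### Power series over a supercommutative algebra -/

namespace PS

variable {σ : Type} [DecidableEq σ] {A : Type} [Ring A] [Algebra ℂ A] [SuperRing A]

theorem sum_antidiagonal_swap (n : σ →₀ ℕ) (φ : (σ →₀ ℕ) → (σ →₀ ℕ) → A) :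
    ∑ p ∈ Finset.HasAntidiagonal.antidiagonal n, φ p.2 p.1 =
      ∑ p ∈ Finset.HasAntidiagonal.antidiagonal n, φ p.1 p.2 :=
  Finset.sum_bij' (fun p _ => p.swap) (fun p _ => p.swap)
    (fun p hp => by simpa [add_comm] using hp) (fun p hp => by simpa [add_comm] using hp)
    (fun _ _ => rfl) (fun _ _ => rfl) (fun _ _ => rfl)

theorem coeff_mul_swap {a g b : MvPowerSeries σ A}
    (h : ∀ m n, MvPowerSeries.coeff m a * MvPowerSeries.coeff n g =
      MvPowerSeries.coeff n g * MvPowerSeries.coeff m b) : a * g = g * b := by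
  ext n
  rw [MvPowerSeries.coeff_mul, MvPowerSeries.coeff_mul, ← sum_antidiagonal_swap n
    (fun k l => MvPowerSeries.coeff k g * MvPowerSeries.coeff l b)]
  exact Finset.sum_congr rfl fun p _ => h _ _

/-- The formal variables are even and central, so parity and commutation signs concern the
coefficients only. -/
instance : SuperRing (MvPowerSeries σ A) where
  sig := MvPowerSeries.mapAlgHom sig
  sig_sig a := by
    ext n
    rw [MvPowerSeries.mapAlgHom_apply, MvPowerSeries.mapAlgHom_apply, MvPowerSeries.coeff_map,
      MvPowerSeries.coeff_map]
    exact sig_sig _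
  even_comm a g h := coeff_mul_swap fun m n => even_comm _ _ (by
    have := congrArg (MvPowerSeries.coeff n) h
    rwa [MvPowerSeries.mapAlgHom_apply, MvPowerSeries.coeff_map] at this)
  odd_comm a g h := coeff_mul_swap fun m n => by
    rw [MvPowerSeries.mapAlgHom_apply, MvPowerSeries.coeff_map]
    refine odd_comm _ _ ?_
    have := congrArg (MvPowerSeries.coeff n) h
    rwa [MvPowerSeries.mapAlgHom_apply, MvPowerSeries.coeff_map, map_neg] at this

theorem coeff_sig (n : σ →₀ ℕ) (f : MvPowerSeries σ A) :
    MvPowerSeries.coeff n (sig f) = sig (MvPowerSeries.coeff n f) := MvPowerSeries.coeff_map _ _ _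

theorem coeff_sgp (p : ZMod 2) (n : σ →₀ ℕ) (f : MvPowerSeries σ A) :
    MvPowerSeries.coeff n (sgp p f) = sgp p (MvPowerSeries.coeff n f) := by
  rcases zmod2_cases p with rfl | rfl
  · rfl
  · exact coeff_sig n f

theorem coeff_csmul (c : ℂ) (n : σ →₀ ℕ) (f : MvPowerSeries σ A) :
    MvPowerSeries.coeff n (c • f) = c • MvPowerSeries.coeff n f := rfl

theorem isPar_of_coeff {p : ZMod 2} {f : MvPowerSeries σ A}
    (h : ∀ n, IsPar p (MvPowerSeries.coeff n f)) : IsPar p f := by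
  ext n
  rw [coeff_sig, coeff_csmul]; exact h n

theorem isPar_C {p : ZMod 2} {a : A} (h : IsPar p a) : IsPar p (MvPowerSeries.C (σ := σ) a) :=
  isPar_of_coeff fun n => by
    rw [MvPowerSeries.coeff_C]
    split_ifs
    · exact h
    · exact isPar_zero p

/-- A linear map applied to all coefficients. -/
def cw (φ : A →ₗ[ℂ] A) : MvPowerSeries σ A →ₗ[ℂ] MvPowerSeries σ A where
  toFun f := fun n => φ (MvPowerSeries.coeff n f)
  map_add' f g := by
    ext n
    exact map_add φ _ _
  map_smul' c f := by
    ext n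
    exact map_smul φ c _

theorem coeff_cw (φ : A →ₗ[ℂ] A) (n : σ →₀ ℕ) (f : MvPowerSeries σ A) :
    MvPowerSeries.coeff n (cw φ f) = φ (MvPowerSeries.coeff n f) := rfl

theorem cw_C (φ : A →ₗ[ℂ] A) (a : A) :
    cw φ (MvPowerSeries.C (σ := σ) a) = MvPowerSeries.C (φ a) := by
  ext n
  rw [coeff_cw, MvPowerSeries.coeff_C, MvPowerSeries.coeff_C]
  split_ifs
  · rfl
  · exact map_zero φ

theorem isLDer_cw {q : ZMod 2} {φ : A →ₗ[ℂ] A} (h : IsLDer q φ) :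
    IsLDer q (cw (σ := σ) φ) where
  leib a b := by
    ext n
    rw [map_add, coeff_cw, MvPowerSeries.coeff_mul, MvPowerSeries.coeff_mul,
      MvPowerSeries.coeff_mul, map_sum, ← Finset.sum_add_distrib]
    refine Finset.sum_congr rfl fun p _ => ?_
    rw [h.leib, coeff_cw, coeff_cw, coeff_sgp]
  sig a := by
    ext n
    rw [coeff_sig, coeff_cw, h.sig, coeff_csmul, coeff_cw, coeff_sig]

/-- Derivative with respect to a formal variable. -/
def dX (i : σ) : MvPowerSeries σ A →ₗ[ℂ] MvPowerSeries σ A where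
  toFun f := fun n => ((n i : ℂ) + 1) • MvPowerSeries.coeff (n + Finsupp.single i 1) f
  map_add' f g := by
    ext n
    exact smul_add ((n i : ℂ) + 1) (MvPowerSeries.coeff (n + Finsupp.single i 1) f)
      (MvPowerSeries.coeff (n + Finsupp.single i 1) g)
  map_smul' c f := by
    ext n
    exact smul_comm ((n i : ℂ) + 1) c (MvPowerSeries.coeff (n + Finsupp.single i 1) f)

theorem coeff_dX (i : σ) (n : σ →₀ ℕ) (f : MvPowerSeries σ A) :
    MvPowerSeries.coeff n (dX i f) =
      ((n i : ℂ) + 1) • MvPowerSeries.coeff (n + Finsupp.single i 1) f := rfl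

/-- Pairs whose first member does not contain the variable `i` have weight zero, the others arise by
raising the exponent. Applied to both factors, with `n i + 1 = p.1 i + p.2 i`, this gives the
Leibniz rule of `dX`. -/
theorem sum_antidiagonal_single (i : σ) (n : σ →₀ ℕ) (φ : (σ →₀ ℕ) → (σ →₀ ℕ) → A) :
    ∑ p ∈ (Finset.HasAntidiagonal.antidiagonal (n + Finsupp.single i 1) :
      Finset ((σ →₀ ℕ) × (σ →₀ ℕ))), (p.1 i : ℂ) • φ p.1 p.2 =
      ∑ p ∈ (Finset.HasAntidiagonal.antidiagonal n :
        Finset ((σ →₀ ℕ) × (σ →₀ ℕ))), ((p.1 i : ℂ) + 1) • φ (p.1 + Finsupp.single i 1) p.2 := by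
  symm
  refine Finset.sum_of_injOn (fun p => (p.1 + Finsupp.single i 1, p.2)) ?_ ?_ ?_ ?_
  · intro p _ q _ h
    simp only [Prod.mk.injEq, add_left_inj] at h
    exact Prod.ext h.1 h.2
  · intro p hp
    simp only [Finset.mem_coe,
      Finset.HasAntidiagonal.mem_antidiagonal] at hp ⊢
    rw [← hp]; abel
  · intro p hp hq
    rw [Finset.HasAntidiagonal.mem_antidiagonal] at hp
    by_cases h0 : p.1 i = 0
    · rw [h0, Nat.cast_zero, zero_smul]
    · refine absurd ?_ hq
      have hle : Finsupp.single i 1 ≤ p.1 := by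
        rw [Finsupp.single_le_iff]; omega
      refine ⟨(p.1 - Finsupp.single i 1, p.2), ?_, ?_⟩
      · rw [Finset.mem_coe, Finset.HasAntidiagonal.mem_antidiagonal]
        have : p.1 - Finsupp.single i 1 + Finsupp.single i 1 + p.2 = n + Finsupp.single i 1 := by
          rw [tsub_add_cancel_of_le hle, hp]
        exact add_right_cancel (b := Finsupp.single i 1) (by
          rw [← this]; exact add_right_comm _ _ _)
      · exact Prod.ext (tsub_add_cancel_of_le hle) rfl
  · intro p _
    simp

theorem isLDer_dX (i : σ) : IsLDer 0 (dX (A := A) i) where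
  leib a b := by
    ext n
    rw [map_add, coeff_dX, MvPowerSeries.coeff_mul, MvPowerSeries.coeff_mul,
      MvPowerSeries.coeff_mul, sgp_zero, Finset.smul_sum]
    have h1 := sum_antidiagonal_single i n
      (fun k l => MvPowerSeries.coeff k a * MvPowerSeries.coeff l b)
    have h2 := sum_antidiagonal_single i n
      (fun k l => MvPowerSeries.coeff l a * MvPowerSeries.coeff k b)
    rw [sum_antidiagonal_swap (n + Finsupp.single i 1) (fun k l => (l i : ℂ) •
      (MvPowerSeries.coeff k a * MvPowerSeries.coeff l b)), sum_antidiagonal_swap n (fun k l =>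
      ((l i : ℂ) + 1) • (MvPowerSeries.coeff k a * MvPowerSeries.coeff (l + Finsupp.single i 1) b))]
      at h2
    simp only [coeff_dX, smul_mul_assoc, mul_smul_comm]
    rw [← h1]
    refine Eq.trans ?_ (congrArg _ h2)
    rw [← Finset.sum_add_distrib]
    refine Finset.sum_congr rfl fun p hp => ?_
    rw [← add_smul]
    congr 1
    have := congrArg (fun m => m i) (Finset.HasAntidiagonal.mem_antidiagonal.mp hp)
    simp only [Finsupp.add_apply, Finsupp.single_eq_same] at this
    change (n i : ℂ) + 1 = (p.1 i : ℂ) + (p.2 i : ℂ)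
    exact_mod_cast this.symm
  sig a := by
    ext n
    rw [coeff_sig, coeff_dX, coeff_csmul, coeff_dX, coeff_sig, map_smul, psign_zero, one_smul]

theorem dX_C (i : σ) (a : A) : dX i (MvPowerSeries.C (σ := σ) a) = 0 := by
  ext n
  rw [coeff_dX, MvPowerSeries.coeff_add_single_C, smul_zero, map_zero]

theorem dX_cw (i : σ) (φ : A →ₗ[ℂ] A) (f : MvPowerSeries σ A) :
    dX i (cw φ f) = cw φ (dX i f) := by
  ext n
  rw [coeff_dX, coeff_cw, coeff_cw, coeff_dX, map_smul]

theorem dX_dX (i j : σ) (f : MvPowerSeries σ A) : dX i (dX j f) = dX j (dX i f) := by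
  ext n
  by_cases h : i = j
  · rw [h]
  simp only [coeff_dX, smul_smul, Finsupp.add_apply, Finsupp.single_eq_of_ne h,
    Finsupp.single_eq_of_ne (Ne.symm h), add_zero]
  rw [mul_comm, add_right_comm]

/-- The constant coefficient as a homomorphism of algebras. -/
def cc : MvPowerSeries σ A →ₐ[ℂ] A :=
  { (MvPowerSeries.constantCoeff : MvPowerSeries σ A →+* A) with
    commutes' := fun c => by
      change MvPowerSeries.constantCoeff (algebraMap ℂ (MvPowerSeries σ A) c) = _
      rw [MvPowerSeries.algebraMap_apply, MvPowerSeries.constantCoeff_C] }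

theorem cc_apply (f : MvPowerSeries σ A) : cc f = MvPowerSeries.coeff 0 f := rfl

end PS

/-! ### Putting the first-level generators to zero -/

namespace Grassmann

variable {κ : Type} [Fintype κ] [LinearOrder κ] {ι : Type} [Fintype ι] [LinearOrder ι]

/-- The generators of the smaller algebra. -/
def inlE : κ ↪ κ ⊕ₗ ι := ⟨fun a => Sum.inlₗ a, fun _ _ h => Sum.inl_injective (toLex.injective h)⟩

theorem mem_map_inlE {a : κ} {S : Finset κ} :
    (Sum.inlₗ a : κ ⊕ₗ ι) ∈ S.map (inlE (ι := ι)) ↔ a ∈ S := by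
  constructor
  · intro h
    obtain ⟨b, hb, e⟩ := Finset.mem_map.mp h
    rwa [← (inlE (ι := ι)).injective e]
  · exact fun h => Finset.mem_map_of_mem _ h

theorem inr_notMem_map (i : ι) (S : Finset κ) : (Sum.inrₗ i : κ ⊕ₗ ι) ∉ S.map inlE := by
  intro h
  obtain ⟨b, -, e⟩ := Finset.mem_map.mp h
  exact Sum.inl_ne_inr (toLex.injective e)

/-- The left summand is embedded with its order, so inversions are the same in both algebras. This
is what makes restriction multiplicative. -/
theorem sgn_map (S T : Finset κ) : sgn (S.map (inlE (ι := ι))) (T.map inlE) = sgn S T := by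
  unfold sgn inv
  rw [Finset.sum_map]
  refine congrArg _ (Finset.sum_congr rfl fun s _ => ?_)
  rw [Finset.sum_map]
  refine Finset.sum_congr rfl fun t _ => ?_
  have : (inlE t : κ ⊕ₗ ι) < inlE s ↔ t < s := Sum.Lex.inl_lt_inl_iff
  simp only [this]

/-- The first-level generators put to zero. -/
def restr : Grassmann (κ ⊕ₗ ι) →ₐ[ℂ] Grassmann κ :=
  AlgHom.ofLinearMap
    { toFun := fun f S => f (S.map inlE)
      map_add' := fun _ _ => rfl
      map_smul' := fun _ _ => rfl }
    (by
      ext S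
      change (1 : Grassmann (κ ⊕ₗ ι)) (S.map inlE) = _
      simp only [one_apply, Finset.map_eq_empty])
    (by
      intro f g
      ext S
      change (f * g) (S.map inlE) = _
      rw [mul_apply, mul_apply]
      symm
      refine Finset.sum_bij (fun T _ => T.map inlE) ?_ ?_ ?_ ?_
      · intro T hT
        rw [Finset.mem_powerset] at hT ⊢
        exact Finset.map_subset_map.mpr hT
      · exact fun T _ T' _ h => Finset.map_injective _ h
      · intro T hT
        obtain ⟨T', h1, h2⟩ := Finset.subset_map_iff.mp (Finset.mem_powerset.mp hT)
        exact ⟨T', Finset.mem_powerset.mpr h1, h2.symm⟩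
      · intro T hT
        rw [← Finset.map_sdiff, sgn_map]
        rfl)

theorem restr_apply (f : Grassmann (κ ⊕ₗ ι)) (S : Finset κ) : restr f S = f (S.map inlE) := rfl

theorem restr_gsig (f : Grassmann (κ ⊕ₗ ι)) : restr (gsig f) = gsig (restr f) := by
  ext S
  rw [restr_apply, gsig_apply, gsig_apply, restr_apply, Finset.card_map]

theorem body_restr (f : Grassmann (κ ⊕ₗ ι)) : body (restr f) = body f := by
  unfold body
  rw [restr_apply, Finset.map_empty]

theorem restr_leftDer (i : κ) (f : Grassmann (κ ⊕ₗ ι)) :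
    restr (leftDer (Sum.inlₗ i) f) = leftDer i (restr f) := by
  ext S
  rw [restr_apply]
  by_cases h : i ∈ S
  · rw [leftDer_apply_of_mem h, leftDer_apply_of_mem (mem_map_inlE.mpr h)]
  · rw [leftDer_apply_of_notMem h, leftDer_apply_of_notMem (fun h' => h (mem_map_inlE.mp h')),
      restr_apply, Finset.map_insert, ← sgn_map (ι := ι) {i} S, Finset.map_singleton]
    rfl

/-- The inclusion as a linear map. -/
def inclₗ : Grassmann κ →ₗ[ℂ] Grassmann (κ ⊕ₗ ι) where
  toFun f := incl f
  map_add' f g := by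
    ext S
    rw [add_apply]
    unfold incl
    split_ifs <;> simp
  map_smul' c f := by
    ext S
    rw [RingHom.id_apply, smul_apply]
    unfold incl
    split_ifs <;> simp

theorem incl_apply_map (f : Grassmann κ) (S : Finset κ) :
    (incl f : Grassmann (κ ⊕ₗ ι)) (S.map inlE) = f S := by
  unfold incl
  rw [if_pos fun i => inr_notMem_map i S]
  refine congrArg f ?_
  ext a
  rw [Finset.mem_filter, and_iff_right (Finset.mem_univ _), mem_map_inlE]

theorem restr_incl (f : Grassmann κ) : restr (incl f : Grassmann (κ ⊕ₗ ι)) = f := by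
  ext S
  rw [restr_apply, incl_apply_map]

theorem leftDer_inr_incl (i : ι) (f : Grassmann κ) :
    leftDer (Sum.inrₗ i) (incl f : Grassmann (κ ⊕ₗ ι)) = 0 := by
  ext S
  by_cases h : (Sum.inrₗ i : κ ⊕ₗ ι) ∈ S
  · rw [leftDer_apply_of_mem h]; rfl
  · rw [leftDer_apply_of_notMem h, incl, if_neg fun h' => h' i (Finset.mem_insert_self _ _),
      mul_zero]
    rfl

theorem incl_parity {f : Grassmann κ} {p : ZMod 2} (hf : HasParity f p) :
    HasParity (incl f : Grassmann (κ ⊕ₗ ι)) p := by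
  intro S hS
  unfold incl at hS
  split_ifs at hS with h
  · have e : S = (Finset.univ.filter fun a : κ => (Sum.inlₗ a : κ ⊕ₗ ι) ∈ S).map inlE := by
      refine Finset.ext fun a => ?_
      rw [Finset.mem_map]
      constructor
      · intro ha
        rcases hc : (ofLex a) with b | i
        · have e : a = Sum.inlₗ b := by rw [← toLex_ofLex a, hc]
          exact ⟨b, Finset.mem_filter.mpr ⟨Finset.mem_univ _, e ▸ ha⟩, e.symm⟩
        · have e : a = Sum.inrₗ i := by rw [← toLex_ofLex a, hc]
          exact absurd (e ▸ ha) (h i)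
      · rintro ⟨b, hb, rfl⟩
        exact (Finset.mem_filter.mp hb).2
    have h2 := congrArg Finset.card e
    rw [Finset.card_map] at h2
    rw [h2, hf _ hS]
  · exact absurd rfl hS

theorem restr_gen_inr (i : ι) : restr (gen (Sum.inrₗ i) : Grassmann (κ ⊕ₗ ι)) = 0 := by
  ext S
  rw [restr_apply]
  unfold gen
  rw [if_neg]
  · rfl
  · intro h
    exact inr_notMem_map i S (h ▸ Finset.mem_singleton_self _)

end Grassmann

namespace Sm

variable {M : ℕ} {ε : Fin M → ZMod 2} {U : Opens (Pt ε)}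
variable {κ : Type} [Fintype κ] [LinearOrder κ] {κ' : Type} [Fintype κ'] [LinearOrder κ']

theorem smooth_linear (L : Grassmann κ →ₗ[ℂ] Grassmann κ') {g : Pt ε → Grassmann κ}
    {U : Set (Pt ε)} (hg : SmoothOn g U) : SmoothOn (fun x => L (g x)) U := SmoothOn.linear L hg

/-- A linear map between Grassmann algebras applied pointwise. -/
def lift (L : Grassmann κ →ₗ[ℂ] Grassmann κ') : Sm U κ →ₗ[ℂ] Sm U κ' where
  toFun f := of (fun x => L (extz f x)) (smooth_linear L (smooth_extz f))
  map_add' f g := ext_ev fun x => by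
    rw [map_add, ev_of, ev_of, ev_of, extz_coe, extz_coe, extz_coe, map_add, map_add]
  map_smul' c f := ext_ev fun x => by
    rw [RingHom.id_apply, map_smul, ev_of, ev_of, extz_coe, extz_coe, map_smul, map_smul]

theorem ev_lift (L : Grassmann κ →ₗ[ℂ] Grassmann κ') (f : Sm U κ) (x : U) :
    ev x (lift L f) = L (ev x f) := by
  rw [← extz_coe f]; rfl

/-- A homomorphism of Grassmann algebras applied pointwise. -/
def liftₐ (L : Grassmann κ →ₐ[ℂ] Grassmann κ') : Sm U κ →ₐ[ℂ] Sm U κ' :=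
  AlgHom.ofLinearMap (lift L.toLinearMap)
    (ext_ev fun x => by
      rw [ev_lift, map_one (ev x), map_one (ev x)]; exact map_one L)
    (fun f g => ext_ev fun x => by
      rw [map_mul (ev x), ev_lift, ev_lift, ev_lift, map_mul]; exact map_mul L _ _)

theorem ev_liftₐ (L : Grassmann κ →ₐ[ℂ] Grassmann κ') (f : Sm U κ) (x : U) :
    ev x (liftₐ L f) = L (ev x f) := ev_lift L.toLinearMap f x

/-- Left derivative with respect to a generator. -/
def dgen (i : κ) : Sm U κ →ₗ[ℂ] Sm U κ := lift (leftDerₗ i)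

theorem ev_dgen (i : κ) (f : Sm U κ) (x : U) : ev x (dgen i f) = leftDer i (ev x f) :=
  ev_lift _ f x

theorem isLDer_dgen (i : κ) : IsLDer 1 (dgen (U := U) i) where
  leib a b := ext_ev fun x => by
    rw [map_add, map_mul (ev x), map_mul (ev x), ev_dgen, ev_dgen, ev_dgen, map_mul (ev x),
      leftDer_mul, ev_sgp]
    rfl
  sig a := ext_ev fun x => by
    rw [map_smul, ev_sig, ev_dgen, ev_dgen, ev_sig, gsig_leftDer, psign_one, neg_one_smul]

theorem dgen_dgen (i j : κ) (f : Sm U κ) : dgen i (dgen j f) = (-1 : ℂ) • dgen j (dgen i f) :=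
  ext_ev fun x => by
    rw [map_smul, ev_dgen, ev_dgen, ev_dgen, ev_dgen, leftDer_leftDer, neg_one_smul]

theorem isLDer_dS (j : OddIx ε → κ) (A : Fin M) : IsLDer (ε A) ((dS (U := U) j).d A) where
  leib := (dS j).leib A
  sig := (dS j).sig_d A

theorem dL_lift (L : Grassmann κ →ₗ[ℂ] Grassmann κ') {g : Pt ε → Grassmann κ}
    (hg : SmoothOn g U) {x : Pt ε} (hx : x ∈ U) {A : Fin M} (h : ε A = 0) {j : OddIx ε → κ}
    {j' : OddIx ε → κ'} : dL j' A (fun y => L (g y)) x = L (dL j A g x) := by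
  rw [dL_even h, dL_even h]
  have := ((toCLM L).hasFDerivAt.comp x (hg.differentiableAt U.2 hx).hasFDerivAt).fderiv
  have e : fderiv ℝ (fun y => L (g y)) x = (toCLM L).comp (fderiv ℝ g x) := this
  rw [e]; rfl

theorem lift_dS {j : OddIx ε → κ} {j' : OddIx ε → κ'} (L : Grassmann κ →ₗ[ℂ] Grassmann κ')
    {A : Fin M} (h : ∀ (hA : ε A ≠ 0) f, L (leftDer (j ⟨A, hA⟩) f) = leftDer (j' ⟨A, hA⟩) (L f))
    (f : Sm U κ) : lift L ((dS j).d A f) = (dS j').d A (lift L f) := ext_ev fun x => by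
  rw [ev_lift, ev_dS]
  have e : lift L f = of _ (smooth_linear L (smooth_extz f)) := rfl
  rw [e, ev_dS_of]
  by_cases hA : ε A = 0
  · exact (dL_lift L (smooth_extz f) x.2 hA).symm
  · rw [dL_odd hA, dL_odd hA, h hA]

/-- The odd derivative is a constant linear map, which commutes with even derivatives, and it
anticommutes with the odd ones. -/
theorem dgen_dS {j : OddIx ε → κ} (i : κ) (A : Fin M) (f : Sm U κ) :
    dgen i ((dS j).d A f) = psign (ε A) • (dS j).d A (dgen i f) := by
  by_cases hA : ε A = 0
  · rw [hA, psign_zero, one_smul]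
    exact lift_dS (leftDerₗ i) (fun h => absurd hA h) f
  · refine ext_ev fun x => ?_
    rw [(zmod2_cases _).resolve_left hA, map_smul, psign_one, neg_one_smul, ev_dgen, ev_dS, ev_dS,
      dL_odd hA, dL_odd hA, leftDer_leftDer, extz_coe, extz_coe, ev_dgen]

end Sm

/-! ### First-level functions over an open set -/

section firstLevel

variable {M K : ℕ} {ε : Fin M → ZMod 2} (U : Opens (Pt ε)) (δ : Fin K → ZMod 2)

/-- Derivative with respect to the even (if `p = 0`) or odd first-level variable. -/
def dFirst (p : ZMod 2) (α : Fin K) :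
    MvPowerSeries (Fin K) (Sm U (OddIx1 ε K)) →ₗ[ℂ] MvPowerSeries (Fin K) (Sm U (OddIx1 ε K)) :=
  if p = 0 then PS.dX α else PS.cw (Sm.dgen (Sum.inrₗ α))

theorem isLDer_dFirst (p : ZMod 2) (α : Fin K) : IsLDer p (dFirst U p α) := by
  rcases zmod2_cases p with rfl | rfl
  · exact PS.isLDer_dX α
  · exact PS.isLDer_cw (Sm.isLDer_dgen (Sum.inrₗ α : OddIx1 ε K))

theorem dFirst_dS (p : ZMod 2) (α : Fin K) (A : Fin M)
    (f : MvPowerSeries (Fin K) (Sm U (OddIx1 ε K))) :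
    dFirst U p α (PS.cw ((Sm.dS fun i => (Sum.inlₗ i : OddIx1 ε K)).d A) f) =
      psign (p * ε A) • PS.cw ((Sm.dS fun i => (Sum.inlₗ i : OddIx1 ε K)).d A)
        (dFirst U p α f) := by
  rcases zmod2_cases p with rfl | rfl
  · rw [zero_mul, psign_zero, one_smul]
    exact PS.dX_cw _ _ _
  · refine MvPowerSeries.ext fun n => ?_
    rw [one_mul, PS.coeff_csmul]
    exact Sm.dgen_dS (Sum.inrₗ α : OddIx1 ε K) _ _

theorem dFirst_dFirst (p q : ZMod 2) (α β : Fin K)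
    (f : MvPowerSeries (Fin K) (Sm U (OddIx1 ε K))) :
    dFirst U p α (dFirst U q β f) = psign (p * q) • dFirst U q β (dFirst U p α f) := by
  rcases zmod2_cases p with rfl | rfl <;> rcases zmod2_cases q with rfl | rfl
  · rw [mul_zero, psign_zero, one_smul]; exact PS.dX_dX _ _ _
  · rw [zero_mul, psign_zero, one_smul]; exact PS.dX_cw _ _ _
  · rw [mul_zero, psign_zero, one_smul]; exact (PS.dX_cw _ _ _).symm
  · refine MvPowerSeries.ext fun n => ?_
    rw [mul_one, psign_one, PS.coeff_csmul]
    exact Sm.dgen_dgen (Sum.inrₗ α : OddIx1 ε K) (Sum.inrₗ β) _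

/-- Formal power series in the even first-level fields over an open set. -/
def firstLevel : FirstLevel (MvPowerSeries (Fin K) (Sm U (OddIx1 ε K))) (Sm U (OddIx ε)) ε δ
    (Sm.dS id) where
  P := (Sm.liftₐ restr).comp PS.cc
  P_sig a := Sm.ext_ev fun x => by
    rw [AlgHom.comp_apply, AlgHom.comp_apply, Sm.ev_liftₐ, Sm.ev_sig, Sm.ev_liftₐ, PS.cc_apply,
      PS.cc_apply, PS.coeff_sig, Sm.ev_sig, restr_gsig]
  D A := PS.cw ((Sm.dS fun i => (Sum.inlₗ i : OddIx1 ε K)).d A)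
  L α := dFirst U (δ α) α
  Ls α := dFirst U (δ α + 1) α
  der_D A := PS.isLDer_cw (Sm.isLDer_dS _ _)
  der_L α := isLDer_dFirst _ _ _
  der_Ls α := isLDer_dFirst _ _ _
  P_D A a := Sm.lift_dS (j := fun i => (Sum.inlₗ i : OddIx1 ε K)) (j' := id)
    restr.toLinearMap (fun hA f => restr_leftDer (⟨A, hA⟩ : OddIx ε) f) _
  L_D α A a := dFirst_dS _ _ _ _ _
  L_L α β a := dFirst_dFirst _ _ _ _ _ _

end firstLevel

end SuperBV
end

/-! ### The exponential of an even series and its derivatives. -/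

open scoped BigOperators
noncomputable section
set_option linter.unusedSectionVars false

namespace SuperBV
open scoped Grassmann.Alg
open SuperRing Grassmann TopologicalSpace

variable {M : ℕ} {ε : Fin M → ZMod 2} {U : Opens (Pt ε)} {κ : Type} [Fintype κ] [LinearOrder κ]

namespace Sm

theorem ev_add (x : U) (f g : Sm U κ) : ev x (f + g) = ev x f + ev x g := rfl
theorem ev_sub (x : U) (f g : Sm U κ) : ev x (f - g) = ev x f - ev x g := rfl
theorem ev_mul (x : U) (f g : Sm U κ) : ev x (f * g) = ev x f * ev x g := rfl
theorem ev_smul (x : U) (c : ℂ) (f : Sm U κ) : ev x (c • f) = c • ev x f := rfl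
theorem ev_zero (x : U) : ev x (0 : Sm U κ) = 0 := rfl
theorem ev_one (x : U) : ev x (1 : Sm U κ) = 1 := rfl
theorem ev_neg (x : U) (f : Sm U κ) : ev x (-f) = -ev x f := rfl
theorem ev_sum {ι : Type*} (x : U) (s : Finset ι) (f : ι → Sm U κ) :
    ev x (∑ i ∈ s, f i) = ∑ i ∈ s, ev x (f i) := map_sum (ev x) f s

theorem ev_scal (φ : Pt ε → ℂ) (hφ : ContDiffOn ℝ ((⊤ : ℕ∞) : WithTop ℕ∞) φ U) (x : U) :
    ev x (scal (κ := κ) φ hφ) = φ x • 1 := rfl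

theorem ev_pow (x : U) (f : Sm U κ) (k : ℕ) : ev x (f ^ k) = ev x f ^ k := rfl

end Sm

theorem SuperRing.IsPar.pow {R : Type} [Ring R] [Algebra ℂ R] [SuperRing R] {a : R} (ha : IsPar 0 a)
    (k : ℕ) : IsPar 0 (a ^ k) := by
  rw [isPar_zero_iff] at *
  rw [map_pow, ha]

namespace PS

variable {K : ℕ}

open Sm

theorem coeff_isPar {σ : Type} [DecidableEq σ] {A : Type} [Ring A] [Algebra ℂ A] [SuperRing A]
    {p : ZMod 2} {f : MvPowerSeries σ A} (hf : IsPar p f) (n : σ →₀ ℕ) :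
    IsPar p (MvPowerSeries.coeff n f) := by
  unfold IsPar at *
  rw [← coeff_sig, hf, coeff_csmul]

/-- Filtration by the total number of first-level fields and odd generators. -/
def Ord (k : ℕ) (f : MvPowerSeries (Fin K) (Sm U κ)) : Prop :=
  -- The subtraction is truncated: there is no condition once the degree of `n` reaches `k`.
  ∀ n x, DegGE (k - n.degree) (ev x (MvPowerSeries.coeff n f))

variable {f g : MvPowerSeries (Fin K) (Sm U κ)} {k l : ℕ}

theorem Ord.add (hf : Ord k f) (hg : Ord k g) : Ord k (f + g) := fun n x => by
  rw [map_add, ev_add]; exact (hf n x).add (hg n x)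

theorem Ord.smul (c : ℂ) (hf : Ord k f) : Ord k (c • f) := fun n x => by
  rw [coeff_csmul, ev_smul]; exact (hf n x).smul c

theorem Ord.neg (hf : Ord k f) : Ord k (-f) := fun n x => by
  rw [map_neg, ev_neg]; exact (hf n x).neg

theorem Ord.sub (hf : Ord k f) (hg : Ord k g) : Ord k (f - g) := by
  rw [sub_eq_add_neg]; exact hf.add hg.neg

theorem ord_zero (f : MvPowerSeries (Fin K) (Sm U κ)) : Ord 0 f := fun n x => by
  rw [Nat.zero_sub]; exact degGE_zero _

theorem Ord.mul (hf : Ord k f) (hg : Ord l g) : Ord (k + l) (f * g) := fun n x => by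
  rw [MvPowerSeries.coeff_mul, ev_sum]
  refine DegGE.sum fun p hp => ?_
  rw [ev_mul]
  refine ((hf p.1 x).mul (hg p.2 x)).mono ?_
  rw [← Finset.HasAntidiagonal.mem_antidiagonal.mp hp, map_add]
  omega

theorem Ord.pow (hf : Ord 1 f) (k : ℕ) : Ord k (f ^ k) := by
  induction k with
  | zero => exact ord_zero _
  | succ k ih => rw [pow_succ]; exact ih.mul hf

theorem Ord.mono (hf : Ord k f) (h : l ≤ k) : Ord l f := fun n x =>
  (hf n x).mono (Nat.sub_le_sub_right h _)

theorem Ord.sum {ι : Type} {s : Finset ι} {f : ι → MvPowerSeries (Fin K) (Sm U κ)}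
    (h : ∀ i ∈ s, Ord k (f i)) : Ord k (∑ i ∈ s, f i) := fun n x => by
  rw [map_sum, ev_sum]; exact DegGE.sum fun i hi => h i hi n x

/-- The filtration is separated: the Grassmann degree is at most the number of generators, so an
order beyond this number plus the degree of `n` kills the coefficient of `n`. -/
theorem eq_of_ord (h : ∀ N, Ord N (f - g)) : f = g := by
  rw [← sub_eq_zero]
  refine MvPowerSeries.ext fun n => ext_ev fun x => ?_
  refine eq_zero_of_degGE ((h (n.degree + (Fintype.card κ + 1)) n x).mono ?_)
  omega

theorem Ord.dX (hf : Ord (k + 1) f) (i : Fin K) : Ord k (dX i f) := fun n x => by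
  rw [coeff_dX, ev_smul]
  refine ((hf _ x).smul _).mono ?_
  rw [map_add, Finsupp.degree_single]; omega

theorem Ord.cw (hf : Ord (k + 1) f) {φ : Sm U κ →ₗ[ℂ] Sm U κ}
    (hφ : ∀ m a, (∀ x, DegGE (m + 1) (ev x a)) → ∀ x, DegGE m (ev x (φ a))) : Ord k (cw φ f) :=
  fun n x => by
  rw [coeff_cw]
  rcases Nat.lt_or_ge k n.degree with h | h
  · rw [Nat.sub_eq_zero_of_le h.le]; exact degGE_zero _
  · refine hφ _ _ (fun y => ?_) x
    have := hf n y
    rwa [Nat.sub_add_comm h] at this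

theorem degGE_leftDer {m : ℕ} {a : Grassmann κ} (h : DegGE (m + 1) a) (i : κ) :
    DegGE m (leftDer i a) := fun S hS => by
  by_cases hi : i ∈ S
  · exact leftDer_apply_of_mem hi a
  · rw [leftDer_apply_of_notMem hi, h _ (by rw [Finset.card_insert_of_notMem hi]; omega), mul_zero]

theorem degGE_dgen (i : κ) (m : ℕ) (a : Sm U κ) (h : ∀ x, DegGE (m + 1) (ev x a)) (x : U) :
    DegGE m (ev x (dgen i a)) := by
  rw [ev_dgen]; exact degGE_leftDer (h x) i

/-- Truncation to low degrees is a constant linear map and commutes with even derivatives. -/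
theorem degGE_dS_even (j : OddIx ε → κ) {A : Fin M} (hA : ε A = 0) (m : ℕ) (a : Sm U κ)
    (h : ∀ x, DegGE m (ev x a)) (x : U) : DegGE m (ev x ((dS j).d A a)) := by
  let L : Grassmann κ →ₗ[ℂ] Grassmann κ :=
    { toFun := fun f S => if S.card < m then f S else 0
      map_add' := fun f g => by
        ext S
        change (if _ then f S + g S else 0) = (if _ then f S else 0) + (if _ then g S else 0)
        split_ifs <;> simp
      map_smul' := fun c f => by
        ext S
        change (if _ then c * f S else 0) = c * (if _ then f S else 0)
        split_ifs <;> simp }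
  have h0 : lift L a = 0 := ext_ev fun y => by
    rw [ev_lift]
    ext S
    change (if S.card < m then ev y a S else 0) = 0
    split_ifs with hS
    · exact h y S hS
    · rfl
  have h1 := lift_dS (j := j) (j' := j) L (A := A) (fun hA' => absurd hA hA') a
  rw [h0, map_zero] at h1
  intro S hS
  have h2 := congrFun (congrArg (ev x) h1) S
  rw [ev_lift] at h2
  change (if S.card < m then ev x ((dS j).d A a) S else 0) = 0 at h2
  rwa [if_pos hS] at h2

theorem degGE_dS (j : OddIx ε → κ) (A : Fin M) (m : ℕ) (a : Sm U κ)
    (h : ∀ x, DegGE (m + 1) (ev x a)) (x : U) : DegGE m (ev x ((dS j).d A a)) := by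
  by_cases hA : ε A = 0
  · exact degGE_dS_even j hA m a (fun y => (h y).mono (Nat.le_succ m)) x
  · rw [ev_dS, dL_odd hA, extz_coe]; exact degGE_leftDer (h x) _

/-- The failure of `X E = E * X w` is expressed through the difference of two consecutive partial
sums `p`, `p1` and through the remainder `E - c * p1`; each of these is of high order. -/
theorem exp_remainder {S : Type} [Ring S] [Algebra ℂ S] [SuperRing S] {q : ZMod 2} {X : S →ₗ[ℂ] S}
    (hX : IsLDer q X) {E c p p1 b s w : S} (hc : IsPar 0 c) (hp : IsPar 0 p1) (h1 : X c = c * X b)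
    (h2 : X p1 = p * X s) (hw : w = b + s) : X E - E * X w =
      c * ((p - p1) * X s) + X (E - c * p1) - (E - c * p1) * X w := by
  have h3 : X (c * p1) = c * (p1 * X b) + c * (p * X s) := by
    rw [hX.leib_par hc, h1, h2, mul_zero, psign_zero, one_smul, mul_assoc, hp.comm_zero]
  rw [map_sub, h3, hw, map_add]
  noncomm_ring

/-! ### The exponential -/

variable (W : MvPowerSeries (Fin K) (Sm U κ))

/-- The body of the constant coefficient. -/
def bS : Sm U κ := scal _ (contDiffOn_body (MvPowerSeries.coeff 0 W))

/-- The exponential of the body of the constant coefficient. -/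
def ebS : Sm U κ := scal (fun x => Complex.exp (body (extz (MvPowerSeries.coeff 0 W) x)))
  ((contDiffOn_body (MvPowerSeries.coeff 0 W)).cexp)

/-- The series without the body of its constant coefficient. -/
def sS : MvPowerSeries (Fin K) (Sm U κ) := W - MvPowerSeries.C (bS W)

/-- Partial sums of the exponential series. -/
def pexp (N : ℕ) : MvPowerSeries (Fin K) (Sm U κ) :=
  ∑ k ∈ Finset.range N, ((k.factorial : ℂ)⁻¹) • sS W ^ k

/-- The exponential. -/
def expS : MvPowerSeries (Fin K) (Sm U κ) := fun n =>
  -- As `sS W` has order 1, its k-th power contributes to the coefficient of `n` only for k at most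
  -- the degree of `n` plus the number of generators. The cutoff is the one in `fexp`.
  ebS W * MvPowerSeries.coeff n (pexp W (n.degree + Fintype.card κ + 1))

theorem coeff_expS (n : Fin K →₀ ℕ) : MvPowerSeries.coeff n (expS W) =
    ebS W * MvPowerSeries.coeff n (pexp W (n.degree + Fintype.card κ + 1)) := rfl

theorem ord_sS : Ord 1 (sS W) := fun n x => by
  by_cases hn : n = 0
  · subst hn
    rw [map_zero, Nat.sub_zero, degGE_one_iff, sS, map_sub, ev_sub,
      MvPowerSeries.coeff_zero_C, bS, ev_scal, ← bodyₐ_apply, map_sub, bodyₐ_apply, bodyₐ_apply,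
      body_smul_one, extz_coe, sub_self]
  · have : 1 - n.degree = 0 := by
      have := Finsupp.degree_eq_zero_iff n |>.not.mpr hn
      omega
    rw [this]; exact degGE_zero _

theorem pexp_sub_ord {A B : ℕ} (h : B ≤ A) : Ord B (pexp W A - pexp W B) := by
  unfold pexp
  rw [← Finset.sum_Ico_eq_sub _ h]
  exact Ord.sum fun k hk => (((ord_sS W).pow k).mono (Finset.mem_Ico.mp hk).1).smul _

/-- The cutoff depends on the coefficient, but any two partial sums agree up to the order of the
shorter one, and beyond the cutoff nothing is left. -/
theorem expS_ord (N : ℕ) : Ord N (expS W - MvPowerSeries.C (ebS W) * pexp W N) := fun n x => by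
  rw [map_sub, coeff_expS, MvPowerSeries.coeff_C_mul, ← mul_sub, ← map_sub, ev_mul]
  set m := n.degree + Fintype.card κ + 1 with hm
  rw [← zero_add (N - n.degree)]
  refine (degGE_zero _).mul ?_
  rcases le_total N m with h | h
  · exact pexp_sub_ord W h n x
  · have h1 := pexp_sub_ord W h n x
    rw [← neg_sub, map_neg, ev_neg, eq_zero_of_degGE (h1.mono (by omega)), neg_zero]
    exact fun S _ => rfl

variable (hW : IsPar 0 W)

include hW

theorem isPar_sS : IsPar 0 (sS W) := hW.sub (isPar_C (isPar_scal _ _))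

theorem isPar_pexp (N : ℕ) : IsPar 0 (pexp W N) :=
  IsPar.sum fun k _ => ((isPar_sS W hW).pow k).smul _

theorem isPar_expS : IsPar 0 (expS W) := isPar_of_coeff fun n => by
  rw [coeff_expS]
  exact (isPar_scal _ _).mul' (coeff_isPar (isPar_pexp W hW _) n) (add_zero 0)

omit hW in
theorem der_pow {S : Type} [Ring S] [Algebra ℂ S] [SuperRing S] {q : ZMod 2} {X : S →ₗ[ℂ] S}
    (hX : IsLDer q X) {s : S} (hs : IsPar 0 s) (k : ℕ) :
    X (s ^ (k + 1)) = ((k : ℂ) + 1) • (s ^ k * X s) := by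
  induction k with
  | zero => simp
  | succ k ih =>
    rw [pow_succ', hX.leib_par hs, ih, mul_zero, psign_zero, one_smul, mul_smul_comm, ← mul_assoc,
      ← pow_succ', (hs.pow (k + 1)).comm_zero, Nat.cast_succ, add_comm,
      add_smul ((k : ℂ) + 1) (1 : ℂ), one_smul]

theorem der_pexp {q : ZMod 2}
    {X : MvPowerSeries (Fin K) (Sm U κ) →ₗ[ℂ] MvPowerSeries (Fin K) (Sm U κ)}
    (hX : IsLDer q X) (N : ℕ) : X (pexp W (N + 1)) = pexp W N * X (sS W) := by
  unfold pexp
  rw [Finset.sum_range_succ', map_add, map_sum, Finset.sum_mul]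
  have h1 : X 1 = 0 := by
    have := hX.leib 1 1
    rw [map_one (sgp q), mul_one, mul_one, one_mul] at this
    exact left_eq_add.mp this
  rw [pow_zero, map_smul, h1, smul_zero, add_zero]
  refine Finset.sum_congr rfl fun k _ => ?_
  rw [map_smul, der_pow hX (isPar_sS W hW), smul_smul, smul_mul_assoc]
  congr 1
  rw [Nat.factorial_succ, Nat.cast_mul, Nat.cast_succ]
  have : (k : ℂ) + 1 ≠ 0 := Nat.cast_add_one_ne_zero k
  have := Nat.cast_ne_zero (R := ℂ).mpr k.factorial_ne_zero
  field_simp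

/-- A derivation that lowers the order by at most one leaves an error of order at least `N` for
every `N`, hence none. -/
theorem der_expS {q : ZMod 2}
    {X : MvPowerSeries (Fin K) (Sm U κ) →ₗ[ℂ] MvPowerSeries (Fin K) (Sm U κ)}
    (hX : IsLDer q X) (hord : ∀ N f, Ord (N + 1) f → Ord N (X f))
    (hb : X (MvPowerSeries.C (ebS W)) = MvPowerSeries.C (ebS W) * X (MvPowerSeries.C (bS W))) :
    X (expS W) = expS W * X W := by
  refine eq_of_ord fun N => ?_
  set c := MvPowerSeries.C (σ := Fin K) (ebS W)
  have hc : IsPar 0 c := isPar_C (isPar_scal _ _)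
  have ho : Ord (N + 1) (expS W - c * pexp W (N + 1)) := expS_ord W (N + 1)
  have e2 : W = MvPowerSeries.C (bS W) + sS W := by rw [sS, add_sub_cancel]
  rw [exp_remainder hX hc (isPar_pexp W hW (N + 1)) hb (der_pexp W hW hX N) e2]
  have hp : Ord N (pexp W N - pexp W (N + 1)) := by
    rw [← neg_sub]; exact (pexp_sub_ord W (Nat.le_succ N)).neg
  refine ((Ord.mul (k := 0) (ord_zero c) (hp.mul (ord_zero (X (sS W))))).mono (by omega)).add
    (hord N _ ho) |>.sub ?_
  exact (ho.mul (ord_zero (X W))).mono (by omega)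

omit hW in
theorem body_expS (x : U) : body (ev x (MvPowerSeries.coeff 0 (expS W))) ≠ 0 := by
  have h := expS_ord W 1 0 x
  rw [map_zero, Nat.sub_zero, degGE_one_iff] at h
  have h1 : pexp W 1 = 1 := by simp [pexp]
  rw [h1, mul_one, map_sub, MvPowerSeries.coeff_zero_C, ev_sub, ebS, ev_scal, ← bodyₐ_apply, map_sub,
    bodyₐ_apply, bodyₐ_apply, body_smul_one, sub_eq_zero] at h
  rw [h]
  exact Complex.exp_ne_zero _

omit hW in
theorem leftDer_smul_one (i : κ) (z : ℂ) : leftDer i (z • (1 : Grassmann κ)) = 0 := by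
  change leftDerₗ i (z • 1) = 0
  rw [map_smul]
  have : leftDerₗ i (1 : Grassmann κ) = 0 := by
    have := leftDer_mul i (1 : Grassmann κ) 1
    rw [mul_one, mul_one, map_one, one_mul] at this
    exact left_eq_add.mp this
  rw [this, smul_zero]

omit hW in
theorem dgen_scal (i : κ) (φ : Pt ε → ℂ) (hφ : ContDiffOn ℝ ((⊤ : ℕ∞) : WithTop ℕ∞) φ U) :
    dgen i (scal φ hφ) = 0 := ext_ev fun x => by
  rw [ev_dgen, ev_scal, ev_zero]
  exact leftDer_smul_one i (φ x)

omit hW in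
theorem dS_scal_exp (j : OddIx ε → κ) (A : Fin M) (φ : Pt ε → ℂ)
    (hφ : ContDiffOn ℝ ((⊤ : ℕ∞) : WithTop ℕ∞) φ U) :
    (dS j).d A (scal (κ := κ) (fun x => Complex.exp (φ x)) hφ.cexp) =
      scal (κ := κ) (fun x => Complex.exp (φ x)) hφ.cexp * (dS j).d A (scal φ hφ) :=
  ext_ev fun x => by
  rw [scal, scal, ev_mul, ev_of, ev_dS_of, ev_dS_of]
  by_cases hA : ε A = 0
  · rw [dL_even hA, dL_even hA]
    have hd : DifferentiableAt ℝ φ x := (hφ.contDiffAt (U.2.mem_nhds x.2)).differentiableAt (by simp)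
    have h1 := (hd.hasFDerivAt.smul_const (1 : Grassmann κ)).fderiv
    have h2 := (hd.hasFDerivAt.cexp.smul_const (1 : Grassmann κ)).fderiv
    rw [h1, h2]
    ext S
    simp
    ring
  · rw [dL_odd hA, dL_odd hA]
    rw [leftDer_smul_one, leftDer_smul_one, mul_zero]

omit hW in
theorem dS_exp (j : OddIx ε → κ) (A : Fin M) :
    (dS j).d A (ebS W) = ebS W * (dS j).d A (bS W) := dS_scal_exp j A _ _

end PS

end SuperBV
end

/-! ### Passage from the given action to the abstract setting; consequences of the Planck number. -/

open scoped BigOperators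
noncomputable section
set_option linter.unusedSectionVars false

namespace SuperBV
open scoped Grassmann.Alg
open SuperRing Grassmann TopologicalSpace Sm

variable {M K : ℕ} {ε : Fin M → ZMod 2} {U : Opens (Pt ε)}

/-- `Y` is the restriction of `X` to an open set. -/
def Rep (X : FL ε K) (Y : MvPowerSeries (Fin K) (Sm U (OddIx1 ε K))) : Prop :=
  ∀ n (x : U), X n x = ev x (MvPowerSeries.coeff n Y)

namespace Rep

variable {X X' : FL ε K} {Y Y' : MvPowerSeries (Fin K) (Sm U (OddIx1 ε K))}

theorem add (h : Rep X Y) (h' : Rep X' Y') : Rep (X + X') (Y + Y') := fun n x => by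
  change X n x + X' n x = _
  rw [h, h', map_add, ev_add]

theorem sub (h : Rep X Y) (h' : Rep X' Y') : Rep (X - X') (Y - Y') := fun n x => by
  change X n x - X' n x = _
  rw [h, h', map_sub, ev_sub]

theorem smul (c : ℂ) (h : Rep X Y) : Rep (c • X) (c • Y) := fun n x => by
  change c • X n x = _
  rw [h, PS.coeff_csmul, ev_smul]

theorem zero : Rep (0 : FL ε K) (0 : MvPowerSeries (Fin K) (Sm U (OddIx1 ε K))) := fun _ _ => rfl

theorem sum {ι : Type} [DecidableEq ι] (s : Finset ι) {X : ι → FL ε K}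
    {Y : ι → MvPowerSeries (Fin K) (Sm U (OddIx1 ε K))} (h : ∀ i ∈ s, Rep (X i) (Y i)) :
    Rep (∑ i ∈ s, X i) (∑ i ∈ s, Y i) := by
  induction s using Finset.induction_on with
  | empty => exact zero
  | insert a s ha ih =>
    rw [Finset.sum_insert ha, Finset.sum_insert ha]
    exact (h a (Finset.mem_insert_self _ _)).add
      (ih fun i hi => h i (Finset.mem_insert_of_mem hi))

theorem mul (h : Rep X Y) (h' : Rep X' Y') : Rep (X * X') (Y * Y') := fun n x => by
  change (MvPowerSeries.coeff n (X * X')) x = _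
  rw [MvPowerSeries.coeff_mul, MvPowerSeries.coeff_mul, ev_sum, Finset.sum_apply]
  exact Finset.sum_congr rfl fun p _ => congrArg₂ (· * ·) (h p.1 x) (h' p.2 x)

theorem C {f : Pt ε → Grassmann (OddIx1 ε K)} {a : Sm U (OddIx1 ε K)}
    (h : ∀ x : U, f x = ev x a) : Rep (MvPowerSeries.C f) (MvPowerSeries.C a) := fun n x => by
  change (MvPowerSeries.coeff n (MvPowerSeries.C f)) x = _
  rw [MvPowerSeries.coeff_C, MvPowerSeries.coeff_C]
  split_ifs
  · exact h x
  · rfl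

theorem one : Rep (1 : FL ε K) (1 : MvPowerSeries (Fin K) (Sm U (OddIx1 ε K))) := by
  rw [← map_one MvPowerSeries.C, ← map_one MvPowerSeries.C]
  exact C fun _ => rfl

theorem pow (h : Rep X Y) (k : ℕ) : Rep (X ^ k) (Y ^ k) := by
  induction k with
  | zero => rw [pow_zero, pow_zero]; exact one
  | succ k ih => rw [pow_succ, pow_succ]; exact ih.mul h

theorem var (α : Fin K) : Rep (MvPowerSeries.X α : FL ε K)
    (MvPowerSeries.X α : MvPowerSeries (Fin K) (Sm U (OddIx1 ε K))) := fun n x => by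
  change (MvPowerSeries.coeff n (MvPowerSeries.X α : FL ε K)) x = _
  rw [MvPowerSeries.coeff_X, MvPowerSeries.coeff_X]
  split_ifs <;> rfl

theorem dGamma (h : Rep X Y) (A : Fin M) :
    Rep (dGamma A X) (PS.cw ((dS fun i => (Sum.inlₗ i : OddIx1 ε K)).d A) Y) := fun n x => by
  rw [PS.coeff_cw, ev_dS]
  exact dL_congr U.2 (fun y hy => by rw [extz_apply _ hy]; exact h n ⟨y, hy⟩) x.2 A

theorem dEven (h : Rep X Y) (α : Fin K) : Rep (dEven α X) (PS.dX α Y) := fun n x => by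
  rw [PS.coeff_dX, ev_smul, ← h]; rfl

theorem dOdd (h : Rep X Y) (α : Fin K) :
    Rep (dOdd α X) (PS.cw (dgen (Sum.inrₗ α : OddIx1 ε K)) Y) := fun n x => by
  rw [PS.coeff_cw, ev_dgen, ← h]; rfl

theorem dLam (h : Rep X Y) (δ : Fin K → ZMod 2) (α : Fin K) :
    Rep (dLam δ α X) (dFirst U (δ α) α Y) := by
  unfold SuperBV.dLam dFirst
  split_ifs
  · exact h.dEven α
  · exact h.dOdd α

theorem dLamStar (h : Rep X Y) (δ : Fin K → ZMod 2) (α : Fin K) :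
    Rep (dLamStar δ α X) (dFirst U (δ α + 1) α Y) := by
  unfold SuperBV.dLamStar dFirst
  rcases zmod2_cases (δ α) with hδ | hδ
  · rw [if_pos hδ, hδ, if_neg (by decide)]
    exact h.dOdd α
  · rw [hδ, if_neg one_ne_zero, if_pos (by decide)]
    exact h.dEven α

theorem up {f : SFun ε} {a : Sm U (OddIx ε)} (h : ∀ x : U, f x = ev x a) :
    Rep (up f : FL ε K) (MvPowerSeries.C (lift inclₗ a)) :=
  C fun x => by rw [ev_lift, h]; rfl

theorem fexp (h : Rep X Y) : Rep (fexp X) (PS.expS Y) := fun n x => by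
  have hb : ∀ y : U, body (X 0 y) = body (extz (MvPowerSeries.coeff 0 Y) y) := fun y => by
    rw [extz_coe, h]
  have hs : Rep (X - MvPowerSeries.C fun y => body (X 0 y) • (1 : Grassmann (OddIx1 ε K)))
      (PS.sS Y) := h.sub (C fun y => by rw [PS.bS, ev_scal, hb])
  rw [PS.coeff_expS, PS.pexp, map_sum, ev_mul, PS.ebS, ev_scal, smul_one_mul, ev_sum]
  unfold SuperBV.fexp
  dsimp only
  rw [hb]
  congr 1
  exact Finset.sum_congr rfl fun k _ => (hs.pow k).smul _ n x

theorem delta (h : Rep X Y) {D : ℕ} {E : Fin M → Fin M → SFun ε} {Θ : Fin D → SFun ε} {ρ : SFun ε}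
    (δ : Fin K → ZMod 2) {En : Fin M → Fin M → Sm U (OddIx ε)} {ρS ρi : Sm U (OddIx ε)}
    (hE : ∀ A B (x : U), diracE E Θ A B x = ev x (En A B)) (hρ : ∀ x : U, ρ x = ev x ρS)
    (hρi : ∀ x : U, Ring.inverse (ρ x) = ev x ρi) :
    Rep (diracDelta1 E Θ ρ δ X) ((firstLevel U δ).delta (MvPowerSeries.C (lift inclₗ ρi))
      (fun A B => MvPowerSeries.C (lift inclₗ (ρS * En A B))) Y) := by
  refine Rep.add (Rep.sum _ fun A _ => Rep.sum _ fun B _ => Rep.smul _ ?_)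
    (Rep.sum _ fun α _ => Rep.smul _ ?_)
  · refine (Rep.up hρi).mul (Rep.dGamma ((Rep.up fun x => ?_).mul (h.dGamma B)) A)
    rw [ev_mul, ← hρ, ← hE]; rfl
  · exact (h.dLamStar δ α).dLam δ α

end Rep

section exponential

variable (w : MvPowerSeries (Fin K) (Sm U (OddIx1 ε K))) (pw : IsPar 0 w)

include pw

theorem dFirst_expS (p : ZMod 2) (α : Fin K) :
    dFirst U p α (PS.expS w) = PS.expS w * dFirst U p α w := by
  refine PS.der_expS w pw (isLDer_dFirst U p α) (fun N f hf => ?_) ?_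
  · unfold dFirst
    split_ifs
    · exact hf.dX α
    · exact hf.cw (PS.degGE_dgen _)
  · unfold dFirst
    split_ifs
    · rw [PS.dX_C, PS.dX_C, mul_zero]
    · rw [PS.cw_C, PS.cw_C, PS.ebS, PS.bS, PS.dgen_scal, PS.dgen_scal, map_zero, mul_zero]

theorem cw_dS_expS (A : Fin M) :
    PS.cw ((dS fun i => (Sum.inlₗ i : OddIx1 ε K)).d A) (PS.expS w) =
      PS.expS w * PS.cw ((dS fun i => (Sum.inlₗ i : OddIx1 ε K)).d A) w := by
  refine PS.der_expS w pw (PS.isLDer_cw (isLDer_dS _ A))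
    (fun N f hf => hf.cw (PS.degGE_dS _ A)) ?_
  rw [PS.cw_C, PS.cw_C, PS.dS_exp, map_mul]

end exponential

section action

variable {δ : Fin K → ZMod 2}

theorem lamDeg_map (S : Finset (OddIx ε)) :
    lamDeg δ 0 (S.map inlE : Finset (OddIx1 ε K)) = 0 :=
  Finset.sum_eq_zero fun α _ => by
    rw [if_neg (inr_notMem_map α S)]; simp

theorem lamStarDeg_map (S : Finset (OddIx ε)) :
    lamStarDeg δ 0 (S.map inlE : Finset (OddIx1 ε K)) = 0 :=
  Finset.sum_eq_zero fun α _ => by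
    rw [if_neg (inr_notMem_map α S)]; simp

/-- Vanishing of all terms with given degrees in the first-level fields. -/
def Van (δ : Fin K → ZMod 2) (Z : ℕ → ℕ → Prop)
    (Y : MvPowerSeries (Fin K) (Sm U (OddIx1 ε K))) : Prop :=
  ∀ n x T, Z (lamDeg δ n T) (lamStarDeg δ n T) → ev x (MvPowerSeries.coeff n Y) T = 0

theorem sum_add_single {f g : Fin K → ℕ} (α : Fin K) (h : ∀ β, f β = g β + if β = α then 1 else 0) :
    ∑ β, f β = ∑ β, g β + 1 := by
  rw [Finset.sum_congr rfl fun β _ => h β, Finset.sum_add_distrib]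
  simp

theorem mem_insert_inr {_ : DecidableEq (OddIx1 ε K)} {α β : Fin K} {T : Finset (OddIx1 ε K)} :
    (Sum.inrₗ β : OddIx1 ε K) ∈ insert (Sum.inrₗ α : OddIx1 ε K) T ↔
      β = α ∨ (Sum.inrₗ β : OddIx1 ε K) ∈ T := by
  rw [Finset.mem_insert]
  refine or_congr_left ⟨fun h => Sum.inr_injective (toLex.injective h), fun h => by rw [h]⟩

theorem lamDeg_add {α : Fin K} (hα : δ α = 0) (n : Fin K →₀ ℕ) (T : Finset (OddIx1 ε K)) :
    lamDeg δ (n + Finsupp.single α 1) T = lamDeg δ n T + 1 :=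
  sum_add_single α fun β => by
    by_cases h : β = α
    · subst h; simp [hα]
    · simp [h]

theorem lamStarDeg_add {α : Fin K} (hα : ¬ δ α = 0) (n : Fin K →₀ ℕ) (T : Finset (OddIx1 ε K)) :
    lamStarDeg δ (n + Finsupp.single α 1) T = lamStarDeg δ n T + 1 :=
  sum_add_single α fun β => by
    by_cases h : β = α
    · subst h; simp [hα]
    · simp [h]

theorem lamDeg_add_of_ne {α : Fin K} (hα : ¬ δ α = 0) (n : Fin K →₀ ℕ)
    (T : Finset (OddIx1 ε K)) : lamDeg δ (n + Finsupp.single α 1) T = lamDeg δ n T :=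
  Finset.sum_congr rfl fun β _ => by
    by_cases h : β = α
    · subst h; simp [hα]
    · simp [h]

theorem lamStarDeg_add_of_eq {α : Fin K} (hα : δ α = 0) (n : Fin K →₀ ℕ)
    (T : Finset (OddIx1 ε K)) : lamStarDeg δ (n + Finsupp.single α 1) T = lamStarDeg δ n T :=
  Finset.sum_congr rfl fun β _ => by
    by_cases h : β = α
    · subst h; simp [hα]
    · simp [h]

theorem lamDeg_insert {α : Fin K} (hα : ¬ δ α = 0) (n : Fin K →₀ ℕ) {T T' : Finset (OddIx1 ε K)}
    (hT : (Sum.inrₗ α : OddIx1 ε K) ∉ T) (hT' : ∀ β, (Sum.inrₗ β : OddIx1 ε K) ∈ T' ↔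
      β = α ∨ (Sum.inrₗ β : OddIx1 ε K) ∈ T) : lamDeg δ n T' = lamDeg δ n T + 1 :=
  sum_add_single α fun β => by
    by_cases h : β = α
    · subst h; simp [hα, hT, hT']
    · simp [h, hT']

theorem lamStarDeg_insert {α : Fin K} (hα : δ α = 0) (n : Fin K →₀ ℕ)
    {T T' : Finset (OddIx1 ε K)} (hT : (Sum.inrₗ α : OddIx1 ε K) ∉ T)
    (hT' : ∀ β, (Sum.inrₗ β : OddIx1 ε K) ∈ T' ↔ β = α ∨ (Sum.inrₗ β : OddIx1 ε K) ∈ T) :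
    lamStarDeg δ n T' = lamStarDeg δ n T + 1 :=
  sum_add_single α fun β => by
    by_cases h : β = α
    · subst h; simp [hα, hT, hT']
    · simp [h, hT']

theorem lamDeg_insert_of_eq {α : Fin K} (hα : δ α = 0) (n : Fin K →₀ ℕ)
    {T T' : Finset (OddIx1 ε K)}
    (hT' : ∀ β, (Sum.inrₗ β : OddIx1 ε K) ∈ T' ↔ β = α ∨ (Sum.inrₗ β : OddIx1 ε K) ∈ T) :
    lamDeg δ n T' = lamDeg δ n T :=
  Finset.sum_congr rfl fun β _ => by
    by_cases h : β = α
    · subst h; simp [hα]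
    · simp [h, hT']

theorem lamStarDeg_insert_of_ne {α : Fin K} (hα : ¬ δ α = 0) (n : Fin K →₀ ℕ)
    {T T' : Finset (OddIx1 ε K)}
    (hT' : ∀ β, (Sum.inrₗ β : OddIx1 ε K) ∈ T' ↔ β = α ∨ (Sum.inrₗ β : OddIx1 ε K) ∈ T) :
    lamStarDeg δ n T' = lamStarDeg δ n T :=
  Finset.sum_congr rfl fun β _ => by
    by_cases h : β = α
    · subst h; simp [hα]
    · simp [h, hT']

/-- A coefficient of degree (l, m) of the λ-derivative comes from one of degree (l + 1, m), whether
the variable λ is a formal one or a Grassmann generator. -/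
theorem van_L {Z : ℕ → ℕ → Prop} {Y : MvPowerSeries (Fin K) (Sm U (OddIx1 ε K))} (h : Van δ Z Y)
    (α : Fin K) : Van δ (fun l m => Z (l + 1) m) ((firstLevel U δ).L α Y) := fun n x T hZ => by
  change ev x (MvPowerSeries.coeff n (dFirst U (δ α) α Y)) T = 0
  unfold dFirst
  by_cases hα : δ α = 0
  · rw [if_pos hα, PS.coeff_dX, ev_smul, Grassmann.smul_apply, h, mul_zero]
    rw [lamStarDeg_add_of_eq hα, lamDeg_add hα]
    exact hZ
  · rw [if_neg hα, PS.coeff_cw, ev_dgen]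
    by_cases hT : (Sum.inrₗ α : OddIx1 ε K) ∈ T
    · exact leftDer_apply_of_mem hT _
    · rw [leftDer_apply_of_notMem hT, h, mul_zero]
      rw [lamStarDeg_insert_of_ne hα n fun _ => mem_insert_inr,
        lamDeg_insert hα n hT fun _ => mem_insert_inr]
      exact hZ

theorem van_Ls {Z : ℕ → ℕ → Prop} {Y : MvPowerSeries (Fin K) (Sm U (OddIx1 ε K))} (h : Van δ Z Y)
    (α : Fin K) : Van δ (fun l m => Z l (m + 1)) ((firstLevel U δ).Ls α Y) := fun n x T hZ => by
  change ev x (MvPowerSeries.coeff n (dFirst U (δ α + 1) α Y)) T = 0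
  unfold dFirst
  rcases zmod2_cases (δ α) with hα | hα
  · rw [if_neg (by rw [hα]; decide), PS.coeff_cw, ev_dgen]
    by_cases hT : (Sum.inrₗ α : OddIx1 ε K) ∈ T
    · exact leftDer_apply_of_mem hT _
    · rw [leftDer_apply_of_notMem hT, h, mul_zero]
      rw [lamStarDeg_insert hα n hT fun _ => mem_insert_inr,
        lamDeg_insert_of_eq hα n fun _ => mem_insert_inr]
      exact hZ
  · have hα' : ¬ δ α = 0 := by rw [hα]; decide
    rw [if_pos (by rw [hα]; decide), PS.coeff_dX, ev_smul, Grassmann.smul_apply, h, mul_zero]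
    rw [lamStarDeg_add hα', lamDeg_add_of_ne hα']
    exact hZ

theorem ev_P (Y : MvPowerSeries (Fin K) (Sm U (OddIx1 ε K))) (x : U) :
    ev x ((firstLevel U δ).P Y) = restr (ev x (MvPowerSeries.coeff 0 Y)) := ev_liftₐ _ _ x

theorem van_P {Z : ℕ → ℕ → Prop} {Y : MvPowerSeries (Fin K) (Sm U (OddIx1 ε K))} (h : Van δ Z Y)
    (h0 : Z 0 0) : (firstLevel U δ).P Y = 0 := ext_ev fun x => by
  rw [ev_P]
  ext T
  rw [restr_apply, h 0 x (T.map inlE) (by rwa [lamDeg_map, lamStarDeg_map])]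
  rfl

theorem P_C (a : Sm U (OddIx ε)) :
    (firstLevel U δ).P (MvPowerSeries.C (lift inclₗ a)) = a := ext_ev fun x => by
  rw [ev_P, MvPowerSeries.coeff_zero_C, ev_lift]
  exact restr_incl _

theorem L_C (α : Fin K) (a : Sm U (OddIx ε)) :
    (firstLevel U δ).L α (MvPowerSeries.C (lift inclₗ a)) = 0 := by
  change dFirst U (δ α) α _ = 0
  unfold dFirst
  split_ifs
  · exact PS.dX_C _ _
  · rw [PS.cw_C]
    have : dgen (Sum.inrₗ α : OddIx1 ε K) (lift (inclₗ (ι := Fin K)) a) = 0 := ext_ev fun x => by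
      rw [ev_dgen, ev_lift, ev_zero]
      exact leftDer_inr_incl _ _
    rw [this, map_zero]

theorem isPar_C_lift {p : ZMod 2} {a : Sm U (OddIx ε)} (ha : IsPar p a) :
    IsPar p (MvPowerSeries.C (σ := Fin K) (lift (inclₗ (ι := Fin K)) a)) :=
  PS.isPar_C (isPar_iff.mpr fun x => by
    rw [ev_lift]
    exact incl_parity (isPar_iff.mp ha x))

/-- The multipliers as first-level functions over an open set. -/
def lamS (U : Opens (Pt ε)) (δ : Fin K → ZMod 2) (α : Fin K) :
    MvPowerSeries (Fin K) (Sm U (OddIx1 ε K)) :=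
  if δ α = 0 then MvPowerSeries.X α else
    MvPowerSeries.C (of (fun _ => gen (Sum.inrₗ α)) (smoothOn_const _ _))

theorem rep_lam (α : Fin K) : Rep (lam δ α : FL ε K) (lamS U δ α) := by
  unfold lam lamS
  split_ifs
  · exact Rep.var α
  · exact Rep.C fun _ => rfl

theorem P_L_lam (α β : Fin K) :
    (firstLevel U δ).P ((firstLevel U δ).L β (lamS U δ α)) = if α = β then 1 else 0 := by
  change (firstLevel U δ).P (dFirst U (δ β) β (lamS U δ α)) = _
  refine ext_ev fun x => ?_
  rw [ev_P]
  unfold dFirst lamS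
  by_cases hα : δ α = 0 <;> by_cases hβ : δ β = 0
  · rw [if_pos hα, if_pos hβ, PS.coeff_dX, MvPowerSeries.coeff_X]
    by_cases h : α = β
    · subst h; simp [ev_one]
    · have : ¬ (Finsupp.single β 1 : Fin K →₀ ℕ) = Finsupp.single α 1 := fun h' =>
        h (Finsupp.single_left_injective one_ne_zero h').symm
      simp [h, this, ev_zero]
  · have h : ¬ α = β := fun h => hβ (h ▸ hα)
    rw [if_pos hα, if_neg hβ, if_neg h, PS.coeff_cw, MvPowerSeries.coeff_zero_X, map_zero, ev_zero,
      map_zero, ev_zero]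
  · have h : ¬ α = β := fun h => hα (h ▸ hβ)
    rw [if_neg hα, if_pos hβ, if_neg h, PS.dX_C, map_zero, ev_zero, map_zero, ev_zero]
  · rw [if_neg hα, if_neg hβ, PS.cw_C, MvPowerSeries.coeff_zero_C, ev_dgen, ev_of]
    refine (congrArg restr (leftDer_gen (κ := OddIx1 ε K) (Sum.inrₗ β) (Sum.inrₗ α))).trans ?_
    by_cases h : α = β
    · subst h; rw [if_pos rfl, if_pos rfl, map_one, ev_one]
    · rw [if_neg h, if_neg, map_zero, ev_zero]
      exact fun h' => h (Sum.inr_injective (toLex.injective h')).symm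

theorem restr_expansion (g : Fin K → Grassmann (OddIx1 ε K)) (h : Grassmann (OddIx ε))
    (hg : ∀ α, restr (g α) = 0) :
    restr (∑ α, g α + (Complex.I * ((1 : ℝ) : ℂ)) • incl h) = Complex.I • h := by
  rw [map_add, map_sum, Finset.sum_eq_zero fun α _ => hg α, zero_add, map_smul,
    Complex.ofReal_one, mul_one]
  exact congrArg (Complex.I • ·) (restr_incl h)

variable {D : ℕ} {E : Fin M → Fin M → SFun ε} {Θ : Fin D → SFun ε} {ρ : SFun ε}
  {X : ℕ → FL ε K} (hX : IsGaugeFixingAction U E Θ ρ δ X)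

include hX

/-- The Planck number determines the power of ħ from the degrees in λ and λ*, so at most one term of
the sum over powers of ħ is present. -/
theorem actionAt_apply (ħ : ℝ) (n : Fin K →₀ ℕ) {x : Pt ε} (hx : x ∈ U)
    (S : Finset (OddIx1 ε K)) : actionAt X ħ n x S =
      if lamDeg δ n S ≤ lamStarDeg δ n S + 1 then
        (Complex.I * (ħ : ℂ)) ^ (lamStarDeg δ n S + 1 - lamDeg δ n S) *
          X (lamStarDeg δ n S + 1 - lamDeg δ n S) n x S
      else 0 := by
  change ∑ᶠ k : ℕ, (Complex.I * (ħ : ℂ)) ^ k * X k n x S = _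
  split_ifs with h
  · refine finsum_eq_single _ _ fun k hk => ?_
    have : X k n x S = 0 := by
      by_contra h0
      have := hX.planck k n x hx S h0
      omega
    rw [this, mul_zero]
  · refine finsum_eq_zero_of_forall_eq_zero fun k => ?_
    have : X k n x S = 0 := by
      by_contra h0
      have := hX.planck k n x hx S h0
      omega
    rw [this, mul_zero]

theorem smooth_actionAt (ħ : ℝ) (n : Fin K →₀ ℕ) : SmoothOn (actionAt X ħ n) U := by
  rw [smoothOn_iff]
  intro S
  refine ContDiffOn.congr (f := fun x => if lamDeg δ n S ≤ lamStarDeg δ n S + 1 then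
        (Complex.I * (ħ : ℂ)) ^ (lamStarDeg δ n S + 1 - lamDeg δ n S) *
          X (lamStarDeg δ n S + 1 - lamDeg δ n S) n x S
      else 0) ?_ fun x hx => actionAt_apply hX ħ n hx S
  split_ifs
  · exact contDiffOn_const.mul (smoothOn_iff.mp (hX.smooth _ n) S)
  · exact contDiffOn_const

theorem parity_actionAt (ħ : ℝ) (n : Fin K →₀ ℕ) (x : Pt ε) (hx : x ∈ U) :
    HasParity (actionAt X ħ n x) 0 := by
  intro S hS
  rw [actionAt_apply hX ħ n hx S] at hS
  split_ifs at hS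
  · exact hX.parity _ n x hx S (right_ne_zero_of_mul hS)
  · exact absurd rfl hS

/-- The action, divided by `-i`, at unit Planck constant. -/
def actS : MvPowerSeries (Fin K) (Sm U (OddIx1 ε K)) := fun n =>
  of (fun x => (Complex.I / ((1 : ℝ) : ℂ)) • actionAt X 1 n x)
    ((smooth_actionAt hX 1 n).const_smul _)

theorem rep_actS : Rep ((Complex.I / ((1 : ℝ) : ℂ)) • actionAt X 1) (actS hX) := fun _ _ => rfl

theorem isPar_actS : IsPar 0 (actS hX) := PS.isPar_of_coeff fun n => isPar_iff.mpr fun x =>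
  hasParity_iff.mpr (by
    change gsig ((Complex.I / ((1 : ℝ) : ℂ)) • actionAt X 1 n x) =
      psign 0 • (Complex.I / ((1 : ℝ) : ℂ)) • actionAt X 1 n x
    rw [map_smul, hasParity_iff.mp (parity_actionAt hX 1 n x x.2), smul_comm])

/-- A λ-degree exceeding the λ*-degree by more than one would need a negative power of ħ. -/
theorem van_actS : Van δ (fun l m => m + 1 < l) (actS hX) := fun n x T hZ => by
  change Complex.I / ((1 : ℝ) : ℂ) * actionAt X 1 n x T = 0
  rw [actionAt_apply hX 1 n x.2, if_neg (by omega), mul_zero]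

variable {G : Fin K → SFun ε} {H : SFun ε} (hGH : HasExpansion U δ X G H)

include hGH

theorem actS_apply (n : Fin K →₀ ℕ) (x : U) (T : Finset (OddIx1 ε K))
    (hT : lamStarDeg δ n T = 0) : ev x (MvPowerSeries.coeff n (actS hX)) T =
      Complex.I * ((∑ α, up (G α) * lam δ α) +
        (Complex.I * ((1 : ℝ) : ℂ)) • up H : FL ε K) n x T := by
  change Complex.I / ((1 : ℝ) : ℂ) * actionAt X 1 n x T = _
  rw [← congrFun (hGH 1 n x x.2) T]
  unfold atLamStarZero
  rw [if_pos hT, Complex.ofReal_one, div_one]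

/-- With all first-level fields at zero only iH is left of the action at ħ = 1, and the factor i of
the exponent turns it into −H. -/
theorem ev_P_actS (x : U) : ev x ((firstLevel U δ).P (actS hX)) = -H x := by
  have h1 : restr (((∑ α, up (G α) * lam δ α) +
        (Complex.I * ((1 : ℝ) : ℂ)) • up H : FL ε K) 0 x) = Complex.I • H x := by
    have e1 : ((∑ α, up (G α) * lam δ α) + (Complex.I * ((1 : ℝ) : ℂ)) • up H : FL ε K) 0 x =
        ∑ α, (up (G α) * lam δ α : FL ε K) 0 x + (Complex.I * ((1 : ℝ) : ℂ)) • (incl (H x) : Grassmann (OddIx1 ε K)) := by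
      have e0 : (∑ α, up (G α) * lam δ α : FL ε K) 0 x =
          ∑ α, (up (G α) * lam δ α : FL ε K) 0 x := by
        change MvPowerSeries.coeff 0 (∑ α, up (G α) * lam δ α : FL ε K) x = _
        rw [map_sum, Finset.sum_apply]
        rfl
      have e2 : (up H : FL ε K) 0 x = incl (H x) := by
        change MvPowerSeries.coeff 0 (MvPowerSeries.C (fun x => incl (H x)) : FL ε K) x = _
        rw [MvPowerSeries.coeff_zero_C]
      rw [← e0, ← e2]; rfl
    refine (congrArg restr e1).trans (restr_expansion _ _ fun α => ?_)
    have e3 : (up (G α) * lam δ α : FL ε K) 0 x = incl (G α x) * (lam δ α : FL ε K) 0 x := by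
      change MvPowerSeries.constantCoeff (up (G α) * lam δ α : FL ε K) x = _
      rw [map_mul, Pi.mul_apply, up, MvPowerSeries.constantCoeff_C]
      rfl
    have e4 : restr ((lam δ α : FL ε K) 0 x) = 0 := by
      unfold lam
      split_ifs
      · change restr (MvPowerSeries.coeff 0 (MvPowerSeries.X α : FL ε K) x) = 0
        rw [MvPowerSeries.coeff_zero_X, Pi.zero_apply, map_zero]
      · change restr (MvPowerSeries.coeff 0 (MvPowerSeries.C (fun _ => gen (Sum.inrₗ α)) : FL ε K) x) = 0
        rw [MvPowerSeries.coeff_zero_C]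
        exact restr_gen_inr α
    rw [e3, map_mul, e4, mul_zero]
  rw [ev_P]
  ext T
  refine (restr_apply _ T).trans ((actS_apply hX hGH 0 x _ (lamStarDeg_map T)).trans ?_)
  refine (congrArg (Complex.I * ·) ((restr_apply _ T).symm.trans (congrFun h1 T))).trans ?_
  change Complex.I * (Complex.I * H x T) = -(H x T)
  rw [← mul_assoc, Complex.I_mul_I, neg_one_mul]

theorem P_L_actS {GS : Fin K → Sm U (OddIx ε)} (hG : ∀ α (x : U), G α x = ev x (GS α))
    (pG : ∀ α, IsPar (δ α) (GS α)) (β : Fin K) :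
    (firstLevel U δ).P ((firstLevel U δ).L β (actS hX)) =
      (Complex.I * psign (δ β)) • GS β := by
  set T := firstLevel (K := K) U δ
  set HS := -T.P (actS hX) with hHS
  let Y : MvPowerSeries (Fin K) (Sm U (OddIx1 ε K)) :=
    (∑ α, MvPowerSeries.C (lift inclₗ (GS α)) * lamS U δ α) +
      (Complex.I * ((1 : ℝ) : ℂ)) • MvPowerSeries.C (lift inclₗ HS)
  have hY : Rep ((∑ α, up (G α) * lam δ α) + (Complex.I * ((1 : ℝ) : ℂ)) • up H : FL ε K) Y :=
    (Rep.sum _ fun α _ => (Rep.up (hG α)).mul (rep_lam α)).add ((Rep.up fun x => by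
      rw [hHS, ev_neg, ev_P_actS hX hGH, neg_neg]).smul _)
  -- The λ-derivative at zero sees only the terms without λ*, where the action agrees with the
  -- explicit series `Y`.
  have hV : Van δ (fun _ m => m = 0) (actS hX - Complex.I • Y) := fun n x S hS => by
    rw [map_sub, ev_sub, Grassmann.sub_apply, actS_apply hX hGH n x S hS, hY n x, PS.coeff_csmul,
      ev_smul, Grassmann.smul_apply, sub_self]
  have h1 : T.P (T.L β (actS hX - Complex.I • Y)) = 0 := van_P (van_L hV β) rfl
  rw [map_sub, map_sub, map_smul, map_smul, sub_eq_zero] at h1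
  rw [h1, ← smul_smul]
  congr 1
  have h2 : ∀ α, T.P (T.L β (MvPowerSeries.C (lift inclₗ (GS α)) * lamS U δ α)) =
      if α = β then psign (δ β) • GS β else 0 := by
    intro α
    -- The sign comes from moving the λ-derivative past the coefficient G, which has the parity of
    -- λ.
    rw [(T.der_L β).mul_of_kill (isPar_C_lift (pG α)) (L_C β _), map_smul, map_mul, P_C, P_L_lam]
    split_ifs with h
    · subst h
      rw [mul_one]
      congr 2
      exact (by decide : ∀ a : ZMod 2, a * a = a) _
    · rw [mul_zero, smul_zero]
  rw [map_add, map_sum, map_smul, L_C, smul_zero, add_zero, map_sum,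
    Finset.sum_congr rfl fun α _ => h2 α]
  simp

/-- The algebraic content of the master equation. -/
theorem master_algebra {GS : Fin K → Sm U (OddIx ε)} (hG : ∀ α (x : U), G α x = ev x (GS α))
    (pG : ∀ α, IsPar (δ α) (GS α))
    {En : Fin M → Fin M → Sm U (OddIx ε)} {ρS ρi : Sm U (OddIx ε)}
    (hE : ∀ A B (x : U), diracE E Θ A B x = ev x (En A B)) (hρ : ∀ x : U, ρ x = ev x ρS)
    (hρi : ∀ x : U, Ring.inverse (ρ x) = ev x ρi) (biv : SDom.IsBiv ε En) (pρ : IsPar 0 ρS)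
    (pρi : IsPar 0 ρi) (inv : ρi * ρS = 1) :
    ∃ HS : Sm U (OddIx ε), (∀ x : U, H x = ev x HS) ∧ IsPar 0 HS ∧
      ∃ v : Fin K → Fin K → Fin K → Sm U (OddIx ε),
        (∀ β σ γ, IsPar (δ σ + δ γ + (δ β + 1)) (v β σ γ)) ∧
        (∀ γ β, (dS id).br En (GS γ) (GS β) = ∑ σ, GS σ * v β σ γ) ∧
        ∀ β (I : Ideal (Sm U (OddIx ε))) [I.IsTwoSided], (∀ α, GS α ∈ I) →
          (dS id).lap En ρS ρi (GS β) - (dS id).br En HS (GS β) -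
            ∑ γ, psign (δ γ) • v β γ γ ∈ I := by
  set T := firstLevel (K := K) U δ with hT
  set w := actS hX with hw
  have pw : IsPar 0 w := isPar_actS hX
  set r : MvPowerSeries (Fin K) (Sm U (OddIx1 ε K)) := MvPowerSeries.C (lift inclₗ ρi) with hr
  set E' : Fin M → Fin M → MvPowerSeries (Fin K) (Sm U (OddIx1 ε K)) :=
    fun A B => MvPowerSeries.C (lift inclₗ (ρS * En A B)) with hE'
  have pe := PS.isPar_expS w pw
  -- The single value ħ = 1 suffices, because the Planck number already tells the powers of ħ apart.
  have hm : T.delta r E' (PS.expS w) = 0 := by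
    refine MvPowerSeries.ext fun n => ext_ev fun x => ?_
    rw [← ((rep_actS hX).fexp.delta δ hE hρ hρi) n x, hX.master 1 one_ne_zero n x x.2]
    rfl
  have hu : IsUnit (T.P (PS.expS w)) := isUnit_of_body fun x => by
    rw [ev_P, body_restr]; exact PS.body_expS w x
  obtain ⟨q1, q2⟩ := T.quantum_eq_zero (r := r) (E' := E') pe (cw_dS_expS w pw)
    (fun α => dFirst_expS w pw _ α) (fun α => dFirst_expS w pw _ α) hu hm
  have pr : IsPar 0 r := isPar_C_lift pρi
  have pE : ∀ A B, IsPar (ε A + ε B + 1) (E' A B) := fun A B =>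
    isPar_C_lift (pρ.mul' (biv.par A B) (zero_add _))
  -- The degrees (2,0), (3,0) and (3,1) in (λ, λ*) all violate the Planck bound l ≤ m + 1.
  have P2 : ∀ γ β, T.P (T.L γ (T.L β w)) = 0 := fun γ β =>
    van_P (van_L (van_L (van_actS hX) β) γ) (by norm_num)
  have P3 : ∀ γ β α, T.P (T.L γ (T.L β (T.L α w))) = 0 := fun γ β α =>
    van_P (van_L (van_L (van_L (van_actS hX) α) β) γ) (by norm_num)
  have P4 : ∀ γ β α, T.P (T.L γ (T.L β (T.L α (T.Ls α w)))) = 0 := fun γ β α =>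
    van_P (van_L (van_L (van_L (van_Ls (van_actS hX) α) α) β) γ) (by norm_num)
  have P0 : T.P w = -(-T.P w) := (neg_neg _).symm
  have pH : IsPar 0 (-T.P w) := (T.P_IsPar pw).neg
  refine ⟨-T.P w, fun x => ?_, pH, T.struc w, T.struc_par pw, fun γ β => ?_, fun β I _ mG => ?_⟩
  · rw [ev_neg, ev_P_actS hX hGH, neg_neg]
  · exact T.br_gauge pr pE (fun α => L_C α _) (fun α A B => L_C α _) inv (P_C _) (fun A B => P_C _)
      pw biv P0 (P_L_actS hX hGH hG pG) P2 P3 P4 pG γ β (q2 γ β)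
  · exact T.lap_sub_mem pr pE (fun α => L_C α _) (fun α A B => L_C α _) inv (P_C _)
      (fun A B => P_C _) pw biv P0 (P_L_actS hX hGH hG pG) P2 pG pH β (q1 β) mG

end action

end SuperBV
end

/-! ### Analysis: parameter integrals, Hadamard's lemma, functions constant along a level set. -/

open scoped BigOperators
noncomputable section
set_option linter.unusedSectionVars false

namespace SuperBV
open MeasureTheory Set Topology
open scoped Interval

section parametric

variable {E : Type} [NormedAddCommGroup E] [NormedSpace ℝ E] [FiniteDimensional ℝ E]

/-- The points all of whose section over the unit interval lies in `O`. -/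
def tube (O : Set (E × ℝ)) : Set E := {p | ∀ t ∈ Icc (0 : ℝ) 1, (p, t) ∈ O}

theorem isOpen_tube {O : Set (E × ℝ)} (hO : IsOpen O) : IsOpen (tube O) := by
  rw [isOpen_iff_mem_nhds]
  intro p hp
  obtain ⟨u, v, hu, -, hpu, hv, huv⟩ := generalized_tube_lemma (isCompact_singleton (x := p))
    (isCompact_Icc (a := (0 : ℝ)) (b := 1)) hO (by rintro ⟨q, t⟩ ⟨rfl, ht⟩; exact hp t ht)
  refine Filter.mem_of_superset (hu.mem_nhds (hpu rfl)) fun q hq t ht => huv ⟨hq, hv ht⟩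

/-- Derivative with respect to the parameter. -/
def dpar {F : Type} [NormedAddCommGroup F] [NormedSpace ℝ F] (h : E × ℝ → F) (z : E × ℝ) :
    E →L[ℝ] F := (fderiv ℝ h z).comp (ContinuousLinearMap.inl ℝ E ℝ)

/-- Differentiation under the integral sign; the dominating constant is a bound for the derivative
on the product of a closed ball and the unit interval, compact in finite dimension. -/
theorem hasFDerivAt_param {F : Type} [NormedAddCommGroup F] [NormedSpace ℝ F]
    {O : Set (E × ℝ)} (hO : IsOpen O) {h : E × ℝ → F}
    (hh : ContDiffOn ℝ ((⊤ : ℕ∞) : WithTop ℕ∞) h O) {p : E} (hp : p ∈ tube O) :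
    HasFDerivAt (fun q => ∫ t in (0 : ℝ)..1, h (q, t)) (∫ t in (0 : ℝ)..1, dpar h (p, t)) p := by
  have hI : Ι (0 : ℝ) 1 ⊆ Icc 0 1 := by
    rw [uIoc_of_le zero_le_one]; exact Ioc_subset_Icc_self
  have cd : ContinuousOn (dpar h) O :=
    (hh.continuousOn_fderiv_of_isOpen hO (by simp)).clm_comp continuousOn_const
  have sec : ∀ {F' : Type} [NormedAddCommGroup F'] {g : E × ℝ → F'}, ContinuousOn g O →
      ∀ q ∈ tube O, ContinuousOn (fun t => g (q, t)) (Icc 0 1) := fun {F'} _ g hg q hq =>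
    hg.comp (by fun_prop) fun t ht => hq t ht
  obtain ⟨r, hr, hball⟩ := Metric.nhds_basis_closedBall.mem_iff.mp
    ((isOpen_tube hO).mem_nhds hp)
  obtain ⟨C, hC⟩ := (((isCompact_closedBall p r).prod (isCompact_Icc (a := (0 : ℝ)) (b := 1)))
    ).exists_bound_of_continuousOn (cd.mono (by rintro ⟨q, t⟩ ⟨hq, ht⟩; exact hball hq t ht))
  have int : ∀ {F' : Type} [NormedAddCommGroup F'] {g : E × ℝ → F'}, ContinuousOn g O →
      ∀ q ∈ tube O, AEStronglyMeasurable (fun t => g (q, t)) (volume.restrict (Ι (0 : ℝ) 1)) :=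
    fun {F'} _ g hg q hq => ((sec hg q hq).mono hI).aestronglyMeasurable measurableSet_uIoc
  refine intervalIntegral.hasFDerivAt_integral_of_dominated_of_fderiv_le
    (F' := fun q t => dpar h (q, t)) (bound := fun _ => C) (Metric.closedBall_mem_nhds p hr)
    ?_ ?_ (int cd p hp) ?_ intervalIntegrable_const ?_
  · filter_upwards [(isOpen_tube hO).mem_nhds hp] with q hq
    exact int hh.continuousOn q hq
  · refine ContinuousOn.intervalIntegrable ?_
    rw [uIcc_of_le zero_le_one]
    exact sec hh.continuousOn p hp
  · exact Filter.Eventually.of_forall fun t ht q hq => hC (q, t) ⟨hq, hI ht⟩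
  · refine Filter.Eventually.of_forall fun t ht q hq => ?_
    have hd : DifferentiableAt ℝ h (q, t) :=
      (hh.contDiffAt (hO.mem_nhds (hball hq t (hI ht)))).differentiableAt (by simp)
    exact hd.hasFDerivAt.comp q (hasFDerivAt_prodMk_left q t)

/-- The derivative is again a parameter integral, with values in a space of linear maps; hence the
induction runs over all target spaces at once. -/
theorem contDiffOn_param_nat {O : Set (E × ℝ)} (hO : IsOpen O) (n : ℕ) :
    ∀ {F : Type} [NormedAddCommGroup F] [NormedSpace ℝ F] {h : E × ℝ → F},
    ContDiffOn ℝ ((⊤ : ℕ∞) : WithTop ℕ∞) h O →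
    ContDiffOn ℝ n (fun q => ∫ t in (0 : ℝ)..1, h (q, t)) (tube O) := by
  induction n with
  | zero =>
    intro F _ _ h hh
    exact contDiffOn_zero.mpr fun p hp =>
      (hasFDerivAt_param hO hh hp).continuousAt.continuousWithinAt
  | succ n ih =>
    intro F _ _ h hh
    rw [Nat.cast_succ, contDiffOn_succ_iff_fderiv_of_isOpen (isOpen_tube hO)]
    refine ⟨fun p hp => (hasFDerivAt_param hO hh hp).differentiableAt.differentiableWithinAt,
      fun h => absurd h (by simp), ?_⟩
    have hd : ContDiffOn ℝ ((⊤ : ℕ∞) : WithTop ℕ∞) (dpar h) O :=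
      (hh.fderiv_of_isOpen hO (by simp)).clm_comp contDiffOn_const
    exact (ih hd).congr fun p hp => (hasFDerivAt_param hO hh hp).fderiv

/-- Integrals over the unit interval depend smoothly on parameters. -/
theorem contDiffOn_param {O : Set (E × ℝ)} (hO : IsOpen O) {F : Type} [NormedAddCommGroup F]
    [NormedSpace ℝ F] {h : E × ℝ → F} (hh : ContDiffOn ℝ ((⊤ : ℕ∞) : WithTop ℕ∞) h O) :
    ContDiffOn ℝ ((⊤ : ℕ∞) : WithTop ℕ∞) (fun q => ∫ t in (0 : ℝ)..1, h (q, t)) (tube O) :=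
  contDiffOn_infty.mpr fun n => contDiffOn_param_nat hO n hh

end parametric

section hadamard

variable {ι : Type} [Fintype ι] [DecidableEq ι] (z : ι → Prop) [DecidablePred z]

/-- Scaling of the coordinates selected by `z`. -/
def scale (t : ℝ) (x : ι → ℝ) : ι → ℝ := fun i => if z i then t * x i else x i

theorem contDiff_scale : ContDiff ℝ ((⊤ : ℕ∞) : WithTop ℕ∞)
    (fun q : (ι → ℝ) × ℝ => scale z q.2 q.1) := by
  rw [contDiff_pi]
  intro i
  unfold scale
  split_ifs <;> fun_prop

/-- The part of `Ω` whose scaling paths stay in `Ω`. -/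
def starPart (Ω : Set (ι → ℝ)) : Set (ι → ℝ) := tube {q : (ι → ℝ) × ℝ | scale z q.2 q.1 ∈ Ω}

theorem isOpen_scale_preimage {Ω : Set (ι → ℝ)} (hΩ : IsOpen Ω) :
    IsOpen {q : (ι → ℝ) × ℝ | scale z q.2 q.1 ∈ Ω} := hΩ.preimage (contDiff_scale z).continuous

theorem isOpen_starPart {Ω : Set (ι → ℝ)} (hΩ : IsOpen Ω) : IsOpen (starPart z Ω) :=
  isOpen_tube (isOpen_scale_preimage z hΩ)

/-- Hadamard's lemma relative to some of the coordinates. -/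
theorem hadamard {Ω : Set (ι → ℝ)} (hΩ : IsOpen Ω) {φ : (ι → ℝ) → ℂ}
    (hφ : ContDiffOn ℝ ((⊤ : ℕ∞) : WithTop ℕ∞) φ Ω) :
    ∃ u : ι → (ι → ℝ) → ℂ, (∀ i, ContDiffOn ℝ ((⊤ : ℕ∞) : WithTop ℕ∞) (u i) (starPart z Ω)) ∧
      ∀ x ∈ starPart z Ω, φ x = φ (scale z 0 x) + ∑ i, if z i then (x i : ℂ) * u i x else 0 := by
  have hd : ∀ i, ContDiffOn ℝ ((⊤ : ℕ∞) : WithTop ℕ∞)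
      (fun q : (ι → ℝ) × ℝ => fderiv ℝ φ (scale z q.2 q.1) (Pi.single i 1))
      {q | scale z q.2 q.1 ∈ Ω} := fun i =>
    ((hφ.fderiv_of_isOpen hΩ (by simp)).comp (contDiff_scale z).contDiffOn
      fun q hq => hq).clm_apply contDiffOn_const
  -- The coefficients come from integrating the derivative of φ along the path that scales the
  -- selected coordinates from 0 to their values.
  refine ⟨fun i x => ∫ t in (0 : ℝ)..1, fderiv ℝ φ (scale z t x) (Pi.single i 1),
    fun i => contDiffOn_param (isOpen_scale_preimage z hΩ) (hd i), fun x hx => ?_⟩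
  let w : ι → ℝ := fun i => if z i then x i else 0
  have hs : ∀ t, HasDerivAt (fun t => scale z t x) w t := fun t => by
    rw [hasDerivAt_pi]
    intro i
    by_cases hi : z i
    · simp only [scale, w, if_pos hi]
      simpa using (hasDerivAt_id t).mul_const (x i)
    · simp only [scale, w, if_neg hi]
      exact hasDerivAt_const t (x i)
  have hder : ∀ t ∈ uIcc (0 : ℝ) 1,
      HasDerivAt (fun t => φ (scale z t x)) (fderiv ℝ φ (scale z t x) w) t := fun t ht => by
    rw [uIcc_of_le zero_le_one] at ht
    have : DifferentiableAt ℝ φ (scale z t x) :=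
      (hφ.contDiffAt (hΩ.mem_nhds (hx t ht))).differentiableAt (by simp)
    exact this.hasFDerivAt.comp_hasDerivAt t (hs t)
  have hcont : ∀ i, ContinuousOn (fun t => fderiv ℝ φ (scale z t x) (Pi.single i 1))
      (uIcc (0 : ℝ) 1) := fun i => by
    rw [uIcc_of_le zero_le_one]
    exact (hd i).continuousOn.comp (f := fun t : ℝ => (x, t)) (by fun_prop) fun t ht => hx t ht
  have hw : ∀ t, fderiv ℝ φ (scale z t x) w =
      ∑ i, if z i then (x i : ℂ) * fderiv ℝ φ (scale z t x) (Pi.single i 1) else 0 := fun t => by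
    have e : w = ∑ i, w i • Pi.single i (1 : ℝ) := by
      conv_lhs => rw [← Finset.univ_sum_single w]
      refine Finset.sum_congr rfl fun i _ => ?_
      rw [← Pi.single_smul, smul_eq_mul, mul_one]
    conv_lhs => rw [e]
    rw [map_sum]
    refine Finset.sum_congr rfl fun i _ => ?_
    rw [map_smul]
    by_cases hi : z i
    · simp only [w, if_pos hi, Complex.real_smul]
    · simp only [w, if_neg hi, zero_smul]
  have hi : ∀ i, IntervalIntegrable (fun t => if z i then
      (x i : ℂ) * fderiv ℝ φ (scale z t x) (Pi.single i 1) else 0) volume 0 1 := fun i => by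
    split_ifs
    · exact (continuousOn_const.mul (hcont i)).intervalIntegrable
    · exact intervalIntegrable_const
  have hsum := intervalIntegral.integral_eq_sub_of_hasDerivAt hder (by
    simp only [hw]
    have := IntervalIntegrable.sum Finset.univ fun i _ => hi i
    rwa [Finset.sum_fn] at this)
  simp only [hw] at hsum
  rw [intervalIntegral.integral_finsetSum fun i _ => hi i] at hsum
  have e1 : scale z 1 x = x := by
    funext i; simp [scale]
  rw [e1] at hsum
  rw [← sub_eq_iff_eq_add', ← hsum]
  refine Finset.sum_congr rfl fun i _ => ?_
  split_ifs
  · exact intervalIntegral.integral_const_mul _ _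
  · simp

variable {W : Set (ι → ℝ)} (hW : IsOpen W) {Y : (ι → ℝ) → ι → ℝ}
  (hY : ContDiffOn ℝ ((⊤ : ℕ∞) : WithTop ℕ∞) Y W)
  (hL : ∀ x ∈ W, ∃ L : (ι → ℝ) ≃L[ℝ] (ι → ℝ), HasFDerivAt Y (L : (ι → ℝ) →L[ℝ] (ι → ℝ)) x)

include hW hY hL

theorem isOpen_image_chart : IsOpen (Y '' W) := by
  rw [isOpen_iff_mem_nhds]
  rintro _ ⟨x, hx, rfl⟩
  obtain ⟨L, hL⟩ := hL x hx
  rw [← ((hY.contDiffAt (hW.mem_nhds hx)).hasStrictFDerivAt' hL (by simp)).map_nhds_eq_of_equiv]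
  exact Filter.image_mem_map (hW.mem_nhds hx)

variable (hi : InjOn Y W)

include hi

theorem invFunOn_chart {x : ι → ℝ} (hx : x ∈ W) : Function.invFunOn Y W (Y x) = x :=
  hi.leftInvOn_invFunOn hx

/-- By injectivity the global inverse agrees near each point with the local inverse of the inverse
function theorem, which is smooth. -/
theorem contDiffOn_invFunOn : ContDiffOn ℝ ((⊤ : ℕ∞) : WithTop ℕ∞) (Function.invFunOn Y W)
    (Y '' W) := by
  rintro _ ⟨x, hx, rfl⟩
  obtain ⟨L, hL⟩ := hL x hx
  have hc := hY.contDiffAt (hW.mem_nhds hx)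
  have hn : ((⊤ : ℕ∞) : WithTop ℕ∞) ≠ 0 := by simp
  have hs := hc.hasStrictFDerivAt' hL hn
  refine (ContDiffAt.congr_of_eventuallyEq (hc.to_localInverse hL hn) ?_).contDiffWithinAt
  have h1 : ∀ᶠ y in 𝓝 (Y x), hc.localInverse hL hn y ∈ W := by
    have : Filter.Tendsto (hc.localInverse hL hn) (𝓝 (Y x)) (𝓝 x) := hs.localInverse_tendsto
    exact this (hW.mem_nhds hx)
  have h2 : ∀ᶠ y in 𝓝 (Y x), Y (hc.localInverse hL hn y) = y := hs.eventually_right_inverse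
  filter_upwards [h1, h2] with y hy1 hy2
  conv_lhs => rw [← hy2]
  exact hi.leftInvOn_invFunOn hy1

/-- A function whose derivatives along the common zero set of some of the coordinates vanish is,
near this set, constant up to a combination of these coordinates. -/
theorem chart_hadamard {φ : (ι → ℝ) → ℂ} (hφ : ContDiffOn ℝ ((⊤ : ℕ∞) : WithTop ℕ∞) φ W)
    {S : Set (ι → ℝ)} (hS : S = {x ∈ W | ∀ i, z i → Y x i = 0}) (hc : IsPreconnected S)
    (h0 : ∀ x ∈ S, ∀ v, (∀ i, z i → fderiv ℝ Y x v i = 0) → fderiv ℝ φ x v = 0) :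
    ∃ (V : Set (ι → ℝ)) (c : ℂ) (u : ι → (ι → ℝ) → ℂ), IsOpen V ∧ S ⊆ V ∧ V ⊆ W ∧
      (∀ i, ContDiffOn ℝ ((⊤ : ℕ∞) : WithTop ℕ∞) (u i) V) ∧
      ∀ x ∈ V, φ x = c + ∑ i, if z i then (Y x i : ℂ) * u i x else 0 := by
  set Ψ := Function.invFunOn Y W with hΨ
  have cΨ : ContDiffOn ℝ ((⊤ : ℕ∞) : WithTop ℕ∞) Ψ (Y '' W) := contDiffOn_invFunOn hW hY hL hi
  have oΩ := isOpen_image_chart hW hY hL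
  have mΨ : MapsTo Ψ (Y '' W) W := by
    rintro _ ⟨x, hx, rfl⟩; rw [hΨ, invFunOn_chart hW hY hL hi hx]; exact hx
  have cφ : ContDiffOn ℝ ((⊤ : ℕ∞) : WithTop ℕ∞) (φ ∘ Ψ) (Y '' W) := hφ.comp cΨ mΨ
  have hΨx : ∀ x ∈ W, (φ ∘ Ψ) (Y x) = φ x := fun x hx => by
    rw [Function.comp_apply, hΨ, invFunOn_chart hW hY hL hi hx]
  obtain ⟨u, hu, hφu⟩ := hadamard z oΩ cφ
  -- In the chart, the derivatives of φ in the unselected directions vanish at the points of `S`.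
  have dφ : ∀ x ∈ S, ∀ v, (∀ i, z i → v i = 0) → fderiv ℝ (φ ∘ Ψ) (Y x) v = 0 := by
    intro x hx v hv
    have hxW : x ∈ W := by rw [hS] at hx; exact hx.1
    obtain ⟨L, hL⟩ := hL x hxW
    have d1 : DifferentiableAt ℝ (φ ∘ Ψ) (Y x) :=
      (cφ.contDiffAt (oΩ.mem_nhds ⟨x, hxW, rfl⟩)).differentiableAt (by simp)
    have d2 := d1.hasFDerivAt.comp x hL
    have e : (φ ∘ Ψ) ∘ Y =ᶠ[𝓝 x] φ := Filter.eventuallyEq_of_mem (hW.mem_nhds hxW) hΨx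
    have d3 := (d2.congr_of_eventuallyEq e.symm).fderiv
    have d4 := h0 x hx (L.symm v) (fun i hi => by
      rw [hL.fderiv]
      change L (L.symm v) i = 0
      rw [L.apply_symm_apply]; exact hv i hi)
    rw [d3] at d4
    change fderiv ℝ (φ ∘ Ψ) (Y x) (L (L.symm v)) = 0 at d4
    rwa [L.apply_symm_apply] at d4
  -- Nearby points of `S` have images in a common ball inside the image of the chart. The segment
  -- between these images keeps the selected coordinates at zero, so it stays in the image of `S`
  -- and φ is constant along it. Connectedness makes the local constant global.
  have hconst : ∃ c, ∀ x ∈ S, φ x = c := by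
    rcases S.eq_empty_or_nonempty with he | ⟨x0, hx0⟩
    · exact ⟨0, fun x hx => by rw [he] at hx; exact hx.elim⟩
    have : PreconnectedSpace S := isPreconnected_iff_preconnectedSpace.mp hc
    have hl : IsLocallyConstant (fun s : S => φ s) := by
      rw [IsLocallyConstant.iff_eventually_eq]
      rintro ⟨s0, hs0⟩
      have hs0' := hs0
      rw [hS] at hs0'
      obtain ⟨r, hr, hball⟩ := Metric.isOpen_iff.mp oΩ (Y s0) ⟨s0, hs0'.1, rfl⟩
      have hcont : ContinuousAt (fun s : S => Y s) ⟨s0, hs0⟩ :=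
        ContinuousAt.comp (f := fun s : S => (s : ι → ℝ))
          (hY.contDiffAt (hW.mem_nhds hs0'.1)).continuousAt continuous_subtype_val.continuousAt
      filter_upwards [hcont (Metric.ball_mem_nhds _ hr)] with ⟨s, hs⟩ hsb
      have hs' := hs
      rw [hS] at hs'
      change Y s ∈ Metric.ball (Y s0) r at hsb
      set v := Y s - Y s0
      have hseg : ∀ t ∈ Icc (0 : ℝ) 1, Y s0 + t • v ∈ Metric.ball (Y s0) r := fun t ht =>
        (convex_ball _ _).add_smul_sub_mem (Metric.mem_ball_self hr) hsb ht
      have hder : ∀ t ∈ Icc (0 : ℝ) 1, HasDerivAt (fun t => (φ ∘ Ψ) (Y s0 + t • v)) 0 t := by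
        intro t ht
        obtain ⟨s', hs'W, hs'Y⟩ := hball (hseg t ht)
        have hv : ∀ i, z i → v i = 0 := fun i hi => by
          simp only [v, Pi.sub_apply, hs'.2 i hi, hs0'.2 i hi, sub_zero]
        have hs'S : s' ∈ S := by
          rw [hS]
          refine ⟨hs'W, fun i hi => ?_⟩
          rw [hs'Y, Pi.add_apply, Pi.smul_apply, hv i hi, hs0'.2 i hi, smul_zero, add_zero]
        have d1 : DifferentiableAt ℝ (φ ∘ Ψ) (Y s0 + t • v) :=
          (cφ.contDiffAt (oΩ.mem_nhds (hball (hseg t ht)))).differentiableAt (by simp)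
        have d2 : HasDerivAt (fun t : ℝ => Y s0 + t • v) v t := by
          simpa using ((hasDerivAt_id t).smul_const v).const_add (Y s0)
        have d3 := d1.hasFDerivAt.comp_hasDerivAt t d2
        rw [← hs'Y, dφ s' hs'S v hv] at d3
        exact d3
      have := constant_of_has_deriv_right_zero
        (fun t ht => (hder t ht).continuousAt.continuousWithinAt)
        (fun t ht => (hder t (Ico_subset_Icc_self ht)).hasDerivWithinAt) 1 (by simp)
      simp only [one_smul, zero_smul, add_zero, v, add_sub_cancel] at this
      rwa [hΨx s hs'.1, hΨx s0 hs0'.1] at this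
    exact ⟨φ x0, fun x hx => hl.apply_eq_of_preconnectedSpace ⟨x, hx⟩ ⟨x0, hx0⟩⟩
  obtain ⟨c, hc⟩ := hconst
  -- The neighbourhood consists of the points whose whole scaling path stays in the image of the
  -- chart. Points of `S` are fixed by the scaling, so they belong to it.
  refine ⟨W ∩ Y ⁻¹' starPart z (Y '' W), c, fun i => u i ∘ Y,
    hY.continuousOn.isOpen_inter_preimage hW (isOpen_starPart z oΩ), ?_, inter_subset_left,
    fun i => (hu i).comp (hY.mono inter_subset_left) fun x hx => hx.2, ?_⟩
  · intro x hx
    have hx' := hx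
    rw [hS] at hx'
    refine ⟨hx'.1, fun t _ => ?_⟩
    have : scale z t (Y x) = Y x := by
      funext i
      by_cases hi : z i
      · rw [scale, if_pos hi, hx'.2 i hi, mul_zero]
      · rw [scale, if_neg hi]
    change scale z t (Y x) ∈ Y '' W
    rw [this]
    exact ⟨x, hx'.1, rfl⟩
  · rintro x ⟨hxW, hx⟩
    have h := hφu (Y x) hx
    rw [hΨx x hxW] at h
    -- The end of the scaling path at t = 0 is the image of a point of `S`, where φ equals the
    -- constant.
    obtain ⟨x0, hx0, hY0⟩ := hx 0 (by simp)
    change Y x0 = scale z 0 (Y x) at hY0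
    have hx0S : x0 ∈ S := by
      rw [hS]
      refine ⟨hx0, fun i hi => ?_⟩
      rw [hY0, scale, if_pos hi, zero_mul]
    rw [h, ← hY0, hΨx x0 hx0, hc x0 hx0S]
    rfl

end hadamard

end SuperBV
end

/-! ### Commuting coordinate derivatives and removal of the odd coordinates. -/

open scoped BigOperators
noncomputable section
set_option linter.unusedSectionVars false

namespace SuperBV
open scoped Grassmann.Alg
open SuperRing Grassmann TopologicalSpace

namespace SDom

variable {R : Type} [Ring R] [Algebra ℂ R] [SuperRing R]
variable {ι : Type} [Fintype ι] [DecidableEq ι] {ε : ι → ZMod 2} (d : SDom R ε)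
variable {y : ι → R} (hy : ∀ A, IsPar (ε A) (y A)) {Ki : Matrix ι ι R}
  (k1 : d.jac y * Ki = 1) (k2 : Ki * d.jac y = 1)

include hy k1 k2

theorem dbar_dbar (A B : ι) (f : R) : d.dbar Ki A (d.dbar Ki B f) =
    ∑ E, d.dr E f * ∑ C, d.dr C (Ki E B) * Ki C A +
      ∑ C, ∑ E, psign (ε C * (ε E + ε B)) • (d.dr C (d.dr E f) * (Ki E B * Ki C A)) := by
  have pK := (d.jac_par hy k1 k2).inv k1 k2
  simp only [Finset.mul_sum]
  rw [dbar_apply, dbar_apply, Finset.sum_comm, ← Finset.sum_add_distrib]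
  refine Finset.sum_congr rfl fun C _ => ?_
  rw [map_sum, Finset.sum_mul, ← Finset.sum_add_distrib]
  refine Finset.sum_congr rfl fun E _ => ?_
  rw [(d.isRDer_dr C).leib, (pK E B).sgp, add_mul, mul_assoc, mul_smul_comm, smul_mul_assoc,
    mul_assoc]

/-- Right derivatives with respect to coordinates commute. -/
theorem dbar_comm (A B : ι) (f : R) :
    d.dbar Ki A (d.dbar Ki B f) = psign (ε A * ε B) • d.dbar Ki B (d.dbar Ki A f) := by
  have pK := (d.jac_par hy k1 k2).inv k1 k2
  -- The second-order parts of the two composites agree up to the sign, by the symmetry of second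
  -- derivatives.
  have h2 : ∀ f, ∑ C, ∑ E, psign (ε C * (ε E + ε B)) • (d.dr C (d.dr E f) * (Ki E B * Ki C A)) =
      psign (ε A * ε B) •
        ∑ C, ∑ E, psign (ε C * (ε E + ε A)) • (d.dr C (d.dr E f) * (Ki E A * Ki C B)) := by
    intro f
    conv_rhs => rw [Finset.sum_comm]
    rw [Finset.smul_sum]
    refine Finset.sum_congr rfl fun C _ => ?_
    rw [Finset.smul_sum]
    refine Finset.sum_congr rfl fun E _ => ?_
    rw [d.dr_comm E C, (pK C A).comm (pK E B), mul_smul_comm, smul_mul_assoc]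
    simp only [smul_smul, ← psign_add]
    congr 2
    generalize ε A = a, ε B = b, ε C = c, ε E = e
    exact (by decide : ∀ a b c e : ZMod 2, c * (e + b) =
      a * b + (e * (c + a) + ((c + a) * (e + b) + e * c))) a b c e
  -- What is left of the graded commutator is a first-order operator with components `c`. It
  -- annihilates every coordinate `y C`, and the Jacobian is invertible, so `c` vanishes.
  let c : ι → R := fun E => ∑ C, d.dr C (Ki E B) * Ki C A -
    psign (ε A * ε B) • ∑ C, d.dr C (Ki E A) * Ki C B
  have key : ∀ f, d.dbar Ki A (d.dbar Ki B f) - psign (ε A * ε B) • d.dbar Ki B (d.dbar Ki A f) =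
      ∑ E, d.dr E f * c E := by
    intro f
    rw [d.dbar_dbar hy k1 k2, d.dbar_dbar hy k1 k2, h2, smul_add, add_sub_add_right_eq_sub,
      Finset.smul_sum, ← Finset.sum_sub_distrib]
    refine Finset.sum_congr rfl fun E _ => ?_
    rw [mul_sub, mul_smul_comm]
  have h1 : ∀ A B C, d.dbar Ki A (d.dbar Ki B (y C)) = 0 := fun A B C => by
    rw [d.dbar_coord k1]
    have h1 : d.dbar Ki A (1 : R) = 0 := by
      have := (d.isRDer_dbar hy k1 k2 A).leib 1 1
      rw [one_mul, one_mul, map_one (sgp (ε A)), mul_one] at this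
      exact left_eq_add.mp this
    by_cases h : C = B
    · rw [h, Matrix.one_apply_eq, h1]
    · rw [Matrix.one_apply_ne h, map_zero]
  have hc : ∀ E, c E = 0 := by
    have h3 : (d.jac y).mulVec c = 0 := funext fun C => by
      have := key (y C)
      rw [h1, h1, smul_zero, sub_zero] at this
      exact this.symm
    have h4 := congrArg Ki.mulVec h3
    rw [Matrix.mulVec_mulVec, k2, Matrix.one_mulVec, Matrix.mulVec_zero] at h4
    exact congrFun h4
  rw [← sub_eq_zero, key]
  exact Finset.sum_eq_zero fun E _ => by rw [hc, mul_zero]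

theorem dbar_odd_sq {A : ι} (hA : ε A = 1) (f : R) : d.dbar Ki A (d.dbar Ki A f) = 0 := by
  have h := d.dbar_comm hy k1 k2 A A f
  rw [hA, mul_one, psign_one, neg_one_smul] at h
  have h2 : (2 : ℂ) • d.dbar Ki A (d.dbar Ki A f) = 0 := by
    rw [two_smul]; nth_rewrite 1 [h]; exact neg_add_cancel _
  exact (smul_eq_zero_iff_right two_ne_zero).mp h2

/-- The dependence on odd coordinates can be removed modulo an ideal. -/
theorem exists_odd_const {I N : Ideal R} [I.IsTwoSided] [N.IsTwoSided] (f : R) (s : Finset ι)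
    (hs : ∀ A ∈ s, ε A = 1) (hN : ∀ A ∈ s, y A ∈ N)
    (hI : ∀ A ∈ s, y A ∈ I ∨ d.dbar Ki A f ∈ I ∧ ∀ a ∈ I, d.dbar Ki A a ∈ I) :
    ∃ g, (∀ A ∈ s, d.dbar Ki A g = 0) ∧ f - g ∈ I ∧ f - g ∈ N := by
  induction s using Finset.induction_on with
  | empty => exact ⟨f, by simp, by simp, by simp⟩
  | insert A s hAs ih =>
    obtain ⟨g, hg, gI, gN⟩ := ih (fun B hB => hs B (Finset.mem_insert_of_mem hB))
      (fun B hB => hN B (Finset.mem_insert_of_mem hB))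
      (fun B hB => hI B (Finset.mem_insert_of_mem hB))
    have hA := hs A (Finset.mem_insert_self _ _)
    -- Subtracting the linear term in the odd coordinate `y A` removes all dependence on it, since
    -- the square of an odd derivative vanishes. The subtracted term lies in `I` either through `y
    -- A` or through the derivative.
    have e : f - (g - d.dbar Ki A g * y A) = (f - g) + d.dbar Ki A g * y A := by abel
    refine ⟨g - d.dbar Ki A g * y A, fun B hB => ?_, ?_, ?_⟩
    · rw [map_sub, (d.isRDer_dbar hy k1 k2 B).leib, d.dbar_coord k1]
      rcases Finset.mem_insert.mp hB with rfl | hB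
      · rw [Matrix.one_apply_eq, mul_one, d.dbar_odd_sq hy k1 k2 hA, zero_mul, add_zero, sub_self]
      · have : A ≠ B := fun h => hAs (h ▸ hB)
        rw [hg B hB, Matrix.one_apply_ne this, d.dbar_comm hy k1 k2, hg B hB, map_zero, smul_zero,
          mul_zero, zero_mul, add_zero, sub_zero]
    · rw [e]
      refine I.add_mem gI ?_
      rcases hI A (Finset.mem_insert_self _ _) with h | ⟨h, h'⟩
      · exact I.mul_mem_left _ h
      · refine I.mul_mem_right _ ?_
        have := I.sub_mem h (h' _ gI)
        rwa [map_sub, sub_sub_cancel] at this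
    · rw [e]
      exact N.add_mem gN (N.mul_mem_left _ (hN A (Finset.mem_insert_self _ _)))

end SDom

namespace Sm

variable {M : ℕ} {ε : Fin M → ZMod 2} {U : Opens (Pt ε)}

/-- Body of a function at a point. -/
def bod {κ : Type} [Fintype κ] [LinearOrder κ] (x : U) : Sm U κ →ₐ[ℂ] ℂ := bodyₐ.comp (ev x)

section

variable {κ : Type} [Fintype κ] [LinearOrder κ]

theorem bod_apply (x : U) (f : Sm U κ) : bod x f = body (ev x f) := rfl
theorem bod_add (x : U) (f g : Sm U κ) : bod x (f + g) = bod x f + bod x g := rfl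
theorem bod_sub (x : U) (f g : Sm U κ) : bod x (f - g) = bod x f - bod x g := rfl
theorem bod_mul (x : U) (f g : Sm U κ) : bod x (f * g) = bod x f * bod x g :=
  map_mul (bodyₐ (κ := κ)) (ev x f) (ev x g)
theorem bod_sum {ι : Type*} (x : U) (s : Finset ι) (f : ι → Sm U κ) :
    bod x (∑ i ∈ s, f i) = ∑ i ∈ s, bod x (f i) := map_sum (bod x) f s

theorem bod_of_odd {f : Sm U κ} (hf : IsPar 1 f) (x : U) : bod x f = 0 :=
  degGE_one_iff.mp (degGE_one_of_parity_one (isPar_iff.mp hf x))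

end

/-- The ideal of functions without body. -/
def bodyIdeal (U : Opens (Pt ε)) (κ : Type) [Fintype κ] [LinearOrder κ] : Ideal (Sm U κ) where
  carrier := {f | ∀ x, bod x f = 0}
  add_mem' ha hb x := by rw [bod_add, ha x, hb x, add_zero]
  zero_mem' _ := rfl
  smul_mem' c f hf x := by rw [smul_eq_mul, bod_mul, hf x, mul_zero]

instance (κ : Type) [Fintype κ] [LinearOrder κ] : (bodyIdeal U κ).IsTwoSided where
  mul_mem_of_left b ha x := by rw [bod_mul, ha x, zero_mul]

variable {y : Fin M → Sm U (OddIx ε)} (hy : ∀ A, IsPar (ε A) (y A))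
  {Ki : Matrix (Fin M) (Fin M) (Sm U (OddIx ε))}
  (k1 : (dS id).jac y * Ki = 1) (k2 : Ki * (dS id).jac y = 1)

/-- Apart from the body, each coefficient of `f` appears, up to sign, as a coefficient of a
derivative whose monomial has one generator less. -/
theorem rightDer_eq_zero {κ : Type} [Fintype κ] [LinearOrder κ] {f : Grassmann κ} {k : ℕ}
    (hb : body f = 0) (h : ∀ i, DegGE k (rightDer i f)) : DegGE (k + 1) f := by
  intro T hT
  rcases T.eq_empty_or_nonempty with rfl | ⟨i, hi⟩
  · exact hb
  · have := h i (T.erase i) (by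
      have := Finset.card_pos.mpr ⟨i, hi⟩
      rw [Finset.card_erase_of_mem hi]; omega)
    rw [rightDer, if_neg (Finset.notMem_erase i T), Finset.insert_erase hi] at this
    exact (mul_eq_zero.mp this).resolve_left (pow_ne_zero _ (by norm_num))

theorem degGE_rightDer {κ : Type} [Fintype κ] [LinearOrder κ] {f : Grassmann κ} {k : ℕ}
    (h : DegGE (k + 1) f) (i : κ) : DegGE k (rightDer i f) := fun S hS => by
  unfold rightDer
  split_ifs with hi
  · rfl
  · rw [h _ (by rw [Finset.card_insert_of_notMem hi]; omega), mul_zero]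

include hy k1 k2

/-- A function without body that does not depend on odd coordinates is zero. -/
theorem eq_zero_of_dbar {g : Sm U (OddIx ε)} (hg : ∀ A, ε A = 1 → (dS id).dbar Ki A g = 0)
    (hb : ∀ x, bod x g = 0) : g = 0 := by
  have pJ := (dS id).jac_par hy k1 k2
  have pK := pJ.inv k1 k2
  -- Induction on the Grassmann degree. Derivatives along the new even coordinates keep the lower
  -- bound: an even Γ-derivative does not lower the degree, and an odd one lowers it by one but
  -- meets an odd entry of `Ki`. Derivatives along the odd Γ's are combinations of these, hence
  -- satisfy the same bound, and this raises the degree of `g` by one.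
  have main : ∀ k, ∀ x, DegGE (k + 1) (ev x g) := by
    intro k
    induction k with
    | zero => exact fun x => degGE_one_iff.mpr (hb x)
    | succ k ih =>
      have h1 : ∀ B x, ε B = 0 → DegGE (k + 1) (ev x ((dS id).dr B g)) := fun B x hB => by
        rw [SDom.dr_apply, hB]
        exact PS.degGE_dS_even id hB (k + 1) g ih x
      have h1' : ∀ B x, DegGE k (ev x ((dS id).dr B g)) := fun B x => by
        rcases zmod2_cases (ε B) with hB | hB
        · exact (h1 B x hB).mono (Nat.le_succ k)
        · rw [ev_dr, dR, dif_neg (by rw [hB]; decide), extz_coe]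
          exact degGE_rightDer (ih x) _
      have h2 : ∀ A x, ε A = 0 → DegGE (k + 1) (ev x ((dS id).dbar Ki A g)) := fun A x hA => by
        rw [SDom.dbar_apply, ev_sum]
        refine DegGE.sum fun B _ => ?_
        rw [ev_mul]
        rcases zmod2_cases (ε B) with hB | hB
        · exact (h1 B x hB).mul (degGE_zero _)
        · exact (h1' B x).mul (degGE_one_of_parity_one
            (isPar_iff.mp ((pK B A).cast (by rw [hA, hB, add_zero])) x))
      intro x
      refine rightDer_eq_zero (hb x) fun i => ?_
      have h3 : rightDer i (ev x g) = ev x ((dS id).dr i.1 g) := by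
        rw [ev_dr, dR, dif_neg i.2, extz_coe]; rfl
      rw [h3, (dS id).dr_eq_dbar k2, ev_sum]
      refine DegGE.sum fun A _ => ?_
      rw [ev_mul]
      have hi : ε i.1 = 1 := (zmod2_cases _).resolve_left i.2
      rcases zmod2_cases (ε A) with hA | hA
      · exact ((h2 A x hA).mul (degGE_one_of_parity_one
          (isPar_iff.mp ((pJ A i.1).cast (by rw [hA, hi, zero_add])) x))).mono (Nat.le_succ _)
      · rw [hg A hA, ev_zero, zero_mul]
        exact fun _ _ => rfl
  exact ext_ev fun x => eq_zero_of_degGE (main (Fintype.card (OddIx ε)) x)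

/-- Every smooth function of the even coordinates is the body of a function that does not depend
on the odd coordinates. -/
theorem exists_lift (φ : Pt ε → ℂ) (hφ : ContDiffOn ℝ ((⊤ : ℕ∞) : WithTop ℕ∞) φ U) :
    ∃ g : Sm U (OddIx ε), (∀ A, ε A = 1 → (dS id).dbar Ki A g = 0) ∧ ∀ x : U, bod x g = φ x := by
  obtain ⟨g, hg, -, gN⟩ := (dS id).exists_odd_const hy k1 k2 (I := ⊤) (N := bodyIdeal U (OddIx ε))
    (scal φ hφ) (Finset.univ.filter fun A => ε A = 1) (fun A hA => (Finset.mem_filter.mp hA).2)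
    (fun A hA x => bod_of_odd ((hy A).cast (Finset.mem_filter.mp hA).2) x)
    (fun _ _ => Or.inl trivial)
  refine ⟨g, fun A hA => hg A (Finset.mem_filter.mpr ⟨Finset.mem_univ _, hA⟩), fun x => ?_⟩
  have := gN x
  rw [bod_sub, sub_eq_zero] at this
  rw [← this, bod_apply, ev_scal, body_smul_one]

end Sm

end SuperBV
end

/-! ### Integration: a function with derivatives in the ideal is constant modulo the constraints. -/

open scoped BigOperators
noncomputable section
set_option linter.unusedSectionVars false

namespace SuperBV
open scoped Grassmann.Alg
open SuperRing Grassmann TopologicalSpace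

/-- The members of a family selected by `z`. -/
def sel {ι R : Type} [Zero R] (z : ι → Prop) [DecidablePred z] (y : ι → R) (A : ι) : R :=
  if z A then y A else 0

namespace SDom

variable {R : Type} [Ring R] [Algebra ℂ R] [SuperRing R]
variable {ι : Type} [Fintype ι] [DecidableEq ι] {ε : ι → ZMod 2} (d : SDom R ε)
variable {y : ι → R} (hy : ∀ A, IsPar (ε A) (y A)) {Ki : Matrix ι ι R}
  (k1 : d.jac y * Ki = 1) (k2 : Ki * d.jac y = 1) (z : ι → Prop) [DecidablePred z]

include hy

omit [Fintype ι] [DecidableEq ι] in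
theorem isPar_sel (A : ι) : IsPar (ε A) (sel z y A) := by
  unfold sel
  split_ifs
  · exact hy A
  · simp [IsPar]

include k1 k2

theorem dbar_one (A : ι) : d.dbar Ki A 1 = 0 := by
  have := (d.isRDer_dbar hy k1 k2 A).leib 1 1
  rw [one_mul, one_mul, map_one (sgp (ε A)), mul_one] at this
  exact left_eq_add.mp this

omit hy k2 in
theorem dbar_sel {A B : ι} (h : A = B → ¬ z A) : d.dbar Ki A (sel z y B) = 0 := by
  unfold sel
  split_ifs with hB
  · rw [d.dbar_coord k1, Matrix.one_apply_ne]
    rintro rfl; exact h rfl hB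
  · exact map_zero _

theorem dbar_sel_mul {A B : ι} (h : A = B → ¬ z A) (a : R) :
    d.dbar Ki A (sel z y B * a) = sel z y B * d.dbar Ki A a := by
  rw [(d.isRDer_dbar hy k1 k2 A).leib, d.dbar_sel k1 z h, zero_mul, add_zero]

theorem dbar_combination {A : ι} (c : ℂ) {w : ι → R} (hw : ∀ B, d.dbar Ki A (w B) = 0)
    (hA : w A = 0) : d.dbar Ki A (c • 1 + ∑ B, sel z y B * w B) = 0 := by
  rw [map_add, map_smul, d.dbar_one hy k1 k2, smul_zero, zero_add, map_sum]
  refine Finset.sum_eq_zero fun B _ => ?_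
  by_cases h : A = B
  · rw [← h, hA, mul_zero, map_zero]
  · rw [d.dbar_sel_mul hy k1 k2 z (fun e => absurd e h), hw, mul_zero]

/-- An odd selected coordinate can be removed because it lies in the ideal itself. An odd unselected
one can be removed because the derivative along it lies in the ideal, which is stable under that
derivative. -/
theorem exists_odd_const_mod {f : R}
    (hf : ∀ A, ¬ z A → d.dbar Ki A f ∈ genIdeal (sel z y) ε (isPar_sel hy z)) :
    ∃ g, (∀ A, ε A = 1 → d.dbar Ki A g = 0) ∧
      f - g ∈ genIdeal (sel z y) ε (isPar_sel hy z) ∧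
      ∀ A, ¬ z A → d.dbar Ki A g ∈ genIdeal (sel z y) ε (isPar_sel hy z) := by
  set I := genIdeal (sel z y) ε (isPar_sel hy z) with hI
  have stab : ∀ A, ¬ z A → ∀ a ∈ I, d.dbar Ki A a ∈ I := by
    rintro A hA _ ⟨u, rfl⟩
    rw [map_sum]
    refine I.sum_mem fun B _ => ?_
    rw [d.dbar_sel_mul hy k1 k2 z fun _ => hA]
    exact I.mul_mem_right _ (gen_mem_genIdeal _ _ _ B)
  obtain ⟨g, hg, gI, -⟩ := d.exists_odd_const hy k1 k2 (I := I) (N := ⊤) f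
    (Finset.univ.filter fun A => ε A = 1) (fun A hA => (Finset.mem_filter.mp hA).2)
    (fun _ _ => trivial) (fun A _ => by
      by_cases hA : z A
      · left
        have := gen_mem_genIdeal (sel z y) ε (isPar_sel hy z) A
        rwa [sel, if_pos hA] at this
      · exact Or.inr ⟨hf A hA, stab A hA⟩)
  refine ⟨g, fun A hA => hg A (Finset.mem_filter.mpr ⟨Finset.mem_univ _, hA⟩), gI, fun A hA => ?_⟩
  have := I.sub_mem (hf A hA) (stab A hA _ gI)
  rwa [map_sub, sub_sub_cancel] at this

end SDom

namespace Sm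

variable {M : ℕ} {ε : Fin M → ZMod 2} {U V : Opens (Pt ε)}

section restriction

variable {κ : Type} [Fintype κ] [LinearOrder κ] (h : V ≤ U)

/-- Restriction to a smaller open set. -/
def res : Sm U κ →ₐ[ℂ] Sm V κ where
  toFun f := ⟨fun x => f.1 ⟨x, h x.2⟩, by
    obtain ⟨g, hg, e⟩ := f.2
    exact ⟨g, hg.mono h, fun x => e _⟩⟩
  map_one' := rfl
  map_mul' _ _ := rfl
  map_zero' := rfl
  map_add' _ _ := rfl
  commutes' _ := rfl

theorem ev_res (f : Sm U κ) (x : V) : ev x (res h f) = ev ⟨x, h x.2⟩ f := rfl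

theorem bod_res (f : Sm U κ) (x : V) : bod x (res h f) = bod ⟨x, h x.2⟩ f := rfl

theorem res_mul (f g : Sm U κ) : res h (f * g) = res h f * res h g := rfl
theorem res_add (f g : Sm U κ) : res h (f + g) = res h f + res h g := rfl
theorem res_sub (f g : Sm U κ) : res h (f - g) = res h f - res h g := rfl
theorem res_smul (c : ℂ) (f : Sm U κ) : res h (c • f) = c • res h f := rfl
theorem res_zero : res h (0 : Sm U κ) = 0 := rfl
theorem res_sum {ι : Type*} (s : Finset ι) (f : ι → Sm U κ) :
    res h (∑ i ∈ s, f i) = ∑ i ∈ s, res h (f i) := map_sum (res h) f s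

theorem res_par {p : ZMod 2} {f : Sm U κ} (hf : IsPar p f) : IsPar p (res h f) :=
  isPar_iff.mpr fun x => isPar_iff.mp hf ⟨x, h x.2⟩

theorem res_d (j : OddIx ε → κ) (A : Fin M) (f : Sm U κ) :
    res h ((dS j).d A f) = (dS j).d A (res h f) := ext_ev fun x => by
  rw [ev_res, ev_dS, ev_dS]
  exact dL_congr V.2 (fun y hy => by rw [extz_apply _ (h hy), extz_apply _ hy]; rfl) x.2 A

theorem res_dr (j : OddIx ε → κ) (A : Fin M) (f : Sm U κ) :
    res h ((dS j).dr A f) = (dS j).dr A (res h f) := by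
  rw [SDom.dr_apply, SDom.dr_apply, ← res_d]
  exact ext_ev fun x => by rw [ev_sgp, ev_res, ev_res, ev_sgp]

theorem res_dbar (j : OddIx ε → κ) (Ki : Matrix (Fin M) (Fin M) (Sm U κ)) (A : Fin M)
    (f : Sm U κ) : res h ((dS j).dbar Ki A f) = (dS j).dbar (Ki.map (res h)) A (res h f) := by
  rw [SDom.dbar_apply, SDom.dbar_apply, res_sum]
  refine Finset.sum_congr rfl fun B _ => ?_
  rw [res_mul, res_dr]; rfl

theorem res_br (j : OddIx ε → κ) (E : Fin M → Fin M → Sm U κ) (f g : Sm U κ) :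
    res h ((dS j).br E f g) = (dS j).br (fun A B => res h (E A B)) (res h f) (res h g) := by
  unfold SDom.br
  rw [res_sum]
  refine Finset.sum_congr rfl fun A _ => ?_
  rw [res_sum]
  refine Finset.sum_congr rfl fun B _ => ?_
  rw [res_mul, res_mul, res_dr, res_d]

theorem res_matrix_mul {n : Type} [Fintype n] [DecidableEq n] {P Q : Matrix n n (Sm U κ)}
    (e : P * Q = 1) : P.map (res h) * Q.map (res h) = 1 := by
  rw [← Matrix.map_mul, e, Matrix.map_one _ (map_zero _) (map_one _)]

theorem res_jac (j : OddIx ε → κ) (y : Fin M → Sm U κ) :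
    ((dS j).jac y).map (res h) = (dS j).jac fun A => res h (y A) :=
  Matrix.ext fun A B => res_dr h j B (y A)

end restriction

theorem fderiv_bod (g : Sm U (OddIx ε)) (x : U) (v : Pt ε) :
    fderiv ℝ (fun x => body (extz g x)) x v =
      ∑ B : {A // ε A = 0}, (v B : ℂ) * bod x ((dS id).dr B.1 g) := by
  have hd := (smooth_extz g).differentiableAt U.2 x.2
  have h1 : HasFDerivAt (fun x => body (extz g x)) ((toCLM (bodyₐ (κ := OddIx ε)).toLinearMap).comp
      (fderiv ℝ (extz g) x)) (x : Pt ε) :=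
    (toCLM (bodyₐ (κ := OddIx ε)).toLinearMap).hasFDerivAt.comp (x : Pt ε) hd.hasFDerivAt
  have e : v = ∑ i, v i • Pi.single i (1 : ℝ) := by
    conv_lhs => rw [← Finset.univ_sum_single v]
    refine Finset.sum_congr rfl fun i _ => ?_
    rw [← Pi.single_smul, smul_eq_mul, mul_one]
  rw [h1.fderiv]
  conv_lhs => rw [e]
  rw [map_sum]
  refine Finset.sum_congr rfl fun B _ => ?_
  rw [map_smul, Complex.real_smul, bod_apply, ev_dr, dR, dif_pos B.2]
  rfl

variable {y : Fin M → Sm U (OddIx ε)} (hy : ∀ A, IsPar (ε A) (y A))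
  {Ki : Matrix (Fin M) (Fin M) (Sm U (OddIx ε))}
  (k1 : (dS id).jac y * Ki = 1) (k2 : Ki * (dS id).jac y = 1)

/-- The bodies of the even coordinates. -/
def chart (y : Fin M → Sm U (OddIx ε)) (x : Pt ε) : Pt ε := fun i => (body (extz (y i.1) x)).re

theorem contDiffOn_chart : ContDiffOn ℝ ((⊤ : ℕ∞) : WithTop ℕ∞) (chart y) U :=
  contDiffOn_pi.mpr fun i =>
    Complex.reCLM.contDiff.comp_contDiffOn (contDiffOn_body (y i.1))

variable (real : ∀ A (x : U), (bod x (y A)).im = 0)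

include real

theorem chart_apply (x : U) (i : {A // ε A = 0}) : (chart y x i : ℂ) = bod x (y i.1) := by
  apply Complex.ext
  · rw [Complex.ofReal_re, chart, extz_coe]; rfl
  · rw [Complex.ofReal_im, real]

theorem fderiv_chart (x : U) (v : Pt ε) (i : {A // ε A = 0}) :
    (fderiv ℝ (chart y) x v i : ℂ) = ∑ B : {A // ε A = 0}, (v B : ℂ) * bod x ((dS id).jac y i.1 B) := by
  have hd : DifferentiableAt ℝ (fun x => body (extz (y i.1) x)) x :=
    ((contDiffOn_body (y i.1)).contDiffAt (U.2.mem_nhds x.2)).differentiableAt (by simp)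
  have hc : DifferentiableAt ℝ (chart y) x :=
    (contDiffOn_chart.contDiffAt (U.2.mem_nhds x.2)).differentiableAt (by simp)
  have h1 : HasFDerivAt (fun x => ((chart y x i : ℝ) : ℂ))
      (Complex.ofRealCLM.comp ((ContinuousLinearMap.proj i).comp (fderiv ℝ (chart y) x))) (x : Pt ε) :=
    Complex.ofRealCLM.hasFDerivAt.comp (x : Pt ε)
      ((ContinuousLinearMap.proj (R := ℝ) (φ := fun _ : {A // ε A = 0} => ℝ) i).hasFDerivAt.comp
        (x : Pt ε) hc.hasFDerivAt)
  have h2 : (fun x => ((chart y x i : ℝ) : ℂ)) =ᶠ[nhds (x : Pt ε)]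
      fun x => body (extz (y i.1) x) :=
    Filter.eventuallyEq_of_mem (U.2.mem_nhds x.2) fun x' hx' => by
      rw [chart_apply real ⟨x', hx'⟩, bod_apply, extz_apply _ hx']
  have h3 := congrArg (fun L => L v) ((h1.congr_of_eventuallyEq h2.symm).fderiv)
  exact h3.symm.trans (fderiv_bod (y i.1) x v)

include hy k1 k2

/-- Odd Jacobian entries have no body, so the bodies of the even-even blocks of `Ki` and of the
Jacobian are inverse to each other. The derivative of the chart is thus an injective endomorphism of
a finite-dimensional space. -/
theorem exists_fderiv_chart (x : U) : ∃ L : Pt ε ≃L[ℝ] Pt ε,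
    HasFDerivAt (chart y) (L : Pt ε →L[ℝ] Pt ε) x := by
  have pJ := (dS id).jac_par hy k1 k2
  have pK := pJ.inv k1 k2
  have hc : DifferentiableAt ℝ (chart y) x :=
    (contDiffOn_chart.contDiffAt (U.2.mem_nhds x.2)).differentiableAt (by simp)
  have hinj : Function.Injective (fderiv ℝ (chart y) x) := by
    rw [injective_iff_map_eq_zero]
    intro v hv
    funext C
    have h1 : ∀ i : {A // ε A = 0}, ∑ B : {A // ε A = 0}, (v B : ℂ) * bod x ((dS id).jac y i.1 B) = 0 :=
      fun i => by rw [← fderiv_chart real, hv]; rfl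
    have h2 : ∀ B : {A // ε A = 0}, ∑ i : {A // ε A = 0}, bod x (Ki C.1 i) * bod x ((dS id).jac y i.1 B) =
        if C = B then 1 else 0 := fun B => by
      have h3 := congrArg (bod x) (congrFun (congrFun k2 C.1) B.1)
      rw [Matrix.mul_apply, bod_sum, ← Fintype.sum_subtype_add_sum_subtype (fun A => ε A = 0)] at h3
      rw [Finset.sum_eq_zero (s := (Finset.univ : Finset {k // ¬ ε k = 0})), add_zero] at h3
      · simp only [bod_mul] at h3
        rw [h3, Matrix.one_apply]
        by_cases hCB : C = B
        · rw [if_pos (congrArg _ hCB), if_pos hCB, map_one]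
        · rw [if_neg (fun e => hCB (Subtype.ext e)), if_neg hCB, map_zero]
      · intro A _
        rw [bod_mul, bod_of_odd ((pK C.1 A.1).cast (by
          rw [C.2, (zmod2_cases _).resolve_left A.2, zero_add])), zero_mul]
    have h3 : ∑ i : {A // ε A = 0}, bod x (Ki C.1 i) *
        ∑ B : {A // ε A = 0}, (v B : ℂ) * bod x ((dS id).jac y i.1 B) = v C := by
      simp only [Finset.mul_sum]
      rw [Finset.sum_comm]
      have : ∀ B : {A // ε A = 0}, ∑ i : {A // ε A = 0}, bod x (Ki C.1 i) *
          ((v B : ℂ) * bod x ((dS id).jac y i.1 B)) = if C = B then (v B : ℂ) else 0 := fun B => by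
        have := congrArg ((v B : ℂ) * ·) (h2 B)
        simp only [Finset.mul_sum, mul_ite, mul_one, mul_zero] at this
        rw [← this]
        exact Finset.sum_congr rfl fun i _ => mul_left_comm _ _ _
      rw [Finset.sum_congr rfl fun B _ => this B, Finset.sum_ite_eq, if_pos (Finset.mem_univ _)]
    rw [Finset.sum_eq_zero fun i _ => by rw [h1, mul_zero]] at h3
    exact_mod_cast h3.symm
  refine ⟨(LinearEquiv.ofInjectiveEndo (fderiv ℝ (chart y) x : Pt ε →ₗ[ℝ] Pt ε)
    hinj).toContinuousLinearEquiv, ?_⟩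
  exact hc.hasFDerivAt

omit real in
/-- A decomposition of the body of a function that does not depend on the odd coordinates extends
to the function. -/
theorem eq_const_add_of_body (z : Fin M → Prop) [DecidablePred z] {g : Sm U (OddIx ε)}
    (hg : ∀ A, ε A = 1 → (dS id).dbar Ki A g = 0) {c : ℂ} {u : {A // ε A = 0} → Pt ε → ℂ}
    (hu : ∀ i, ContDiffOn ℝ ((⊤ : ℕ∞) : WithTop ℕ∞) (u i) U)
    (hb : ∀ x : U, bod x g = c + ∑ i : {A // ε A = 0}, if z i.1 then bod x (y i.1) * u i x else 0) :
    ∃ w : Fin M → Sm U (OddIx ε), g = c • 1 + ∑ A, sel z y A * w A := by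
  choose û hû hû' using fun i => exists_lift hy k1 k2 (u i) (hu i)
  let w : Fin M → Sm U (OddIx ε) := fun A => if hA : ε A = 0 then û ⟨A, hA⟩ else 0
  have w0 : ∀ i : {A // ε A = 0}, w i.1 = û i := fun i => dif_pos i.2
  have w1 : ∀ A, ¬ ε A = 0 → w A = 0 := fun A hA => dif_neg hA
  have hw : ∀ B A, ε B = 1 → (dS id).dbar Ki B (w A) = 0 := fun B A hB => by
    by_cases hA : ε A = 0
    · rw [w0 ⟨A, hA⟩]; exact hû _ B hB
    · rw [w1 A hA]; exact map_zero _
  -- The coefficients are lifted to functions independent of the odd coordinates. The difference of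
  -- both sides is then independent of them and has no body, so it vanishes.
  refine ⟨w, sub_eq_zero.mp (eq_zero_of_dbar hy k1 k2 (fun B hB => ?_) fun x => ?_)⟩
  · rw [map_sub, hg B hB, (dS id).dbar_combination hy k1 k2 z c (fun A => hw B A hB)
      (w1 B (by rw [hB]; decide)), sub_zero]
  · have e2 : ∀ i : {A // ε A = 0}, bod x (sel z y i.1 * w i.1) =
        if z i.1 then bod x (y i.1) * u i x else 0 := fun i => by
      rw [bod_mul, w0, hû']
      unfold sel
      split_ifs with hi
      · rfl
      · exact zero_mul _
    have e3 : bod x (c • (1 : Sm U (OddIx ε))) = c := body_smul_one c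
    rw [bod_sub, hb, bod_add, bod_sum, e3,
      ← Fintype.sum_subtype_add_sum_subtype (fun A => ε A = 0)
      (fun A => bod x (sel z y A * w A)),
      Finset.sum_eq_zero (s := (Finset.univ : Finset {k // ¬ ε k = 0}))
        (fun A _ => by rw [w1 A.1 A.2, mul_zero]; rfl), add_zero, Finset.sum_congr rfl fun i _ => e2 i, sub_self]

omit k1 k2 real in
theorem bod_eq_zero_of_mem (z : Fin M → Prop) [DecidablePred z] {a : Sm U (OddIx ε)}
    (ha : a ∈ genIdeal (sel z y) ε (SDom.isPar_sel hy z)) {x : U} (hx : ∀ A, z A → bod x (y A) = 0) :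
    bod x a = 0 := by
  obtain ⟨u, rfl⟩ := ha
  rw [bod_sum]
  refine Finset.sum_eq_zero fun A _ => ?_
  rw [bod_mul]
  unfold sel
  split_ifs with hA
  · rw [hx A hA, zero_mul]
  · exact zero_mul _

omit k1 in
theorem fderiv_bod_chain {g : Sm U (OddIx ε)} (hg : ∀ A, ε A = 1 → (dS id).dbar Ki A g = 0) (x : U)
    (v : Pt ε) : fderiv ℝ (fun x => body (extz g x)) x v =
      ∑ A : {A // ε A = 0}, bod x ((dS id).dbar Ki A g) * (fderiv ℝ (chart y) x v A : ℂ) := by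
  have e : ∀ B : {A // ε A = 0}, (v B : ℂ) * bod x ((dS id).dr B.1 g) =
      ∑ A : {A // ε A = 0}, bod x ((dS id).dbar Ki A g) *
        ((v B : ℂ) * bod x ((dS id).jac y A B)) := fun B => by
    rw [(dS id).dr_eq_dbar k2, bod_sum, Finset.mul_sum,
      ← Fintype.sum_subtype_add_sum_subtype (fun A => ε A = 0),
      Finset.sum_eq_zero (s := (Finset.univ : Finset {k // ¬ ε k = 0})), add_zero]
    · refine Finset.sum_congr rfl fun A _ => ?_
      rw [bod_mul, mul_left_comm]
    · intro A _
      rw [hg A.1 ((zmod2_cases _).resolve_left A.2), zero_mul]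
      exact mul_zero _
  rw [fderiv_bod, Finset.sum_congr rfl fun B _ => e B, Finset.sum_comm]
  refine Finset.sum_congr rfl fun A _ => ?_
  rw [← Finset.mul_sum, fderiv_chart real]

omit k1 k2 in
-- Selected odd coordinates have no body and impose no condition on points; the surface is the zero
-- set of the selected chart coordinates.
theorem surface_eq (z : Fin M → Prop) {S : Set (Pt ε)}
    (hS : ∀ x, x ∈ S ↔ ∃ h : x ∈ U, ∀ A, z A → bod ⟨x, h⟩ (y A) = 0) :
    S = {x ∈ (U : Set (Pt ε)) | ∀ i : {A // ε A = 0}, z i.1 → chart y x i = 0} := by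
  ext x
  rw [hS]
  constructor
  · rintro ⟨h, hx⟩
    refine ⟨h, fun i hi => ?_⟩
    have := chart_apply real ⟨x, h⟩ i
    rw [hx i.1 hi] at this
    exact_mod_cast this
  · rintro ⟨h, hx⟩
    refine ⟨h, fun A hA => ?_⟩
    rcases zmod2_cases (ε A) with h0 | h1
    · rw [← chart_apply real ⟨x, h⟩ ⟨A, h0⟩, hx ⟨A, h0⟩ hA, Complex.ofReal_zero]
    · exact bod_of_odd ((hy A).cast h1) _

omit k1 k2 in
theorem injOn_chart (inj : ∀ x x' : U, (∀ A, bod x (y A) = bod x' (y A)) → x = x') :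
    Set.InjOn (chart y) U := by
  intro x hx x' hx' hxx
  have := inj ⟨x, hx⟩ ⟨x', hx'⟩ fun A => by
    rcases zmod2_cases (ε A) with h0 | h1
    · rw [← chart_apply real ⟨x, hx⟩ ⟨A, h0⟩, ← chart_apply real ⟨x', hx'⟩ ⟨A, h0⟩]
      exact congrArg _ (congrFun hxx _)
    · rw [bod_of_odd ((hy A).cast h1), bod_of_odd ((hy A).cast h1)]
  exact congrArg Subtype.val this

/-- A function whose derivatives along the unconstrained coordinates vanish on the constraint
surface is, near a connected constraint surface, a constant modulo the constraints. -/
theorem eq_const_add (inj : ∀ x x' : U, (∀ A, bod x (y A) = bod x' (y A)) → x = x')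
    (z : Fin M → Prop) [DecidablePred z] {f : Sm U (OddIx ε)}
    (hf : ∀ A, ¬ z A → (dS id).dbar Ki A f ∈ genIdeal (sel z y) ε (SDom.isPar_sel hy z))
    {S : Set (Pt ε)} (hS : ∀ x, x ∈ S ↔ ∃ h : x ∈ U, ∀ A, z A → bod ⟨x, h⟩ (y A) = 0)
    (hc : IsPreconnected S) :
    ∃ (V : Opens (Pt ε)) (hV : V ≤ U) (c : ℂ) (u : Fin M → Sm V (OddIx ε)), S ⊆ V ∧
      res hV f = c • 1 + ∑ A, res hV (sel z y A) * u A := by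
  -- Modulo the ideal, `f` is replaced by a function that does not depend on the odd coordinates;
  -- only its body has to be studied.
  obtain ⟨g, hg, ⟨r, hr⟩, hgI⟩ := (dS id).exists_odd_const_mod hy k1 k2 z hf
  obtain ⟨V', c, u, oV, hSV, hVU, hu, hφ⟩ := chart_hadamard
    (fun i : {A // ε A = 0} => z i.1) U.2 contDiffOn_chart
    (fun x hx => exists_fderiv_chart hy k1 k2 real ⟨x, hx⟩) (injOn_chart hy real inj)
    (contDiffOn_body g) (surface_eq hy real z hS) hc (by
      intro x hx v hv
      obtain ⟨hxU, hx⟩ := (hS x).mp hx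
      -- Along selected coordinates the vector has no component, and along the others the derivative
      -- of `g` lies in the ideal, whose elements have no body on the surface.
      rw [fderiv_bod_chain hy k2 real hg ⟨x, hxU⟩]
      refine Finset.sum_eq_zero fun A _ => ?_
      by_cases hA : z A
      · rw [hv A hA, Complex.ofReal_zero, mul_zero]
      · rw [bod_eq_zero_of_mem hy z (hgI A hA) hx, zero_mul])
  let V : Opens (Pt ε) := ⟨V', oV⟩
  have hV : V ≤ U := hVU
  have k1' : (dS id).jac (fun A => res hV (y A)) * Ki.map (res hV) = 1 := by
    rw [← res_jac]; exact res_matrix_mul hV k1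
  have k2' : Ki.map (res hV) * (dS id).jac (fun A => res hV (y A)) = 1 := by
    rw [← res_jac]; exact res_matrix_mul hV k2
  obtain ⟨w, hw⟩ := eq_const_add_of_body (U := V) (fun A => res_par hV (hy A)) k1' k2' z
    (g := res hV g) (fun B hB => by rw [← res_dbar, hg B hB, res_zero]) hu (fun x => by
      rw [bod_res, bod_apply, ← extz_apply g (hVU x.2), hφ x x.2]
      congr 1
      refine Finset.sum_congr rfl fun i _ => ?_
      split_ifs
      · rw [chart_apply real ⟨x, hVU x.2⟩ i]; rfl
      · rfl)
  have e1 : ∀ A, res hV (sel z y A) = sel z (fun A => res hV (y A)) A := fun A => by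
    unfold sel
    split_ifs <;> rfl
  refine ⟨V, hV, c, fun A => w A + res hV (r A), hSV, ?_⟩
  have e : f = g + ∑ A, sel z y A * r A := by rw [← hr]; abel
  rw [e, res_add, hw, res_sum, add_assoc, ← Finset.sum_add_distrib]
  congr 1
  refine Finset.sum_congr rfl fun A _ => ?_
  rw [res_mul, e1, mul_add]

end Sm

end SuperBV
end

/-! ### Reality of bodies and smooth logarithms. -/

open scoped BigOperators
noncomputable section
set_option linter.unusedSectionVars false

namespace SuperBV
open scoped Grassmann.Alg
open SuperRing Grassmann TopologicalSpace

variable {M : ℕ} {ε : Fin M → ZMod 2} {κ : Type} [Fintype κ] [LinearOrder κ]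

namespace Grassmann

theorem conj_sgn (S T : Finset κ) : (starRingEnd ℂ) (sgn S T) = sgn S T := by
  rw [sgn, map_pow, map_neg, map_one]

/-- Complex conjugation of the coefficients. -/
def conj : Grassmann κ →+* Grassmann κ where
  toFun f S := (starRingEnd ℂ) (f S)
  map_one' := by
    funext S
    change (starRingEnd ℂ) (if S = ∅ then 1 else 0) = if S = ∅ then 1 else 0
    split_ifs <;> simp
  map_mul' f g := by
    funext S
    change (starRingEnd ℂ) (∑ T ∈ S.powerset, sgn T (S \ T) * f T * g (S \ T)) =
      ∑ T ∈ S.powerset, sgn T (S \ T) * (starRingEnd ℂ) (f T) * (starRingEnd ℂ) (g (S \ T))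
    rw [map_sum]
    refine Finset.sum_congr rfl fun T _ => ?_
    rw [map_mul (starRingEnd ℂ) (sgn T (S \ T) * f T), map_mul (starRingEnd ℂ) (sgn T (S \ T)),
      conj_sgn]
  map_zero' := funext fun _ => map_zero _
  map_add' f g := funext fun S => map_add _ (f S) (g S)

theorem conj_eq_iff {f : Grassmann κ} : conj f = f ↔ IsReal f := by
  constructor
  · exact fun h S => Complex.conj_eq_iff_im.mp (congrFun h S)
  · exact fun h => funext fun S => Complex.conj_eq_iff_im.mpr (h S)

theorem IsReal.gsigp {f : Grassmann κ} (hf : IsReal f) (p : ZMod 2) : IsReal (gsigp p f) := by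
  rcases zmod2_cases p with rfl | rfl
  · exact hf
  · intro S
    change ((-1 : ℂ) ^ S.card * f S).im = 0
    rcases neg_one_pow_eq_or ℂ S.card with h | h <;> rw [h] <;> simp [hf S]

theorem IsReal.leftDer {f : Grassmann κ} (hf : IsReal f) (i : κ) : IsReal (leftDer i f) := by
  intro S
  unfold Grassmann.leftDer
  split_ifs
  · rfl
  · rw [Complex.mul_im, hf, mul_zero, zero_add, Complex.conj_eq_iff_im.mp (conj_sgn _ _), zero_mul]

/-- The imaginary part of a coefficient. -/
def imL (S : Finset κ) : Grassmann κ →ₗ[ℝ] ℝ where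
  toFun f := (f S).im
  map_add' f g := Complex.add_im (f S) (g S)
  map_smul' c f := by
    change ((c : ℂ) * f S).im = _
    simp

end Grassmann

open Grassmann

namespace Sm

variable {U : Opens (Pt ε)}

/-- The real functions. -/
def realS (U : Opens (Pt ε)) (κ : Type) [Fintype κ] [LinearOrder κ] : Subring (Sm U κ) where
  carrier := {f | ∀ x, conj (ev x f) = ev x f}
  mul_mem' {f g} hf hg x := by rw [ev_mul, map_mul, hf, hg]
  one_mem' x := by rw [ev_one, map_one]
  add_mem' {f g} hf hg x := by rw [ev_add, map_add, hf, hg]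
  zero_mem' x := by rw [ev_zero, map_zero]
  neg_mem' {f} hf x := by rw [ev_neg, map_neg, hf]

theorem mem_realS {f : Sm U κ} : f ∈ realS U κ ↔ ∀ x, IsReal (ev x f) :=
  forall_congr' fun _ => conj_eq_iff

theorem bod_im {f : Sm U κ} (hf : f ∈ realS U κ) (x : U) : (bod x f).im = 0 :=
  mem_realS.mp hf x ∅

theorem sgp_mem_realS {f : Sm U κ} (hf : f ∈ realS U κ) (p : ZMod 2) : sgp p f ∈ realS U κ :=
  mem_realS.mpr fun x => by
    rw [ev_sgp]; exact (mem_realS.mp hf x).gsigp p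

theorem d_mem_realS {f : Sm U κ} (hf : f ∈ realS U κ) (j : OddIx ε → κ) (A : Fin M) :
    (dS j).d A f ∈ realS U κ := mem_realS.mpr fun x => by
  rw [ev_dS]
  have hr : ∀ y, IsReal (extz f y) := fun y => by
    by_cases hy : y ∈ U
    · rw [extz_apply _ hy]; exact mem_realS.mp hf _
    · have : extz f y = 0 := dif_neg hy
      rw [this]; exact fun _ => rfl
  by_cases hA : ε A = 0
  · intro S
    rw [dL_even hA]
    have hd : DifferentiableAt ℝ (extz f) x :=
      ((smooth_extz f).contDiffAt (U.2.mem_nhds x.2)).differentiableAt (by simp)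
    have h1 := ((imL S).toContinuousLinearMap.hasFDerivAt.comp (x : Pt ε) hd.hasFDerivAt)
    have h0 : ((imL (κ := κ) S).toContinuousLinearMap ∘ extz f) = fun _ => (0 : ℝ) :=
      funext fun y => hr y S
    rw [h0] at h1
    have h2 := h1.unique (hasFDerivAt_const (0 : ℝ) (x : Pt ε))
    exact DFunLike.congr_fun h2 (Pi.single ⟨A, hA⟩ 1)
  · rw [dL_odd hA]
    exact (hr x).leftDer _

theorem dr_mem_realS {f : Sm U κ} (hf : f ∈ realS U κ) (j : OddIx ε → κ) (A : Fin M) :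
    (dS j).dr A f ∈ realS U κ := sgp_mem_realS (d_mem_realS hf j A) _

theorem br_mem_realS {E : Fin M → Fin M → Sm U κ} (hE : ∀ A B, E A B ∈ realS U κ) {f g : Sm U κ}
    (hf : f ∈ realS U κ) (hg : g ∈ realS U κ) (j : OddIx ε → κ) :
    (dS j).br E f g ∈ realS U κ :=
  Subring.sum_mem _ fun A _ => Subring.sum_mem _ fun B _ =>
    Subring.mul_mem _ (Subring.mul_mem _ (dr_mem_realS hf j A) (hE A B)) (d_mem_realS hg j B)

variable {n : Type} [Fintype n] [DecidableEq n]

/-- The conjugate of an inverse of a real matrix is again an inverse of it. -/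
theorem inverse_mem_realS {N Ni : Matrix n n (Sm U κ)} (hN : ∀ i j, N i j ∈ realS U κ)
    (h1 : N * Ni = 1) (h2 : Ni * N = 1) (i j : n) : Ni i j ∈ realS U κ := fun x => by
  have e1 : (Ni.map (ev x)) * (N.map (ev x)) = 1 := by
    have := congrArg (ev x).toRingHom.mapMatrix h2
    rwa [map_mul, map_one] at this
  have e2 : (N.map (ev x)) * ((Ni.map (ev x)).map conj) = 1 := by
    have := congrArg (conj.comp (ev x).toRingHom).mapMatrix h1
    rw [map_mul, map_one] at this
    refine Eq.trans ?_ this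
    congr 1
    exact Matrix.ext fun i j => (hN i j x).symm
  have e3 := left_inv_eq_right_inv e1 e2
  exact (congrFun (congrFun e3 i) j).symm

theorem evb_evp (x : U) (f : Sm U κ) : evb x (evp f) = bod x f := by
  have := congrArg (fun z : evenSubring κ => body (z : Grassmann κ)) (evE_evp x f)
  refine this.trans ?_
  simp [evenPart, body, bod_apply]

/-- On bodies the odd blocks drop out, and the Berezinian is a quotient of two determinants of real
matrices. -/
theorem ber_body_real {p : n → ZMod 2} {N : Matrix n n (Sm U κ)} (hN : MatPar p p N)
    (hr : ∀ i j, N i j ∈ realS U κ) (hD : IsUnit (berD p N).det) (x : U) :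
    (bod x (ber p N : Sm U κ)).im = 0 := by
  have hodd : ∀ i : {i // p i ≠ 0}, p i = 1 := fun i => (zmod2_cases _).resolve_left i.2
  have hS : (berS p N).map (evb x) = Matrix.of fun i j => bod x (N i.1 j.1) := Matrix.ext fun i j => by
    refine (evb_evp x ((blk (p · = 0) (p · = 0) N -
      blk (p · = 0) (p · ≠ 0) N * coeM (berD p N)⁻¹ * blk (p · ≠ 0) (p · = 0) N) i j)).trans ?_
    rw [Matrix.sub_apply, bod_sub, Matrix.mul_apply, bod_sum]
    have h0 : ∀ k, bod x ((blk (p · = 0) (p · ≠ 0) N * coeM (berD p N)⁻¹) i k *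
        blk (p · ≠ 0) (p · = 0) N k j) = 0 := fun k => by
      rw [bod_mul]
      have := bod_of_odd ((hN k j).cast (by rw [hodd, j.2, add_zero])) x
      exact mul_eq_zero_of_right _ this
    rw [Finset.sum_eq_zero fun k _ => h0 k, sub_zero]
    rfl
  have hDm : (berD p N).map (evb x) = Matrix.of fun i j => bod x (N i.1 j.1) :=
    Matrix.ext fun i j => evb_evp x (N i j)
  have key : evb x (ber p N) =
      (Matrix.of fun i j => bod x (N i j) : Matrix {i // p i = 0} {i // p i = 0} ℂ).det *
        ((Matrix.of fun i j => bod x (N i j) : Matrix {i // p i ≠ 0} {i // p i ≠ 0} ℂ).det)⁻¹ := by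
    rw [ber, map_mul (evb x), map_ring_inverse (evb x) hD, (evb x).map_det, (evb x).map_det,
      RingHom.mapMatrix_apply, RingHom.mapMatrix_apply, hS, hDm, Ring.inverse_eq_inv']
  have hreal : ∀ {m : Type} [Fintype m] [DecidableEq m] (a : m → n),
      (starRingEnd ℂ) (Matrix.of fun i j => bod x (N (a i) (a j)) : Matrix m m ℂ).det =
        (Matrix.of fun i j => bod x (N (a i) (a j)) : Matrix m m ℂ).det := fun a => by
    rw [RingHom.map_det]
    congr 1
    exact Matrix.ext fun i j => Complex.conj_eq_iff_im.mpr (bod_im (hr _ _) x)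
  refine Complex.conj_eq_iff_im.mp ?_
  change (starRingEnd ℂ) (evb x (ber p N)) = evb x (ber p N)
  rw [key, map_mul, map_inv₀]
  exact congrArg₂ (fun a b => a * b⁻¹) (hreal Subtype.val) (hreal Subtype.val)

end Sm

/-! ### Logarithms -/

namespace SuperRing

variable {R : Type} [Ring R] [Algebra ℂ R] [SuperRing R] {q : ZMod 2} {X : R →ₗ[ℂ] R}

theorem IsRDer.pow (hX : IsRDer q X) {s : R} (hs : IsPar 0 s) (k : ℕ) :
    X (s ^ (k + 1)) = ((k : ℂ) + 1) • (s ^ k * X s) := by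
  induction k with
  | zero => simp
  | succ k ih =>
    rw [pow_succ', hX.leib_even _ (hs.pow _), ih, mul_smul_comm, ← mul_assoc, ← pow_succ',
      Nat.cast_succ, add_smul ((k : ℂ) + 1) (1 : ℂ), one_smul]

/-- The logarithm of `1 + s` for nilpotent `s`. -/
def nlog (N : ℕ) (s : R) : R := ∑ k ∈ Finset.Icc 1 N, ((-1 : ℂ) ^ (k + 1) / (k : ℂ)) • s ^ k

theorem IsRDer.nlog (hX : IsRDer q X) {s : R} (hs : IsPar 0 s) {N : ℕ} (hN : s ^ (N + 1) = 0) :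
    (1 + s) * X (nlog N s) = X s := by
  have h1 : X (SuperRing.nlog N s) = (∑ j ∈ Finset.range N, (-s) ^ j) * X s := by
    rw [SuperRing.nlog, ← Finset.Ico_add_one_right_eq_Icc, Finset.sum_Ico_eq_sum_range, map_sum,
      Finset.sum_mul]
    refine Finset.sum_congr (by simp) fun j _ => ?_
    rw [map_smul, add_comm 1 j, hX.pow hs, smul_smul, neg_pow s j, ← smul_mul_assoc]
    congr 1
    have h : ((-1 : R)) ^ j = ((-1 : ℂ) ^ j) • (1 : R) := by
      rcases neg_one_pow_eq_or ℂ j with h | h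
      · rcases Nat.even_or_odd j with e | e
        · simp [e.neg_one_pow]
        · simp [e.neg_one_pow]
      · rcases Nat.even_or_odd j with e | e
        · simp [e.neg_one_pow]
        · simp [e.neg_one_pow]
    rw [h, smul_one_mul]
    congr 1
    have : (j : ℂ) + 1 ≠ 0 := Nat.cast_add_one_ne_zero j
    push_cast
    field_simp
    ring
  -- Differentiating `s ^ (N + 1) = 0` kills the remainder of the finite geometric sum.
  have h2 : s ^ N * X s = 0 := by
    have h3 := hX.pow hs N
    rw [hN, map_zero] at h3
    exact (smul_eq_zero.mp h3.symm).resolve_left (Nat.cast_add_one_ne_zero N)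
  have h4 : (1 + s) * ∑ j ∈ Finset.range N, (-s) ^ j = 1 - (-s) ^ N := by
    have := mul_neg_geom_sum (-s) N
    rwa [sub_neg_eq_add] at this
  rw [h1, ← mul_assoc, h4, sub_mul, one_mul, neg_pow, mul_assoc, h2, mul_zero, sub_zero]

theorem IsRDer.log (hX : IsRDer q X) {b l s : R} (hs : IsPar 0 s) {N : ℕ}
    (hN : s ^ (N + 1) = 0) (hl : X b = b * X l) :
    (b * (1 + s)) * X (l + SuperRing.nlog N s) = X (b * (1 + s)) := by
  have h1 : IsPar 0 (1 + s) := isPar_one.add hs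
  rw [map_add, mul_add, mul_assoc b _ (X (SuperRing.nlog N s)), hX.nlog hs hN, hX.leib_even b h1,
    map_add, hX.map_one, zero_add, hl, add_comm, ← mul_assoc, h1.comm_zero b]

end SuperRing

namespace Sm

variable {U : Opens (Pt ε)}

/-- The principal logarithm jumps across the negative axis, but a continuous real function without
zeros keeps its sign locally. The argument is then locally constant and the logarithm is smooth also
for negative values. -/
theorem contDiffOn_clog {b : Pt ε → ℂ} (hb : ContDiffOn ℝ ((⊤ : ℕ∞) : WithTop ℕ∞) b U)
    (hr : ∀ x ∈ U, (b x).im = 0) (h0 : ∀ x ∈ U, b x ≠ 0) :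
    ContDiffOn ℝ ((⊤ : ℕ∞) : WithTop ℕ∞) (fun x => Complex.log (b x)) U := fun x hx => by
  have hU : (U : Set (Pt ε)) ∈ nhds x := U.2.mem_nhds hx
  have hbx := hb.contDiffAt hU
  have hre : ContDiffAt ℝ ((⊤ : ℕ∞) : WithTop ℕ∞) (fun y => (b y).re) x :=
    Complex.reCLM.contDiff.contDiffAt.comp x hbx
  have hne : (b x).re ≠ 0 := fun h => h0 x hx (Complex.ext h (hr x hx))
  have hlog : ContDiffAt ℝ ((⊤ : ℕ∞) : WithTop ℕ∞)
      (fun y => ((Real.log (b y).re : ℝ) : ℂ) + ((Complex.arg (b x) : ℝ) : ℂ) * Complex.I) x :=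
    (Complex.ofRealCLM.contDiff.contDiffAt.comp x (hre.log hne)).add contDiffAt_const
  refine (hlog.congr_of_eventuallyEq ?_).contDiffWithinAt
  have hbr : ∀ y ∈ U, b y = ((b y).re : ℂ) := fun y hy => Complex.ext rfl (hr y hy)
  have hlg : ∀ y ∈ U, Complex.log (b y) = ((Real.log (b y).re : ℝ) : ℂ) +
      ((Complex.arg (b y) : ℝ) : ℂ) * Complex.I := fun y hy => by
    rw [Complex.log]
    congr 2
    conv_lhs => rw [hbr y hy]
    rw [Complex.norm_real, Real.norm_eq_abs, Real.log_abs]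
  rcases lt_or_gt_of_ne hne with h | h
  · filter_upwards [hU, hre.continuousAt.eventually_lt continuousAt_const h] with y hy hy'
    rw [hlg y hy, hbr y hy, hbr x hx, Complex.arg_ofReal_of_neg h, Complex.arg_ofReal_of_neg hy']
  · filter_upwards [hU, continuousAt_const.eventually_lt hre.continuousAt h] with y hy hy'
    rw [hlg y hy, hbr y hy, hbr x hx, Complex.arg_ofReal_of_nonneg h.le,
      Complex.arg_ofReal_of_nonneg hy'.le]

/-- A smooth logarithm of an even function with real nowhere vanishing body. -/
theorem exists_log {f : Sm U κ} (hf : IsPar 0 f) (hr : ∀ x, (bod x f).im = 0)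
    (h0 : ∀ x, bod x f ≠ 0) (j : OddIx ε → κ) :
    ∃ l : Sm U κ, (∀ x, ev x l = glog (ev x f)) ∧ ∀ (q : ZMod 2) (E : Fin M → Fin M → Sm U κ)
      (g : Sm U κ), IsRDer q ((dS j).brL E g) → f * (dS j).br E l g = (dS j).br E f g := by
  have hb := contDiffOn_body f
  have e0 : ∀ y (hy : y ∈ U), body (extz f y) = bod ⟨y, hy⟩ f := fun y hy => by
    rw [extz_apply _ hy]; rfl
  have hl := contDiffOn_clog hb (fun y hy => by rw [e0 y hy]; exact hr _)
    (fun y hy => by rw [e0 y hy]; exact h0 _)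
  have hi : ContDiffOn ℝ ((⊤ : ℕ∞) : WithTop ℕ∞) (fun x => (body (extz f x))⁻¹) U :=
    hb.inv fun y hy => by rw [e0 y hy]; exact h0 _
  set n : Sm U κ := scal _ hi * f - 1 with hn
  have hnp : IsPar 0 n := by
    rw [hn]
    exact (((isPar_scal _ hi).mul hf).cast (add_zero _)).sub isPar_one
  have evn : ∀ x, ev x n = (body (ev x f))⁻¹ • ev x f - 1 := fun x => by
    rw [hn, ev_sub, ev_mul, ev_scal, extz_coe, ev_one, smul_one_mul]
  have hnil : n ^ (Fintype.card κ + 1) = 0 := pow_eq_zero_of_body fun x => by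
    rw [evn, ← bodyₐ_apply, map_sub, map_smul, map_one, bodyₐ_apply, smul_eq_mul,
      inv_mul_cancel₀ (show body (ev x f) ≠ 0 from h0 x), sub_self]
  -- The body is written as the exponential of its logarithm, for which the logarithmic derivative
  -- is known; the remaining factor is 1 plus a nilpotent function.
  set b : Sm U κ := scal (fun x => Complex.exp (Complex.log (body (extz f x)))) hl.cexp with hbdef
  have hfb : f = b * (1 + n) := ext_ev fun x => by
    rw [ev_mul, ev_add, evn, ev_one, hbdef, ev_scal, add_sub_cancel, extz_coe, smul_one_mul,
      smul_smul, Complex.exp_log (show body (ev x f) ≠ 0 from h0 x)]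
    exact ((congrArg (· • ev x f) (mul_inv_cancel₀ (h0 x))).trans (one_smul _ _)).symm
  refine ⟨scal _ hl + nlog (Fintype.card κ) n, fun x => ?_, fun q E g hX => ?_⟩
  · rw [ev_add, nlog, ev_sum, ev_scal, extz_coe]
    unfold glog
    simp only [ev_smul, ev_pow, evn]
  · rw [← SDom.brL_apply, ← SDom.brL_apply]
    have hβ : (dS j).brL E g b = b * (dS j).brL E g (scal _ hl) := by
      simp only [SDom.brL_apply, SDom.br_eq_ham, Finset.mul_sum]
      refine Finset.sum_congr rfl fun A _ => ?_
      rw [← mul_assoc, SDom.dr_apply, SDom.dr_apply, hbdef, PS.dS_scal_exp, map_mul,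
        show sgp (ε A) (scal _ hl.cexp) = scal _ hl.cexp from ?_]
      have := (isPar_scal (κ := κ) _ hl.cexp).sgp (ε A)
      rwa [mul_zero, psign_zero, one_smul] at this
    have := hX.log hnp hnil hβ
    rw [← hfb] at this
    exact this

end Sm

end SuperBV
end

/-! ### Independence of the gauge functions; invertibility of the gauge matrix. -/

open scoped BigOperators
noncomputable section
set_option linter.unusedSectionVars false

namespace SuperBV
open SuperRing

namespace SDom

variable {R : Type} [Ring R] [Algebra ℂ R] [SuperRing R]
variable {ι : Type} [Fintype ι] [DecidableEq ι] {ε : ι → ZMod 2} (d : SDom R ε)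

section gauge

variable {E : ι → ι → R} (hE : IsBiv ε E)
variable {k t : Type} [Fintype k] [DecidableEq k] [Fintype t] [DecidableEq t]
  {δ : k → ZMod 2} (e : (k ⊕ k) ⊕ t ≃ ι)
  (eF : ∀ α, ε (e (Sum.inl (Sum.inl α))) = δ α + 1) (eG : ∀ α, ε (e (Sum.inl (Sum.inr α))) = δ α)
  {F G : k → R} {Θ : t → R} {y : ι → R} (yF : ∀ α, y (e (Sum.inl (Sum.inl α))) = F α)
  (yG : ∀ α, y (e (Sum.inl (Sum.inr α))) = G α) (yΘ : ∀ a, y (e (Sum.inr a)) = Θ a)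
  (hy : ∀ A, IsPar (ε A) (y A)) {Ki : Matrix ι ι R}
  (k1 : d.jac y * Ki = 1) (k2 : Ki * d.jac y = 1)

include hE eF eG yF yG yΘ hy k1 k2

/-- The combination of the action and the logarithm of the Jacobians that does not depend on the
gauge functions modulo the constraints. -/
theorem dbar_action_add_log_mem {I : Ideal R} [I.IsTwoSided] (mG : ∀ α, G α ∈ I)
    (cΘ : ∀ f a, d.br E (Θ a) f = 0) {ρ ρi : R} (hρ : IsPar 0 ρ) (hi : IsPar 0 ρi)
    (hρi : ρi * ρ = 1) {Mi : Matrix k k R}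
    (m1 : d.gmat E F G * Mi = 1) (m2 : Mi * d.gmat E F G = 1) {v : k → k → k → R}
    (hv : ∀ γ β, d.br E (G γ) (G β) = ∑ σ, G σ * v β σ γ)
    (pv : ∀ β σ γ, IsPar (δ σ + δ γ + (δ β + 1)) (v β σ γ))
    (hJ : ∀ α γ β, d.br E (d.br E (F α) (G γ)) (G β) -
      (d.br E (F α) (d.br E (G γ) (G β)) +
        psign ((δ β + 1) * (δ γ + 1)) • d.br E (d.br E (F α) (G β)) (G γ)) ∈ I)
    (hD : IsUnit (berD ε (d.jac y)).det) (hM : IsUnit (berD δ (d.gmat E F G)).det) {H l : R}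
    (hl : ∀ β, (ber ε (d.jac y) : R) * (ber δ (d.gmat E F G) : R) * ρi * d.br E l (G β) =
      d.br E ((ber ε (d.jac y) : R) * (ber δ (d.gmat E F G) : R) * ρi) (G β))
    (hH : ∀ β, d.lap E ρ ρi (G β) - d.br E H (G β) - ∑ γ, psign (δ γ) • v β γ γ ∈ I) (α : k) :
    d.dbar Ki (e (Sum.inl (Sum.inl α))) (H + (1 / 2 : ℂ) • l) ∈ I := by
  have hinv : ∀ γ β, d.br E (G γ) (G β) ∈ I := fun γ β => by
    rw [hv]; exact I.sum_mem fun σ _ => I.mul_mem_right _ (mG σ)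
  refine d.dbar_mem e yF yG yΘ k2 cΘ hinv m1 (fun β => ?_) α
  have pG := par_G e eG hy yG
  have pJ := d.jac_par hy k1 k2
  have pM := d.par_gmat hE e eF eG yF yG hy
  set J : R := (ber ε (d.jac y) : R) with hJd
  set N : R := (ber δ (d.gmat E F G) : R) with hNd
  have eJ : IsPar 0 J := coe_isPar _
  have eN : IsPar 0 N := coe_isPar _
  have hX := d.isRDer_brL hE (pG β)
  have x1 := ber_log hX pJ k1 k2 hD
  have x2 := ber_log hX pM m1 m2 hM
  have hlap := d.lap_gauge hE e eF eG yF yG yΘ hy k1 k2 mG cΘ hinv hρ hρi m1 m2 β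
    (fun γ => hv γ β) (pv β) (fun α γ => hJ α γ β)
  rw [← hJd] at x1
  rw [← hNd] at x2
  set tJ := strq (δ β + 1) ε (Ki * xmap (δ β + 1) ε (d.brL E (G β)) (d.jac y))
  set tN := strq (δ β + 1) δ (Mi * xmap (δ β + 1) δ (d.brL E (G β)) (d.gmat E F G))
  simp only [← brL_apply] at hl hlap hH ⊢
  set X := d.brL E (G β)
  have hr : ρ * ρi = 1 := by rw [hi.comm_zero, hρi]
  have x3 : X ρi = -(ρi * (ρi * X ρ)) := by
    have h := hX.leib_even ρi hρ
    rw [hρi, hX.map_one] at h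
    have h2 := congrArg (ρi * ·) h
    simp only [mul_zero, mul_add, ← mul_assoc ρi ρ, hρi, one_mul] at h2
    exact (neg_eq_of_add_eq_zero_right h2.symm).symm
  obtain ⟨Ji, hJi⟩ := (ber_isUnit pJ k1 k2 hD).exists_left_inv
  obtain ⟨Ni, hNi⟩ := (ber_isUnit pM m1 m2 hM).exists_left_inv
  have hJi' : (Ji : R) * J = 1 := congrArg (Subtype.val) hJi
  have hNi' : (Ni : R) * N = 1 := congrArg (Subtype.val) hNi
  have cancel : ρ * (Ni * Ji) * (J * N * ρi) = 1 := by
    rw [mul_assoc J, mul_assoc ρ, mul_assoc (Ni : R), ← mul_assoc (Ji : R), hJi', one_mul,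
      ← mul_assoc (Ni : R), hNi', one_mul, hr]
  -- The logarithmic derivative of J N / ρ along the field of `G β` is the sum of the two
  -- supertraces minus that of ρ. The factor is then cancelled, being a unit.
  have x4 : X (J * N * ρi) = J * N * ρi * (tJ + tN - ρi * X ρ) := by
    rw [hX.leib_even _ hi, x3, hX.leib_even _ eN, x1, x2, mul_sub, mul_add, mul_neg]
    have c1 : ρi * (J * (N * tN)) = J * N * ρi * tN := by
      rw [← mul_assoc J, ← mul_assoc ρi, ← hi.comm_zero]
    have c2 : ρi * (N * (J * tJ)) = J * N * ρi * tJ := by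
      rw [← mul_assoc N, ← mul_assoc ρi, ← hi.comm_zero, eN.comm_zero J]
    rw [mul_add, c1, c2, ← mul_assoc (J * N)]
    abel
  have x5 : X l = tJ + tN - ρi * X ρ := by
    have h : ρ * (Ni * Ji) * (J * N * ρi * X l) =
        ρ * (Ni * Ji) * (J * N * ρi * (tJ + tN - ρi * X ρ)) := congrArg _ ((hl β).trans x4)
    rwa [← mul_assoc (ρ * (Ni * Ji : R)), cancel, one_mul, ← mul_assoc (ρ * (Ni * Ji : R)), cancel,
      one_mul] at h
  -- Twice the first-order master equation is subtracted from the divergence formula: the Laplacians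
  -- and the traces of `v` cancel, and twice the bracket of H + ½ l with `G β` is left.
  have h2 := I.sub_mem hlap (smul_mem_ideal (2 : ℂ) (hH β))
  have h3 := smul_mem_ideal (1 / 2 : ℂ) h2
  convert h3 using 1
  rw [map_add, map_smul, x5]
  module

omit hE eF eG in
/-- On the constraint surface the matrix of brackets of gauge functions with constraints is
invertible. -/
theorem det_gmat_ne_zero {τ : t → ZMod 2} (hG : ∀ β, IsPar (δ β) (G β)) (hΘ : ∀ a, IsPar (τ a) (Θ a))
    {Ei : Matrix t t R} (h1 : d.cmat E Θ * Ei = 1) {L : Matrix ι ι R} (hL : L * Matrix.of E = 1)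
    (φ : R →ₐ[ℂ] ℂ) (hφ : ∀ a, IsPar 1 a → φ a = 0)
    (h0 : ∀ γ β, φ (d.br (d.dirE E Θ Ei) (G γ) (G β)) = 0) :
    (Matrix.of fun α β => φ (d.gmat (d.dirE E Θ Ei) F G α β)).det ≠ 0 := by
  intro hdet
  -- A null vector `v` of the body matrix is shown to give a linear relation between the
  -- differentials of the G's and the Θ's.
  obtain ⟨v, hv0, hv⟩ := Matrix.exists_mulVec_eq_zero_iff.mpr hdet
  have hd : ∀ {p : ZMod 2} {g : R} (A : ι), IsPar p g → φ (d.d A g) = φ (d.dr A g) := by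
    intro p g A hg
    rcases zmod2_cases (p + ε A) with h | h
    · rw [d.d_eq_dr hg, h, mul_zero, psign_zero, one_smul]
    · rw [hφ _ ((d.d_par hg).cast h), hφ _ (((d.isRDer_dr A).par hg).cast h)]
  -- The combination of the G's with coefficients `v` has vanishing Dirac bracket with all
  -- coordinates: with F by the choice of `v`, with G by involution on the surface, with Θ
  -- identically. So its Hamiltonian field vanishes at the point.
  have key : ∀ A, ∑ β, φ (d.br (d.dirE E Θ Ei) (y A) (G β)) * v β = 0 := fun A => by
    obtain ⟨i, rfl⟩ := e.surjective A
    rcases i with (α | γ) | a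
    · rw [yF]; exact congrFun hv α
    · rw [yG]; exact Finset.sum_eq_zero fun β _ => by rw [h0, zero_mul]
    · rw [yΘ]
      exact Finset.sum_eq_zero fun β _ => by rw [d.br_dirE_left h1, map_zero, zero_mul]
  have hw : ∀ B, ∑ β, φ (d.ham (d.dirE E Θ Ei) (G β) B) * v β = 0 := fun B => by
    have h : ∑ A, φ (Ki B A) * ∑ β, φ (d.br (d.dirE E Θ Ei) (y A) (G β)) * v β =
        ∑ β, φ (d.ham (d.dirE E Θ Ei) (G β) B) * v β := by
      simp only [Finset.mul_sum]
      rw [Finset.sum_comm]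
      refine Finset.sum_congr rfl fun β _ => ?_
      simp only [← mul_assoc, ← Finset.sum_mul, ← map_mul, ← map_sum]
      congr 2
      simp only [br_eq_ham, Finset.mul_sum, ← mul_assoc]
      rw [Finset.sum_comm]
      have h2 : ∀ C, ∑ A, Ki B A * d.dr C (y A) = (1 : Matrix ι ι R) B C := fun C => by
        rw [← k2, Matrix.mul_apply]; rfl
      simp only [← Finset.sum_mul, h2, Matrix.one_apply]
      simp
    rw [← h]
    exact Finset.sum_eq_zero fun A _ => by rw [key, mul_zero]
  have hham : ∀ g A, d.ham (d.dirE E Θ Ei) g A = d.ham E g A -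
      ∑ a, d.ham E (Θ a) A * ∑ b, Ei a b * d.br E (Θ b) g := fun g A => by
    unfold dirE
    rw [ham]
    simp only [sub_mul, Finset.sum_sub_distrib]
    congr 1
    simp only [Finset.sum_mul, Finset.mul_sum]
    rw [Finset.sum_comm]
    refine Finset.sum_congr rfl fun a _ => ?_
    rw [Finset.sum_comm]
    refine Finset.sum_congr rfl fun b _ => ?_
    rw [br_eq_cham, Finset.mul_sum, Finset.mul_sum]
    exact Finset.sum_congr rfl fun B _ => by simp only [mul_assoc]
  -- The Dirac field is the ordinary field of the combination of the G's minus that of a combination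
  -- of the Θ's with coefficients `c`. `κ` is the resulting covector in the coordinates `y`; it has
  -- no F-components.
  let c : t → ℂ := fun a => ∑ β, φ (∑ b, Ei a b * d.br E (Θ b) (G β)) * v β
  let κ : ι → ℂ := fun A => Sum.elim (Sum.elim 0 v) (-c) (e.symm A)
  have hκ : ∀ C, ∑ A, κ A * φ (d.dr C (y A)) =
      ∑ β, v β * φ (d.d C (G β)) - ∑ a, c a * φ (d.d C (Θ a)) := fun C => by
    rw [← Equiv.sum_comp e, Fintype.sum_sum_type, Fintype.sum_sum_type]
    simp only [κ, Equiv.symm_apply_apply, Sum.elim_inl, Sum.elim_inr, yF, yG, yΘ, Pi.zero_apply,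
      zero_mul, Finset.sum_const_zero, zero_add, Pi.neg_apply, neg_mul, Finset.sum_neg_distrib,
      hd C (hG _), hd C (hΘ _)]
    ring
  have hs : ∀ {s : Type} [Fintype s] (g : s → R) (w : s → ℂ) (A : ι),
      ∑ C, φ (E A C) * ∑ i, w i * φ (d.d C (g i)) = ∑ i, φ (d.ham E (g i) A) * w i := by
    intro s _ g w A
    simp only [ham, map_sum, map_mul, Finset.mul_sum, Finset.sum_mul]
    rw [Finset.sum_comm]
    exact Finset.sum_congr rfl fun i _ => Finset.sum_congr rfl fun C _ => by ring
  have hE0 : ∀ A, ∑ C, φ (E A C) * ∑ B, κ B * φ (d.dr C (y B)) = 0 := fun A => by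
    have h := hw A
    simp only [hham, map_sub, map_sum φ, map_mul φ (d.ham E _ A), sub_mul,
      Finset.sum_sub_distrib] at h
    simp only [hκ, mul_sub, Finset.sum_sub_distrib, hs]
    rw [← h]
    congr 1
    simp only [c, map_sum φ, Finset.mul_sum, Finset.sum_mul]
    rw [Finset.sum_comm]
    refine Finset.sum_congr rfl fun a _ => Finset.sum_congr rfl fun b _ =>
      Finset.sum_congr rfl fun β _ => ?_
    ring
  -- Nondegeneracy of E makes the covector vanish, and invertibility of the Jacobian makes its
  -- components vanish, among them `v`.
  have hκ0 : ∀ C, ∑ A, κ A * φ (d.dr C (y A)) = 0 := fun C => by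
    have h : ∑ A, φ (L C A) * ∑ D, φ (E A D) * ∑ B, κ B * φ (d.dr D (y B)) =
        ∑ B, κ B * φ (d.dr C (y B)) := by
      simp only [Finset.mul_sum (ι := ι) _ _ (φ (L C _)), ← mul_assoc]
      rw [Finset.sum_comm]
      have h2 : ∀ D, ∑ A, φ (L C A) * φ (E A D) = φ ((1 : Matrix ι ι R) C D) := fun D => by
        rw [← hL, Matrix.mul_apply, map_sum]
        exact Finset.sum_congr rfl fun A _ => (map_mul φ _ _).symm
      simp only [← Finset.sum_mul, h2, Matrix.one_apply, apply_ite φ, map_one, map_zero]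
      simp
    rw [← h]
    exact Finset.sum_eq_zero fun A _ => by rw [hE0, mul_zero]
  have hκz : ∀ B, κ B = 0 := fun B => by
    have h : ∑ C, (∑ A, κ A * φ (d.dr C (y A))) * φ (Ki C B) = κ B := by
      simp only [Finset.sum_mul, mul_assoc]
      rw [Finset.sum_comm]
      have h2 : ∀ A, ∑ C, φ (d.dr C (y A)) * φ (Ki C B) = φ ((1 : Matrix ι ι R) A B) := fun A => by
        rw [← k1, Matrix.mul_apply, map_sum]
        exact Finset.sum_congr rfl fun C _ => (map_mul φ _ _).symm
      simp only [← Finset.mul_sum, h2, Matrix.one_apply, apply_ite φ, map_one, map_zero]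
      simp
    rw [← h]
    exact Finset.sum_eq_zero fun C _ => by rw [hκ0, zero_mul]
  refine hv0 (funext fun β => ?_)
  have := hκz (e (Sum.inl (Sum.inr β)))
  simpa [κ] using this

end gauge

end SDom

end SuperBV
end

/-! ### Pointwise definitions of the statement compared with the algebra of smooth functions. -/

open scoped BigOperators
noncomputable section
set_option linter.unusedSectionVars false

namespace SuperBV
open scoped Grassmann.Alg
open SuperRing Grassmann TopologicalSpace

theorem _root_.Ring.inverse_eq_of_mul {R : Type*} [MonoidWithZero R] {a b : R} (h1 : a * b = 1)
    (h2 : b * a = 1) : Ring.inverse a = b := Ring.inverse_unit ⟨a, b, h1, h2⟩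

namespace Sm

variable {M : ℕ} {ε : Fin M → ZMod 2} {U : Opens (Pt ε)}

theorem ev_br {E' : Fin M → Fin M → SFun ε} {F' G' : SFun ε}
    {E : Fin M → Fin M → Sm U (OddIx ε)} {F G : Sm U (OddIx ε)}
    (hE : ∀ A B (x : U), E' A B x = ev x (E A B)) (hF : ∀ x : U, F' x = ev x F)
    (hG : ∀ x : U, G' x = ev x G) (x : U) : antibracket E' F' G' x = ev x ((dS id).br E F G) := by
  unfold antibracket SDom.br
  rw [ev_sum, Finset.sum_apply]
  refine Finset.sum_congr rfl fun A _ => ?_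
  rw [ev_sum, Finset.sum_apply]
  refine Finset.sum_congr rfl fun B _ => ?_
  rw [ev_mul, ev_mul, ev_dr, ev_dS, ← hE]
  change dR id A F' x * E' A B x * dL id B G' x = _
  rw [dR_congr (U := U) (f := F') (g := extz F)
      (fun y hy => by rw [extz_apply _ hy]; exact hF ⟨y, hy⟩) x.2,
    dL_congr (f := G') (g := extz G) U.2
      (fun y hy => by rw [extz_apply _ hy]; exact hG ⟨y, hy⟩) x.2]

variable {D : ℕ} {E : Fin M → Fin M → SFun ε} {Θ : Fin D → SFun ε}
  {ES : Fin M → Fin M → Sm U (OddIx ε)} {ΘS : Fin D → Sm U (OddIx ε)}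
  (hE : ∀ A B (x : U), E A B x = ev x (ES A B)) (hΘ : ∀ a (x : U), Θ a x = ev x (ΘS a))
  {Ei : Matrix (Fin D) (Fin D) (Sm U (OddIx ε))}
  (h1 : (dS id).cmat ES ΘS * Ei = 1) (h2 : Ei * (dS id).cmat ES ΘS = 1)

include hE hΘ

theorem ev_cmat (x : U) : constraintMatrix E Θ x = ((dS id).cmat ES ΘS).map (ev x) :=
  Matrix.ext fun a b => ev_br hE (hΘ a) (hΘ b) x

include h1 h2

theorem ev_constraintInv (a b : Fin D) (x : U) : constraintInv E Θ a b x = ev x (Ei a b) := by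
  unfold constraintInv
  rw [ev_cmat hE hΘ x, Ring.inverse_eq_of_mul (b := Ei.map (ev x))]
  · rfl
  · rw [← Matrix.map_mul, h1, Matrix.map_one _ (map_zero _) (map_one _)]
  · rw [← Matrix.map_mul, h2, Matrix.map_one _ (map_zero _) (map_one _)]

theorem ev_diracBracket {F G : SFun ε} {FS GS : Sm U (OddIx ε)} (hF : ∀ x : U, F x = ev x FS)
    (hG : ∀ x : U, G x = ev x GS) (x : U) :
    diracBracket E Θ F G x = ev x ((dS id).br ((dS id).dirE ES ΘS Ei) FS GS) := by
  rw [SDom.br_dirE, ev_sub, ev_sum, ← ev_br hE hF hG]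
  unfold diracBracket
  rw [Pi.sub_apply, Finset.sum_apply]
  congr 1
  refine Finset.sum_congr rfl fun a _ => ?_
  rw [Finset.sum_apply, ev_sum]
  refine Finset.sum_congr rfl fun b _ => ?_
  rw [ev_mul, ev_mul, ← ev_br hE hF (hΘ a), ← ev_br hE (hΘ b) hG,
    ← ev_constraintInv hE hΘ h1 h2]
  rfl

omit hE hΘ h1 h2 in
theorem smooth_coord (A : Fin M) : SmoothOn (coord ε A) U := by
  by_cases h : ε A = 0
  · have e : coord ε A = fun x => ((x ⟨A, h⟩ : ℝ) : ℂ) • (1 : Grassmann (OddIx ε)) :=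
      funext fun x => dif_pos h
    rw [e]
    exact SmoothOn.smul_one (Complex.ofRealCLM.contDiff.comp (contDiff_apply ℝ ℝ _)).contDiffOn
  · have e : coord ε A = fun _ => (gen ⟨A, h⟩ : Grassmann (OddIx ε)) :=
      funext fun x => dif_neg h
    rw [e]
    exact smoothOn_const _ _

omit hE hΘ h1 h2 in
theorem d_coord (A B : Fin M) : (dS id).d B (of (coord ε A) (smooth_coord A) : Sm U (OddIx ε)) =
    if B = A then 1 else 0 := ext_ev fun x => by
  rw [ev_dS_of]
  by_cases hB : ε B = 0
  · rw [dL_even hB]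
    by_cases hA : ε A = 0
    · have e : coord ε A = fun x => ((x ⟨A, hA⟩ : ℝ) : ℂ) • (1 : Grassmann (OddIx ε)) :=
        funext fun x => dif_pos hA
      have hd : HasFDerivAt (fun x : Pt ε => ((x ⟨A, hA⟩ : ℝ) : ℂ))
          (Complex.ofRealCLM.comp (ContinuousLinearMap.proj (R := ℝ) (⟨A, hA⟩ : {A // ε A = 0})))
          (x : Pt ε) :=
        Complex.ofRealCLM.hasFDerivAt.comp (x : Pt ε)
          (ContinuousLinearMap.proj (R := ℝ) (φ := fun _ => ℝ) (⟨A, hA⟩ : {A // ε A = 0})).hasFDerivAt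
      rw [e, (hd.smul_const (1 : Grassmann (OddIx ε))).fderiv]
      change (((Pi.single (⟨B, hB⟩ : {A // ε A = 0}) (1 : ℝ) : Pt ε) ⟨A, hA⟩ : ℝ) : ℂ) •
        (1 : Grassmann (OddIx ε)) = _
      by_cases h : B = A
      · subst h
        rw [Pi.single_eq_same, Complex.ofReal_one, one_smul, if_pos rfl]; rfl
      · rw [Pi.single_eq_of_ne (fun h' => h (congrArg Subtype.val h').symm), Complex.ofReal_zero,
          zero_smul, if_neg h]; rfl
    · have e : coord ε A = fun _ => (gen ⟨A, hA⟩ : Grassmann (OddIx ε)) :=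
        funext fun x => dif_neg hA
      rw [e, if_neg (show ¬ B = A from fun h => hA (h ▸ hB))]
      rw [(hasFDerivAt_const (gen ⟨A, hA⟩ : Grassmann (OddIx ε)) (x : Pt ε)).fderiv]
      rfl
  · rw [dL_odd hB]
    by_cases hA : ε A = 0
    · have e : coord ε A x = ((x.1 ⟨A, hA⟩ : ℝ) : ℂ) • (1 : Grassmann (OddIx ε)) := dif_pos hA
      rw [e, PS.leftDer_smul_one, if_neg (show ¬ B = A from fun h => hB (h ▸ hA))]; rfl
    · have e : coord ε A x = gen ⟨A, hA⟩ := dif_neg hA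
      rw [e]
      refine (leftDer_gen _ _).trans ?_
      by_cases h : B = A
      · subst h; exact (if_pos rfl).trans (by rw [if_pos rfl]; rfl)
      · exact (if_neg fun h' => h (congrArg Subtype.val h')).trans (by rw [if_neg h]; rfl)

theorem ev_diracE (A B : Fin M) (x : U) :
    diracE E Θ A B x = ev x ((dS id).dirE ES ΘS Ei A B) := by
  unfold diracE
  rw [ev_diracBracket hE hΘ h1 h2 (FS := of (coord ε A) (smooth_coord A))
    (GS := of (coord ε B) (smooth_coord B)) (fun _ => rfl) (fun _ => rfl)]
  congr 1
  unfold SDom.br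
  have hr : ∀ C, (dS id).dr C (of (coord ε A) (smooth_coord A) : Sm U (OddIx ε)) =
      if C = A then 1 else 0 := fun C => by
    rw [SDom.dr_apply, d_coord]
    split_ifs
    · exact map_one (sgp (ε C))
    · exact map_zero _
  simp only [hr, d_coord, ite_mul, one_mul, zero_mul, mul_ite, mul_one, mul_zero,
    Finset.sum_ite_eq', Finset.mem_univ, if_true]

omit hΘ h1 h2 in
-- The hypothesis concerns functions on the whole space that are smooth on `U`; extension by zero
-- provides them.
theorem jacobi_of_isAntisymplectic (h : IsAntisymplectic U E) (F G H : Sm U (OddIx ε))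
    (f g k : ZMod 2) (hF : IsPar f F) (hG : IsPar g G) (hH : IsPar k H) :
    psign ((f + 1) * (k + 1)) • (dS id).br ES F ((dS id).br ES G H) +
      psign ((g + 1) * (f + 1)) • (dS id).br ES G ((dS id).br ES H F) +
      psign ((k + 1) * (g + 1)) • (dS id).br ES H ((dS id).br ES F G) = 0 := ext_ev fun x => by
  have hz : ∀ (f : Sm U (OddIx ε)) (x : U), extz f x = ev x f := fun f x => extz_coe f x
  have hp : ∀ {p : ZMod 2} {f : Sm U (OddIx ε)}, IsPar p f → ∀ x ∈ (U : Set (Pt ε)),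
      HasParity (extz f x) p := fun hf x hx => by
    rw [extz_apply _ hx]; exact isPar_iff.mp hf ⟨x, hx⟩
  have := h.jacobi _ _ _ f g k (smooth_extz F) (smooth_extz G) (smooth_extz H) (hp hF) (hp hG)
    (hp hH) x x.2
  rw [ev_br hE (hz F) (ev_br hE (hz G) (hz H)), ev_br hE (hz G) (ev_br hE (hz H) (hz F)),
    ev_br hE (hz H) (ev_br hE (hz F) (hz G))] at this
  exact this

end Sm

end SuperBV
end

/-! ### Assembly of the square-root formula. -/

open scoped BigOperators
noncomputable section
set_option linter.unusedSectionVars false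

namespace SuperBV
open scoped Grassmann.Alg
open SuperRing Grassmann TopologicalSpace

theorem IsGaugeFixingAction.mono {M K D : ℕ} {ε : Fin M → ZMod 2} {U V : Set (Pt ε)}
    {E : Fin M → Fin M → SFun ε} {Θ : Fin D → SFun ε} {ρ : SFun ε} {δ : Fin K → ZMod 2}
    {X : ℕ → FL ε K} (h : IsGaugeFixingAction U E Θ ρ δ X) (hV : V ⊆ U) :
    IsGaugeFixingAction V E Θ ρ δ X where
  smooth k n := (h.smooth k n).mono hV
  parity k n x hx := h.parity k n x (hV hx)
  planck k n x hx := h.planck k n x (hV hx)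
  master ħ hħ n x hx := h.master ħ hħ n x (hV hx)

theorem HasExpansion.mono {M K : ℕ} {ε : Fin M → ZMod 2} {U V : Set (Pt ε)} {δ : Fin K → ZMod 2}
    {X : ℕ → FL ε K} {G : Fin K → SFun ε} {H : SFun ε} (h : HasExpansion U δ X G H)
    (hV : V ⊆ U) : HasExpansion V δ X G H := fun ħ n x hx => h ħ n x (hV hx)

namespace Sm

theorem mul_mul_inv_im {a b c : ℂ} (ha : a.im = 0) (hb : b.im = 0) (hc : c.im = 0) :
    (a * b * c⁻¹).im = 0 := by
  rw [← Complex.conj_eq_iff_im] at *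
  rw [map_mul, map_mul, map_inv₀, ha, hb, hc]

theorem bod_ne_zero {M : ℕ} {ε : Fin M → ZMod 2} {U : Opens (Pt ε)} {κ : Type} [Fintype κ]
    [LinearOrder κ] {a b : Sm U κ} (h : a * b = 1) (x : U) : bod x a ≠ 0 := fun h0 => by
  have := congrArg (bod x) h
  rw [bod_mul, h0, zero_mul, map_one] at this
  exact zero_ne_one this

theorem bod_ne_zero_of_isUnit {M : ℕ} {ε : Fin M → ZMod 2} {U : Opens (Pt ε)} {κ : Type}
    [Fintype κ] [LinearOrder κ] {a : evenSub (Sm U κ)} (h : IsUnit a) (x : U) :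
    bod x (a : Sm U κ) ≠ 0 := by
  obtain ⟨b, hb⟩ := h.exists_right_inv
  exact bod_ne_zero (congrArg Subtype.val hb) x

variable {M K D : ℕ} {ε : Fin M → ZMod 2} {δ : Fin K → ZMod 2}
  {e : (Fin K ⊕ Fin K) ⊕ Fin D ≃ Fin M} {U : Opens (Pt ε)}
  {E : Fin M → Fin M → SFun ε} {Θ : Fin D → SFun ε} {F G : Fin K → SFun ε} {ρ H : SFun ε}
  {X : ℕ → FL ε K}
  (eF : ∀ α, ε (e (Sum.inl (Sum.inl α))) = δ α + 1) (eG : ∀ α, ε (e (Sum.inl (Sum.inr α))) = δ α)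
  {ES : Fin M → Fin M → Sm U (OddIx ε)} {y : Fin M → Sm U (OddIx ε)} {ρS ρi : Sm U (OddIx ε)}
  (biv : SDom.IsBiv ε ES) (hE : ∀ A B (x : U), E A B x = ev x (ES A B))
  (hy : ∀ A, IsPar (ε A) (y A)) (hyv : ∀ A (x : U), combine e F G Θ A x = ev x (y A))

include hyv

theorem combine_F (α : Fin K) (x : U) : F α x = ev x (y (e (Sum.inl (Sum.inl α)))) := by
  rw [← hyv, combine, Equiv.symm_apply_apply]; rfl

theorem combine_G (α : Fin K) (x : U) : G α x = ev x (y (e (Sum.inl (Sum.inr α)))) := by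
  rw [← hyv, combine, Equiv.symm_apply_apply]; rfl

theorem combine_Θ (a : Fin D) (x : U) : Θ a x = ev x (y (e (Sum.inr a))) := by
  rw [← hyv, combine, Equiv.symm_apply_apply]; rfl

theorem jacobianMatrix_eq (x : U) :
    jacobianMatrix (combine e F G Θ) x = ((dS id).jac y).map (ev x) := Matrix.ext fun A B => by
  change dR id B (combine e F G Θ A) x = ev x ((dS id).dr B (y A))
  rw [ev_dr]
  exact dR_congr (U := U) (fun z hz => by rw [extz_apply _ hz]; exact hyv A ⟨z, hz⟩) x.2 B

theorem mem_constraintSurface (x : Pt ε) : x ∈ constraintSurface U G Θ ↔ ∃ h : x ∈ U,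
    ∀ A, (∀ α, A ≠ e (Sum.inl (Sum.inl α))) → bod ⟨x, h⟩ (y A) = 0 := by
  constructor
  · rintro ⟨h, hG, hT⟩
    refine ⟨h, fun A hA => ?_⟩
    obtain ⟨i, rfl⟩ := e.surjective A
    rcases i with (α | α) | a
    · exact absurd rfl (hA α)
    · rw [bod_apply, ← combine_G hyv α ⟨x, h⟩]; exact hG α
    · rw [bod_apply, ← combine_Θ hyv a ⟨x, h⟩]; exact hT a
  · rintro ⟨h, hA⟩
    refine ⟨h, fun α => ?_, fun a => ?_⟩
    · rw [combine_G hyv α ⟨x, h⟩]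
      exact hA _ fun β hβ => by simpa using e.injective hβ
    · rw [combine_Θ hyv a ⟨x, h⟩]
      exact hA _ fun β hβ => by simpa using e.injective hβ

include eF eG biv hE hy

variable {Ei : Matrix (Fin D) (Fin D) (Sm U (OddIx ε))}
  (h1 : (dS id).cmat ES (fun a => y (e (Sum.inr a))) * Ei = 1)
  (h2 : Ei * (dS id).cmat ES (fun a => y (e (Sum.inr a))) = 1)

include h1 h2

set_option maxHeartbeats 2000000 in
/-- The square-root formula over an open set on which the matrix of brackets of gauge functions
with constraints is invertible. -/
theorem square_root_formula_of_gauge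
    (hX : IsGaugeFixingAction U E Θ ρ δ X) (hGH : HasExpansion U δ X G H)
    (hEr : ∀ A B, ES A B ∈ realS U (OddIx ε)) (hyr : ∀ A, y A ∈ realS U (OddIx ε))
    (hρ : ∀ x : U, ρ x = ev x ρS) (pρ : IsPar 0 ρS) (ρr : ρS ∈ realS U (OddIx ε))
    (pρi : IsPar 0 ρi) (inv : ρi * ρS = 1)
    {Ki : Matrix (Fin M) (Fin M) (Sm U (OddIx ε))}
    (k1 : (dS id).jac y * Ki = 1) (k2 : Ki * (dS id).jac y = 1)
    (inj : ∀ x x' : U, (∀ A, bod x (y A) = bod x' (y A)) → x = x')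
    (hdet : ∀ x : U, (Matrix.of fun α β => bod x ((dS id).gmat
      ((dS id).dirE ES (fun a => y (e (Sum.inr a))) Ei) (fun α => y (e (Sum.inl (Sum.inl α))))
      (fun α => y (e (Sum.inl (Sum.inr α)))) α β)).det ≠ 0)
    (hJ : ∀ α γ β, (dS id).br ((dS id).dirE ES (fun a => y (e (Sum.inr a))) Ei)
        ((dS id).br ((dS id).dirE ES (fun a => y (e (Sum.inr a))) Ei)
          (y (e (Sum.inl (Sum.inl α)))) (y (e (Sum.inl (Sum.inr γ))))) (y (e (Sum.inl (Sum.inr β)))) -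
      ((dS id).br ((dS id).dirE ES (fun a => y (e (Sum.inr a))) Ei) (y (e (Sum.inl (Sum.inl α))))
        ((dS id).br ((dS id).dirE ES (fun a => y (e (Sum.inr a))) Ei)
          (y (e (Sum.inl (Sum.inr γ)))) (y (e (Sum.inl (Sum.inr β))))) +
        psign ((δ β + 1) * (δ γ + 1)) •
          (dS id).br ((dS id).dirE ES (fun a => y (e (Sum.inr a))) Ei)
            ((dS id).br ((dS id).dirE ES (fun a => y (e (Sum.inr a))) Ei)
              (y (e (Sum.inl (Sum.inl α)))) (y (e (Sum.inl (Sum.inr β)))))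
            (y (e (Sum.inl (Sum.inr γ))))) ∈
      genIdeal (fun a => y (e (Sum.inr a))) (fun a => ε (e (Sum.inr a))) fun a => hy (e (Sum.inr a)))
    (hconn : IsPreconnected (constraintSurface U G Θ)) :
    ∃ (c : ℂ) (V : Set (Pt ε)), IsOpen V ∧ constraintSurface U G Θ ⊆ V ∧ V ⊆ U ∧
      (∀ x ∈ V, IsUnit (gaugeMatrix E Θ F G x)) ∧
      IsOrderOn V G Θ (fun x =>
        H x - (-lnSqrt (sdet ε (jacobianMatrix (combine e F G Θ) x) *
            sdet δ (gaugeMatrix E Θ F G x) * Ring.inverse (ρ x)) + c • 1)) := by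
  set FS : Fin K → Sm U (OddIx ε) := fun α => y (e (Sum.inl (Sum.inl α)))
  set GS : Fin K → Sm U (OddIx ε) := fun α => y (e (Sum.inl (Sum.inr α)))
  set ΘS : Fin D → Sm U (OddIx ε) := fun a => y (e (Sum.inr a))
  set ED := (dS id).dirE ES ΘS Ei with hED
  have pΘ : ∀ a, IsPar (ε (e (Sum.inr a))) (ΘS a) := fun a => hy _
  have pG : ∀ α, IsPar (δ α) (GS α) := fun α => (hy _).cast (eG α)
  have vF := combine_F hyv
  have vG := combine_G hyv
  have vΘ := combine_Θ hyv
  have bivD : SDom.IsBiv ε ED := (dS id).isBiv_dirE biv pΘ h1 h2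
  have inv' : ρS * ρi = 1 := by rw [pρi.comm_zero, inv]
  have hρi : ∀ x : U, Ring.inverse (ρ x) = ev x ρi := fun x => by
    rw [hρ]
    exact Ring.inverse_eq_of_mul (congrArg (ev x) inv') (congrArg (ev x) inv)
  obtain ⟨HS, hH, -, v, pv, hv, hmaster⟩ := SuperBV.master_algebra hX hGH vG pG
    (ev_diracE hE vΘ h1 h2) hρ hρi bivD pρ pρi inv
  obtain ⟨Mi, m1, m2⟩ := exists_inverse_of_body hdet
  have pJ := (dS id).jac_par hy k1 k2
  have pM := (dS id).par_gmat bivD e eF eG (F := FS) (G := GS) (fun _ => rfl) (fun _ => rfl) hy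
  have uJ := isUnit_berD pJ k1
  have uM := isUnit_berD pM m1
  -- `q` is the argument of the logarithm. It has real body without zeros, so its logarithm is
  -- smooth.
  set q : Sm U (OddIx ε) := (ber ε ((dS id).jac y) : Sm U (OddIx ε)) *
    (ber δ ((dS id).gmat ED FS GS) : Sm U (OddIx ε)) * ρi with hq
  have pq : IsPar 0 q :=
    (((coe_isPar _).mul (coe_isPar _)).mul pρi).cast (by simp)
  have hbody : ∀ x, bod x ρi = (bod x ρS)⁻¹ := fun x =>
    eq_inv_of_mul_eq_one_left (by rw [← bod_mul, inv, map_one])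
  have hDr : ∀ A B, ED A B ∈ realS U (OddIx ε) := by
    have hyr' : ∀ a, ΘS a ∈ realS U (OddIx ε) := fun a => hyr _
    have hEi := inverse_mem_realS (fun a b => br_mem_realS hEr (hyr' a) (hyr' b) id) h1 h2
    exact fun A B => Subring.sub_mem _ (hEr A B) <| Subring.sum_mem _ fun a _ =>
      Subring.sum_mem _ fun b _ => Subring.mul_mem _ (Subring.mul_mem _
        (Subring.sum_mem _ fun C _ => Subring.mul_mem _ (hEr _ _) (d_mem_realS (hyr' a) id C))
        (hEi a b)) (Subring.sum_mem _ fun C _ =>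
          Subring.mul_mem _ (dr_mem_realS (hyr' b) id C) (hEr _ _))
  have q_real : ∀ x, (bod x q).im = 0 := fun x => by
    have c1 := ber_body_real pJ (fun A B => dr_mem_realS (hyr A) id B) uJ x
    have c2 := ber_body_real pM (fun α β => br_mem_realS hDr (hyr _) (hyr _) id) uM x
    have c3 := bod_im ρr x
    rw [hq, bod_mul, bod_mul, hbody]
    exact mul_mul_inv_im c1 c2 c3
  have q_ne : ∀ x, bod x q ≠ 0 := fun x => by
    rw [hq, bod_mul, bod_mul]
    exact mul_ne_zero (mul_ne_zero (bod_ne_zero_of_isUnit (ber_isUnit pJ k1 k2 uJ) x)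
      (bod_ne_zero_of_isUnit (ber_isUnit pM m1 m2 uM) x)) (bod_ne_zero inv x)
  obtain ⟨l, hl, hlX⟩ := exists_log pq q_real q_ne id
  -- The selected coordinates are G and Θ; the unselected ones are the F's.
  let z : Fin M → Prop := fun A => ∀ α, A ≠ e (Sum.inl (Sum.inl α))
  have zG : ∀ α, z (e (Sum.inl (Sum.inr α))) := fun α β hβ => by simpa using e.injective hβ
  have zΘ : ∀ a, z (e (Sum.inr a)) := fun a β hβ => by simpa using e.injective hβ
  have zF : ∀ α, ¬ z (e (Sum.inl (Sum.inl α))) := fun α h => h α rfl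
  set I := genIdeal (sel z y) ε (SDom.isPar_sel hy z) with hI
  have mem : ∀ A, z A → y A ∈ I := fun A hA => by
    have := gen_mem_genIdeal (sel z y) ε (SDom.isPar_sel hy z) A
    rwa [show sel z y A = y A from if_pos hA] at this
  have hJ' : ∀ {a}, a ∈ genIdeal ΘS (fun a => ε (e (Sum.inr a))) pΘ → a ∈ I := by
    rintro _ ⟨u, rfl⟩
    exact I.sum_mem fun a _ => I.mul_mem_right _ (mem _ (zΘ a))
  have hf := (dS id).dbar_action_add_log_mem bivD e eF eG (F := FS) (G := GS) (Θ := ΘS)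
    (fun _ => rfl) (fun _ => rfl) (fun _ => rfl) hy k1 k2 (I := I) (fun α => mem _ (zG α))
    (fun f a => (dS id).br_dirE_left h1 f a) pρ pρi inv m1 m2 hv pv (fun α γ β => hJ' (hJ α γ β))
    uJ uM (H := HS) (l := l)
    (fun β => hlX _ ED (GS β) ((dS id).isRDer_brL bivD (pG β)))
    (fun β => hmaster β I fun α => mem _ (zG α))
  -- The combination H + ½ ln q has its F-derivatives in the ideal, so it is integrated to a
  -- constant near the surface.
  obtain ⟨V, hV, c, u, hSV, hres⟩ := eq_const_add hy k1 k2 (fun A => bod_im (hyr A)) inj z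
    (f := HS + (1 / 2 : ℂ) • l) (fun A hA => by
      obtain ⟨α, rfl⟩ : ∃ α, A = e (Sum.inl (Sum.inl α)) := by
        by_contra h
        exact hA fun α hα => h ⟨α, hα⟩
      exact hf α) (mem_constraintSurface hyv) hconn
  have hgm : ∀ x : U, gaugeMatrix E Θ F G x = ((dS id).gmat ED FS GS).map (ev x) := fun x =>
    Matrix.ext fun α β => ev_diracBracket hE vΘ h1 h2 (vF α) (vG β) x
  refine ⟨c, V, V.2, hSV, hV, fun x hx => ?_, fun α => extz (u (e (Sum.inl (Sum.inr α)))),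
    fun a => extz (u (e (Sum.inr a))), fun _ => smooth_extz _, fun _ => smooth_extz _,
    fun x hx => ?_⟩
  · rw [hgm ⟨x, hV hx⟩]
    refine isUnit_iff_exists.mpr ⟨Mi.map (ev ⟨x, hV hx⟩), ?_, ?_⟩
    · rw [← Matrix.map_mul, m1, Matrix.map_one _ (map_zero _) (map_one _)]
    · rw [← Matrix.map_mul, m2, Matrix.map_one _ (map_zero _) (map_one _)]
  · have e1 : sdet ε (jacobianMatrix (combine e F G Θ) x) * sdet δ (gaugeMatrix E Θ F G x) *
        Ring.inverse (ρ x) = ev ⟨x, hV hx⟩ q := by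
      rw [hq, ev_mul, ev_mul, ev_ber uJ, ev_ber uM, ← hρi, ← hgm, ← jacobianMatrix_eq hyv]
    have e2 := congrArg (ev ⟨x, hx⟩) hres
    rw [ev_add, ev_smul, ev_one, ev_sum, ← Equiv.sum_comp e, Fintype.sum_sum_type,
      Fintype.sum_sum_type] at e2
    have e3 : ev ⟨x, hx⟩ (res hV (HS + (1 / 2 : ℂ) • l)) = H x + lnSqrt (ev ⟨x, hV hx⟩ q) := by
      rw [lnSqrt, ← hl]
      change ev ⟨x, hV hx⟩ HS + (1 / 2 : ℂ) • ev ⟨x, hV hx⟩ l = _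
      rw [← hH]
    have s1 : ∀ A, z A → ev ⟨x, hx⟩ (res hV (sel z y A) * u A) =
        ev ⟨x, hV hx⟩ (y A) * extz (u A) x := fun A hA => by
      rw [show sel z y A = y A from if_pos hA, ev_mul, extz_apply _ hx]; rfl
    have s0 : ∀ A, ¬ z A → ev ⟨x, hx⟩ (res hV (sel z y A) * u A) = 0 := fun A hA => by
      rw [show sel z y A = 0 from if_neg hA, res_zero, zero_mul, ev_zero]
    rw [e3, Finset.sum_eq_zero fun α _ => s0 _ (zF α), zero_add,
      Finset.sum_congr rfl fun α _ => s1 _ (zG α), Finset.sum_congr rfl fun a _ => s1 _ (zΘ a)] at e2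
    simp only [← vG _ ⟨x, hV hx⟩, ← vΘ _ ⟨x, hV hx⟩] at e2
    beta_reduce
    rw [e1, ← sub_eq_of_eq_add' e2]
    abel

omit eF eG biv hE hy hyv h1 h2 in
theorem isOpen_det_ne_zero {n : Type} [Fintype n] [DecidableEq n]
    (N : Matrix n n (Sm U (OddIx ε))) :
    IsOpen {x | ∃ h : x ∈ U, (Matrix.of fun i j => bod ⟨x, h⟩ (N i j)).det ≠ 0} := by
  have hc : ContinuousOn (fun x => (Matrix.of fun i j => body (extz (N i j) x)).det) U :=
    (continuous_id.matrix_det).comp_continuousOn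
      (continuousOn_pi.mpr fun i => continuousOn_pi.mpr fun j => (contDiffOn_body (N i j)).continuousOn)
  convert hc.isOpen_inter_preimage U.2 (isOpen_ne (x := (0 : ℂ))) using 1
  ext x
  constructor
  · rintro ⟨h, hx⟩
    refine ⟨h, ?_⟩
    simpa only [Set.mem_preimage, Set.mem_ofPred_eq, extz_apply _ h, bod_apply] using hx
  · rintro ⟨h, hx⟩
    refine ⟨h, ?_⟩
    simpa only [Set.mem_preimage, Set.mem_ofPred_eq, extz_apply _ h, bod_apply] using hx

omit eF eG biv hE hy hyv h1 h2 in
theorem res_mem_realS {V : Opens (Pt ε)} (hV : V ≤ U) {f : Sm U (OddIx ε)}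
    (hf : f ∈ realS U (OddIx ε)) : res hV f ∈ realS V (OddIx ε) := fun x => hf ⟨x, hV x.2⟩

end Sm

end SuperBV
end

open scoped BigOperators
noncomputable section
set_option linter.unusedSectionVars false

namespace SuperBV
open scoped Grassmann.Alg
open SuperRing Grassmann TopologicalSpace

namespace Sm

variable {M K D : ℕ} {ε : Fin M → ZMod 2} {δ : Fin K → ZMod 2}
  {e : (Fin K ⊕ Fin K) ⊕ Fin D ≃ Fin M} {U : Opens (Pt ε)}
  {E : Fin M → Fin M → SFun ε} {Θ : Fin D → SFun ε} {F G : Fin K → SFun ε} {ρ H : SFun ε}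
  {X : ℕ → FL ε K}

theorem res_cmat {V : Opens (Pt ε)} (hV : V ≤ U) (E : Fin M → Fin M → Sm U (OddIx ε))
    (Θ : Fin D → Sm U (OddIx ε)) : ((dS id).cmat E Θ).map (res hV) =
      (dS id).cmat (fun A B => res hV (E A B)) fun a => res hV (Θ a) :=
  Matrix.ext fun a b => res_br hV id E (Θ a) (Θ b)

-- The gauge matrix is only known to be invertible on the constraint surface, hence near it. All
-- data are restricted to the open set where its body determinant does not vanish, and
-- `square_root_formula_of_gauge` is applied there.
set_option maxHeartbeats 2000000 in
theorem square_root_formula {τ : Fin D → ZMod 2} (hE : IsAntisymplectic (U : Set (Pt ε)) E)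
    (hΘ : IsSecondClass U E τ Θ) (hρ : IsDensity U ρ)
    (hX : IsGaugeFixingAction U E Θ ρ δ X) (hGH : HasExpansion U δ X G H)
    (hF : ∀ α, ε (e (Sum.inl (Sum.inl α))) = δ α + 1)
    (hG : ∀ α, ε (e (Sum.inl (Sum.inr α))) = δ α)
    (hcoord : IsCoordinateSystem U (combine e F G Θ))
    (hconn : IsPreconnected (constraintSurface U G Θ)) :
    ∃ (c : ℂ) (V : Set (Pt ε)), IsOpen V ∧ constraintSurface U G Θ ⊆ V ∧ V ⊆ U ∧
      (∀ x ∈ V, IsUnit (gaugeMatrix E Θ F G x)) ∧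
      IsOrderOn V G Θ (fun x =>
        H x - (-lnSqrt (sdet ε (jacobianMatrix (combine e F G Θ) x) *
            sdet δ (gaugeMatrix E Θ F G x) * Ring.inverse (ρ x)) + c • 1)) := by
  let ES : Fin M → Fin M → Sm U (OddIx ε) := fun A B => of (E A B) (hE.smooth A B)
  let y : Fin M → Sm U (OddIx ε) := fun A => of (combine e F G Θ A) (hcoord.smooth A)
  let ρS : Sm U (OddIx ε) := of ρ hρ.smooth
  have biv : SDom.IsBiv ε ES := ⟨fun A B => isPar_of (hE.parity A B),
    fun A B => ext_ev fun x => hE.skew A B x x.2⟩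
  have vE : ∀ A B (x : U), E A B x = ev x (ES A B) := fun _ _ _ => rfl
  have vy : ∀ A (x : U), combine e F G Θ A x = ev x (y A) := fun _ _ => rfl
  have hy : ∀ A, IsPar (ε A) (y A) := fun A => isPar_of (hcoord.parity A)
  have pρ : IsPar 0 ρS := isPar_of hρ.parity
  have rE : ∀ A B, ES A B ∈ realS U (OddIx ε) := fun A B =>
    mem_realS.mpr fun x => hE.real A B x x.2
  have ry : ∀ A, y A ∈ realS U (OddIx ε) := fun A => mem_realS.mpr fun x => hcoord.real A x x.2
  have rρ : ρS ∈ realS U (OddIx ε) := mem_realS.mpr fun x => hρ.real x x.2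
  obtain ⟨Ei, h1, h2⟩ := exists_inverse
    (N := (dS id).cmat ES fun a => y (e (Sum.inr a))) fun x => by
      rw [← ev_cmat vE (combine_Θ vy)]; exact hΘ.invertible x x.2
  obtain ⟨Ki, k1, k2⟩ := exists_inverse (N := (dS id).jac y) fun x => by
      rw [← jacobianMatrix_eq vy]; exact hcoord.jacobian x x.2
  obtain ⟨L, -, hL⟩ := exists_inverse (N := Matrix.of ES) fun x => hE.nondegenerate x x.2
  obtain ⟨ρi, inv', inv⟩ := isUnit_iff_exists.mp
    (isUnit_of_body (f := ρS) fun x => hρ.body_ne_zero x x.2)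
  have pρi : IsPar 0 ρi := by
    have h := congrArg sig inv
    rw [map_mul, map_one, isPar_zero_iff.mp pρ] at h
    exact isPar_zero_iff.mpr (left_inv_eq_right_inv h inv')
  set ΘS : Fin D → Sm U (OddIx ε) := fun a => y (e (Sum.inr a)) with hΘS
  have pΘ : ∀ a, IsPar (ε (e (Sum.inr a))) (ΘS a) := fun a => hy _
  have pG : ∀ α, IsPar (δ α) (y (e (Sum.inl (Sum.inr α)))) := fun α => (hy _).cast (hG α)
  have pF : ∀ α, IsPar (δ α + 1) (y (e (Sum.inl (Sum.inl α)))) := fun α => (hy _).cast (hF α)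
  let ED := (dS id).dirE ES ΘS Ei
  let N : Matrix (Fin K) (Fin K) (Sm U (OddIx ε)) := (dS id).gmat ED
    (fun α => y (e (Sum.inl (Sum.inl α)))) (fun α => y (e (Sum.inl (Sum.inr α))))
  let W : Opens (Pt ε) := ⟨_, isOpen_det_ne_zero N⟩
  have hW : W ≤ U := fun x hx => hx.1
  have vD := ev_diracE vE (combine_Θ vy) h1 h2
  -- The involution relations, already available over `U`, show that the brackets of the G's have no
  -- body on the surface; this is what `det_gmat_ne_zero` needs.
  have hSW : constraintSurface U G Θ ⊆ W := by
    obtain ⟨HS, -, -, v, -, hv, -⟩ := master_algebra hX hGH (combine_G vy) pG vD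
      (fun _ => rfl) (ρi := ρi) (fun x => Ring.inverse_eq_of_mul (congrArg (ev x) inv')
        (congrArg (ev x) inv)) ((dS id).isBiv_dirE biv pΘ h1 h2) pρ pρi inv
    intro x hx
    refine ⟨hx.1, (dS id).det_gmat_ne_zero e (fun _ => rfl) (fun _ => rfl) (fun _ => rfl) hy k1 k2
      pG pΘ h1 hL (bod ⟨x, hx.1⟩) (fun a ha => bod_of_odd ha _) fun γ β => ?_⟩
    rw [hv, bod_sum]
    refine Finset.sum_eq_zero fun σ _ => ?_
    rw [bod_mul, bod_apply, ← combine_G vy σ ⟨x, hx.1⟩]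
    exact mul_eq_zero_of_left (hx.2.1 σ) _
  let r := res (κ := OddIx ε) hW
  let EW : Fin M → Fin M → Sm W (OddIx ε) := fun A B => r (ES A B)
  let yW : Fin M → Sm W (OddIx ε) := fun A => r (y A)
  have vEW : ∀ A B (x : W), E A B x = ev x (EW A B) := fun _ _ _ => rfl
  have vyW : ∀ A (x : W), combine e F G Θ A x = ev x (yW A) := fun _ _ => rfl
  have hyW : ∀ A, IsPar (ε A) (yW A) := fun A => res_par hW (hy A)
  have h1W : (dS id).cmat EW (fun a => yW (e (Sum.inr a))) * Ei.map r = 1 := by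
    rw [← res_cmat]; exact res_matrix_mul hW h1
  have h2W : Ei.map r * (dS id).cmat EW (fun a => yW (e (Sum.inr a))) = 1 := by
    rw [← res_cmat]; exact res_matrix_mul hW h2
  have k1W : (dS id).jac yW * Ki.map r = 1 := by
    rw [← res_jac]; exact res_matrix_mul hW k1
  have k2W : Ki.map r * (dS id).jac yW = 1 := by
    rw [← res_jac]; exact res_matrix_mul hW k2
  have hD : (fun A B => r (ED A B)) =
      (dS id).dirE EW (fun a => yW (e (Sum.inr a))) (Ei.map r) := by
    funext A B
    exact ext_ev fun x => (vD A B ⟨x, hW x.2⟩).symm.trans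
      (ev_diracE vEW (combine_Θ vyW) h1W h2W A B x)
  have hbr : ∀ f g, r ((dS id).br ED f g) =
      (dS id).br ((dS id).dirE EW (fun a => yW (e (Sum.inr a))) (Ei.map r)) (r f) (r g) :=
    fun f g => by rw [← hD]; exact res_br hW id ED f g
  have hS : constraintSurface (W : Set (Pt ε)) G Θ = constraintSurface U G Θ :=
    Set.ext fun x => ⟨fun h => ⟨hW h.1, h.2⟩, fun h => ⟨hSW h, h.2⟩⟩
  have hdet : ∀ x : W, (Matrix.of fun α β => bod x ((dS id).gmat
      ((dS id).dirE EW (fun a => yW (e (Sum.inr a))) (Ei.map r))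
      (fun α => yW (e (Sum.inl (Sum.inl α)))) (fun α => yW (e (Sum.inl (Sum.inr α)))) α β)).det ≠ 0 :=
    fun x => by
      obtain ⟨h, hx⟩ := x.2
      refine fun h0 => hx (Eq.trans ?_ h0)
      congr 1
      exact Matrix.ext fun α β => congrArg (bod x) (hbr _ _)
  have hJ : ∀ α γ β, (dS id).br ((dS id).dirE EW (fun a => yW (e (Sum.inr a))) (Ei.map r))
        ((dS id).br ((dS id).dirE EW (fun a => yW (e (Sum.inr a))) (Ei.map r))
          (yW (e (Sum.inl (Sum.inl α)))) (yW (e (Sum.inl (Sum.inr γ)))))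
          (yW (e (Sum.inl (Sum.inr β)))) -
      ((dS id).br ((dS id).dirE EW (fun a => yW (e (Sum.inr a))) (Ei.map r))
          (yW (e (Sum.inl (Sum.inl α))))
        ((dS id).br ((dS id).dirE EW (fun a => yW (e (Sum.inr a))) (Ei.map r))
          (yW (e (Sum.inl (Sum.inr γ)))) (yW (e (Sum.inl (Sum.inr β))))) +
        psign ((δ β + 1) * (δ γ + 1)) •
          (dS id).br ((dS id).dirE EW (fun a => yW (e (Sum.inr a))) (Ei.map r))
            ((dS id).br ((dS id).dirE EW (fun a => yW (e (Sum.inr a))) (Ei.map r))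
              (yW (e (Sum.inl (Sum.inl α)))) (yW (e (Sum.inl (Sum.inr β)))))
            (yW (e (Sum.inl (Sum.inr γ))))) ∈
      genIdeal (fun a => yW (e (Sum.inr a))) (fun a => ε (e (Sum.inr a)))
        fun a => hyW (e (Sum.inr a)) := fun α γ β => by
    -- The Jacobi identity modulo the constraints is proved over `U`, where the hypothesis on E is
    -- given, and its coefficients are then restricted.
    obtain ⟨u, hu⟩ := (dS id).jacobi_dirE biv pΘ h1 h2
      (fun F G H f g k => jacobi_of_isAntisymplectic vE hE F G H f g k) (pF α) (pG β) (pG γ)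
    refine ⟨fun a => r (u a), ?_⟩
    have h := congrArg r hu
    rw [res_sum, res_sub, res_add, res_smul] at h
    rw [← hbr, ← hbr, ← hbr, ← hbr, ← hbr, ← hbr]
    exact h
  obtain ⟨c, V, hVo, hSV, hVW, hV⟩ := square_root_formula_of_gauge hF hG
    ⟨fun A B => res_par hW (biv.par A B), fun A B => congrArg r (biv.skew A B)⟩ vEW hyW vyW h1W h2W
    (hX.mono hW) (hGH.mono hW) (fun A B => res_mem_realS hW (rE A B))
    (fun A => res_mem_realS hW (ry A)) (ρS := r ρS) (ρi := r ρi) (fun _ => rfl) (res_par hW pρ)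
    (res_mem_realS hW rρ) (res_par hW pρi) (congrArg r inv) k1W k2W
    (fun x x' h => Subtype.ext (hcoord.injective (hW x.2) (hW x'.2) (funext h)))
    hdet hJ (by rwa [hS])
  rw [hS] at hSV
  exact ⟨c, V, hVo, hSV, hVW.trans hW, hV⟩

end Sm

end SuperBV
end

theorem mainTheorem11 {M K D : ℕ} (ε : Fin M → ZMod 2) (δ : Fin K → ZMod 2) (τ : Fin D → ZMod 2)
    (e : (Fin K ⊕ Fin K) ⊕ Fin D ≃ Fin M)
    (U : Set (Pt ε)) (hU : IsOpen U)
    (E : Fin M → Fin M → SFun ε) (hE : IsAntisymplectic U E)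
    (Θ : Fin D → SFun ε) (hΘ : IsSecondClass U E τ Θ)
    (ρ : SFun ε) (hρ : IsDensity U ρ)
    (X : ℕ → FL ε K) (hX : IsGaugeFixingAction U E Θ ρ δ X)
    (G : Fin K → SFun ε) (H : SFun ε) (hGH : HasExpansion U δ X G H)
    (F : Fin K → SFun ε)
    (hF : ∀ α, ε (e (Sum.inl (Sum.inl α))) = δ α + 1)
    (hG : ∀ α, ε (e (Sum.inl (Sum.inr α))) = δ α)
    (hτ : ∀ a, ε (e (Sum.inr a)) = τ a)
    (hcoord : IsCoordinateSystem U (combine e F G Θ))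
    (hconn : IsPreconnected (constraintSurface U G Θ)) :
    ∃ (c : ℂ) (V : Set (Pt ε)), IsOpen V ∧ constraintSurface U G Θ ⊆ V ∧ V ⊆ U ∧
      (∀ x ∈ V, IsUnit (gaugeMatrix E Θ F G x)) ∧
      IsOrderOn V G Θ (fun x =>
        H x - (-lnSqrt (sdet ε (jacobianMatrix (combine e F G Θ) x) *
            sdet δ (gaugeMatrix E Θ F G x) * Ring.inverse (ρ x)) + c • 1)) := by
  exact Sm.square_root_formula (U := ⟨U, hU⟩) hE hΘ hρ hX hGH hF hG hcoord hconn
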